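/- A translation surface is a pair $M=(X,\omega)$, where $X$ is a compact connected Riemann surface and $\omega$ is a non-zero holomorphic $1$-form on $X$; integrating $\omega$ gives translation charts off the zeros of $\omega$. Let $\mathrm{Aff}(M)$ be the group of homeomorphisms of $X$ that preserve the set of zeros of $\omega$ and are affine in the translation charts, with linear part in $SL(2,\mathbb{R})$. It acts on $H^1(X,\mathbb{R})$ preserving the symplectic form given by the cup product. Let $H^1_\perp(M,\mathbb{R})$ be the symplectic complement of the tautological plane $\mathrm{span}_{\mathbb{R}}(\mathrm{Re}\,\omega,\mathrm{Im}\,\omega)\subset H^1(X,\mathbb{R})$, and let $\Gamma_\perp(M)$ be the group of restrictions to $H^1_\perp(M,\mathbb{R})$ of the action of $\mathrm{Aff}(M)$. Let $\mathcal{H}(4)$ be the stratum of (genus three) translation surfaces for which $\omega$ has a single zero, of order $4$. Its hyperelliptic component $\mathcal{H}(4)^{hyp}$ consists of the surfaces that admit an involution in $\mathrm{Aff}(M)$ with derivative $-\mathrm{Id}$ and exactly $8$ fixed points. Its odd component $\mathcal{H}(4)^{odd}$ consists of the surfaces whose spin structure has odd parity, i.e. $\sum_{i=1}^{3}(\mathrm{ind}_\omega(\alpha_i)+1)(\mathrm{ind}_\omega(\beta_i)+1)\equiv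 1 \pmod 2$ for a symplectic basis $\alpha_i,\beta_i$ of the homology represented by simple closed regular curves that avoid the zero, where $\mathrm{ind}_\omega(\gamma)$ is the degree of the Gauss map of $\gamma$ in the translation charts. Proposition. In each of $\mathcal{H}(4)^{hyp}$ and $\mathcal{H}(4)^{odd}$ there is a translation surface $M$ such that $H^1_\perp(M,\mathbb{R})$ has dimension $4$ and, in a symplectic basis of it, the Zariski closure of $\Gamma_\perp(M)$ is $Sp(4,\mathbb{R})$. More precisely, for every $s>0$, glue six squares of side $s$, numbered from $1$ to $6$, by translations so that square $h(i)$ is to the right of square $i$ and square $v(i)$ is on top of it. With $h=(1)(2,3)(4,5,6)$ and $v=(1,2)(3,4)(5)(6)$ one obtains such a surface in $\mathcal{H}(4)^{hyp}$, and with the same $h$ and $v=(1,4,2)(3,5)(6)$ one obtains such a surface in $\mathcal{H}(4)^{odd}$. (The side $s=6^{-1/2}$ gives unit area.) -/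

import Mathlib

open Topology Filter

noncomputable section

/-! ### Alexander–Spanier cohomology with real coefficients in degrees one and two

Cochains of degree `n` are arbitrary functions of `n + 1` points, two of them being identified when
they agree near the diagonal.  On compact surfaces this is the usual cohomology. -/

namespace AlexanderSpanier

variable (X : Type) [TopologicalSpace X]

/-- 1-cochains whose coboundary vanishes near the diagonal. -/
def cocycles1 : Submodule ℝ (X → X → ℝ) where
  carrier := {f | ∀ p, ∃ U ∈ 𝓝 p, ∀ x ∈ U, ∀ y ∈ U, ∀ z ∈ U, f y z - f x z + f x y = 0}
  add_mem' := by
    intro f g hf hg p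
    obtain ⟨U, hU, h⟩ := hf p
    obtain ⟨V, hV, k⟩ := hg p
    refine ⟨U ∩ V, inter_mem hU hV, fun x hx y hy z hz => ?_⟩
    have h1 := h x hx.1 y hy.1 z hz.1
    have h2 := k x hx.2 y hy.2 z hz.2
    simp only [Pi.add_apply]
    linarith
  zero_mem' := fun _ => ⟨Set.univ, univ_mem, by simp⟩
  smul_mem' := by
    intro c f hf p
    obtain ⟨U, hU, h⟩ := hf p
    refine ⟨U, hU, fun x hx y hy z hz => ?_⟩
    have h1 := h x hx y hy z hz
    simp only [Pi.smul_apply, smul_eq_mul]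
    linear_combination c * h1

/-- 1-cochains which agree near the diagonal with the coboundary of a function. -/
def coboundaries1 : Submodule ℝ (X → X → ℝ) where
  carrier := {f | ∃ u : X → ℝ, ∀ p, ∃ U ∈ 𝓝 p, ∀ x ∈ U, ∀ y ∈ U, f x y = u y - u x}
  add_mem' := by
    rintro f g ⟨u, hf⟩ ⟨w, hg⟩
    refine ⟨u + w, fun p => ?_⟩
    obtain ⟨U, hU, h⟩ := hf p
    obtain ⟨V, hV, k⟩ := hg p
    refine ⟨U ∩ V, inter_mem hU hV, fun x hx y hy => ?_⟩
    have h1 := h x hx.1 y hy.1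
    have h2 := k x hx.2 y hy.2
    simp only [Pi.add_apply]
    linarith
  zero_mem' := ⟨0, fun _ => ⟨Set.univ, univ_mem, by simp⟩⟩
  smul_mem' := by
    rintro c f ⟨u, hf⟩
    refine ⟨c • u, fun p => ?_⟩
    obtain ⟨U, hU, h⟩ := hf p
    refine ⟨U, hU, fun x hx y hy => ?_⟩
    have h1 := h x hx y hy
    simp only [Pi.smul_apply, smul_eq_mul]
    linear_combination c * h1

/-- 2-cochains whose coboundary vanishes near the diagonal. -/
def cocycles2 : Submodule ℝ (X → X → X → ℝ) where
  carrier := {f | ∀ p, ∃ U ∈ 𝓝 p, ∀ x ∈ U, ∀ y ∈ U, ∀ z ∈ U, ∀ w ∈ U,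
    f y z w - f x z w + f x y w - f x y z = 0}
  add_mem' := by
    intro f g hf hg p
    obtain ⟨U, hU, h⟩ := hf p
    obtain ⟨V, hV, k⟩ := hg p
    refine ⟨U ∩ V, inter_mem hU hV, fun x hx y hy z hz w hw => ?_⟩
    have h1 := h x hx.1 y hy.1 z hz.1 w hw.1
    have h2 := k x hx.2 y hy.2 z hz.2 w hw.2
    simp only [Pi.add_apply]
    linarith
  zero_mem' := fun _ => ⟨Set.univ, univ_mem, by simp⟩
  smul_mem' := by
    intro c f hf p
    obtain ⟨U, hU, h⟩ := hf p
    refine ⟨U, hU, fun x hx y hy z hz w hw => ?_⟩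
    have h1 := h x hx y hy z hz w hw
    simp only [Pi.smul_apply, smul_eq_mul]
    linear_combination c * h1

/-- 2-cochains which agree near the diagonal with the coboundary of a 1-cochain. -/
def coboundaries2 : Submodule ℝ (X → X → X → ℝ) where
  carrier := {f | ∃ u : X → X → ℝ, ∀ p, ∃ U ∈ 𝓝 p, ∀ x ∈ U, ∀ y ∈ U, ∀ z ∈ U,
    f x y z = u y z - u x z + u x y}
  add_mem' := by
    rintro f g ⟨u, hf⟩ ⟨w, hg⟩
    refine ⟨u + w, fun p => ?_⟩
    obtain ⟨U, hU, h⟩ := hf p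
    obtain ⟨V, hV, k⟩ := hg p
    refine ⟨U ∩ V, inter_mem hU hV, fun x hx y hy z hz => ?_⟩
    have h1 := h x hx.1 y hy.1 z hz.1
    have h2 := k x hx.2 y hy.2 z hz.2
    simp only [Pi.add_apply]
    linarith
  zero_mem' := ⟨0, fun _ => ⟨Set.univ, univ_mem, by simp⟩⟩
  smul_mem' := by
    rintro c f ⟨u, hf⟩
    refine ⟨c • u, fun p => ?_⟩
    obtain ⟨U, hU, h⟩ := hf p
    refine ⟨U, hU, fun x hx y hy z hz => ?_⟩
    have h1 := h x hx y hy z hz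
    simp only [Pi.smul_apply, smul_eq_mul]
    linear_combination c * h1

/-- The cohomology group `H¹(X, ℝ)`. -/
abbrev H1 : Type := ↥(cocycles1 X) ⧸ (coboundaries1 X).submoduleOf (cocycles1 X)

/-- The cohomology group `H²(X, ℝ)`. -/
abbrev H2 : Type := ↥(cocycles2 X) ⧸ (coboundaries2 X).submoduleOf (cocycles2 X)

variable {X}

/-- The class of a 1-cocycle. -/
def H1.mk : ↥(cocycles1 X) →ₗ[ℝ] H1 X := Submodule.mkQ _

/-- The class of a 2-cocycle. -/
def H2.mk : ↥(cocycles2 X) →ₗ[ℝ] H2 X := Submodule.mkQ _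

theorem cup_mem (f g : ↥(cocycles1 X)) :
    (fun x y z => f.1 x y * g.1 y z) ∈ cocycles2 X := by
  intro p
  obtain ⟨U, hU, h⟩ := f.2 p
  obtain ⟨V, hV, k⟩ := g.2 p
  refine ⟨U ∩ V, inter_mem hU hV, fun x hx y hy z hz w hw => ?_⟩
  have h1 := h x hx.1 y hy.1 z hz.1
  have h2 := k y hy.2 z hz.2 w hw.2
  dsimp only
  linear_combination g.1 z w * h1 - f.1 x y * h2

/-- The cup product `(f ∪ g)(x, y, z) = f(x, y) g(y, z)` of 1-cocycles. -/
def cupCocycle : ↥(cocycles1 X) →ₗ[ℝ] ↥(cocycles1 X) →ₗ[ℝ] ↥(cocycles2 X) :=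
  LinearMap.mk₂ ℝ (fun f g => ⟨fun x y z => f.1 x y * g.1 y z, cup_mem f g⟩)
    (fun f f' g => by ext x y z; simp [add_mul])
    (fun c f g => by ext x y z; simp [mul_assoc])
    (fun f g g' => by ext x y z; simp [mul_add])
    (fun c f g => by ext x y z; simp [mul_left_comm])

theorem cup_coboundary_left (f g : ↥(cocycles1 X)) (hf : f.1 ∈ coboundaries1 X) :
    (cupCocycle f g).1 ∈ coboundaries2 X := by
  obtain ⟨u, hu⟩ := hf
  refine ⟨fun x y => u x * g.1 x y, fun p => ?_⟩
  obtain ⟨U, hU, h⟩ := hu p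
  obtain ⟨V, hV, k⟩ := g.2 p
  refine ⟨U ∩ V, inter_mem hU hV, fun x hx y hy z hz => ?_⟩
  have h1 := h x hx.1 y hy.1
  have h2 := k x hx.2 y hy.2 z hz.2
  change f.1 x y * g.1 y z = _
  rw [h1]
  linear_combination (-u x) * h2

theorem cup_coboundary_right (f g : ↥(cocycles1 X)) (hg : g.1 ∈ coboundaries1 X) :
    (cupCocycle f g).1 ∈ coboundaries2 X := by
  obtain ⟨u, hu⟩ := hg
  refine ⟨fun x y => -(f.1 x y * u y), fun p => ?_⟩
  obtain ⟨U, hU, h⟩ := hu p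
  obtain ⟨V, hV, k⟩ := f.2 p
  refine ⟨U ∩ V, inter_mem hU hV, fun x hx y hy z hz => ?_⟩
  have h1 := h y hy.1 z hz.1
  have h2 := k x hx.2 y hy.2 z hz.2
  change f.1 x y * g.1 y z = _
  rw [h1]
  linear_combination u z * h2

/-- The cup product `H¹(X, ℝ) × H¹(X, ℝ) → H²(X, ℝ)`. -/
def cup : H1 X →ₗ[ℝ] H1 X →ₗ[ℝ] H2 X :=
  Submodule.liftQ _
    (LinearMap.flip (Submodule.liftQ _ (LinearMap.flip (cupCocycle.compr₂ H2.mk)) (by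
      intro g hg
      ext f
      exact (Submodule.Quotient.mk_eq_zero _).2 (cup_coboundary_right f g hg))))
    (by
      intro f hf
      refine LinearMap.ext fun y => ?_
      obtain ⟨g, rfl⟩ := Submodule.Quotient.mk_surjective _ y
      exact (Submodule.Quotient.mk_eq_zero _).2 (cup_coboundary_left f g hf))

theorem cup_mk (f g : ↥(cocycles1 X)) : cup (H1.mk f) (H1.mk g) = H2.mk (cupCocycle f g) := rfl

/-- The pullback of 1-cocycles along a continuous map. -/
def pullbackCocycle {Y : Type} [TopologicalSpace Y] (φ : C(X, Y)) :
    ↥(cocycles1 Y) →ₗ[ℝ] ↥(cocycles1 X) where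
  toFun f := ⟨fun x y => f.1 (φ x) (φ y), fun p => by
    obtain ⟨U, hU, h⟩ := f.2 (φ p)
    exact ⟨φ ⁻¹' U, φ.continuous.continuousAt hU,
      fun x hx y hy z hz => h _ hx _ hy _ hz⟩⟩
  map_add' _ _ := rfl
  map_smul' _ _ := rfl

/-- The map `φ^* : H¹(Y, ℝ) → H¹(X, ℝ)` induced by a continuous map `φ : X → Y`. -/
def pullback {Y : Type} [TopologicalSpace Y] (φ : C(X, Y)) : H1 Y →ₗ[ℝ] H1 X :=
  Submodule.mapQ _ _ (pullbackCocycle φ) (by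
    rintro f ⟨u, hu⟩
    refine ⟨fun x => u (φ x), fun p => ?_⟩
    obtain ⟨U, hU, h⟩ := hu (φ p)
    exact ⟨φ ⁻¹' U, φ.continuous.continuousAt hU, fun x hx y hy => h _ hx _ hy⟩)

end AlexanderSpanier

open AlexanderSpanier

/-! ### Translation surfaces -/

/-- A translation surface: a compact connected surface with a translation atlas having conical
singularities.  Around every point `p` there is a coordinate `z = chart p`, centred at `p`, such
that `z ^ (ord p + 1)` is a local primitive of the Abelian differential `ω`; two local primitives
differ by locally constant functions.  So `ord p` is the order of `ω` at `p`, and `p` is a conical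
point of angle `2 π (ord p + 1)`; where `ord p = 0` the coordinate is a translation chart. -/
structure TranslationSurface where
  carrier : Type
  [top : TopologicalSpace carrier]
  [t2 : T2Space carrier]
  [compact : CompactSpace carrier]
  [connected : ConnectedSpace carrier]
  /-- order of vanishing of `ω` -/
  ord : carrier → ℕ
  chart : carrier → OpenPartialHomeomorph carrier ℂ
  mem_source : ∀ p, p ∈ (chart p).source
  chart_self : ∀ p, chart p p = 0
  compat : ∀ p q, ∀ x ∈ (chart p).source, x ∈ (chart q).source →
    ∀ᶠ y in 𝓝 x, chart p y ^ (ord p + 1) - chart q y ^ (ord q + 1) =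
      chart p x ^ (ord p + 1) - chart q x ^ (ord q + 1)

namespace TranslationSurface

attribute [instance] top t2 compact connected

variable (M : TranslationSurface)

/-- The local primitive of `ω` at `p`, defined on `(M.chart p).source` and vanishing at `p`. -/
def primitive (p x : M.carrier) : ℂ := M.chart p x ^ (M.ord p + 1)

/-- The class `ξ` is the class of the closed real 1-form `ℓ ∘ ω`, where `ℓ : ℂ → ℝ` is linear: it is
represented by the cocycle `(x, y) ↦ ℓ (∫_x^y ω)`, the integral being taken along a short path. -/
def IsClassOf (ℓ : ℂ →ₗ[ℝ] ℝ) (ξ : H1 M.carrier) : Prop :=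
  ∃ c : ↥(cocycles1 M.carrier), H1.mk c = ξ ∧
    ∀ p, ∃ U ∈ 𝓝 p, ∀ x ∈ U, ∀ y ∈ U, c.1 x y = ℓ (M.primitive p y - M.primitive p x)

/-- The tautological plane, spanned by the classes of `Re ω` and `Im ω`. -/
def tautologicalPlane : Submodule ℝ (H1 M.carrier) :=
  Submodule.span ℝ {ξ | M.IsClassOf Complex.reLm ξ ∨ M.IsClassOf Complex.imLm ξ}

/-- The symplectic complement `H¹_⊥(M, ℝ)` of the tautological plane. -/
def H1perp : Submodule ℝ (H1 M.carrier) where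
  carrier := {ξ | ∀ η ∈ M.tautologicalPlane, cup ξ η = 0}
  add_mem' := by
    intro a b ha hb η hη
    rw [map_add, LinearMap.add_apply, ha η hη, hb η hη, add_zero]
  zero_mem' := by
    intro η _
    rw [map_zero, LinearMap.zero_apply]
  smul_mem' := by
    intro c a ha η hη
    rw [map_smul, LinearMap.smul_apply, ha η hη, smul_zero]

/-- The homeomorphism `f` preserves the zeros of `ω` and is affine with linear part `D` in the
translation charts: `∫_{f p}^{f x} ω = D (∫_p^x ω)` for `x` close to `p`. -/
def IsAffineWith (f : M.carrier ≃ₜ M.carrier) (D : ℂ →ₗ[ℝ] ℂ) : Prop :=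
  (∀ p, M.ord (f p) = 0 ↔ M.ord p = 0) ∧
    ∀ p, ∀ᶠ x in 𝓝 p, M.primitive (f p) (f x) = D (M.primitive p x)

/-- The affine group `Aff(M)`; the linear parts lie in `SL(2, ℝ)`. -/
def affineGroup : Set (M.carrier ≃ₜ M.carrier) :=
  {f | ∃ D : ℂ →ₗ[ℝ] ℂ, LinearMap.det D = 1 ∧ M.IsAffineWith f D}

/-- The image `Γ_⊥(M)` of the affine group in the endomorphisms of `H¹_⊥(M, ℝ)`: the restrictions
to `H¹_⊥(M, ℝ)` of the maps `f^*`, `f ∈ Aff(M)`. -/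
def gammaPerp : Set (↥M.H1perp →ₗ[ℝ] ↥M.H1perp) :=
  {g | ∃ f ∈ M.affineGroup, ∀ ξ : ↥M.H1perp,
    (g ξ : H1 M.carrier) = pullback (f : C(M.carrier, M.carrier)) ξ}

/-! ### The stratum `H(4)` and its components -/

/-- `ω` has a single zero, of order four; the genus is then three. -/
def InH4 : Prop := ∃ p₀, M.ord p₀ = 4 ∧ ∀ p, p ≠ p₀ → M.ord p = 0

/-- The hyperelliptic component of `H(4)`: there is an affine involution with derivative `-Id`
and exactly eight fixed points. -/
def InH4Hyp : Prop :=
  M.InH4 ∧ ∃ τ : M.carrier ≃ₜ M.carrier,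
    M.IsAffineWith τ (-LinearMap.id) ∧ (∀ p, τ (τ p) = p) ∧ {p | τ p = p}.ncard = 8

/-- A simple closed regular `C¹` curve avoiding the zeros of `ω`, parametrized with period one;
`vel t = ω(γ'(t))` is its velocity in the translation charts. -/
structure SimpleClosedCurve where
  toFun : ℝ → M.carrier
  vel : ℝ → ℂ
  continuous_toFun : Continuous toFun
  periodic : ∀ t, toFun (t + 1) = toFun t
  injOn : Set.InjOn toFun (Set.Ico 0 1)
  regular : ∀ t, M.ord (toFun t) = 0
  hasDeriv : ∀ t, HasDerivAt (fun s => M.primitive (toFun t) (toFun s)) (vel t) t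
  continuous_vel : Continuous vel
  vel_ne_zero : ∀ t, vel t ≠ 0

variable {M}

/-- `ind_ω(γ) = n`: the degree of the Gauss map `t ↦ vel t / |vel t|` is `n`. -/
def SimpleClosedCurve.HasIndex (γ : M.SimpleClosedCurve) (n : ℤ) : Prop :=
  ∃ θ : ℝ → ℝ, Continuous θ ∧
    (∀ t, γ.vel t = (‖γ.vel t‖ : ℂ) * Complex.exp (θ t * Complex.I)) ∧
    θ 1 - θ 0 = 2 * Real.pi * n

/-- The pairs of parameters at which two curves meet. -/
def SimpleClosedCurve.meets (γ δ : M.SimpleClosedCurve) : Set (ℝ × ℝ) :=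
  {q | q.1 ∈ Set.Ico (0 : ℝ) 1 ∧ q.2 ∈ Set.Ico (0 : ℝ) 1 ∧ γ.toFun q.1 = δ.toFun q.2}

/-- The oriented area `vel_γ(s) ∧ vel_δ(t)` spanned by the velocities. -/
def SimpleClosedCurve.wedge (γ δ : M.SimpleClosedCurve) (q : ℝ × ℝ) : ℝ :=
  (starRingEnd ℂ (γ.vel q.1) * δ.vel q.2).im

/-- The two curves meet transversally, at finitely many points, and their algebraic intersection
number is `n`. -/
def SimpleClosedCurve.HasIntersection (γ δ : M.SimpleClosedCurve) (n : ℤ) : Prop :=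
  (γ.meets δ).Finite ∧ (∀ q ∈ γ.meets δ, γ.wedge δ q ≠ 0) ∧
    ∑ᶠ q ∈ γ.meets δ, (SignType.sign (γ.wedge δ q) : ℤ) = n

variable (M)

/-- The parity of the spin structure of a translation surface of genus `g` is `ε`: in some canonical
symplectic basis `α i, β i` of the homology, given by simple closed curves,
`∑ i, (ind (α i) + 1) (ind (β i) + 1) ≡ ε` modulo 2. -/
def HasSpinParity (g : ℕ) (ε : ZMod 2) : Prop :=
  ∃ (α β : Fin g → M.SimpleClosedCurve) (a b : Fin g → ℤ),
    (∀ i j, (α i).HasIntersection (β j) (if i = j then 1 else 0)) ∧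
    (∀ i j, i ≠ j → (α i).HasIntersection (α j) 0) ∧
    (∀ i j, i ≠ j → (β i).HasIntersection (β j) 0) ∧
    (∀ i, (α i).HasIndex (a i)) ∧ (∀ i, (β i).HasIndex (b i)) ∧
    ((∑ i, (a i + 1) * (b i + 1) : ℤ) : ZMod 2) = ε

/-- The odd component of `H(4)`: the parity of the spin structure is odd. -/
def InH4Odd : Prop := M.InH4 ∧ M.HasSpinParity 3 1

/-! ### Square-tiled surfaces -/

/-- `M` is tiled by `n` squares of side `s`, where `h i` is the square to the right of the `i`-th
one and `v i` the square on top of it.  The `i`-th square is parametrized by `sq i` on the closed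
unit square. -/
def IsSquareTiled (s : ℝ) {n : ℕ} (h v : Equiv.Perm (Fin n)) : Prop :=
  ∃ sq : Fin n → ℂ → M.carrier,
    (∀ i, ContinuousOn (sq i) (Set.Icc 0 1 ×ℂ Set.Icc 0 1)) ∧
    (∀ x, ∃ i, ∃ z ∈ Set.Icc (0 : ℝ) 1 ×ℂ Set.Icc (0 : ℝ) 1, sq i z = x) ∧
    (∀ i j, ∀ z ∈ Set.Ioo (0 : ℝ) 1 ×ℂ Set.Ioo (0 : ℝ) 1,
      ∀ w ∈ Set.Icc (0 : ℝ) 1 ×ℂ Set.Icc (0 : ℝ) 1, sq i z = sq j w → i = j ∧ z = w) ∧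
    (∀ i, ∀ z ∈ Set.Icc (0 : ℝ) 1 ×ℂ Set.Icc (0 : ℝ) 1,
      ∀ᶠ w in 𝓝[Set.Icc (0 : ℝ) 1 ×ℂ Set.Icc (0 : ℝ) 1] z,
        M.primitive (sq i z) (sq i w) = s * (w - z)) ∧
    (∀ i, ∀ t ∈ Set.Icc (0 : ℝ) 1, sq i (1 + t * Complex.I) = sq (h i) (t * Complex.I)) ∧
    (∀ i, ∀ t ∈ Set.Icc (0 : ℝ) 1, sq i (t + Complex.I) = sq (v i) t)

end TranslationSurface

/-- `(1)(2,3)(4,5,6)`, with the squares numbered from 0. -/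
def hPerm : Equiv.Perm (Fin 6) := List.formPerm [1, 2] * List.formPerm [3, 4, 5]

/-- `(1,2)(3,4)(5)(6)`, with the squares numbered from 0. -/
def vPermHyp : Equiv.Perm (Fin 6) := List.formPerm [0, 1] * List.formPerm [2, 3]

/-- `(1,4,2)(3,5)(6)`, with the squares numbered from 0. -/
def vPermOdd : Equiv.Perm (Fin 6) := List.formPerm [0, 3, 1] * List.formPerm [2, 4]

/-- The Zariski closure of a set of real matrices. -/
def zariskiClosure {n : Type} (S : Set (Matrix n n ℝ)) : Set (Matrix n n ℝ) :=
  {A | ∀ P : MvPolynomial (n × n) ℝ,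
    (∀ B ∈ S, MvPolynomial.eval (fun e => B e.1 e.2) P = 0) →
      MvPolynomial.eval (fun e => A e.1 e.2) P = 0}

/-- A basis `b` of `H¹_⊥(M, ℝ)` is symplectic if the cup products of its members are the entries of
the standard symplectic matrix `J`, for some generator `κ` of the line `H²(M, ℝ)`. -/
def IsSymplecticBasis (M : TranslationSurface)
    (b : Module.Basis (Fin 2 ⊕ Fin 2) ℝ ↥M.H1perp) : Prop :=
  ∃ κ : H2 M.carrier, κ ≠ 0 ∧
    ∀ i j, cup (b i : H1 M.carrier) (b j : H1 M.carrier) = Matrix.J (Fin 2) ℝ i j • κ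

/-- The Zariski closure of `Γ_⊥(M)` is `Sp(4, ℝ)`, read in a symplectic basis of `H¹_⊥(M, ℝ)`. -/
def ZariskiClosureIsSp4 (M : TranslationSurface) : Prop :=
  ∃ b : Module.Basis (Fin 2 ⊕ Fin 2) ℝ ↥M.H1perp, IsSymplecticBasis M b ∧
    zariskiClosure (LinearMap.toMatrix b b '' M.gammaPerp) =
      (Matrix.symplecticGroup (Fin 2) ℝ : Set (Matrix (Fin 2 ⊕ Fin 2) (Fin 2 ⊕ Fin 2) ℝ))

end

/-! Each surface is built as the quotient of six unit squares, and every assertion about it becomes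
a finite computation with the permutations `h` and `v`. Vertices of the tiling are the cycles of the
commutator `comm h v`, and the cone angle at a vertex is `2 π` times the length of the cycle. One
cycle of length five and one fixed point therefore give a single zero of order four. Charts come
from a comparison principle (`exists_openPartialHomeomorph`): a compact set which parametrizes both
a star on the surface and a region of the plane, with the same fibres, yields a homeomorphism
between them. At a vertex of cone angle `2 π k` the common parameter space is `4 k` quadrants.

A class in `H¹` is determined by its periods along the edges of the squares (`mem_coboundaries1`): a
cocycle has a potential on each square, and these potentials glue when the periods come from a
function on the vertices. For the two given surfaces every class is a sum of crossing cocycles of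
the horizontal and vertical middle lines of the squares. Products of two horizontal or two vertical
crossing cocycles vanish, and a mixed product is a sum of point masses at centres of squares. All
centres carry the same class in `H²`, since it can be pushed across edges. This class is non-zero by
a discrete Stokes argument on a fine grid (`kap_ne_zero`). So the cup product is an explicit
bilinear form on pairs of invariant functions (`cup_cls`), and `Re ω`, `Im ω` are given by constant
functions.

Affine homeomorphisms are words in the horizontal and vertical unit shears. A shear carries the
surface of one pair of permutations to that of another and acts on edge periods by an integral
formula, because it sends the left edge of a square to a diagonal. A word which returns to the
initial pair of permutations is an element of the affine group. The words used are conjugates of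
powers of a single shear, and each is certified, by integer arithmetic modulo vertex functions, to
act on the complement of the tautological plane as a symplectic transvection.

Four such transvections suffice. The Zariski closure of a semigroup is a semigroup, and it contains
the whole one-parameter group of any transvection with non-zero factor in the semigroup. The vectors
whose transvections all lie in the closure form a cone closed under `x ↦ x + t y` whenever `x` and
`y` pair non-trivially. Two vectors spanning a hyperbolic plane, and two more reaching the remaining
two directions, generate all non-zero vectors in this way (`mem_of_transvection_closed`). All
transvections generate `Sp(4, ℝ)` by the argument of Witt's theorem (`mem_of_isometry`). Conversely,
affine maps of determinant one preserve `Re ω ∪ Im ω`, hence every cup product, so the closure is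
not larger.

The first surface is hyperelliptic because the half-turn of all squares, with two squares exchanged,
is well defined and fixes four centres, two midpoints of edges and two vertices. For the second one
the spin parity is read off from six explicit smooth curves running through a subdivision of the
squares into nine cells. Their simplicity, intersections and indices are decided combinatorially. -/

open Topology Filter

noncomputable section

namespace Origami

open Set

/-! ### Surfaces glued from unit squares -/

variable {n : ℕ} {h v : Equiv.Perm (Fin n)} {Y : Type*}

/-- The gluing of `n` unit squares along their edges by the permutations `h` and `v`. -/
inductive Glue (h v : Equiv.Perm (Fin n)) :
    Fin n × unitInterval × unitInterval → Fin n × unitInterval × unitInterval → Prop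
  | right (i : Fin n) (b : unitInterval) : Glue h v (i, 1, b) (h i, 0, b)
  | top (i : Fin n) (a : unitInterval) : Glue h v (i, a, 1) (v i, a, 0)

/-- The surface glued from unit squares. -/
def Surface (h v : Equiv.Perm (Fin n)) : Type := Quot (Glue h v)

instance : TopologicalSpace (Surface h v) := inferInstanceAs (TopologicalSpace (Quot _))

instance : CompactSpace (Surface h v) := inferInstanceAs (CompactSpace (Quot _))

/-- The gluing map. -/
def proj (z : Fin n × unitInterval × unitInterval) : Surface h v := Quot.mk _ z

theorem continuous_proj : Continuous (proj : _ → Surface h v) := continuous_quot_mk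

/-- The closed unit square. -/
def unitSq : Set (ℝ × ℝ) := Icc 0 1 ×ˢ Icc 0 1

/-- The point of the `i`-th square with coordinates `a`, `b` (clamped to the unit square). -/
def pt (i : Fin n) (a b : ℝ) : Surface h v :=
  proj (i, projIcc 0 1 zero_le_one a, projIcc 0 1 zero_le_one b)

theorem proj_eq_pt (i : Fin n) (a b : unitInterval) : (proj (i, a, b) : Surface h v) = pt i a b := by
  simp [pt]

theorem continuous_pt (i : Fin n) :
    Continuous fun z : ℝ × ℝ => (pt i z.1 z.2 : Surface h v) := by
  refine continuous_proj.comp ?_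
  refine continuous_const.prodMk ((continuous_projIcc.comp continuous_fst).prodMk
    (continuous_projIcc.comp continuous_snd))

@[fun_prop]
theorem continuous_pt_comp {T : Type*} [TopologicalSpace T] (i : Fin n) {f g : T → ℝ}
    (hf : Continuous f) (hg : Continuous g) :
    Continuous fun t => (pt i (f t) (g t) : Surface h v) :=
  (continuous_pt i).comp (hf.prodMk hg)

theorem pt_right (i : Fin n) (b : ℝ) : (pt i 1 b : Surface h v) = pt (h i) 0 b := by
  have : (proj (i, 1, projIcc 0 1 zero_le_one b) : Surface h v) = proj (h i, 0, _) :=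
    Quot.sound (Glue.right i (projIcc 0 1 zero_le_one b))
  simpa [pt, projIcc_left, projIcc_right] using this

theorem pt_top (i : Fin n) (a : ℝ) : (pt i a 1 : Surface h v) = pt (v i) a 0 := by
  have : (proj (i, projIcc 0 1 zero_le_one a, 1) : Surface h v) = proj (v i, _, 0) :=
    Quot.sound (Glue.top i (projIcc 0 1 zero_le_one a))
  simpa [pt, projIcc_left, projIcc_right] using this

theorem exists_pt (x : Surface h v) :
    ∃ i, ∃ a ∈ Icc (0 : ℝ) 1, ∃ b ∈ Icc (0 : ℝ) 1, pt i a b = x := by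
  obtain ⟨⟨i, a, b⟩, rfl⟩ := Quot.exists_rep x
  exact ⟨i, a, a.2, b, b.2, (proj_eq_pt i a b).symm⟩

/-- Functions on the surface are compatible families of functions on the squares. -/
def lift (F : Fin n → ℝ → ℝ → Y) (hr : ∀ i, ∀ b ∈ Icc (0 : ℝ) 1, F i 1 b = F (h i) 0 b)
    (ht : ∀ i, ∀ a ∈ Icc (0 : ℝ) 1, F i a 1 = F (v i) a 0) : Surface h v → Y :=
  Quot.lift (fun z => F z.1 z.2.1 z.2.2) (by
    rintro _ _ (⟨i, b⟩ | ⟨i, a⟩)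
    · exact hr i b b.2
    · exact ht i a a.2)

theorem lift_pt (F : Fin n → ℝ → ℝ → Y) (hr : ∀ i, ∀ b ∈ Icc (0 : ℝ) 1, F i 1 b = F (h i) 0 b)
    (ht : ∀ i, ∀ a ∈ Icc (0 : ℝ) 1, F i a 1 = F (v i) a 0) {i : Fin n} {a b : ℝ}
    (ha : a ∈ Icc (0 : ℝ) 1) (hb : b ∈ Icc (0 : ℝ) 1) : lift F hr ht (pt i a b) = F i a b := by
  simp [lift, pt, proj, projIcc_of_mem _ ha, projIcc_of_mem _ hb]

theorem continuous_lift [TopologicalSpace Y] (F : Fin n → ℝ → ℝ → Y)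
    (hr : ∀ i, ∀ b ∈ Icc (0 : ℝ) 1, F i 1 b = F (h i) 0 b)
    (ht : ∀ i, ∀ a ∈ Icc (0 : ℝ) 1, F i a 1 = F (v i) a 0)
    (hF : ∀ i, ContinuousOn (fun z : ℝ × ℝ => F i z.1 z.2) unitSq) :
    Continuous (lift F hr ht) := by
  refine continuous_quot_lift _ ?_
  rw [continuous_prod_of_discrete_left]
  intro i
  have : Continuous fun z : unitInterval × unitInterval => ((z.1 : ℝ), (z.2 : ℝ)) := by fun_prop
  exact (hF i).comp_continuous this fun z => ⟨z.1.2, z.2.2⟩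

/-! ### Normal forms of points -/

/-- The monodromy around the lower left corners of the squares. -/
def comm (h v : Equiv.Perm (Fin n)) : Equiv.Perm (Fin n) := v * h * v⁻¹ * h⁻¹

/-- The vertices of the tiling. -/
abbrev Vertex (h v : Equiv.Perm (Fin n)) : Type :=
  Quotient (Equiv.Perm.SameCycle.setoid (comm h v))

/-- The square which contains the point in its half-open version `[0, 1) × [0, 1)`. -/
def base (h v : Equiv.Perm (Fin n)) (i : Fin n) (a b : ℝ) : Fin n :=
  (if b = 1 then v else 1) ((if a = 1 then h else 1) i)

/-- Both squares have the upper right corner of the square `i` as their lower left corner; this is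
the only identification that the edge gluings force on corners. -/
theorem sameCycle_comm (i : Fin n) : (comm h v).SameCycle (h (v i)) (v (h i)) :=
  ⟨1, by simp [comm]⟩

theorem fract_of_mem_Ico {a : ℝ} (ha : a ∈ Ico (0 : ℝ) 1) : Int.fract a = a :=
  Int.fract_eq_self.2 ha

theorem fract_eq_zero {a : ℝ} (ha : a ∈ Icc (0 : ℝ) 1) : Int.fract a = 0 ↔ a = 0 ∨ a = 1 := by
  rcases ha.2.eq_or_lt with rfl | h1
  · simp
  · rw [fract_of_mem_Ico ⟨ha.1, h1⟩]
    simp [h1.ne]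

/-- The normal form of a point: a vertex, or a point of a half-open square. -/
def nf : Surface h v → (Fin n × ℝ × ℝ) ⊕ Vertex h v :=
  lift (fun i a b => if Int.fract a = 0 ∧ Int.fract b = 0 then
      Sum.inr (Quotient.mk (Equiv.Perm.SameCycle.setoid (comm h v)) (base h v i a b))
    else Sum.inl (base h v i a b, Int.fract a, Int.fract b))
    (by intro i b hb; simp [base])
    (by
      intro i a ha
      rcases eq_or_ne a 1 with rfl | ha1
      · simp only [Int.fract_one, Int.fract_zero, and_self, if_true, base]
        congr 1
        refine (Quotient.sound ?_)
        change (comm h v).SameCycle _ _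
        simpa using (sameCycle_comm (h := h) (v := v) i).symm
      · simp [base, ha1])

theorem nf_pt {i : Fin n} {a b : ℝ} (ha : a ∈ Icc (0 : ℝ) 1) (hb : b ∈ Icc (0 : ℝ) 1) :
    nf (pt i a b : Surface h v) = if Int.fract a = 0 ∧ Int.fract b = 0 then
      Sum.inr (Quotient.mk (Equiv.Perm.SameCycle.setoid (comm h v)) (base h v i a b))
    else Sum.inl (base h v i a b, Int.fract a, Int.fract b) :=
  lift_pt _ _ _ ha hb

theorem pt_eq_base {i : Fin n} {a b : ℝ} (ha : a ∈ Icc (0 : ℝ) 1) (hb : b ∈ Icc (0 : ℝ) 1) :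
    (pt i a b : Surface h v) = pt (base h v i a b) (Int.fract a) (Int.fract b) := by
  have fr : ∀ {c : ℝ}, c ∈ Icc (0 : ℝ) 1 → c ≠ 1 → Int.fract c = c := fun hc h1 =>
    fract_of_mem_Ico ⟨hc.1, lt_of_le_of_ne hc.2 h1⟩
  rcases eq_or_ne a 1 with rfl | ha1 <;> rcases eq_or_ne b 1 with rfl | hb1
  · rw [pt_right, pt_top]
    simp [base]
  · simp [base, pt_right, hb1, fr hb hb1]
  · simp [base, pt_top, ha1, fr ha ha1]
  · simp [base, ha1, hb1, fr ha ha1, fr hb hb1]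

/-- With `i = h (v k)`, both points are the upper right corner of the square `k`, reached through
its top edge or through its right edge. -/
theorem pt_comm (i : Fin n) : (pt (comm h v i) 0 0 : Surface h v) = pt i 0 0 := by
  obtain ⟨j, rfl⟩ := h.surjective i
  obtain ⟨k, rfl⟩ := v.surjective j
  have : comm h v (h (v k)) = v (h k) := by simp [comm]
  rw [this, ← pt_right, ← pt_top, ← pt_top, ← pt_right]

theorem pt_eq_of_sameCycle {i j : Fin n} (hij : (comm h v).SameCycle i j) :
    (pt i 0 0 : Surface h v) = pt j 0 0 := by
  obtain ⟨k, rfl⟩ := hij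
  induction k with
  | zero => simp
  | succ k ih => rw [ih, add_comm, zpow_add, zpow_one, Equiv.Perm.mul_apply, pt_comm]
  | pred k ih =>
    rw [ih, ← pt_comm (((comm h v) ^ (-(k : ℤ) - 1)) i), ← Equiv.Perm.mul_apply, ← zpow_one_add]
    congr 3
    ring

/-- Equality in the quotient is generated by a relation and is hard to refute directly. The map `nf`
respects the gluing and remembers the point, so it decides equality. -/
theorem nf_injective : Function.Injective (nf (h := h) (v := v)) := by
  intro x y hxy
  obtain ⟨i, a, ha, b, hb, rfl⟩ := exists_pt x
  obtain ⟨j, c, hc, d, hd, rfl⟩ := exists_pt y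
  rw [nf_pt ha hb, nf_pt hc hd] at hxy
  rw [pt_eq_base ha hb, pt_eq_base hc hd]
  split_ifs at hxy with h1 h2 h2
  · rw [h1.1, h1.2, h2.1, h2.2]
    exact pt_eq_of_sameCycle (Quotient.exact (Sum.inr_injective hxy))
  · have := Sum.inl_injective hxy
    simp only [Prod.mk.injEq] at this
    rw [this.1, this.2.1, this.2.2]

/-- Equality of points that are not vertices. -/
theorem pt_eq_pt_iff {i j : Fin n} {a b c d : ℝ} (ha : a ∈ Icc (0 : ℝ) 1) (hb : b ∈ Icc (0 : ℝ) 1)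
    (hc : c ∈ Icc (0 : ℝ) 1) (hd : d ∈ Icc (0 : ℝ) 1)
    (hv : ¬(Int.fract a = 0 ∧ Int.fract b = 0)) :
    (pt i a b : Surface h v) = pt j c d ↔
      base h v i a b = base h v j c d ∧ Int.fract a = Int.fract c ∧ Int.fract b = Int.fract d := by
  rw [← nf_injective.eq_iff, nf_pt ha hb, nf_pt hc hd, if_neg hv]
  constructor
  · intro e
    split_ifs at e with h1
    simpa using e
  · rintro ⟨e1, e2, e3⟩
    rw [← e2, ← e3, if_neg hv, e1]

theorem pt_vertex_iff {i j : Fin n} :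
    (pt i 0 0 : Surface h v) = pt j 0 0 ↔ (comm h v).SameCycle i j := by
  constructor
  · intro e
    have := congrArg nf e
    rw [nf_pt (by simp) (by simp), nf_pt (by simp) (by simp)] at this
    simp only [Int.fract_zero, and_self, if_true, base, zero_ne_one, if_false] at this
    exact Quotient.exact (Sum.inr_injective this)
  · exact pt_eq_of_sameCycle

theorem exists_pt_Ico (x : Surface h v) :
    ∃ i, ∃ a ∈ Ico (0 : ℝ) 1, ∃ b ∈ Ico (0 : ℝ) 1, pt i a b = x := by
  obtain ⟨i, a, ha, b, hb, rfl⟩ := exists_pt x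
  exact ⟨_, _, ⟨Int.fract_nonneg _, Int.fract_lt_one _⟩, _, ⟨Int.fract_nonneg _, Int.fract_lt_one _⟩,
    (pt_eq_base ha hb).symm⟩

/-- The horizontal coordinate modulo one. -/
def tX : Surface h v → ℝ :=
  lift (fun _ a _ => Int.fract a) (by simp) (by simp)

/-- The vertical coordinate modulo one. -/
def tY : Surface h v → ℝ :=
  lift (fun _ _ b => Int.fract b) (by simp) (by simp)

theorem tX_pt {i : Fin n} {a b : ℝ} (ha : a ∈ Icc (0 : ℝ) 1) (hb : b ∈ Icc (0 : ℝ) 1) :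
    tX (pt i a b : Surface h v) = Int.fract a := lift_pt _ _ _ ha hb

theorem tY_pt {i : Fin n} {a b : ℝ} (ha : a ∈ Icc (0 : ℝ) 1) (hb : b ∈ Icc (0 : ℝ) 1) :
    tY (pt i a b : Surface h v) = Int.fract b := lift_pt _ _ _ ha hb

/-! ### Stars -/

/-- Every representative of `p` either has a coordinate zero or one, or is at distance at least
`r` from the edges of its square. -/
def Good (r : ℝ) (p : Surface h v) : Prop :=
  r ≤ 1 / 2 ∧ ∀ j, ∀ a ∈ Icc (0 : ℝ) 1, ∀ b ∈ Icc (0 : ℝ) 1, pt j a b = p →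
    (a = 0 ∨ r ≤ a) ∧ (a = 1 ∨ a ≤ 1 - r) ∧ (b = 0 ∨ r ≤ b) ∧ (b = 1 ∨ b ≤ 1 - r)

/-- The distance of a number to the integers, with the value `1 / 2` at integers. -/
def edgeDist (a : ℝ) : ℝ :=
  if Int.fract a = 0 then 1 / 2 else min (Int.fract a) (1 - Int.fract a)

theorem edgeDist_pos (a : ℝ) : 0 < edgeDist a := by
  unfold edgeDist
  split_ifs with h0
  · norm_num
  · exact lt_min (lt_of_le_of_ne (Int.fract_nonneg a) (Ne.symm h0))
      (by linarith [Int.fract_lt_one a])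

theorem edgeDist_le (a : ℝ) : edgeDist a ≤ 1 / 2 := by
  unfold edgeDist
  split_ifs with h0
  · norm_num
  · rcases le_total (Int.fract a) (1 / 2) with h1 | h1
    · exact (min_le_left _ _).trans h1
    · exact (min_le_right _ _).trans (by linarith)

theorem edgeDist_spec {a t : ℝ} (ha : a ∈ Icc (0 : ℝ) 1) (hat : Int.fract a = Int.fract t) :
    (a = 0 ∨ edgeDist t ≤ a) ∧ (a = 1 ∨ a ≤ 1 - edgeDist t) := by
  unfold edgeDist
  rw [← hat]
  by_cases h0 : Int.fract a = 0
  · rw [if_pos h0]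
    rcases (fract_eq_zero ha).1 h0 with rfl | rfl <;> norm_num
  · rw [if_neg h0]
    have h1 : a ≠ 1 := fun h1 => h0 (by simp [h1])
    rw [fract_of_mem_Ico ⟨ha.1, lt_of_le_of_ne ha.2 h1⟩]
    refine ⟨Or.inr (min_le_left _ _), Or.inr ?_⟩
    linarith [min_le_right a (1 - a)]

/-- A radius for which the star of a point is embedded. -/
def rad (p : Surface h v) : ℝ := min (edgeDist (tX p)) (edgeDist (tY p))

theorem rad_pos (p : Surface h v) : 0 < rad p := lt_min (edgeDist_pos _) (edgeDist_pos _)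

theorem rad_le (p : Surface h v) : rad p ≤ 1 / 2 := (min_le_left _ _).trans (edgeDist_le _)

theorem good_rad (p : Surface h v) : Good (rad p) p := by
  refine ⟨rad_le p, ?_⟩
  rintro j a ha b hb rfl
  have h1 : Int.fract a = Int.fract (tX (pt j a b : Surface h v)) := by
    rw [tX_pt ha hb, Int.fract_fract]
  have h2 : Int.fract b = Int.fract (tY (pt j a b : Surface h v)) := by
    rw [tY_pt ha hb, Int.fract_fract]
  obtain ⟨k1, k2⟩ := edgeDist_spec ha h1
  obtain ⟨k3, k4⟩ := edgeDist_spec hb h2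
  have m1 : rad (pt j a b : Surface h v) ≤ _ := min_le_left _ _
  have m2 : rad (pt j a b : Surface h v) ≤ _ := min_le_right _ _
  exact ⟨k1.imp_right m1.trans, k2.imp_right fun k => k.trans (by linarith),
    k3.imp_right m2.trans, k4.imp_right fun k => k.trans (by linarith)⟩

theorem Good.mono {r r' : ℝ} {p : Surface h v} (hg : Good r p) (hr : r' ≤ r) : Good r' p := by
  refine ⟨hr.trans hg.1, fun j a ha b hb e => ?_⟩
  obtain ⟨k1, k2, k3, k4⟩ := hg.2 j a ha b hb e
  exact ⟨k1.imp_right hr.trans, k2.imp_right fun k => k.trans (by linarith),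
    k3.imp_right hr.trans, k4.imp_right fun k => k.trans (by linarith)⟩

/-- The point with coordinates `(a, b)` in the square `j` is displaced by `(x, y)` from `p`. -/
def Displaced (p : Surface h v) (x y : ℝ) (j : Fin n) (a b : ℝ) : Prop :=
  (a - x) ∈ Icc (0 : ℝ) 1 ∧ (b - y) ∈ Icc (0 : ℝ) 1 ∧ pt j (a - x) (b - y) = p

/-- Small displacements are well defined. -/
theorem Displaced.congr {r : ℝ} {p : Surface h v} (hg : Good r p) {x y : ℝ} (hx : |x| < r)
    (hy : |y| < r) {i j : Fin n} {a b c d : ℝ} (ha : a ∈ Icc (0 : ℝ) 1) (hb : b ∈ Icc (0 : ℝ) 1)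
    (hc : c ∈ Icc (0 : ℝ) 1) (hd : d ∈ Icc (0 : ℝ) 1) (e : (pt i a b : Surface h v) = pt j c d)
    (hD : Displaced p x y i a b) : Displaced p x y j c d := by
  rw [abs_lt] at hx hy
  -- Being displaced by `(x, y)` from `p` is a proposition-valued function on the squares. Once it
  -- is compatible with the gluing it descends to the surface.
  have key := congrArg (lift (Displaced p x y) (by
      intro i b hb
      refine propext ⟨?_, ?_⟩
      · rintro ⟨h1, h2, h3⟩
        obtain ⟨-, k, -, -⟩ := hg.2 _ _ h1 _ h2 h3
        -- The representative `1 - x` of a coordinate of `p` is `1` or at least `r` away from it. As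
        -- `|x| < r`, the point `p` lies on the same edge and the gluing can be applied to it.
        obtain rfl : x = 0 := by rcases k with k | k <;> linarith
        rw [sub_zero, pt_right] at h3
        exact ⟨by simp, h2, by simpa using h3⟩
      · rintro ⟨h1, h2, h3⟩
        obtain ⟨k, -, -, -⟩ := hg.2 _ _ h1 _ h2 h3
        obtain rfl : x = 0 := by rcases k with k | k <;> linarith
        rw [sub_zero, ← pt_right] at h3
        exact ⟨by simp, h2, by simpa using h3⟩) (by
      intro i a ha
      refine propext ⟨?_, ?_⟩
      · rintro ⟨h1, h2, h3⟩
        obtain ⟨-, -, -, k⟩ := hg.2 _ _ h1 _ h2 h3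
        obtain rfl : y = 0 := by rcases k with k | k <;> linarith
        rw [sub_zero, pt_top] at h3
        exact ⟨h1, by simp, by simpa using h3⟩
      · rintro ⟨h1, h2, h3⟩
        obtain ⟨-, -, k, -⟩ := hg.2 _ _ h1 _ h2 h3
        obtain rfl : y = 0 := by rcases k with k | k <;> linarith
        rw [sub_zero, ← pt_top] at h3
        exact ⟨h1, by simp, by simpa using h3⟩)) e
  rw [lift_pt _ _ _ ha hb, lift_pt _ _ _ hc hd] at key
  exact key.mp hD

/-- Coordinates with equal fractional parts differ by an integer, and an integer of absolute value
below one is zero. -/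
theorem eq_of_pt_eq_of_abs_lt {j : Fin n} {a b c d : ℝ} (ha : a ∈ Icc (0 : ℝ) 1)
    (hb : b ∈ Icc (0 : ℝ) 1) (hc : c ∈ Icc (0 : ℝ) 1) (hd : d ∈ Icc (0 : ℝ) 1)
    (e1 : tX (pt j a b : Surface h v) = tX (pt j c d : Surface h v))
    (e2 : tY (pt j a b : Surface h v) = tY (pt j c d : Surface h v))
    (h1 : |a - c| < 1) (h2 : |b - d| < 1) : a = c ∧ b = d := by
  rw [tX_pt ha hb, tX_pt hc hd, Int.fract_eq_fract] at e1
  rw [tY_pt ha hb, tY_pt hc hd, Int.fract_eq_fract] at e2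
  have aux : ∀ {x y : ℝ}, |x - y| < 1 → (∃ z : ℤ, x - y = z) → x = y := by
    rintro x y hxy ⟨z, hz⟩
    rw [hz] at hxy
    have : |z| < 1 := by exact_mod_cast hxy
    rw [Int.abs_lt_one_iff] at this
    rw [this] at hz
    push_cast at hz
    linarith
  exact ⟨aux h1 e1, aux h2 e2⟩

/-- The displacement of a point from `p` is unique. -/
theorem Displaced.unique {r : ℝ} {p : Surface h v} (hr : r ≤ 1 / 2) {x y x' y' : ℝ} (hx : |x| < r)
    (hy : |y| < r) (hx' : |x'| < r) (hy' : |y'| < r) {j : Fin n} {a b : ℝ}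
    (h1 : Displaced p x y j a b) (h2 : Displaced p x' y' j a b) : x = x' ∧ y = y' := by
  rw [abs_lt] at hx hy hx' hy'
  have e := h1.2.2.trans h2.2.2.symm
  obtain ⟨k1, k2⟩ := eq_of_pt_eq_of_abs_lt h1.1 h1.2.1 h2.1 h2.2.1 (congrArg tX e) (congrArg tY e)
    (by rw [abs_lt]; constructor <;> linarith) (by rw [abs_lt]; constructor <;> linarith)
  constructor <;> linarith

/-- The open star of radius `r` around `p`. -/
def star (r : ℝ) (p : Surface h v) : Set (Surface h v) :=
  {q | ∃ j, ∃ a ∈ Icc (0 : ℝ) 1, ∃ b ∈ Icc (0 : ℝ) 1, q = pt j a b ∧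
    ∃ x y, |x| < r ∧ |y| < r ∧ Displaced p x y j a b}

theorem pt_mem_star {r : ℝ} {p : Surface h v} (hg : Good r p) {j : Fin n} {a b : ℝ}
    (ha : a ∈ Icc (0 : ℝ) 1) (hb : b ∈ Icc (0 : ℝ) 1) :
    pt j a b ∈ star r p ↔ ∃ x y, |x| < r ∧ |y| < r ∧ Displaced p x y j a b := by
  constructor
  · rintro ⟨i, c, hc, d, hd, e, x, y, hx, hy, hD⟩
    exact ⟨x, y, hx, hy, hD.congr hg hx hy hc hd ha hb e.symm⟩
  · rintro ⟨x, y, hx, hy, hD⟩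
    exact ⟨j, a, ha, b, hb, rfl, x, y, hx, hy, hD⟩

theorem self_mem_star {r : ℝ} (hr : 0 < r) (p : Surface h v) : p ∈ star r p := by
  obtain ⟨i, a, ha, b, hb, rfl⟩ := exists_pt p
  exact ⟨i, a, ha, b, hb, rfl, 0, 0, by simpa using hr, by simpa using hr,
    by simpa using ha, by simpa using hb, by simp⟩

/-- The preimage in each square is a union of open coordinate boxes centred at the representatives
of `p` in that square. -/
theorem isOpen_star {r : ℝ} {p : Surface h v} (hg : Good r p) : IsOpen (star r p) := by
  have : IsOpen (proj ⁻¹' star r p) := by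
    have : proj ⁻¹' star r p = ⋃ (j : Fin n) (c : {c : ℝ × ℝ // c.1 ∈ Icc (0 : ℝ) 1 ∧
        c.2 ∈ Icc (0 : ℝ) 1 ∧ pt j c.1 c.2 = p}),
        {z : Fin n × unitInterval × unitInterval |
          z.1 = j ∧ |(z.2.1 : ℝ) - c.1.1| < r ∧ |(z.2.2 : ℝ) - c.1.2| < r} := by
      ext ⟨j, a, b⟩
      rw [mem_preimage, proj_eq_pt, pt_mem_star hg a.2 b.2]
      simp only [mem_iUnion, mem_ofPred_eq, Subtype.exists, Prod.exists]
      constructor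
      · rintro ⟨x, y, hx, hy, h1, h2, h3⟩
        exact ⟨j, a - x, b - y, ⟨h1, h2, h3⟩, rfl, by simpa using hx, by simpa using hy⟩
      · rintro ⟨j, c, d, ⟨h1, h2, h3⟩, rfl, hx, hy⟩
        exact ⟨a - c, b - d, hx, hy, by simpa using h1, by simpa using h2, by simpa using h3⟩
    rw [this]
    refine isOpen_iUnion fun j => isOpen_iUnion fun c => ?_
    refine ((isOpen_discrete {j}).preimage continuous_fst).inter (IsOpen.inter ?_ ?_)
    · exact isOpen_lt (f := fun z : Fin n × unitInterval × unitInterval =>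
        |(z.2.1 : ℝ) - c.1.1|) (by fun_prop) continuous_const
    · exact isOpen_lt (f := fun z : Fin n × unitInterval × unitInterval =>
        |(z.2.2 : ℝ) - c.1.2|) (by fun_prop) continuous_const
  exact this

/-- The real coordinate jumps at the edges; it becomes continuous only as a point of the circle. -/
theorem continuous_coe_tX : Continuous fun p : Surface h v => (tX p : UnitAddCircle) := by
  have : (fun p : Surface h v => (tX p : UnitAddCircle)) =
      lift (fun _ a _ => (a : UnitAddCircle)) (by simp) (by simp) := by
    funext p
    obtain ⟨i, a, ha, b, hb, rfl⟩ := exists_pt p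
    rw [lift_pt _ _ _ ha hb, tX_pt ha hb]
    exact AddCircle.coe_fract a
  rw [this]
  refine continuous_lift _ _ _ fun i => ?_
  exact ((AddCircle.continuous_mk' 1).comp continuous_fst).continuousOn

theorem continuous_coe_tY : Continuous fun p : Surface h v => (tY p : UnitAddCircle) := by
  have : (fun p : Surface h v => (tY p : UnitAddCircle)) =
      lift (fun _ _ b => (b : UnitAddCircle)) (by simp) (by simp) := by
    funext p
    obtain ⟨i, a, ha, b, hb, rfl⟩ := exists_pt p
    rw [lift_pt _ _ _ ha hb, tY_pt ha hb]
    exact AddCircle.coe_fract b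
  rw [this]
  refine continuous_lift _ _ _ fun i => ?_
  exact ((AddCircle.continuous_mk' 1).comp continuous_snd).continuousOn

/-- Points with different coordinates are separated by the maps to the circle. For points with equal
coordinates, a common point of the two stars would be displaced from both by amounts below `1 / 2`,
hence from the same point of its square. -/
instance : T2Space (Surface h v) := by
  refine ⟨fun p q hpq => ?_⟩
  by_cases e1 : (tX p : UnitAddCircle) = tX q
  swap
  · exact separated_by_continuous continuous_coe_tX e1
  by_cases e2 : (tY p : UnitAddCircle) = tY q
  swap
  · exact separated_by_continuous continuous_coe_tY e2
  have f1 : tX p = tX q := by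
    obtain ⟨i, a, ha, b, hb, rfl⟩ := exists_pt p
    obtain ⟨j, c, hc, d, hd, rfl⟩ := exists_pt q
    rw [tX_pt ha hb, tX_pt hc hd] at e1 ⊢
    rw [AddCircle.coe_fract, AddCircle.coe_fract] at e1
    rw [Int.fract_eq_fract]
    obtain ⟨m, hm⟩ := (AddCircle.coe_eq_zero_iff 1).1
      ((AddCircle.coe_sub 1 a c).trans (sub_eq_zero.2 e1))
    exact ⟨m, by simpa using hm.symm⟩
  have f2 : tY p = tY q := by
    obtain ⟨i, a, ha, b, hb, rfl⟩ := exists_pt p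
    obtain ⟨j, c, hc, d, hd, rfl⟩ := exists_pt q
    rw [tY_pt ha hb, tY_pt hc hd] at e2 ⊢
    rw [AddCircle.coe_fract, AddCircle.coe_fract] at e2
    rw [Int.fract_eq_fract]
    obtain ⟨m, hm⟩ := (AddCircle.coe_eq_zero_iff 1).1
      ((AddCircle.coe_sub 1 b d).trans (sub_eq_zero.2 e2))
    exact ⟨m, by simpa using hm.symm⟩
  refine ⟨star (rad p) p, star (rad q) q, isOpen_star (good_rad p), isOpen_star (good_rad q),
    self_mem_star (rad_pos p) p, self_mem_star (rad_pos q) q, ?_⟩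
  rw [Set.disjoint_left]
  intro z hz hz'
  obtain ⟨i, a, ha, b, hb, rfl⟩ := exists_pt z
  obtain ⟨x, y, hx, hy, k1, k2, k3⟩ := (pt_mem_star (good_rad p) ha hb).1 hz
  obtain ⟨x', y', hx', hy', l1, l2, l3⟩ := (pt_mem_star (good_rad q) ha hb).1 hz'
  rw [abs_lt] at hx hy hx' hy'
  have := rad_le p
  have := rad_le q
  obtain ⟨m1, m2⟩ := eq_of_pt_eq_of_abs_lt (h := h) (v := v) (j := i) k1 k2 l1 l2
    (by rw [k3, l3, f1]) (by rw [k3, l3, f2])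
    (by rw [abs_lt]; constructor <;> linarith) (by rw [abs_lt]; constructor <;> linarith)
  rw [m1, m2] at k3
  exact hpq (k3.symm.trans l3)

theorem isClosedMap_proj : IsClosedMap (proj : _ → Surface h v) :=
  continuous_proj.isClosedMap

/-- A property holds near `p` if it holds near every representative of `p`. -/
theorem eventually_nhds {p : Surface h v} {P : Surface h v → Prop}
    (H : ∀ j, ∀ a ∈ Icc (0 : ℝ) 1, ∀ b ∈ Icc (0 : ℝ) 1, pt j a b = p →
      ∀ᶠ z : ℝ × ℝ in 𝓝 (a, b), z ∈ unitSq → P (pt j z.1 z.2)) : ∀ᶠ q in 𝓝 p, P q := by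
  have := isClosedMap_proj.eventually_nhds_fiber (p := fun z => P (proj z)) p ?_
  · filter_upwards [this] with q hq
    obtain ⟨z, rfl⟩ := Quot.exists_rep q
    exact hq z rfl
  · rintro ⟨j, a, b⟩ e
    have e' : pt j a b = p := (proj_eq_pt j a b).symm.trans e
    have h1 := H j a a.2 b b.2 e'
    have c : Continuous fun z : Fin n × unitInterval × unitInterval =>
      ((z.2.1 : ℝ), (z.2.2 : ℝ)) := by fun_prop
    have h2 := (c.tendsto (j, a, b)).eventually h1
    have h3 : ∀ᶠ z : Fin n × unitInterval × unitInterval in 𝓝 (j, a, b), z.1 = j :=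
      continuous_fst.continuousAt.eventually (p := fun k => k = j) (by simp)
    filter_upwards [h2, h3] with z hz hzj
    have := hz ⟨z.2.1.2, z.2.2.2⟩
    rwa [← hzj, ← proj_eq_pt] at this

/-- Connectedness of the gluing pattern. -/
def Transitive (h v : Equiv.Perm (Fin n)) : Prop :=
  ∀ P : Fin n → Prop, (∀ i, P (h i) ↔ P i) → (∀ i, P (v i) ↔ P i) → ∀ i j, P i → P j

/-- A clopen set contains a square as soon as it meets it, so the squares it contains are stable
under `h` and `v`. -/
theorem preconnectedSpace (ht : Transitive h v) : PreconnectedSpace (Surface h v) := by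
  rw [preconnectedSpace_iff_clopen]
  intro U hU
  by_contra hne
  push Not at hne
  obtain ⟨h1, h2⟩ := hne
  have sqc : ∀ i : Fin n, ∀ a b c d : ℝ, (pt i a b : Surface h v) ∈ U → pt i c d ∈ U := by
    intro i a b c d hab
    have : IsClopen ((fun z : ℝ × ℝ => (pt i z.1 z.2 : Surface h v)) ⁻¹' U) :=
      hU.preimage (continuous_pt i)
    rcases isClopen_iff.1 this with h | h
    · have : (a, b) ∈ (∅ : Set (ℝ × ℝ)) := h ▸ hab
      exact this.elim
    · have : (c, d) ∈ (univ : Set (ℝ × ℝ)) := mem_univ _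
      rw [← h] at this
      exact this
  have := ht (fun i => (pt i 0 0 : Surface h v) ∈ U)
    (fun i => by rw [← pt_right]; exact ⟨sqc _ _ _ _ _, sqc _ _ _ _ _⟩)
    (fun i => by rw [← pt_top]; exact ⟨sqc _ _ _ _ _, sqc _ _ _ _ _⟩)
  obtain ⟨x, hx⟩ := h1
  refine h2 (eq_univ_of_forall fun y => ?_)
  obtain ⟨i, a, ha, b, hb, rfl⟩ := exists_pt x
  obtain ⟨j, c, hc, d, hd, rfl⟩ := exists_pt y
  exact sqc _ _ _ _ _ (this i j (sqc _ _ _ _ _ hx))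

theorem connectedSpace (ht : Transitive h v) (i : Fin n) : ConnectedSpace (Surface h v) :=
  { preconnectedSpace ht with toNonempty := ⟨pt i 0 0⟩ }

end Origami

namespace Origami

open Set

variable {n : ℕ} {h v : Equiv.Perm (Fin n)}

/-! ### Charts -/

/-- The preimage under `g` of a closed set is the image under `E` of a closed, hence compact, part
of `S`, and is therefore closed. -/
theorem continuousOn_of_factor {T X Y : Type*} [TopologicalSpace T] [T2Space T]
    [TopologicalSpace X] [T2Space X] [TopologicalSpace Y] {S : Set T} (hS : IsCompact S)
    {E : T → X} {G : T → Y} (hE : ContinuousOn E S) (hG : ContinuousOn G S) {g : X → Y}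
    (hg : ∀ t ∈ S, g (E t) = G t) : ContinuousOn g (E '' S) := by
  rw [continuousOn_iff_isClosed]
  intro C hC
  refine ⟨E '' (S ∩ G ⁻¹' C), ?_, ?_⟩
  · have hc : IsCompact (S ∩ G ⁻¹' C) :=
      hS.of_isClosed_subset (hG.preimage_isClosed_of_isClosed hS.isClosed hC) inter_subset_left
    exact (hc.image_of_continuousOn (hE.mono inter_subset_left)).isClosed
  · ext x
    constructor
    · rintro ⟨hx, t, ht, rfl⟩
      refine ⟨⟨t, ⟨ht, ?_⟩, rfl⟩, t, ht, rfl⟩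
      rw [mem_preimage, hg t ht] at hx
      exact hx
    · rintro ⟨⟨t, ⟨ht, htC⟩, rfl⟩, hx⟩
      refine ⟨?_, hx⟩
      rw [mem_preimage, hg t ht]
      exact htC

/-- Two parametrizations by the same compact set with the same fibres differ by a
homeomorphism. -/
theorem exists_openPartialHomeomorph {T X Y : Type*} [TopologicalSpace T] [T2Space T]
    [TopologicalSpace X] [T2Space X] [TopologicalSpace Y] [T2Space Y] [Nonempty X] [Nonempty Y]
    {S S₀ : Set T} (hS : IsCompact S) (h0 : S₀ ⊆ S) {E : T → X} {G : T → Y}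
    (hE : ContinuousOn E S) (hG : ContinuousOn G S)
    (hk : ∀ s ∈ S, ∀ t ∈ S, E s = E t ↔ G s = G t) (hN : IsOpen (E '' S₀))
    (hO : IsOpen (G '' S₀)) :
    ∃ φ : OpenPartialHomeomorph X Y, φ.source = E '' S₀ ∧ ∀ t ∈ S₀, φ (E t) = G t := by
  classical
  -- Outside the images of `S` both maps take an arbitrary value, which plays no role on source and
  -- target.
  let g : X → Y := fun x => if hx : ∃ t ∈ S, E t = x then G hx.choose else Classical.arbitrary Y
  let e : Y → X := fun y => if hy : ∃ t ∈ S, G t = y then E hy.choose else Classical.arbitrary X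
  have hg : ∀ t ∈ S, g (E t) = G t := by
    intro t ht
    have hx : ∃ t' ∈ S, E t' = E t := ⟨t, ht, rfl⟩
    simp only [g, dif_pos hx]
    exact (hk _ hx.choose_spec.1 _ ht).1 hx.choose_spec.2
  have he : ∀ t ∈ S, e (G t) = E t := by
    intro t ht
    have hx : ∃ t' ∈ S, G t' = G t := ⟨t, ht, rfl⟩
    simp only [e, dif_pos hx]
    exact (hk _ hx.choose_spec.1 _ ht).2 hx.choose_spec.2
  refine ⟨{ toFun := g, invFun := e, source := E '' S₀, target := G '' S₀,
            map_source' := ?_, map_target' := ?_, left_inv' := ?_, right_inv' := ?_,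
            open_source := hN, open_target := hO, continuousOn_toFun := ?_,
            continuousOn_invFun := ?_ }, rfl, fun t ht => hg t (h0 ht)⟩
  · rintro _ ⟨t, ht, rfl⟩
    exact ⟨t, ht, (hg t (h0 ht)).symm⟩
  · rintro _ ⟨t, ht, rfl⟩
    exact ⟨t, ht, (he t (h0 ht)).symm⟩
  · rintro _ ⟨t, ht, rfl⟩
    rw [hg t (h0 ht), he t (h0 ht)]
  · rintro _ ⟨t, ht, rfl⟩
    rw [he t (h0 ht), hg t (h0 ht)]
  · exact (continuousOn_of_factor hS hE hG hg).mono (image_mono h0)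
  · exact (continuousOn_of_factor hS hG hE he).mono (image_mono h0)

/-- There is a coordinate on the star of `p` whose `k`-th power is the displacement from `p`,
scaled by `s`. -/
def ChartSpec (s : ℝ) (k : ℕ) (p : Surface h v) (φ : OpenPartialHomeomorph (Surface h v) ℂ) : Prop :=
  φ.source = star (rad p / 2) p ∧
    ∀ j, ∀ a ∈ Icc (0 : ℝ) 1, ∀ b ∈ Icc (0 : ℝ) 1, ∀ x y : ℝ, |x| < rad p / 2 → |y| < rad p / 2 →
      Displaced p x y j a b → φ (pt j a b) ^ k = s * (x + y * Complex.I)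

theorem half_rad_lt (p : Surface h v) : rad p / 2 < rad p := by linarith [rad_pos p]

/-- The map `E` plays the role of the exponential map at `p`: `h1` says that `E w` is displaced by
`w`, and `h2` that displaced points are values of `E`. Uniqueness of displacements then makes `E`
injective near `0`. The chart is kept to half the radius, so that the closed box lies in the region
where displacements are unique. -/
theorem exists_chart_of_exp {s : ℝ} (hs : 0 < s) (p : Surface h v) (E : ℝ × ℝ → Surface h v)
    (hc : Continuous E)
    (h1 : ∀ w : ℝ × ℝ, |w.1| < rad p → |w.2| < rad p →
      ∃ j, ∃ a ∈ Icc (0 : ℝ) 1, ∃ b ∈ Icc (0 : ℝ) 1, E w = pt j a b ∧ Displaced p w.1 w.2 j a b)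
    (h2 : ∀ j, ∀ a ∈ Icc (0 : ℝ) 1, ∀ b ∈ Icc (0 : ℝ) 1, pt j a b = p → ∀ w : ℝ × ℝ,
      |w.1| < rad p → |w.2| < rad p → a + w.1 ∈ Icc (0 : ℝ) 1 → b + w.2 ∈ Icc (0 : ℝ) 1 →
        pt j (a + w.1) (b + w.2) = E w) :
    ∃ φ, ChartSpec s 1 p φ := by
  set ρ := rad p / 2 with hρ
  have hρr : ρ < rad p := half_rad_lt p
  let S : Set (ℝ × ℝ) := Icc (-ρ) ρ ×ˢ Icc (-ρ) ρ
  let S₀ : Set (ℝ × ℝ) := Ioo (-ρ) ρ ×ˢ Ioo (-ρ) ρ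
  let G : ℝ × ℝ → ℂ := fun w => s * (w.1 + w.2 * Complex.I)
  have hre : ∀ w, (G w).re = s * w.1 := fun w => by simp [G]
  have him : ∀ w, (G w).im = s * w.2 := fun w => by simp [G]
  have h0 : S₀ ⊆ S := prod_mono Ioo_subset_Icc_self Ioo_subset_Icc_self
  have habs : ∀ w ∈ S, |w.1| < rad p ∧ |w.2| < rad p := fun w hw =>
    ⟨(abs_le.2 hw.1).trans_lt hρr, (abs_le.2 hw.2).trans_lt hρr⟩
  have hGinj : ∀ w w', G w = G w' → w = w' := by
    intro w w' e
    have e1 := congrArg Complex.re e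
    have e2 := congrArg Complex.im e
    rw [hre, hre] at e1
    rw [him, him] at e2
    exact Prod.ext (mul_left_cancel₀ hs.ne' e1) (mul_left_cancel₀ hs.ne' e2)
  have hstar : E '' S₀ = star ρ p := by
    ext q
    constructor
    · rintro ⟨w, hw, rfl⟩
      obtain ⟨j, a, ha, b, hb, e, hD⟩ := h1 w (habs w (h0 hw)).1 (habs w (h0 hw)).2
      exact ⟨j, a, ha, b, hb, e, w.1, w.2, abs_lt.2 hw.1, abs_lt.2 hw.2, hD⟩
    · rintro ⟨j, a, ha, b, hb, rfl, x, y, hx, hy, hD⟩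
      refine ⟨(x, y), ⟨abs_lt.1 hx, abs_lt.1 hy⟩, ?_⟩
      have := h2 j _ hD.1 _ hD.2.1 hD.2.2 (x, y) (hx.trans hρr) (hy.trans hρr)
        (by simpa using ha) (by simpa using hb)
      rw [← this]
      simp
  have hopen : IsOpen (G '' S₀) := by
    have : G '' S₀ = {z : ℂ | z.re / s ∈ Ioo (-ρ) ρ} ∩ {z : ℂ | z.im / s ∈ Ioo (-ρ) ρ} := by
      ext z
      constructor
      · rintro ⟨w, hw, rfl⟩
        simp only [mem_inter_iff, mem_ofPred_eq, hre, him, mul_div_cancel_left₀ _ hs.ne']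
        exact hw
      · rintro ⟨hz1, hz2⟩
        refine ⟨(z.re / s, z.im / s), ⟨hz1, hz2⟩, ?_⟩
        apply Complex.ext
        · rw [hre]; field_simp
        · rw [him]; field_simp
    rw [this]
    exact (isOpen_Ioo.preimage (by fun_prop : Continuous fun z : ℂ => z.re / s)).inter
      (isOpen_Ioo.preimage (by fun_prop : Continuous fun z : ℂ => z.im / s))
  have : Nonempty (Surface h v) := ⟨p⟩
  obtain ⟨φ, hφ, hφ'⟩ := exists_openPartialHomeomorph (S := S) (S₀ := S₀) (E := E) (G := G)
    (isCompact_Icc.prod isCompact_Icc) h0 hc.continuousOn (by fun_prop) (by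
      intro w hw w' hw'
      refine ⟨fun e => ?_, fun e => by rw [hGinj _ _ e]⟩
      obtain ⟨j, a, ha, b, hb, e1, hD⟩ := h1 w (habs w hw).1 (habs w hw).2
      obtain ⟨j', a', ha', b', hb', e1', hD'⟩ := h1 w' (habs w' hw').1 (habs w' hw').2
      have := hD.congr (good_rad p) (habs w hw).1 (habs w hw).2 ha hb ha' hb'
        (by rw [← e1, ← e1', e])
      obtain ⟨k1, k2⟩ := this.unique (rad_le p) (habs w hw).1 (habs w hw).2 (habs w' hw').1
        (habs w' hw').2 hD'
      rw [Prod.ext k1 k2]) (by rw [hstar]; exact isOpen_star ((good_rad p).mono hρr.le)) hopen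
  refine ⟨φ, hφ.trans hstar, ?_⟩
  intro j a ha b hb x y hx hy hD
  have := h2 j _ hD.1 _ hD.2.1 hD.2.2 (x, y) (hx.trans hρr) (hy.trans hρr)
    (by simpa using ha) (by simpa using hb)
  simp only [sub_add_cancel] at this
  rw [this, hφ' _ ⟨abs_lt.1 hx, abs_lt.1 hy⟩, pow_one]

theorem exists_chart_interior {s : ℝ} (hs : 0 < s) {i : Fin n} {a b : ℝ} (ha : a ∈ Ioo (0 : ℝ) 1)
    (hb : b ∈ Ioo (0 : ℝ) 1) : ∃ φ, ChartSpec s 1 (pt i a b : Surface h v) φ := by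
  have ha' := Ioo_subset_Icc_self ha
  have hb' := Ioo_subset_Icc_self hb
  have hfa : Int.fract a = a := fract_of_mem_Ico (Ioo_subset_Ico_self ha)
  have hfb : Int.fract b = b := fract_of_mem_Ico (Ioo_subset_Ico_self hb)
  refine exists_chart_of_exp hs _ (fun w => pt i (a + w.1) (b + w.2)) (by fun_prop) ?_ ?_
  · intro w hw1 hw2
    obtain ⟨k1, k2, k3, k4⟩ := (good_rad (pt i a b : Surface h v)).2 i a ha' b hb' rfl
    have k1 := k1.resolve_left ha.1.ne'
    have k2 := k2.resolve_left ha.2.ne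
    have k3 := k3.resolve_left hb.1.ne'
    have k4 := k4.resolve_left hb.2.ne
    rw [abs_lt] at hw1 hw2
    exact ⟨i, _, ⟨by linarith, by linarith⟩, _, ⟨by linarith, by linarith⟩, rfl,
      by simpa using ha', by simpa using hb', by simp⟩
  · intro j c hc d hd e w _ _ _ _
    rw [eq_comm, pt_eq_pt_iff ha' hb' hc hd (by rw [hfa]; exact fun k => ha.1.ne' k.1)] at e
    obtain ⟨e1, e2, e3⟩ := e
    rw [hfa] at e2
    rw [hfb] at e3
    have hc1 : c ≠ 1 := by rintro rfl; simp at e2; exact ha.1.ne' e2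
    have hd1 : d ≠ 1 := by rintro rfl; simp at e3; exact hb.1.ne' e3
    rw [fract_of_mem_Ico ⟨hc.1, lt_of_le_of_ne hc.2 hc1⟩] at e2
    rw [fract_of_mem_Ico ⟨hd.1, lt_of_le_of_ne hd.2 hd1⟩] at e3
    have e1 : i = j := by simpa [base, ha.2.ne, hb.2.ne, hc1, hd1] using e1
    rw [e1, e2, e3]

theorem exists_chart_left {s : ℝ} (hs : 0 < s) {i : Fin n} {b : ℝ}
    (hb : b ∈ Ioo (0 : ℝ) 1) : ∃ φ, ChartSpec s 1 (pt i 0 b : Surface h v) φ := by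
  have hb' := Ioo_subset_Icc_self hb
  have hfb : Int.fract b = b := fract_of_mem_Ico (Ioo_subset_Ico_self hb)
  -- Negative horizontal displacements lead into the left neighbour `h⁻¹ i`.
  refine exists_chart_of_exp hs _ (fun w => if 0 ≤ w.1 then pt i w.1 (b + w.2) else
    pt (h⁻¹ i) (1 + w.1) (b + w.2)) ?_ ?_ ?_
  · refine Continuous.if_le (by fun_prop) (by fun_prop) continuous_const continuous_fst ?_
    intro w hw
    rw [← hw, add_zero, pt_right]
    simp
  · intro w hw1 hw2
    obtain ⟨-, -, k3, k4⟩ := (good_rad (pt i 0 b : Surface h v)).2 i 0 (by simp) b hb' rfl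
    have k3 := k3.resolve_left hb.1.ne'
    have k4 := k4.resolve_left hb.2.ne
    have := rad_le (pt i 0 b : Surface h v)
    rw [abs_lt] at hw1 hw2
    split_ifs with h0
    · exact ⟨i, _, ⟨by linarith, by linarith⟩, _, ⟨by linarith, by linarith⟩, rfl,
        by simp, by simpa using hb', by simp⟩
    · exact ⟨h⁻¹ i, _, ⟨by linarith, by linarith⟩, _, ⟨by linarith, by linarith⟩, rfl,
        by simp, by simpa using hb', by simp [pt_right]⟩
  · intro j c hc d hd e w _ _ hcw _
    rw [eq_comm, pt_eq_pt_iff (by simp) hb' hc hd (by rw [hfb]; exact fun k => hb.1.ne' k.2)] at e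
    obtain ⟨e1, e2, e3⟩ := e
    rw [hfb] at e3
    have hd1 : d ≠ 1 := by rintro rfl; simp at e3; exact hb.1.ne' e3
    rw [fract_of_mem_Ico ⟨hd.1, lt_of_le_of_ne hd.2 hd1⟩] at e3
    subst e3
    rw [Int.fract_zero, eq_comm, fract_eq_zero hc] at e2
    rcases e2 with rfl | rfl
    · obtain rfl : i = j := by simpa [base, hd1] using e1
      rw [zero_add] at hcw ⊢
      rw [if_pos hcw.1]
    · obtain rfl : i = h j := by simpa [base, hd1] using e1
      split_ifs with h0
      · have : w.1 = 0 := by linarith [hcw.2]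
        rw [this, add_zero, pt_right]
      · simp

theorem exists_chart_bottom {s : ℝ} (hs : 0 < s) {i : Fin n} {a : ℝ}
    (ha : a ∈ Ioo (0 : ℝ) 1) : ∃ φ, ChartSpec s 1 (pt i a 0 : Surface h v) φ := by
  have ha' := Ioo_subset_Icc_self ha
  have hfa : Int.fract a = a := fract_of_mem_Ico (Ioo_subset_Ico_self ha)
  refine exists_chart_of_exp hs _ (fun w => if 0 ≤ w.2 then pt i (a + w.1) w.2 else
    pt (v⁻¹ i) (a + w.1) (1 + w.2)) ?_ ?_ ?_
  · refine Continuous.if_le (by fun_prop) (by fun_prop) continuous_const continuous_snd ?_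
    intro w hw
    rw [← hw, add_zero, pt_top]
    simp
  · intro w hw1 hw2
    obtain ⟨k1, k2, -, -⟩ := (good_rad (pt i a 0 : Surface h v)).2 i a ha' 0 (by simp) rfl
    have k1 := k1.resolve_left ha.1.ne'
    have k2 := k2.resolve_left ha.2.ne
    have := rad_le (pt i a 0 : Surface h v)
    rw [abs_lt] at hw1 hw2
    split_ifs with h0
    · exact ⟨i, _, ⟨by linarith, by linarith⟩, _, ⟨by linarith, by linarith⟩, rfl,
        by simpa using ha', by simp, by simp⟩
    · exact ⟨v⁻¹ i, _, ⟨by linarith, by linarith⟩, _, ⟨by linarith, by linarith⟩, rfl,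
        by simpa using ha', by simp, by simp [pt_top]⟩
  · intro j c hc d hd e w _ _ _ hdw
    rw [eq_comm, pt_eq_pt_iff ha' (by simp) hc hd (by rw [hfa]; exact fun k => ha.1.ne' k.1)] at e
    obtain ⟨e1, e2, e3⟩ := e
    rw [hfa] at e2
    have hc1 : c ≠ 1 := by rintro rfl; simp at e2; exact ha.1.ne' e2
    rw [fract_of_mem_Ico ⟨hc.1, lt_of_le_of_ne hc.2 hc1⟩] at e2
    subst e2
    rw [Int.fract_zero, eq_comm, fract_eq_zero hd] at e3
    rcases e3 with rfl | rfl
    · obtain rfl : i = j := by simpa [base, hc1] using e1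
      rw [zero_add] at hdw ⊢
      rw [if_pos hdw.1]
    · obtain rfl : i = v j := by simpa [base, hc1] using e1
      split_ifs with h0
      · have : w.2 = 0 := by linarith [hdw.2]
        rw [this, add_zero, pt_top]
      · simp

end Origami

namespace Origami

open Set

variable {n : ℕ} {h v : Equiv.Perm (Fin n)}

/-! ### Charts at the vertices -/

/-- The rotation by `q` quarter turns. -/
def rot (q : Fin 4) (x y : ℝ) : ℝ × ℝ := ![(x, y), (-y, x), (-x, -y), (y, -x)] q

/-- The squares met when turning around the lower left corner of the square `i`. -/
def sector (h v : Equiv.Perm (Fin n)) (i : Fin n) (q : Fin 4) (l : ℕ) : Fin n :=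
  ![1, h⁻¹, v⁻¹ * h⁻¹, h * v⁻¹ * h⁻¹] q ((comm h v)^[l] i)

/-- The corner of the `q`-th sector. -/
def corner (q : Fin 4) : ℝ × ℝ := ![(0, 0), (1, 0), (1, 1), (0, 1)] q

/-- Parametrization of the star of a vertex by sectors. -/
def coneExp (h v : Equiv.Perm (Fin n)) (i : Fin n) (q : Fin 4) (l : ℕ) (x y : ℝ) : Surface h v :=
  pt (sector h v i q l) ((corner q).1 + (rot q x y).1) ((corner q).2 + (rot q x y).2)

/-- The corresponding points of the complex plane. -/
def coneCoord (s : ℝ) (k : ℕ) (q : Fin 4) (l : ℕ) (x y : ℝ) : ℂ :=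
  ((s : ℂ) * (x + y * Complex.I)) ^ ((k : ℂ)⁻¹) *
    Complex.exp (2 * Real.pi * Complex.I * ((4 * l + (q : ℕ) : ℕ) : ℂ) / (4 * k))

/-- The `k`-th power multiplies the angle `2 π (4 l + q) / (4 k)` by `k`: the turns `l` disappear
and `q` quarter turns remain. -/
theorem coneCoord_pow {s : ℝ} {k : ℕ} (hk : k ≠ 0) (q : Fin 4) (l : ℕ) (x y : ℝ) :
    coneCoord s k q l x y ^ k = s * ((rot q x y).1 + (rot q x y).2 * Complex.I) := by
  have hk' : (k : ℂ) ≠ 0 := by exact_mod_cast hk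
  have e1 : Complex.exp (2 * Real.pi * Complex.I * ((4 * l + (q : ℕ) : ℕ) : ℂ) / (4 * k)) ^ k =
      Complex.I ^ (q : ℕ) := by
    rw [← Complex.exp_nat_mul]
    have : (k : ℂ) * (2 * Real.pi * Complex.I * ((4 * l + (q : ℕ) : ℕ) : ℂ) / (4 * k)) =
        l * (2 * Real.pi * Complex.I) + (q : ℕ) * (Real.pi / 2 * Complex.I) := by
      push_cast
      field_simp
      ring
    rw [this, Complex.exp_add, Complex.exp_nat_mul_two_pi_mul_I, one_mul, Complex.exp_nat_mul,
      Complex.exp_pi_div_two_mul_I]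
  rw [coneCoord, mul_pow, Complex.cpow_nat_inv_pow _ hk, e1]
  fin_cases q
  · simp [rot]
  · simp [rot]
    linear_combination (s : ℂ) * y * Complex.I_sq
  · simp [rot]
    ring
  · simp [rot, pow_succ]
    linear_combination (-(s : ℂ) * y) * Complex.I_sq

/-- Going counterclockwise, the last edge of a quadrant is the first edge of the next one. After
four quadrants the square is replaced by its image under `comm h v`, which raises `l`. -/
theorem coneExp_eq_next (i : Fin n) (q : Fin 4) (l : ℕ) (y : ℝ) :
    coneExp h v i q l 0 y = if q = 3 then coneExp h v i 0 (l + 1) y 0 else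
      coneExp h v i (q + 1) l y 0 := by
  fin_cases q
  · simp [coneExp, sector, corner, rot, pt_right]
  · simp [coneExp, sector, corner, rot, pt_top]
  · simp [coneExp, sector, corner, rot, pt_right, ← sub_eq_add_neg]
  · simp only [coneExp, sector, corner, rot]
    simp [pt_top, Function.iterate_succ_apply', -Function.iterate_succ]
    simp [comm]

/-- The principal `k`-th root of `I` is `exp (2 π I / (4 k))`, exactly the angle of one sector. -/
theorem coneCoord_eq_next {s : ℝ} (hs : 0 < s) {k : ℕ} (hk : k ≠ 0) (q : Fin 4) (l : ℕ) {y : ℝ}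
    (hy : 0 < y) :
    coneCoord s k q l 0 y = if q = 3 then coneCoord s k 0 (l + 1) y 0 else
      coneCoord s k (q + 1) l y 0 := by
  have hk' : (k : ℂ) ≠ 0 := by exact_mod_cast hk
  have hsy : 0 < s * y := mul_pos hs hy
  have hsy' : ((s * y : ℝ) : ℂ) ≠ 0 := by exact_mod_cast hsy.ne'
  have e1 : ((s : ℂ) * ((0 : ℝ) + y * Complex.I)) ^ ((k : ℂ)⁻¹) =
      ((s : ℂ) * (y + (0 : ℝ) * Complex.I)) ^ ((k : ℂ)⁻¹) *
        Complex.exp (2 * Real.pi * Complex.I / (4 * k)) := by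
    have e2 : (s : ℂ) * ((0 : ℝ) + y * Complex.I) = ((s * y : ℝ) : ℂ) * Complex.I := by
      push_cast; ring
    have e3 : (s : ℂ) * (y + (0 : ℝ) * Complex.I) = ((s * y : ℝ) : ℂ) := by
      push_cast; ring
    rw [e2, e3, Complex.cpow_def_of_ne_zero (mul_ne_zero hsy' Complex.I_ne_zero),
      Complex.cpow_def_of_ne_zero hsy', Complex.log_ofReal_mul hsy Complex.I_ne_zero,
      Complex.log_I, ← Complex.ofReal_log hsy.le, ← Complex.exp_add]
    congr 1
    field_simp
    ring
  have e4 : ∀ m : ℕ, Complex.exp (2 * Real.pi * Complex.I / (4 * k)) *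
      Complex.exp (2 * Real.pi * Complex.I * (m : ℂ) / (4 * k)) =
        Complex.exp (2 * Real.pi * Complex.I * ((m + 1 : ℕ) : ℂ) / (4 * k)) := by
    intro m
    rw [← Complex.exp_add]
    congr 1
    push_cast
    ring
  unfold coneCoord
  rw [e1, mul_assoc, e4]
  fin_cases q <;> simp [mul_add, add_assoc]

theorem coneCoord_wrap (s : ℝ) {k : ℕ} (hk : k ≠ 0) (q : Fin 4) (x y : ℝ) :
    coneCoord s k q k x y = coneCoord s k q 0 x y := by
  have hk' : (k : ℂ) ≠ 0 := by exact_mod_cast hk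
  unfold coneCoord
  congr 1
  rw [← mul_one (Complex.exp (_ * ((4 * 0 + (q : ℕ) : ℕ) : ℂ) / _)), ← Complex.exp_two_pi_mul_I,
    ← Complex.exp_add]
  congr 1
  push_cast
  field_simp
  ring

theorem coneExp_wrap (i : Fin n) (q : Fin 4) (x y : ℝ) :
    coneExp h v i q (Function.minimalPeriod (comm h v) i) x y = coneExp h v i q 0 x y := by
  unfold coneExp sector
  rw [Function.iterate_minimalPeriod, Function.iterate_zero, id]

theorem coneExp_mem {q : Fin 4} {x y : ℝ} (hx : x ∈ Icc (0 : ℝ) 1) (hy : y ∈ Icc (0 : ℝ) 1) :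
    (corner q).1 + (rot q x y).1 ∈ Icc (0 : ℝ) 1 ∧ (corner q).2 + (rot q x y).2 ∈ Icc (0 : ℝ) 1 := by
  obtain ⟨hx0, hx1⟩ := hx
  obtain ⟨hy0, hy1⟩ := hy
  fin_cases q <;> simp [corner, rot] <;> refine ⟨⟨?_, ?_⟩, ?_, ?_⟩ <;> linarith

theorem pt_corner (i : Fin n) (q : Fin 4) (l : ℕ) :
    (pt (sector h v i q l) (corner q).1 (corner q).2 : Surface h v) = pt i 0 0 := by
  have e0 : ∀ m, (pt ((comm h v)^[m] i) 0 0 : Surface h v) = pt i 0 0 := by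
    intro m
    induction m with
    | zero => rfl
    | succ m ih => rw [Function.iterate_succ_apply', pt_comm, ih]
  fin_cases q
  · simpa [sector, corner] using e0 l
  · simpa [sector, corner, pt_right] using e0 l
  · simpa [sector, corner, pt_top, pt_right] using e0 l
  · have := e0 (l + 1)
    rw [Function.iterate_succ_apply'] at this
    simpa [sector, corner, pt_top, pt_right, comm] using this

theorem displaced_coneExp (i : Fin n) (q : Fin 4) (l : ℕ) (x y : ℝ) :
    Displaced (pt i 0 0 : Surface h v) (rot q x y).1 (rot q x y).2 (sector h v i q l)
      ((corner q).1 + (rot q x y).1) ((corner q).2 + (rot q x y).2) := by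
  have : (corner q).1 ∈ Icc (0 : ℝ) 1 ∧ (corner q).2 ∈ Icc (0 : ℝ) 1 := by
    fin_cases q <;> simp [corner]
  refine ⟨by simpa using this.1, by simpa using this.2, ?_⟩
  simpa using pt_corner i q l

theorem abs_rot_lt {q : Fin 4} {x y r : ℝ} :
    (|(rot q x y).1| < r ∧ |(rot q x y).2| < r) ↔ |x| < r ∧ |y| < r := by
  fin_cases q <;> simp [rot] <;> exact and_comm

/-- Rotations of a half-open quadrant are disjoint. -/
theorem rot_injective {q q' : Fin 4} {x y x' y' : ℝ} (hx : 0 < x) (hy : 0 ≤ y) (hx' : 0 < x')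
    (hy' : 0 ≤ y') (e : rot q x y = rot q' x' y') : q = q' ∧ x = x' ∧ y = y' := by
  fin_cases q <;> fin_cases q' <;> simp [rot] at e ⊢ <;> obtain ⟨e1, e2⟩ := e <;>
    first | exact ⟨by linarith, by linarith⟩ | (exfalso; linarith)

theorem rot_eq_zero {q : Fin 4} {x y : ℝ} (e : rot q x y = (0, 0)) : x = 0 ∧ y = 0 := by
  fin_cases q <;> simp [rot] at e <;> tauto

theorem rot_zero (q : Fin 4) : rot q 0 0 = (0, 0) := by
  fin_cases q <;> simp [rot]

theorem sector_injective {i : Fin n} {q : Fin 4} {l l' : ℕ}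
    (hl : l < Function.minimalPeriod (comm h v) i) (hl' : l' < Function.minimalPeriod (comm h v) i)
    (e : sector h v i q l = sector h v i q l') : l = l' :=
  Function.iterate_injOn_Iio_minimalPeriod hl hl' (Equiv.injective _ e)

theorem base_injective {i j : Fin n} {a b : ℝ} (e : base h v i a b = base h v j a b) : i = j := by
  unfold base at e
  exact Equiv.injective _ (Equiv.injective _ e)

theorem minimalPeriod_pos (g : Equiv.Perm (Fin n)) (i : Fin n) :
    0 < Function.minimalPeriod g i :=
  Function.minimalPeriod_pos_of_mem_periodicPts (g.injective.mem_periodicPts i)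

/-- The displacement from the vertex is unique and determines `q`, `x`, `y`. The square containing
the point then determines the iterate of `comm h v`, and so `l`. -/
theorem coneExp_injective {i : Fin n} {q q' : Fin 4} {l l' : ℕ} {x y x' y' : ℝ}
    (hl : l < Function.minimalPeriod (comm h v) i) (hl' : l' < Function.minimalPeriod (comm h v) i)
    (hx : 0 < x) (hx2 : x < 1 / 2) (hy : 0 ≤ y) (hy2 : y < 1 / 2) (hx' : 0 < x')
    (hx2' : x' < 1 / 2) (hy' : 0 ≤ y') (hy2' : y' < 1 / 2)
    (hr : rad (pt i 0 0 : Surface h v) = 1 / 2)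
    (e : coneExp h v i q l x y = coneExp h v i q' l' x' y') :
    q = q' ∧ l = l' ∧ x = x' ∧ y = y' := by
  have m1 := coneExp_mem (q := q) (x := x) (y := y) ⟨hx.le, by linarith⟩ ⟨hy, by linarith⟩
  have m2 := coneExp_mem (q := q') (x := x') (y := y') ⟨hx'.le, by linarith⟩ ⟨hy', by linarith⟩
  have a1 := (abs_rot_lt (q := q) (x := x) (y := y) (r := 1 / 2)).2
    ⟨by rwa [abs_of_pos hx], by rwa [abs_of_nonneg hy]⟩
  have a2 := (abs_rot_lt (q := q') (x := x') (y := y') (r := 1 / 2)).2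
    ⟨by rwa [abs_of_pos hx'], by rwa [abs_of_nonneg hy']⟩
  have hD := (displaced_coneExp (h := h) (v := v) i q l x y).congr (hr ▸ good_rad _) a1.1 a1.2
    m1.1 m1.2 m2.1 m2.2 e
  obtain ⟨k1, k2⟩ := hD.unique le_rfl a1.1 a1.2 a2.1 a2.2 (displaced_coneExp i q' l' x' y')
  obtain ⟨rfl, rfl, rfl⟩ := rot_injective hx hy hx' hy' (Prod.ext k1 k2)
  refine ⟨rfl, ?_, rfl, rfl⟩
  unfold coneExp at e
  rw [pt_eq_pt_iff m1.1 m1.2 m2.1 m2.2] at e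
  · exact sector_injective hl hl' (base_injective e.1)
  · rintro ⟨f1, f2⟩
    rw [fract_eq_zero m1.1] at f1
    rw [fract_eq_zero m1.2] at f2
    fin_cases q <;> simp [rot, corner] at f1 f2 <;> rcases f1 with f1 | f1 <;>
      rcases f2 with f2 | f2 <;> linarith

/-- The `k`-th power determines `q`, `x`, `y`; the remaining root of unity determines `l` modulo
`k`. -/
theorem coneCoord_injective {s : ℝ} (hs : 0 < s) {k : ℕ} (hk : k ≠ 0) {q q' : Fin 4} {l l' : ℕ}
    {x y x' y' : ℝ} (hl : l < k) (hl' : l' < k) (hx : 0 < x) (hy : 0 ≤ y) (hx' : 0 < x')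
    (hy' : 0 ≤ y') (e : coneCoord s k q l x y = coneCoord s k q' l' x' y') :
    q = q' ∧ l = l' ∧ x = x' ∧ y = y' := by
  have hk' : (k : ℂ) ≠ 0 := by exact_mod_cast hk
  have hs' : (s : ℂ) ≠ 0 := by exact_mod_cast hs.ne'
  have e1 := congrArg (· ^ k) e
  simp only [coneCoord_pow hk] at e1
  have e1 := mul_left_cancel₀ hs' e1
  have e2 : rot q x y = rot q' x' y' := by
    refine Prod.ext ?_ ?_
    · simpa using congrArg Complex.re e1
    · simpa using congrArg Complex.im e1
  obtain ⟨rfl, rfl, rfl⟩ := rot_injective hx hy hx' hy' e2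
  refine ⟨rfl, ?_, rfl, rfl⟩
  have hne : ((s : ℂ) * (x + y * Complex.I)) ^ ((k : ℂ)⁻¹) ≠ 0 := by
    rw [Complex.cpow_ne_zero_iff_of_exponent_ne_zero (inv_ne_zero hk')]
    refine mul_ne_zero hs' fun h0 => hx.ne' ?_
    simpa using congrArg Complex.re h0
  have e3 := mul_left_cancel₀ hne e
  rw [Complex.exp_eq_exp_iff_exists_int] at e3
  obtain ⟨m, hm⟩ := e3
  have hpi : (2 * Real.pi * Complex.I : ℂ) ≠ 0 := Complex.two_pi_I_ne_zero
  have e4 : (2 * Real.pi * Complex.I : ℂ) * (l - l' - m * k) = 0 := by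
    field_simp at hm
    push_cast at hm
    linear_combination (2 * Real.pi * Complex.I / 4 : ℂ) * hm
  have e5 := (mul_eq_zero.1 e4).resolve_left hpi
  have e6 : (l : ℤ) - l' - m * k = 0 := by exact_mod_cast e5
  have : m = 0 := by
    by_contra hm0
    rcases lt_or_gt_of_ne hm0 with h1 | h1
    · nlinarith
    · nlinarith
  rw [this] at e6
  omega

/-- Every complex number is rotated into the first sector by a multiple of `2 π / (4 k)`. -/
theorem exists_sector {k : ℕ} (hk : k ≠ 0) (z : ℂ) :
    ∃ q : Fin 4, ∃ l < k, ∃ φ : ℝ, 0 ≤ φ ∧ φ * k ≤ Real.pi / 2 ∧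
      z = ‖z‖ * Complex.exp (φ * Complex.I) *
        Complex.exp (2 * Real.pi * Complex.I * ((4 * l + (q : ℕ) : ℕ) : ℂ) / (4 * k)) := by
  have hk0 : (0 : ℝ) < k := by exact_mod_cast Nat.pos_of_ne_zero hk
  have hk' : (k : ℂ) ≠ 0 := by exact_mod_cast hk
  have hpi := Real.pi_pos
  obtain ⟨θ, h0, h1, e⟩ : ∃ θ : ℝ, 0 ≤ θ ∧ θ < 2 * Real.pi ∧
      z = ‖z‖ * Complex.exp (θ * Complex.I) := by
    rcases le_or_gt 0 z.arg with h0 | h0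
    · exact ⟨z.arg, h0, by linarith [Complex.arg_le_pi z], (Complex.norm_mul_exp_arg_mul_I z).symm⟩
    · refine ⟨z.arg + 2 * Real.pi, by linarith [Complex.neg_pi_lt_arg z], by linarith, ?_⟩
      push_cast
      rw [add_mul, Complex.exp_add, Complex.exp_two_pi_mul_I, mul_one]
      exact (Complex.norm_mul_exp_arg_mul_I z).symm
  -- A sector has opening `π / (2 k)`, so `m` is the number of the sector containing the angle `θ`.
  set m := ⌊θ * (2 * k) / Real.pi⌋₊ with hm
  have m1 : (m : ℝ) ≤ θ * (2 * k) / Real.pi := Nat.floor_le (by positivity)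
  have m2 : θ * (2 * k) / Real.pi < m + 1 := Nat.lt_floor_add_one _
  rw [le_div_iff₀ hpi] at m1
  rw [div_lt_iff₀ hpi] at m2
  have m3 : m < 4 * k := by
    have : (m : ℝ) * Real.pi < (4 * k) * Real.pi := by nlinarith
    have := lt_of_mul_lt_mul_right this hpi.le
    exact_mod_cast this
  refine ⟨⟨m % 4, Nat.mod_lt _ (by norm_num)⟩, m / 4, by omega, θ - m * Real.pi / (2 * k), ?_, ?_, ?_⟩
  · rw [sub_nonneg, div_le_iff₀ (by positivity)]
    linarith
  · have : (θ - m * Real.pi / (2 * k)) * k = θ * k - m * Real.pi / 2 := by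
      field_simp
    rw [this]
    linarith
  · rw [mul_assoc, ← Complex.exp_add]
    have : 4 * (m / 4) + m % 4 = m := by omega
    simp only [this]
    rw [e]
    simp only [norm_mul, Complex.norm_real, norm_norm, Complex.norm_exp_ofReal_mul_I, mul_one]
    congr 2
    push_cast
    field_simp
    ring

theorem rad_vertex (i : Fin n) : rad (pt i 0 0 : Surface h v) = 1 / 2 := by
  rw [rad, tX_pt (by simp) (by simp), tY_pt (by simp) (by simp)]
  simp [edgeDist]

end Origami

/-! ### Matching the two sector parametrizations at a vertex -/

namespace Origami

open Set

variable {n : ℕ} {h v : Equiv.Perm (Fin n)}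

/-- The closed right half plane avoids the cut of the principal root, and the root is continuous at
`0` because the exponent is positive. -/
theorem continuousOn_coneCoord (s : ℝ) (hs : 0 < s) {k : ℕ} (hk : k ≠ 0) (q : Fin 4) (l : ℕ) :
    ContinuousOn (fun w : ℝ × ℝ => coneCoord s k q l w.1 w.2) {w | 0 ≤ w.1} := by
  have hk0 : (0 : ℝ) < k := by exact_mod_cast Nat.pos_of_ne_zero hk
  intro w hw
  refine ContinuousAt.continuousWithinAt ?_
  unfold coneCoord
  refine ContinuousAt.mul ?_ continuousAt_const
  have c : ContinuousAt (fun w : ℝ × ℝ => (s : ℂ) * (w.1 + w.2 * Complex.I)) w := by fun_prop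
  refine ContinuousAt.comp (g := fun z : ℂ => z ^ ((k : ℂ)⁻¹)) ?_ c
  refine Complex.continuousAt_cpow_const_of_re_pos (Or.inl ?_) ?_
  · simpa using mul_nonneg hs.le hw
  · rw [← Complex.ofReal_natCast, ← Complex.ofReal_inv, Complex.ofReal_re]
    positivity

/-- A sector coordinate with positive first component, or the origin of the first sector. -/
def NormalSector (q : Fin 4) (l : ℕ) (x y : ℝ) : Prop :=
  0 < x ∨ (q = 0 ∧ l = 0 ∧ x = 0 ∧ y = 0)

/-- Points on the last edge of a sector, and the cone point itself, have several descriptions by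
sectors. Both parametrizations make the same identifications, so a common normal form exists. -/
theorem exists_normalSector {s : ℝ} (hs : 0 < s) (i : Fin n) (q : Fin 4) {l : ℕ}
    (hl : l < Function.minimalPeriod (comm h v) i) {x y r : ℝ} (hx : x ∈ Icc 0 r)
    (hy : y ∈ Icc 0 r) :
    ∃ (q' : Fin 4) (l' : ℕ) (x' y' : ℝ), l' < Function.minimalPeriod (comm h v) i ∧
      x' ∈ Icc 0 r ∧ y' ∈ Icc 0 r ∧ NormalSector q' l' x' y' ∧
      coneExp h v i q l x y = coneExp h v i q' l' x' y' ∧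
      coneCoord s (Function.minimalPeriod (comm h v) i) q l x y =
        coneCoord s (Function.minimalPeriod (comm h v) i) q' l' x' y' := by
  set k := Function.minimalPeriod (comm h v) i with hk
  have hk0 : 0 < k := minimalPeriod_pos _ i
  rcases hx.1.eq_or_lt with rfl | hx0
  swap
  · exact ⟨q, l, x, y, hl, hx, hy, Or.inl hx0, rfl, rfl⟩
  rcases hy.1.eq_or_lt with rfl | hy0
  · refine ⟨0, 0, 0, 0, hk0, hx, hx, Or.inr ⟨rfl, rfl, rfl, rfl⟩, ?_, ?_⟩
    · have := pt_corner (h := h) (v := v) i q l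
      have h2 := pt_corner (h := h) (v := v) i 0 0
      simp only [coneExp, rot_zero, add_zero]
      rw [this, h2]
    · have : (k : ℂ)⁻¹ ≠ 0 := inv_ne_zero (by exact_mod_cast hk0.ne')
      simp [coneCoord, this]
  · rw [coneExp_eq_next, coneCoord_eq_next hs hk0.ne' q l hy0]
    by_cases hq : q = 3
    · rw [if_pos hq, if_pos hq]
      by_cases hl1 : l + 1 = k
      · refine ⟨0, 0, y, 0, hk0, hy, hx, Or.inl hy0, ?_, ?_⟩
        · rw [hl1, hk, coneExp_wrap]
        · rw [hl1, coneCoord_wrap s hk0.ne']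
      · exact ⟨0, l + 1, y, 0, by omega, hy, hx, Or.inl hy0, rfl, rfl⟩
    · rw [if_neg hq, if_neg hq]
      exact ⟨q + 1, l, y, 0, hl, hy, hx, Or.inl hy0, rfl, rfl⟩

/-- On normal forms both parametrizations are injective, hence they have the same fibres. This is
the hypothesis that turns the pair into a chart. -/
theorem coneExp_eq_iff {s : ℝ} (hs : 0 < s) (i : Fin n) {q q' : Fin 4} {l l' : ℕ}
    (hl : l < Function.minimalPeriod (comm h v) i) (hl' : l' < Function.minimalPeriod (comm h v) i)
    {x y x' y' r : ℝ} (hr : r < 1 / 2) (hx : x ∈ Icc 0 r) (hy : y ∈ Icc 0 r) (hx' : x' ∈ Icc 0 r)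
    (hy' : y' ∈ Icc 0 r) :
    coneExp h v i q l x y = coneExp h v i q' l' x' y' ↔
      coneCoord s (Function.minimalPeriod (comm h v) i) q l x y =
        coneCoord s (Function.minimalPeriod (comm h v) i) q' l' x' y' := by
  have hk0 : 0 < Function.minimalPeriod (comm h v) i := minimalPeriod_pos _ i
  obtain ⟨q1, l1, x1, y1, hl1, hx1, hy1, N1, e1, f1⟩ :=
    exists_normalSector (h := h) (v := v) hs i q hl hx hy
  obtain ⟨q2, l2, x2, y2, hl2, hx2, hy2, N2, e2, f2⟩ :=
    exists_normalSector (h := h) (v := v) hs i q' hl' hx' hy'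
  rw [e1, e2, f1, f2]
  have key : ∀ {q : Fin 4} {l : ℕ} {x y : ℝ}, x ∈ Icc 0 r → y ∈ Icc 0 r → 0 < x →
      coneExp h v i q l x y ≠ coneExp h v i 0 0 0 0 ∧
      coneCoord s (Function.minimalPeriod (comm h v) i) q l x y ≠
        coneCoord s (Function.minimalPeriod (comm h v) i) 0 0 0 0 := by
    intro q l x y hx hy hx0
    constructor
    · intro e
      have m1 := coneExp_mem (q := q) (x := x) (y := y) ⟨hx0.le, by linarith [hx.2]⟩
        ⟨hy.1, by linarith [hy.2]⟩
      have m2 := coneExp_mem (q := 0) (x := 0) (y := 0) (by simp) (by simp)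
      have a1 := (abs_rot_lt (q := q) (x := x) (y := y) (r := 1 / 2)).2
        ⟨by rw [abs_of_pos hx0]; linarith [hx.2], by rw [abs_of_nonneg hy.1]; linarith [hy.2]⟩
      have a2 := (abs_rot_lt (q := 0) (x := 0) (y := 0) (r := 1 / 2)).2 ⟨by simp, by simp⟩
      have hD := (displaced_coneExp (h := h) (v := v) i q l x y).congr
        (rad_vertex (h := h) (v := v) i ▸ good_rad _) a1.1 a1.2 m1.1 m1.2 m2.1 m2.2 e
      obtain ⟨k1, k2⟩ := hD.unique le_rfl a1.1 a1.2 a2.1 a2.2 (displaced_coneExp i 0 0 0 0)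
      have := Prod.ext k1 k2
      rw [rot_zero] at this
      exact hx0.ne' (rot_eq_zero this).1
    · intro e
      have e := congrArg (· ^ Function.minimalPeriod (comm h v) i) e
      simp only [coneCoord_pow hk0.ne', rot_zero] at e
      have e := mul_left_cancel₀ (by exact_mod_cast hs.ne') e
      have : rot q x y = (0, 0) := by
        refine Prod.ext ?_ ?_
        · simpa using congrArg Complex.re e
        · simpa using congrArg Complex.im e
      exact hx0.ne' (rot_eq_zero this).1
  rcases N1 with N1 | ⟨rfl, rfl, rfl, rfl⟩ <;> rcases N2 with N2 | ⟨rfl, rfl, rfl, rfl⟩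
  · constructor
    · intro e
      obtain ⟨rfl, rfl, rfl, rfl⟩ := coneExp_injective hl1 hl2 N1 (by linarith [hx1.2]) hy1.1
        (by linarith [hy1.2]) N2 (by linarith [hx2.2]) hy2.1 (by linarith [hy2.2]) (rad_vertex i) e
      rfl
    · intro e
      obtain ⟨rfl, rfl, rfl, rfl⟩ := coneCoord_injective hs hk0.ne' hl1 hl2 N1 hy1.1 N2 hy2.1 e
      rfl
  · exact iff_of_false (key hx1 hy1 N1).1 (key hx1 hy1 N1).2
  · exact iff_of_false (key hx2 hy2 N2).1.symm (key hx2 hy2 N2).2.symm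
  · simp

theorem exists_iterate_of_pt_eq {i j : Fin n} (e : (pt j 0 0 : Surface h v) = pt i 0 0) :
    ∃ l < Function.minimalPeriod (comm h v) i, (comm h v)^[l] i = j := by
  obtain ⟨m, hm0, hm1, hm⟩ := (pt_vertex_iff.1 e).symm.exists_pow_eq''
  refine ⟨m % Function.minimalPeriod (comm h v) i, Nat.mod_lt _ (minimalPeriod_pos _ i), ?_⟩
  rw [Function.iterate_mod_minimalPeriod_eq, Equiv.Perm.iterate_eq_pow, hm]

/-- Displacements from a vertex are given by sectors. -/
theorem exists_coneExp {i j : Fin n} {a b x y r : ℝ} (ha : a ∈ Icc (0 : ℝ) 1)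
    (hb : b ∈ Icc (0 : ℝ) 1) (hx : |x| < r) (hy : |y| < r)
    (hD : Displaced (pt i 0 0 : Surface h v) x y j a b) :
    ∃ (q : Fin 4) (l : ℕ) (x' y' : ℝ), l < Function.minimalPeriod (comm h v) i ∧
      x' ∈ Ico 0 r ∧ y' ∈ Ico 0 r ∧ rot q x' y' = (x, y) ∧
      pt j a b = coneExp h v i q l x' y' := by
  obtain ⟨h1, h2, h3⟩ := hD
  have f1 : Int.fract (a - x) = 0 := by
    have := congrArg tX h3
    rwa [tX_pt h1 h2, tX_pt (by simp) (by simp), Int.fract_zero] at this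
  have f2 : Int.fract (b - y) = 0 := by
    have := congrArg tY h3
    rwa [tY_pt h1 h2, tY_pt (by simp) (by simp), Int.fract_zero] at this
  rw [abs_lt] at hx hy
  rcases (fract_eq_zero h1).1 f1 with e1 | e1 <;> rcases (fract_eq_zero h2).1 f2 with e2 | e2 <;>
    rw [e1, e2] at h3
  · obtain ⟨l, hl, e⟩ := exists_iterate_of_pt_eq h3
    obtain rfl : a = x := by linarith
    obtain rfl : b = y := by linarith
    refine ⟨0, l, a, b, hl, ⟨ha.1, hx.2⟩, ⟨hb.1, hy.2⟩, rfl, ?_⟩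
    simp [coneExp, sector, corner, rot, e]
  · have h4 : (pt ((comm h v)⁻¹ (v j)) 0 0 : Surface h v) = pt i 0 0 := by
      rw [← pt_comm, ← h3, pt_top]
      simp
    obtain ⟨l, hl, e⟩ := exists_iterate_of_pt_eq h4
    obtain rfl : a = x := by linarith
    obtain rfl : b = 1 + y := by linarith
    refine ⟨3, l, -y, a, hl, ⟨by linarith [hb.2], by linarith⟩, ⟨ha.1, hx.2⟩, by simp [rot], ?_⟩
    have e' : (comm h v)⁻¹ = h * v * h⁻¹ * v⁻¹ := by simp [comm, mul_assoc]
    rw [e'] at e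
    simp [coneExp, sector, corner, rot, e]
  · rw [pt_right] at h3
    obtain ⟨l, hl, e⟩ := exists_iterate_of_pt_eq h3
    obtain rfl : a = 1 + x := by linarith
    obtain rfl : b = y := by linarith
    refine ⟨1, l, b, -x, hl, ⟨hb.1, hy.2⟩, ⟨by linarith [ha.2], by linarith⟩, by simp [rot], ?_⟩
    simp [coneExp, sector, corner, rot, e]
  · rw [pt_top, pt_right] at h3
    obtain ⟨l, hl, e⟩ := exists_iterate_of_pt_eq h3
    obtain rfl : a = 1 + x := by linarith
    obtain rfl : b = 1 + y := by linarith
    refine ⟨2, l, -x, -y, hl, ⟨by linarith [ha.2], by linarith⟩, ⟨by linarith [hb.2], by linarith⟩,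
      by simp [rot], ?_⟩
    simp [coneExp, sector, corner, rot, e]

theorem exists_chart_vertex {s : ℝ} (hs : 0 < s) (i : Fin n) :
    ∃ φ, ChartSpec s (Function.minimalPeriod (comm h v) i) (pt i 0 0 : Surface h v) φ := by
  set k := Function.minimalPeriod (comm h v) i with hk
  have hk0 : 0 < k := minimalPeriod_pos _ i
  have hs' : (s : ℂ) ≠ 0 := by exact_mod_cast hs.ne'
  obtain ⟨ρ, hρ, hρ2⟩ : ∃ ρ, rad (pt i 0 0 : Surface h v) / 2 = ρ ∧ ρ < 1 / 2 :=
    ⟨_, rfl, by rw [rad_vertex]; norm_num⟩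
  let S : Set ((Fin 4 × Fin k) × ℝ × ℝ) := univ ×ˢ (Icc 0 ρ ×ˢ Icc 0 ρ)
  let S₀ : Set ((Fin 4 × Fin k) × ℝ × ℝ) := univ ×ˢ (Ico 0 ρ ×ˢ Ico 0 ρ)
  let E : (Fin 4 × Fin k) × ℝ × ℝ → Surface h v := fun t => coneExp h v i t.1.1 t.1.2 t.2.1 t.2.2
  let G : (Fin 4 × Fin k) × ℝ × ℝ → ℂ := fun t => coneCoord s k t.1.1 t.1.2 t.2.1 t.2.2
  have h0 : S₀ ⊆ S := prod_mono le_rfl (prod_mono Ico_subset_Icc_self Ico_subset_Icc_self)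
  have hstar : E '' S₀ = star ρ (pt i 0 0) := by
    ext p
    constructor
    · rintro ⟨⟨⟨q, l⟩, x, y⟩, ⟨-, hx, hy⟩, rfl⟩
      change x ∈ Ico 0 ρ at hx
      change y ∈ Ico 0 ρ at hy
      obtain ⟨m1, m2⟩ := coneExp_mem (q := q) (x := x) (y := y) ⟨hx.1, by linarith [hx.2]⟩
        ⟨hy.1, by linarith [hy.2]⟩
      obtain ⟨a1, a2⟩ := (abs_rot_lt (q := q) (x := x) (y := y) (r := ρ)).2
        ⟨by rw [abs_of_nonneg hx.1]; exact hx.2, by rw [abs_of_nonneg hy.1]; exact hy.2⟩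
      exact ⟨_, _, m1, _, m2, rfl, _, _, a1, a2, displaced_coneExp i q l x y⟩
    · rintro ⟨j, a, ha, b, hb, rfl, x, y, hx, hy, hD⟩
      obtain ⟨q, l, x', y', hl, hx', hy', -, e⟩ := exists_coneExp ha hb hx hy hD
      exact ⟨((q, ⟨l, hl⟩), x', y'), ⟨mem_univ _, hx', hy'⟩, e.symm⟩
  have hopen : IsOpen (G '' S₀) := by
    -- Describing the image through the power map makes its openness evident; the work lies in
    -- finding the sector parameters of a given `z`.
    have : G '' S₀ = {z : ℂ | |(z ^ k).re| < s * ρ} ∩ {z : ℂ | |(z ^ k).im| < s * ρ} := by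
      ext z
      constructor
      · rintro ⟨⟨⟨q, l⟩, x, y⟩, ⟨-, hx, hy⟩, rfl⟩
        obtain ⟨a1, a2⟩ := (abs_rot_lt (q := q) (x := x) (y := y) (r := ρ)).2
          ⟨by rw [abs_of_nonneg hx.1]; exact hx.2, by rw [abs_of_nonneg hy.1]; exact hy.2⟩
        simp only [G, mem_inter_iff, mem_ofPred_eq, coneCoord_pow hk0.ne']
        constructor
        · simpa [abs_mul, abs_of_pos hs, -one_div] using mul_lt_mul_of_pos_left a1 hs
        · simpa [abs_mul, abs_of_pos hs, -one_div] using mul_lt_mul_of_pos_left a2 hs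
      · rintro ⟨hz1, hz2⟩
        obtain ⟨q, l, hl, φ, hφ0, hφ1, e⟩ := exists_sector hk0.ne' z
        have hpi := Real.pi_pos
        set ζ : ℂ := ‖z‖ * Complex.exp (φ * Complex.I) with hζ
        have hkR : (1 : ℝ) ≤ k := by exact_mod_cast hk0
        have hζk : ζ ^ k = ((‖z‖ ^ k : ℝ) : ℂ) * Complex.exp ((φ * k : ℝ) * Complex.I) := by
          rw [hζ, mul_pow, ← Complex.exp_nat_mul]
          push_cast
          congr 2
          ring
        have hre : (ζ ^ k).re = ‖z‖ ^ k * Real.cos (φ * k) := by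
          rw [hζk, Complex.re_ofReal_mul, Complex.exp_ofReal_mul_I_re]
        have him : (ζ ^ k).im = ‖z‖ ^ k * Real.sin (φ * k) := by
          rw [hζk, Complex.im_ofReal_mul, Complex.exp_ofReal_mul_I_im]
        have hre0 : 0 ≤ (ζ ^ k).re := by
          rw [hre]
          have : 0 ≤ φ * k := by positivity
          exact mul_nonneg (by positivity) (Real.cos_nonneg_of_neg_pi_div_two_le_of_le
            (by linarith) hφ1)
        have him0 : 0 ≤ (ζ ^ k).im := by
          rw [him]
          exact mul_nonneg (by positivity) (Real.sin_nonneg_of_nonneg_of_le_pi (by positivity)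
            (by linarith))
        have hw : (s : ℂ) * (((ζ ^ k).re / s : ℝ) + ((ζ ^ k).im / s : ℝ) * Complex.I) = ζ ^ k := by
          push_cast
          rw [← mul_div_right_comm, ← add_div, mul_div_cancel₀ _ hs', Complex.re_add_im]
        -- The argument `φ` of `ζ` is at most `π / (2 k)`, so `ζ` is the principal root of its
        -- `k`-th power.
        have hroot : (ζ ^ k) ^ ((k : ℂ)⁻¹) = ζ := by
          rcases eq_or_ne z 0 with rfl | hz
          · have : (k : ℂ)⁻¹ ≠ 0 := inv_ne_zero (by exact_mod_cast hk0.ne')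
            simp [hζ, hk0.ne', this]
          · have harg : ζ.arg = φ := by
              rw [hζ, Complex.arg_real_mul _ (norm_pos_iff.2 hz), Complex.arg_exp_mul_I,
                toIocMod_eq_self]
              constructor
              · linarith
              · nlinarith
            have hφ2 : φ ≤ Real.pi / 2 / k := by rwa [le_div_iff₀ (by linarith)]
            have : 0 < Real.pi / k := by positivity
            refine Complex.pow_cpow_nat_inv hk0.ne' ?_ ?_
            · rw [harg]; linarith
            · rw [harg]
              refine hφ2.trans ?_
              gcongr
              linarith
        have hG : coneCoord s k q l ((ζ ^ k).re / s) ((ζ ^ k).im / s) = z := by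
          unfold coneCoord
          rw [hw, hroot]
          exact e.symm
        refine ⟨((q, ⟨l, hl⟩), (ζ ^ k).re / s, (ζ ^ k).im / s), ⟨mem_univ _, ?_⟩, hG⟩
        have hp := coneCoord_pow (s := s) hk0.ne' q l ((ζ ^ k).re / s) ((ζ ^ k).im / s)
        rw [hG] at hp
        rw [mem_ofPred_eq, hp] at hz1 hz2
        have hz1 : s * |(rot q ((ζ ^ k).re / s) ((ζ ^ k).im / s)).1| < s * ρ := by
          simpa [abs_mul, abs_of_pos hs, -one_div] using hz1
        have hz2 : s * |(rot q ((ζ ^ k).re / s) ((ζ ^ k).im / s)).2| < s * ρ := by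
          simpa [abs_mul, abs_of_pos hs, -one_div] using hz2
        obtain ⟨b1, b2⟩ := abs_rot_lt.1 ⟨lt_of_mul_lt_mul_left hz1 hs.le,
          lt_of_mul_lt_mul_left hz2 hs.le⟩
        exact ⟨⟨div_nonneg hre0 hs.le, (abs_lt.1 b1).2⟩, ⟨div_nonneg him0 hs.le, (abs_lt.1 b2).2⟩⟩
    rw [this]
    exact (isOpen_lt (by fun_prop) continuous_const).inter
      (isOpen_lt (by fun_prop) continuous_const)
  have hcE : ContinuousOn E S := by
    refine Continuous.continuousOn ?_
    rw [continuous_prod_of_discrete_left]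
    rintro ⟨q, l⟩
    have : Continuous fun w : ℝ × ℝ => rot q w.1 w.2 := by
      fin_cases q <;> simp [rot] <;> constructor <;> fun_prop
    exact continuous_pt_comp (f := fun w : ℝ × ℝ => (corner q).1 + (rot q w.1 w.2).1)
      (g := fun w : ℝ × ℝ => (corner q).2 + (rot q w.1 w.2).2) (sector h v i q l) (by fun_prop)
      (by fun_prop)
  have hcG : ContinuousOn G S := by
    rintro ⟨⟨q, l⟩, w⟩ ⟨-, hw⟩
    have h1 := continuousOn_coneCoord s hs hk0.ne' q l w hw.1.1
    have h2 : ∀ᶠ t : (Fin 4 × Fin k) × ℝ × ℝ in 𝓝[S] ((q, l), w), t.1 = (q, l) :=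
      (continuous_fst.continuousAt.eventually (p := fun t => t = (q, l)) (by simp)).filter_mono
        nhdsWithin_le_nhds
    have h3 : Tendsto (fun t : (Fin 4 × Fin k) × ℝ × ℝ => t.2) (𝓝[S] ((q, l), w))
        (𝓝[{w | 0 ≤ w.1}] w) := by
      refine tendsto_nhdsWithin_iff.2 ⟨?_, ?_⟩
      · exact (continuous_snd.tendsto _).mono_left nhdsWithin_le_nhds
      · filter_upwards [self_mem_nhdsWithin] with t ht
        exact ht.2.1.1
    refine (h1.tendsto.comp h3).congr' ?_
    filter_upwards [h2] with t ht
    simp [G, ht]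
  have : Nonempty (Surface h v) := ⟨pt i 0 0⟩
  obtain ⟨φ, hφ, hφ'⟩ := exists_openPartialHomeomorph (S := S) (S₀ := S₀) (E := E) (G := G)
    (isCompact_univ.prod (isCompact_Icc.prod isCompact_Icc)) h0 hcE hcG
    (fun t ht t' ht' => coneExp_eq_iff hs i t.1.2.2 t'.1.2.2 hρ2 ht.2.1 ht.2.2 ht'.2.1 ht'.2.2)
    (by rw [hstar]; exact isOpen_star ((good_rad _).mono (hρ ▸ (half_rad_lt _).le))) hopen
  refine ⟨φ, by rw [hφ, hstar, hρ], ?_⟩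
  intro j a ha b hb x y hx hy hD
  rw [hρ] at hx hy
  obtain ⟨q, l, x', y', hl, hx', hy', hr, e⟩ := exists_coneExp ha hb hx hy hD
  have h1 := hφ' ((q, ⟨l, hl⟩), x', y') ⟨mem_univ _, hx', hy'⟩
  rw [e]
  change φ (coneExp h v i q l x' y') = coneCoord s k q l x' y' at h1
  rw [h1, coneCoord_pow hk0.ne', hr]

end Origami

namespace Origami

open Set

variable {n : ℕ} {h v : Equiv.Perm (Fin n)} {s : ℝ}

/-! ### The translation structure -/

/-- The cone angle, divided by `2 π`. -/
def mult : Surface h v → ℕ :=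
  lift (fun i a b => if Int.fract a = 0 ∧ Int.fract b = 0 then
      Function.minimalPeriod (comm h v) (base h v i a b) else 1)
    (by intro i b hb; simp [base])
    (by
      intro i a ha
      rcases eq_or_ne a 1 with rfl | ha1
      -- At the upper right corner the two descriptions give consecutive squares of one cycle of
      -- `comm h v`, which have the same period.
      · simp only [Int.fract_one, Int.fract_zero, and_self, if_true, base]
        have e : comm h v (h (v i)) = v (h i) := by simp [comm]
        simpa [e] using Function.minimalPeriod_apply (f := comm h v) (x := h (v i))
          ((comm h v).injective.mem_periodicPts _)
      · simp [base, ha1])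

theorem mult_pt {i : Fin n} {a b : ℝ} (ha : a ∈ Icc (0 : ℝ) 1) (hb : b ∈ Icc (0 : ℝ) 1) :
    mult (pt i a b : Surface h v) = if Int.fract a = 0 ∧ Int.fract b = 0 then
      Function.minimalPeriod (comm h v) (base h v i a b) else 1 := lift_pt _ _ _ ha hb

theorem mult_vertex (i : Fin n) :
    mult (pt i 0 0 : Surface h v) = Function.minimalPeriod (comm h v) i := by
  rw [mult_pt (by simp) (by simp)]
  simp [base]

theorem mult_of_ne {i : Fin n} {a b : ℝ} (ha : a ∈ Ico (0 : ℝ) 1) (hb : b ∈ Ico (0 : ℝ) 1)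
    (hab : ¬(a = 0 ∧ b = 0)) : mult (pt i a b : Surface h v) = 1 := by
  rw [mult_pt (Ico_subset_Icc_self ha) (Ico_subset_Icc_self hb), fract_of_mem_Ico ha,
    fract_of_mem_Ico hb, if_neg hab]

theorem mult_pos (p : Surface h v) : 0 < mult p := by
  obtain ⟨i, a, ha, b, hb, rfl⟩ := exists_pt p
  rw [mult_pt ha hb]
  split_ifs
  · exact minimalPeriod_pos _ _
  · exact one_pos

theorem exists_chart (hs : 0 < s) (p : Surface h v) : ∃ φ, ChartSpec s (mult p) p φ := by
  obtain ⟨i, a, ha, b, hb, rfl⟩ := exists_pt_Ico p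
  by_cases hab : a = 0 ∧ b = 0
  · obtain ⟨rfl, rfl⟩ := hab
    rw [mult_vertex]
    exact exists_chart_vertex hs i
  rw [mult_of_ne ha hb hab]
  rcases ha.1.eq_or_lt with rfl | ha0
  · have hb0 : 0 < b := lt_of_le_of_ne hb.1 fun h0 => hab ⟨rfl, h0.symm⟩
    exact exists_chart_left hs ⟨hb0, hb.2⟩
  · rcases hb.1.eq_or_lt with rfl | hb0
    · exact exists_chart_bottom hs ⟨ha0, ha.2⟩
    · exact exists_chart_interior hs ⟨ha0, ha.2⟩ ⟨hb0, hb.2⟩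

/-- The local coordinate at `p`. -/
def chart (hs : 0 < s) (p : Surface h v) : OpenPartialHomeomorph (Surface h v) ℂ :=
  (exists_chart hs p).choose

theorem chart_spec (hs : 0 < s) (p : Surface h v) : ChartSpec s (mult p) p (chart hs p) :=
  (exists_chart hs p).choose_spec

/-- The local primitive of the differential at `p`. -/
def prim (hs : 0 < s) (p x : Surface h v) : ℂ := chart hs p x ^ mult p

theorem prim_of_displaced (hs : 0 < s) {p : Surface h v} {j : Fin n} {a b x y : ℝ}
    (ha : a ∈ Icc (0 : ℝ) 1) (hb : b ∈ Icc (0 : ℝ) 1) (hx : |x| < rad p / 2) (hy : |y| < rad p / 2)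
    (hD : Displaced p x y j a b) : prim hs p (pt j a b) = s * (x + y * Complex.I) :=
  (chart_spec hs p).2 j a ha b hb x y hx hy hD

/-- In the coordinates of a square every local primitive is `s` times the coordinate, up to a
constant. Hence two primitives differ locally by a constant, which is the compatibility of the
charts. -/
theorem prim_sub (hs : 0 < s) {p : Surface h v} {j : Fin n} {a b : ℝ}
    (ha : a ∈ Icc (0 : ℝ) 1) (hb : b ∈ Icc (0 : ℝ) 1) (hp : pt j a b ∈ (chart hs p).source) :
    ∀ᶠ z : ℝ × ℝ in 𝓝 (a, b), z ∈ unitSq →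
      prim hs p (pt j z.1 z.2) - prim hs p (pt j a b) =
        s * ((z.1 - a : ℝ) + (z.2 - b : ℝ) * Complex.I) := by
  rw [(chart_spec hs p).1, pt_mem_star ((good_rad p).mono (half_rad_lt p).le) ha hb] at hp
  obtain ⟨x, y, hx, hy, hD⟩ := hp
  have c1 : ∀ᶠ z : ℝ × ℝ in 𝓝 (a, b), |x + (z.1 - a)| < rad p / 2 := by
    have : ContinuousAt (fun z : ℝ × ℝ => |x + (z.1 - a)|) (a, b) := by fun_prop
    exact this.eventually (gt_mem_nhds (by simpa using hx))
  have c2 : ∀ᶠ z : ℝ × ℝ in 𝓝 (a, b), |y + (z.2 - b)| < rad p / 2 := by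
    have : ContinuousAt (fun z : ℝ × ℝ => |y + (z.2 - b)|) (a, b) := by fun_prop
    exact this.eventually (gt_mem_nhds (by simpa using hy))
  filter_upwards [c1, c2] with z h1 h2 hz
  have hD' : Displaced p (x + (z.1 - a)) (y + (z.2 - b)) j z.1 z.2 := by
    have e1 : z.1 - (x + (z.1 - a)) = a - x := by ring
    have e2 : z.2 - (y + (z.2 - b)) = b - y := by ring
    rw [Displaced, e1, e2]
    exact hD
  rw [prim_of_displaced hs hz.1 hz.2 h1 h2 hD', prim_of_displaced hs ha hb hx hy hD]
  push_cast
  ring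

theorem self_mem_chart_source (hs : 0 < s) (p : Surface h v) : p ∈ (chart hs p).source := by
  rw [(chart_spec hs p).1]
  exact self_mem_star (by linarith [rad_pos p]) p

theorem prim_self (hs : 0 < s) (p : Surface h v) : prim hs p p = 0 := by
  obtain ⟨i, a, ha, b, hb, rfl⟩ := exists_pt p
  have := rad_pos (pt i a b : Surface h v)
  rw [prim_of_displaced hs (x := 0) (y := 0) ha hb (by simpa) (by simpa)]
  · simp
  · exact ⟨by simpa using ha, by simpa using hb, by simp⟩

/-- The primitive in the coordinates of a square. -/
theorem prim_pt (hs : 0 < s) {j : Fin n} {a b : ℝ} (ha : a ∈ Icc (0 : ℝ) 1)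
    (hb : b ∈ Icc (0 : ℝ) 1) : ∀ᶠ z : ℝ × ℝ in 𝓝 (a, b), z ∈ unitSq →
      prim hs (pt j a b : Surface h v) (pt j z.1 z.2) =
        s * ((z.1 - a : ℝ) + (z.2 - b : ℝ) * Complex.I) := by
  filter_upwards [prim_sub hs (p := (pt j a b : Surface h v)) ha hb (self_mem_chart_source hs _)]
    with z hz hz'
  have := hz hz'
  rwa [prim_self, sub_zero] at this

/-- The translation surface glued from squares of side `s`. -/
def surf (hs : 0 < s) (ht : Transitive h v) (i₀ : Fin n) : TranslationSurface where
  carrier := Surface h v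
  connected := connectedSpace ht i₀
  ord p := mult p - 1
  chart := chart hs
  mem_source := self_mem_chart_source hs
  chart_self p := by
    have := prim_self hs p
    exact pow_eq_zero_iff (mult_pos p).ne' |>.1 this
  compat p q x hp hq := by
    simp only [Nat.sub_add_cancel (mult_pos _)]
    refine eventually_nhds ?_
    rintro j a ha b hb rfl
    filter_upwards [prim_sub hs ha hb hp, prim_sub hs ha hb hq] with z h1 h2 hz
    have := (h1 hz).trans (h2 hz).symm
    simp only [prim] at this
    linear_combination this

theorem surf_primitive (hs : 0 < s) (ht : Transitive h v) (i₀ : Fin n) (p x : Surface h v) :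
    (surf hs ht i₀).primitive p x = prim hs p x := by
  change chart hs p x ^ (mult p - 1 + 1) = _
  rw [Nat.sub_add_cancel (mult_pos _)]
  rfl

theorem pt_interior_eq {i j : Fin n} {a b c d : ℝ} (ha : a ∈ Ioo (0 : ℝ) 1)
    (hb : b ∈ Ioo (0 : ℝ) 1) (hc : c ∈ Icc (0 : ℝ) 1) (hd : d ∈ Icc (0 : ℝ) 1)
    (e : (pt i a b : Surface h v) = pt j c d) : i = j ∧ a = c ∧ b = d := by
  have hfa : Int.fract a = a := fract_of_mem_Ico (Ioo_subset_Ico_self ha)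
  have hfb : Int.fract b = b := fract_of_mem_Ico (Ioo_subset_Ico_self hb)
  rw [pt_eq_pt_iff (Ioo_subset_Icc_self ha) (Ioo_subset_Icc_self hb) hc hd
    (by rw [hfa]; exact fun k => ha.1.ne' k.1)] at e
  obtain ⟨e1, e2, e3⟩ := e
  rw [hfa] at e2
  rw [hfb] at e3
  have hc1 : c ≠ 1 := by rintro rfl; simp at e2; exact ha.1.ne' e2
  have hd1 : d ≠ 1 := by rintro rfl; simp at e3; exact hb.1.ne' e3
  rw [fract_of_mem_Ico ⟨hc.1, lt_of_le_of_ne hc.2 hc1⟩] at e2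
  rw [fract_of_mem_Ico ⟨hd.1, lt_of_le_of_ne hd.2 hd1⟩] at e3
  exact ⟨by simpa [base, ha.2.ne, hb.2.ne, hc1, hd1] using e1, e2, e3⟩

theorem isSquareTiled_surf (hs : 0 < s) (ht : Transitive h v) (i₀ : Fin n) :
    (surf hs ht i₀).IsSquareTiled s h v := by
  refine ⟨fun i z => (pt i z.re z.im : Surface h v), ?_, ?_, ?_, ?_, ?_, ?_⟩
  · intro i
    exact (continuous_pt_comp i Complex.continuous_re Complex.continuous_im).continuousOn
  · intro x
    obtain ⟨i, a, ha, b, hb, e⟩ := exists_pt (x : Surface h v)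
    exact ⟨i, ⟨a, b⟩, ⟨ha, hb⟩, e⟩
  · intro i j z hz w hw e
    obtain ⟨rfl, e1, e2⟩ := pt_interior_eq hz.1 hz.2 hw.1 hw.2 e
    exact ⟨rfl, Complex.ext e1 e2⟩
  · intro i z hz
    have h1 := prim_pt (h := h) (v := v) hs (j := i) hz.1 hz.2
    have h2 : ContinuousAt (fun w : ℂ => (w.re, w.im)) z := by fun_prop
    filter_upwards [(h2.eventually h1).filter_mono nhdsWithin_le_nhds, self_mem_nhdsWithin]
      with w hw hw'
    refine (surf_primitive hs ht i₀ _ _).trans ((hw ⟨hw'.1, hw'.2⟩).trans ?_)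
    congr 1
    apply Complex.ext <;> simp
  · intro i t ht
    change (pt i (1 + t * Complex.I : ℂ).re _ : Surface h v) = _
    simpa using pt_right (h := h) (v := v) i t
  · intro i t ht
    change (pt i (t + Complex.I : ℂ).re _ : Surface h v) = _
    simpa using pt_top (h := h) (v := v) i t

theorem inH4_surf (hs : 0 < s) (ht : Transitive h v) (i₀ : Fin n)
    (h5 : Function.minimalPeriod (comm h v) i₀ = 5)
    (h1 : ∀ j, (comm h v).SameCycle i₀ j ∨ comm h v j = j) : (surf hs ht i₀).InH4 := by
  refine ⟨(pt i₀ 0 0 : Surface h v), ?_, ?_⟩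
  · change mult (pt i₀ 0 0 : Surface h v) - 1 = 4
    rw [mult_vertex, h5]
  · intro p hp
    change mult (p : Surface h v) - 1 = 0
    obtain ⟨j, a, ha, b, hb, e⟩ := exists_pt_Ico (p : Surface h v)
    by_cases hab : a = 0 ∧ b = 0
    · obtain ⟨rfl, rfl⟩ := hab
      rw [← e, mult_vertex]
      rcases h1 j with h1 | h1
      · exact absurd (e.symm.trans (pt_vertex_iff.2 h1.symm)) hp
      · rw [Function.minimalPeriod_eq_one_iff_isFixedPt.2 h1]
    · rw [← e, mult_of_ne ha hb hab]

end Origami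

namespace Origami

open Set

variable {n : ℕ} {h v h' v' h'' v'' : Equiv.Perm (Fin n)} {s : ℝ}

/-! ### Affine maps between square-tiled surfaces -/

/-- The map `F` preserves cone angles and is affine with linear part `D`. -/
def IsAffine (hs : 0 < s) (F : Surface h v → Surface h' v') (D : ℂ →ₗ[ℝ] ℂ) : Prop :=
  (∀ p, mult (F p) = mult p) ∧ ∀ p, ∀ᶠ x in 𝓝 p, prim hs (F p) (F x) = D (prim hs p x)

theorem IsAffine.comp {hs : 0 < s} {F : Surface h v → Surface h' v'}
    {F' : Surface h' v' → Surface h'' v''} {D D' : ℂ →ₗ[ℝ] ℂ} (hF' : IsAffine hs F' D')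
    (hF : IsAffine hs F D) (hc : Continuous F) : IsAffine hs (F' ∘ F) (D' ∘ₗ D) := by
  refine ⟨fun p => (hF'.1 _).trans (hF.1 _), fun p => ?_⟩
  filter_upwards [hF.2 p, (hc.tendsto p).eventually (hF'.2 (F p))] with x h1 h2
  rw [Function.comp_apply, Function.comp_apply, h2, h1]
  rfl

theorem IsAffine.symm {hs : 0 < s} {F : Surface h v ≃ₜ Surface h' v'} {D D' : ℂ →ₗ[ℝ] ℂ}
    (hF : IsAffine hs F D) (hD : D' ∘ₗ D = LinearMap.id) : IsAffine hs F.symm D' := by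
  refine ⟨fun p => ?_, fun p => ?_⟩
  · rw [← hF.1, F.apply_symm_apply]
  · have h1 := hF.2 (F.symm p)
    have h2 := (F.symm.continuous.tendsto p).eventually h1
    filter_upwards [h2] with x hx
    rw [F.apply_symm_apply, F.apply_symm_apply] at hx
    rw [hx, ← LinearMap.comp_apply, hD, LinearMap.id_apply]

/-- Neighbourhoods of a point are controlled by its representatives (`eventually_nhds`), and
`prim_pt` describes the primitive near each of them. -/
theorem isAffine_of_squares {hs : 0 < s} {F : Surface h v → Surface h' v'} {D : ℂ →ₗ[ℝ] ℂ}
    (hm : ∀ p, mult (F p) = mult p)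
    (H : ∀ j, ∀ a ∈ Icc (0 : ℝ) 1, ∀ b ∈ Icc (0 : ℝ) 1, ∀ᶠ z : ℝ × ℝ in 𝓝 (a, b), z ∈ unitSq →
      prim hs (F (pt j a b)) (F (pt j z.1 z.2)) =
        D (s * ((z.1 - a : ℝ) + (z.2 - b : ℝ) * Complex.I))) : IsAffine hs F D := by
  refine ⟨hm, fun p => eventually_nhds ?_⟩
  rintro j a ha b hb rfl
  filter_upwards [H j a ha b hb, prim_pt hs ha hb] with z h1 h2 hz
  rw [h1 hz, h2 hz]

/-- The linear map with the given entries. -/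
def linMap (a b c d : ℝ) : ℂ →ₗ[ℝ] ℂ where
  toFun z := ⟨a * z.re + b * z.im, c * z.re + d * z.im⟩
  map_add' z w := by apply Complex.ext <;> simp <;> ring
  map_smul' r z := by apply Complex.ext <;> simp <;> ring

theorem det_linMap (a b c d : ℝ) : LinearMap.det (linMap a b c d) = a * d - b * c := by
  rw [← LinearMap.det_toMatrix Complex.basisOneI, Matrix.det_fin_two]
  simp [LinearMap.toMatrix_apply, linMap]

/-- The reflection exchanging the two coordinates. -/
def swap (h v : Equiv.Perm (Fin n)) : Surface h v ≃ₜ Surface v h where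
  toFun := lift (fun i a b => pt i b a) (fun i b _ => pt_top i b) (fun i a _ => pt_right i a)
  invFun := lift (fun i a b => pt i b a) (fun i b _ => pt_top i b) (fun i a _ => pt_right i a)
  left_inv p := by
    obtain ⟨i, a, ha, b, hb, rfl⟩ := exists_pt p
    rw [lift_pt _ _ _ ha hb, lift_pt _ _ _ hb ha]
  right_inv p := by
    obtain ⟨i, a, ha, b, hb, rfl⟩ := exists_pt p
    rw [lift_pt _ _ _ ha hb, lift_pt _ _ _ hb ha]
  continuous_toFun := continuous_lift _ _ _ fun i => by fun_prop
  continuous_invFun := continuous_lift _ _ _ fun i => by fun_prop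

theorem swap_pt {i : Fin n} {a b : ℝ} (ha : a ∈ Icc (0 : ℝ) 1) (hb : b ∈ Icc (0 : ℝ) 1) :
    swap h v (pt i a b) = pt i b a :=
  lift_pt (h := h) (v := v) (fun i a b => (pt i b a : Surface v h))
    (fun i b _ => pt_top i b) (fun i a _ => pt_right i a) ha hb

/-- A reflection reverses the sense of turning around a vertex. -/
theorem comm_swap (h v : Equiv.Perm (Fin n)) : comm v h = (comm h v)⁻¹ := by
  simp [comm, mul_assoc]

theorem minimalPeriod_inv (g : Equiv.Perm (Fin n)) (i : Fin n) :
    Function.minimalPeriod (g⁻¹ : Equiv.Perm (Fin n)) i = Function.minimalPeriod g i := by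
  refine Nat.dvd_antisymm ?_ ?_ <;> refine Function.IsPeriodicPt.minimalPeriod_dvd ?_
  · have := Function.isPeriodicPt_minimalPeriod g i
    rw [Function.IsPeriodicPt, Function.IsFixedPt, Equiv.Perm.iterate_eq_pow] at this ⊢
    rw [inv_pow, Equiv.Perm.inv_eq_iff_eq, this]
  · have := Function.isPeriodicPt_minimalPeriod (g⁻¹ : Equiv.Perm (Fin n)) i
    rw [Function.IsPeriodicPt, Function.IsFixedPt, Equiv.Perm.iterate_eq_pow] at this ⊢
    rw [inv_pow, Equiv.Perm.inv_eq_iff_eq] at this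
    exact this.symm

theorem isAffine_swap (hs : 0 < s) (h v : Equiv.Perm (Fin n)) :
    IsAffine hs (swap h v) (linMap 0 1 1 0) := by
  refine isAffine_of_squares (fun p => ?_) ?_
  · obtain ⟨i, a, ha, b, hb, rfl⟩ := exists_pt_Ico p
    rw [swap_pt (Ico_subset_Icc_self ha) (Ico_subset_Icc_self hb)]
    by_cases hab : a = 0 ∧ b = 0
    · obtain ⟨rfl, rfl⟩ := hab
      rw [mult_vertex, mult_vertex, comm_swap, minimalPeriod_inv]
    · rw [mult_of_ne ha hb hab, mult_of_ne hb ha fun k => hab ⟨k.2, k.1⟩]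
  · intro j a ha b hb
    have c : ContinuousAt (fun z : ℝ × ℝ => (z.2, z.1)) (a, b) := by fun_prop
    filter_upwards [c.eventually (prim_pt (h := v) (v := h) hs (j := j) hb ha)] with z hz hz'
    rw [swap_pt ha hb, swap_pt hz'.1 hz'.2, hz ⟨hz'.2, hz'.1⟩]
    apply Complex.ext <;> simp [linMap]

/-- The shear `(a, b) ↦ (a + b, b)`. -/
def shearFun (h v : Equiv.Perm (Fin n)) : Surface h v → Surface h (v * h⁻¹) :=
  lift (fun i a b => if a + b ≤ 1 then pt i (a + b) b else pt (h i) (a + b - 1) b)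
    (by
      intro i b hb
      split_ifs with h1 h2 h2
      · obtain rfl : b = 0 := by linarith [hb.1]
        simp [pt_right]
      · exact absurd hb.2 (by simpa using h2)
      · simp
      · exact absurd hb.2 (by simpa using h2))
    (by
      intro i a ha
      split_ifs with h1 h2 h2
      · obtain rfl : a = 0 := by linarith [ha.1]
        rw [zero_add, pt_right, pt_top]
        simp
      · exact absurd ha.2 (by simpa using h2)
      · simp [pt_top]
      · exact absurd ha.2 (by simpa using h2))

theorem shearFun_pt {i : Fin n} {a b : ℝ} (ha : a ∈ Icc (0 : ℝ) 1) (hb : b ∈ Icc (0 : ℝ) 1) :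
    shearFun h v (pt i a b) = if a + b ≤ 1 then pt i (a + b) b else pt (h i) (a + b - 1) b :=
  lift_pt _ _ _ ha hb

theorem continuous_shearFun : Continuous (shearFun h v) := by
  refine continuous_lift _ _ _ fun i => Continuous.continuousOn ?_
  refine Continuous.if_le (by fun_prop) (by fun_prop) (by fun_prop) continuous_const ?_
  intro z hz
  rw [hz, pt_right, sub_self]

/-- The inverse shear `(a, b) ↦ (a - b, b)`. -/
def unshearFun (h v : Equiv.Perm (Fin n)) : Surface h (v * h⁻¹) → Surface h v :=
  lift (fun i a b => if b ≤ a then pt i (a - b) b else pt (h⁻¹ i) (a - b + 1) b)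
    (by
      intro i b hb
      rw [if_pos hb.2]
      split_ifs with h1
      · obtain rfl : b = 0 := le_antisymm h1 hb.1
        simp [pt_right]
      · rw [zero_sub, neg_add_eq_sub]
        simp)
    (by
      intro i a ha
      rw [if_pos ha.1]
      split_ifs with h1
      · obtain rfl : a = 1 := le_antisymm ha.2 h1
        rw [sub_self, sub_zero, pt_right, pt_top]
        -- The two branches give the lower left corners of `v i` and of `h (v (h⁻¹ i))`, which agree
        -- only as vertices.
        exact pt_eq_of_sameCycle (by simpa using (sameCycle_comm (h := h) (v := v) (h⁻¹ i)).symm)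
      · simp [pt_top])

theorem unshearFun_pt {i : Fin n} {a b : ℝ} (ha : a ∈ Icc (0 : ℝ) 1) (hb : b ∈ Icc (0 : ℝ) 1) :
    unshearFun h v (pt i a b) = if b ≤ a then pt i (a - b) b else pt (h⁻¹ i) (a - b + 1) b :=
  lift_pt _ _ _ ha hb

theorem continuous_unshearFun : Continuous (unshearFun h v) := by
  refine continuous_lift _ _ _ fun i => Continuous.continuousOn ?_
  refine Continuous.if_le (by fun_prop) (by fun_prop) (by fun_prop) (by fun_prop) ?_
  intro z hz
  rw [hz, sub_self, zero_add, pt_right]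
  simp

/-- The shear as a homeomorphism. -/
def shear (h v : Equiv.Perm (Fin n)) : Surface h v ≃ₜ Surface h (v * h⁻¹) where
  toFun := shearFun h v
  invFun := unshearFun h v
  left_inv p := by
    obtain ⟨i, a, ha, b, hb, rfl⟩ := exists_pt p
    rw [shearFun_pt ha hb]
    split_ifs with h1
    · rw [unshearFun_pt ⟨by linarith [ha.1, hb.1], h1⟩ hb, if_pos (by linarith [ha.1])]
      simp
    · rw [unshearFun_pt ⟨by linarith, by linarith [ha.2, hb.2]⟩ hb]
      split_ifs with h2
      · obtain rfl : a = 1 := le_antisymm ha.2 (by linarith)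
        rw [pt_right]
        simp
      · rw [show a + b - 1 - b + 1 = a by ring]
        simp
  right_inv p := by
    obtain ⟨i, a, ha, b, hb, rfl⟩ := exists_pt p
    rw [unshearFun_pt ha hb]
    split_ifs with h1
    · rw [shearFun_pt ⟨by linarith, by linarith [ha.2, hb.1]⟩ hb, if_pos (by linarith [ha.2])]
      simp
    · rw [shearFun_pt ⟨by linarith [ha.1, hb.2], by linarith⟩ hb]
      split_ifs with h2
      · obtain rfl : a = 0 := le_antisymm (by linarith) ha.1
        simp [pt_right]
      · rw [show a - b + 1 + b - 1 = a by ring]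
        simp
  continuous_toFun := continuous_shearFun
  continuous_invFun := continuous_unshearFun

theorem shear_pt {i : Fin n} {a b : ℝ} (ha : a ∈ Icc (0 : ℝ) 1) (hb : b ∈ Icc (0 : ℝ) 1) :
    shear h v (pt i a b) = if a + b ≤ 1 then pt i (a + b) b else pt (h i) (a + b - 1) b :=
  shearFun_pt ha hb

/-- The shear fixes the bottom edges, so it leaves the turning around the vertices, and the cone
angles, unchanged. -/
theorem comm_shear (h v : Equiv.Perm (Fin n)) : comm h (v * h⁻¹) = comm h v := by
  simp [comm, mul_assoc]

theorem isAffine_shear (hs : 0 < s) (h v : Equiv.Perm (Fin n)) :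
    IsAffine hs (shear h v) (linMap 1 1 0 1) := by
  refine isAffine_of_squares (fun p => ?_) ?_
  · obtain ⟨i, a, ha, b, hb, rfl⟩ := exists_pt_Ico p
    have ha' := Ico_subset_Icc_self ha
    have hb' := Ico_subset_Icc_self hb
    rw [shear_pt ha' hb']
    rcases hb.1.eq_or_lt with rfl | hb0
    · rw [add_zero, if_pos ha.2.le]
      rcases ha.1.eq_or_lt with rfl | ha0
      · rw [mult_vertex, mult_vertex, comm_shear]
      · rw [mult_of_ne ha hb fun k => ha0.ne' k.1, mult_of_ne ha hb fun k => ha0.ne' k.1]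
    · rw [mult_of_ne ha hb fun k => hb0.ne' k.2]
      have hf : ∀ {c : ℝ}, ¬(Int.fract c = 0 ∧ Int.fract b = 0) := fun k => by
        rw [fract_of_mem_Ico hb] at k
        exact hb0.ne' k.2
      split_ifs with h1
      · rw [mult_pt ⟨by linarith [ha.1], h1⟩ hb', if_neg hf]
      · rw [mult_pt ⟨by linarith, by linarith [ha.2, hb.2]⟩ hb', if_neg hf]
  · intro j a ha b hb
    have key : ∀ w : ℂ, linMap 1 1 0 1 w = ⟨w.re + w.im, w.im⟩ := fun w => by simp [linMap]
    -- The square is cut by its antidiagonal `a + b = 1`. `A` treats the lower left triangle, `B`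
    -- the upper right one, and both are needed at points of the antidiagonal.
    have A : a + b ≤ 1 → ∀ᶠ z : ℝ × ℝ in 𝓝 (a, b), z ∈ unitSq → z.1 + z.2 ≤ 1 →
        prim hs (pt j (a + b) b : Surface h (v * h⁻¹)) (pt j (z.1 + z.2) z.2) =
          linMap 1 1 0 1 (s * ((z.1 - a : ℝ) + (z.2 - b : ℝ) * Complex.I)) := by
      intro hab
      have c : ContinuousAt (fun z : ℝ × ℝ => (z.1 + z.2, z.2)) (a, b) := by fun_prop
      filter_upwards [c.eventually (prim_pt (h := h) (v := v * h⁻¹) hs (j := j)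
        ⟨by linarith [ha.1, hb.1], hab⟩ hb)] with z hz hz1 hz2
      rw [hz ⟨⟨by linarith [hz1.1.1, hz1.2.1], hz2⟩, hz1.2⟩, key]
      apply Complex.ext <;> simp
      ring
    have B : 1 ≤ a + b → ∀ᶠ z : ℝ × ℝ in 𝓝 (a, b), z ∈ unitSq → 1 ≤ z.1 + z.2 →
        prim hs (pt (h j) (a + b - 1) b : Surface h (v * h⁻¹)) (pt (h j) (z.1 + z.2 - 1) z.2) =
          linMap 1 1 0 1 (s * ((z.1 - a : ℝ) + (z.2 - b : ℝ) * Complex.I)) := by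
      intro hab
      have c : ContinuousAt (fun z : ℝ × ℝ => (z.1 + z.2 - 1, z.2)) (a, b) := by fun_prop
      filter_upwards [c.eventually (prim_pt (h := h) (v := v * h⁻¹) hs (j := h j)
        ⟨by linarith, by linarith [ha.2, hb.2]⟩ hb)] with z hz hz1 hz2
      rw [hz ⟨⟨by linarith, by linarith [hz1.1.2, hz1.2.2]⟩, hz1.2⟩, key]
      apply Complex.ext <;> simp
      ring
    have c : ContinuousAt (fun z : ℝ × ℝ => z.1 + z.2) (a, b) := by fun_prop
    rcases lt_trichotomy (a + b) 1 with hab | hab | hab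
    · filter_upwards [A hab.le, c.eventually (gt_mem_nhds hab)] with z h1 h2 hz
      rw [shear_pt ha hb, shear_pt hz.1 hz.2, if_pos hab.le, if_pos h2.le, h1 hz h2.le]
    · filter_upwards [A hab.le, B hab.ge] with z h1 h2 hz
      rw [shear_pt ha hb, shear_pt hz.1 hz.2, if_pos hab.le]
      split_ifs with h3
      · rw [h1 hz h3]
      · rw [← h2 hz (not_le.1 h3).le, hab, pt_right, sub_self]
    · filter_upwards [B hab.le, c.eventually (lt_mem_nhds hab)] with z h1 h2 hz
      rw [shear_pt ha hb, shear_pt hz.1 hz.2, if_neg (not_le.2 hab), if_neg (not_le.2 h2),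
        h1 hz (le_of_lt h2)]

end Origami

namespace Origami

open Set AlexanderSpanier

variable {n : ℕ} {h v h' v' : Equiv.Perm (Fin n)} {s : ℝ}

/-! ### Periods of one-dimensional cocycles -/

/-- `u` is a potential of `f` on the set `K`. -/
def IsPotential {E : Type*} [TopologicalSpace E] (K : Set E) (f : E → E → ℝ) (u : E → ℝ) : Prop :=
  ∀ p ∈ K, ∃ U ∈ 𝓝 p, ∀ x ∈ U ∩ K, ∀ y ∈ U ∩ K, f x y = u y - u x

theorem IsPotential.comp {E E' : Type*} [TopologicalSpace E] [TopologicalSpace E'] {K : Set E}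
    {K' : Set E'} {f : E → E → ℝ} {u : E → ℝ} (hu : IsPotential K f u) {γ : E' → E}
    (hγ : Continuous γ) (hK : MapsTo γ K' K) :
    IsPotential K' (fun x y => f (γ x) (γ y)) (fun x => u (γ x)) := by
  intro p hp
  obtain ⟨U, hU, H⟩ := hu (γ p) (hK hp)
  exact ⟨γ ⁻¹' U, hγ.continuousAt hU, fun x hx y hy => H _ ⟨hx.1, hK hx.2⟩ _ ⟨hy.1, hK hy.2⟩⟩

/-- Cocycles on star-shaped compact sets are coboundaries. -/
theorem exists_isPotential {E : Type*} [NormedAddCommGroup E] [NormedSpace ℝ E] {K : Set E}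
    (hK : IsCompact K) (hs : ∀ x ∈ K, ∀ t ∈ Icc (0 : ℝ) 1, t • x ∈ K) {f : E → E → ℝ}
    (hf : ∀ p ∈ K, ∃ U ∈ 𝓝 p, ∀ x ∈ U ∩ K, ∀ y ∈ U ∩ K, ∀ z ∈ U ∩ K,
      f y z - f x z + f x y = 0) : ∃ u, IsPotential K f u := by
  choose! U hU hfU using hf
  -- A Lebesgue number makes the cocycle identity hold at one scale `ε` everywhere in `K`.
  obtain ⟨ε, hε, H⟩ := lebesgue_number_lemma_of_metric (c := fun p : K => interior (U p)) hK
    (fun p => isOpen_interior) (fun x hx => mem_iUnion.2 ⟨⟨x, hx⟩, mem_interior_iff_mem_nhds.2 (hU x hx)⟩)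
  have cyc : ∀ p ∈ K, ∀ x ∈ Metric.ball p ε ∩ K, ∀ y ∈ Metric.ball p ε ∩ K,
      ∀ z ∈ Metric.ball p ε ∩ K, f y z - f x z + f x y = 0 := by
    intro p hp x hx y hy z hz
    obtain ⟨q, hq⟩ := H p hp
    exact hfU q q.2 x ⟨interior_subset (hq hx.1), hx.2⟩ y ⟨interior_subset (hq hy.1), hy.2⟩ z
      ⟨interior_subset (hq hz.1), hz.2⟩
  obtain ⟨R, hR⟩ := hK.isBounded.exists_norm_le
  -- With this `N` all steps of the subdivided segments from the origin are shorter than `ε / 2`.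
  obtain ⟨N, hN⟩ := exists_nat_gt (2 * (|R| + 1) / ε)
  have hN0 : (0 : ℝ) < N := lt_trans (by positivity) hN
  have hstep : ∀ x ∈ K, ‖x‖ / N < ε / 2 := by
    intro x hx
    rw [div_lt_iff₀ hε] at hN
    rw [div_lt_iff₀ hN0]
    have := (hR x hx).trans (le_abs_self R)
    linarith
  let P : ℕ → E → E := fun k x => ((k : ℝ) / N) • x
  have hPK : ∀ k ≤ N, ∀ x ∈ K, P k x ∈ K := fun k hk x hx => hs x hx _
    ⟨by positivity, by rw [div_le_one hN0]; exact_mod_cast hk⟩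
  have hP1 : ∀ k x, P (k + 1) x - P k x = (1 / N : ℝ) • x := by
    intro k x
    simp only [P, ← sub_smul]
    congr 1
    push_cast
    ring
  -- The potential at `x` is the sum of `f` along `N` equal steps from the origin to `x`.
  let u : E → ℝ := fun x => ∑ k ∈ Finset.range N, f (P k x) (P (k + 1) x)
  refine ⟨u, fun p hp => ⟨Metric.ball p (ε / 4), Metric.ball_mem_nhds p (by positivity), ?_⟩⟩
  intro x hx y hy
  have hxy : ‖y - x‖ < ε / 2 := by
    have h1 := hx.1
    have h2 := hy.1
    rw [mem_ball_iff_norm] at h1 h2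
    calc ‖y - x‖ = ‖(y - p) - (x - p)‖ := by congr 1; abel
      _ ≤ ‖y - p‖ + ‖x - p‖ := norm_sub_le _ _
      _ < ε / 2 := by linarith
  -- The segments to `x` and `y` are the sides of a ladder. The identity is the cocycle relation on
  -- the two triangles of a rung; in the sum the rungs telescope and leave `f x y`.
  have ladder : ∀ k ∈ Finset.range N, f (P k y) (P (k + 1) y) - f (P k x) (P (k + 1) x) =
      f (P (k + 1) x) (P (k + 1) y) - f (P k x) (P k y) := by
    intro k hk
    rw [Finset.mem_range] at hk
    have k1 := hPK k hk.le x hx.2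
    have k2 := hPK (k + 1) hk x hx.2
    have k3 := hPK k hk.le y hy.2
    have k4 := hPK (k + 1) hk y hy.2
    have hd : ∀ m ≤ N, ‖P m y - P m x‖ < ε / 2 := by
      intro m hm
      simp only [P, ← smul_sub, norm_smul, Real.norm_eq_abs]
      rw [abs_of_nonneg (by positivity)]
      have : (m : ℝ) / N ≤ 1 := by rw [div_le_one hN0]; exact_mod_cast hm
      calc (m : ℝ) / N * ‖y - x‖ ≤ 1 * ‖y - x‖ := by gcongr
        _ < ε / 2 := by linarith
    have hn : ∀ z ∈ K, ‖P (k + 1) z - P k z‖ < ε / 2 := by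
      intro z hz
      rw [hP1, norm_smul, Real.norm_eq_abs, abs_of_nonneg (by positivity), one_div_mul_eq_div]
      exact hstep z hz
    have b1 : P k x ∈ Metric.ball (P k x) ε ∩ K := ⟨Metric.mem_ball_self hε, k1⟩
    have b2 : P (k + 1) x ∈ Metric.ball (P k x) ε ∩ K :=
      ⟨by rw [mem_ball_iff_norm]; linarith [hn x hx.2], k2⟩
    have b3 : P k y ∈ Metric.ball (P k x) ε ∩ K :=
      ⟨by rw [mem_ball_iff_norm]; linarith [hd k hk.le], k3⟩
    have b4 : P (k + 1) y ∈ Metric.ball (P k x) ε ∩ K := by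
      refine ⟨?_, k4⟩
      rw [mem_ball_iff_norm]
      calc ‖P (k + 1) y - P k x‖ = ‖(P (k + 1) y - P k y) + (P k y - P k x)‖ := by congr 1; abel
        _ ≤ _ := norm_add_le _ _
        _ < ε := by linarith [hn y hy.2, hd k hk.le]
    have c1 := cyc _ k1 _ b1 _ b2 _ b4
    have c2 := cyc _ k1 _ b1 _ b3 _ b4
    linarith
  have h0 : f (P 0 x) (P 0 y) = 0 := by
    have hz : P 0 x ∈ K := hPK 0 (Nat.zero_le _) x hx.2
    have hb : P 0 x ∈ Metric.ball (P 0 x) ε ∩ K := ⟨Metric.mem_ball_self hε, hz⟩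
    have := cyc _ hz _ hb _ hb _ hb
    have e : P 0 y = P 0 x := by simp [P]
    rw [e]
    linarith
  have hNx : ∀ z, P N z = z := fun z => by simp [P, hN0.ne']
  have := Finset.sum_congr rfl ladder
  rw [Finset.sum_sub_distrib, Finset.sum_range_sub (fun k => f (P k x) (P k y)), h0, hNx, hNx] at this
  simp only [u]
  linarith

/-- Potentials on the unit interval are unique up to constants. -/
theorem IsPotential.unique {f : ℝ → ℝ → ℝ} {u w : ℝ → ℝ} (hu : IsPotential (Icc 0 1) f u)
    (hw : IsPotential (Icc 0 1) f w) {s t : ℝ} (hs : s ∈ Icc (0 : ℝ) 1) (ht : t ∈ Icc (0 : ℝ) 1) :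
    u t - u s = w t - w s := by
  have hl : ∀ p ∈ Icc (0 : ℝ) 1, ∀ᶠ x in 𝓝[Icc 0 1] p, u x - w x = u p - w p := by
    intro p hp
    obtain ⟨U, hU, H⟩ := hu p hp
    obtain ⟨V, hV, H'⟩ := hw p hp
    filter_upwards [self_mem_nhdsWithin, mem_nhdsWithin_of_mem_nhds hU,
      mem_nhdsWithin_of_mem_nhds hV] with x hx hxU hxV
    have h1 := H p ⟨mem_of_mem_nhds hU, hp⟩ x ⟨hxU, hx⟩
    have h2 := H' p ⟨mem_of_mem_nhds hV, hp⟩ x ⟨hxV, hx⟩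
    linarith
  -- The difference of the two potentials is locally constant on a connected interval.
  have := isPreconnected_Icc.induction₂ (fun x y => u x - w x = u y - w y)
    (fun p hp => (hl p hp).mono fun x hx => hx.symm) (fun _ _ _ _ _ _ => Eq.trans)
    (fun _ _ _ _ => Eq.symm) hs ht
  linarith

theorem IsPotential.congr {E : Type*} [TopologicalSpace E] {K : Set E} {f g : E → E → ℝ}
    {u : E → ℝ} (hu : IsPotential K f u) (hfg : ∀ x ∈ K, ∀ y ∈ K, g x y = f x y) :
    IsPotential K g u := by
  intro p hp
  obtain ⟨U, hU, H⟩ := hu p hp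
  exact ⟨U, hU, fun x hx y hy => (hfg x hx.2 y hy.2).trans (H x hx y hy)⟩

theorem exists_pot (f : ↥(cocycles1 (Surface h v))) (i : Fin n) :
    ∃ u : ℝ × ℝ → ℝ, IsPotential unitSq (fun z w => f.1 (pt i z.1 z.2) (pt i w.1 w.2)) u := by
  refine exists_isPotential (isCompact_Icc.prod isCompact_Icc) ?_ ?_
  · rintro ⟨a, b⟩ ⟨ha, hb⟩ t ht
    exact ⟨⟨mul_nonneg ht.1 ha.1, mul_le_one₀ ht.2 ha.1 ha.2⟩,
      ⟨mul_nonneg ht.1 hb.1, mul_le_one₀ ht.2 hb.1 hb.2⟩⟩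
  · intro p _
    obtain ⟨U, hU, H⟩ := f.2 (pt i p.1 p.2)
    exact ⟨_, (continuous_pt i).continuousAt hU,
      fun x hx y hy z hz => H _ hx.1 _ hy.1 _ hz.1⟩

/-- A potential of a cocycle on the `i`-th square. -/
def pot (f : ↥(cocycles1 (Surface h v))) (i : Fin n) : ℝ × ℝ → ℝ := (exists_pot f i).choose

theorem isPotential_pot (f : ↥(cocycles1 (Surface h v))) (i : Fin n) :
    IsPotential unitSq (fun z w => f.1 (pt i z.1 z.2) (pt i w.1 w.2)) (pot f i) :=
  (exists_pot f i).choose_spec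

/-- The restriction of the potential to a path in the `i`-th square. -/
theorem isPotential_pot_comp (f : ↥(cocycles1 (Surface h v))) (i : Fin n) {c d : ℝ → ℝ}
    (hc : Continuous c) (hd : Continuous d) (hcI : MapsTo c (Icc 0 1) (Icc 0 1))
    (hdI : MapsTo d (Icc 0 1) (Icc 0 1)) :
    IsPotential (Icc 0 1) (fun s t => f.1 (pt i (c s) (d s)) (pt i (c t) (d t)))
      (fun t => pot f i (c t, d t)) :=
  (isPotential_pot f i).comp (hc.prodMk hd) fun _ ht => ⟨hcI ht, hdI ht⟩

theorem mapsTo_const {c : ℝ} (hc : c ∈ Icc (0 : ℝ) 1) :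
    MapsTo (fun _ : ℝ => c) (Icc 0 1) (Icc 0 1) := fun _ _ => hc

/-- The period along the bottom edge of the `i`-th square. -/
def px (f : ↥(cocycles1 (Surface h v))) (i : Fin n) : ℝ := pot f i (1, 0) - pot f i (0, 0)

/-- The period along the left edge of the `i`-th square. -/
def py (f : ↥(cocycles1 (Surface h v))) (i : Fin n) : ℝ := pot f i (0, 1) - pot f i (0, 0)

theorem eq_px {f : ↥(cocycles1 (Surface h v))} {i : Fin n} {w : ℝ → ℝ}
    (hw : IsPotential (Icc 0 1) (fun s t => f.1 (pt i s 0) (pt i t 0)) w) {t : ℝ}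
    (ht : t ∈ Icc (0 : ℝ) 1) : w t - w 0 = pot f i (t, 0) - pot f i (0, 0) :=
  hw.unique (isPotential_pot_comp f i continuous_id continuous_const (mapsTo_id _)
    (mapsTo_const (by simp))) (by simp) ht

theorem eq_py {f : ↥(cocycles1 (Surface h v))} {i : Fin n} {w : ℝ → ℝ}
    (hw : IsPotential (Icc 0 1) (fun s t => f.1 (pt i 0 s) (pt i 0 t)) w) {t : ℝ}
    (ht : t ∈ Icc (0 : ℝ) 1) : w t - w 0 = pot f i (0, t) - pot f i (0, 0) :=
  hw.unique (isPotential_pot_comp f i continuous_const continuous_id (mapsTo_const (by simp))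
    (mapsTo_id _)) (by simp) ht

/-- The potential along the right edge. -/
theorem pot_right (f : ↥(cocycles1 (Surface h v))) (i : Fin n) {t : ℝ} (ht : t ∈ Icc (0 : ℝ) 1) :
    pot f i (1, t) - pot f i (1, 0) = pot f (h i) (0, t) - pot f (h i) (0, 0) := by
  have := isPotential_pot_comp f i (c := fun _ => 1) (d := id) continuous_const continuous_id
    (mapsTo_const (by simp)) (mapsTo_id _)
  simp only [pt_right] at this
  exact eq_py this ht

/-- The potential along the top edge. -/
theorem pot_top (f : ↥(cocycles1 (Surface h v))) (i : Fin n) {t : ℝ} (ht : t ∈ Icc (0 : ℝ) 1) :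
    pot f i (t, 1) - pot f i (0, 1) = pot f (v i) (t, 0) - pot f (v i) (0, 0) := by
  have := isPotential_pot_comp f i (c := id) (d := fun _ => 1) continuous_id continuous_const
    (mapsTo_id _) (mapsTo_const (by simp))
  simp only [pt_top] at this
  exact eq_px this ht

/-- The period along the boundary of a square vanishes, since there is a potential on the whole
square. -/
theorem px_add_py (f : ↥(cocycles1 (Surface h v))) (i : Fin n) :
    px f i + py f (h i) = py f i + px f (v i) := by
  have h1 := pot_right f i (t := 1) (by simp)
  have h2 := pot_top f i (t := 1) (by simp)
  unfold px py
  linarith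

/-- The shear maps a left edge to a diagonal, so the periods along diagonals are needed. -/
theorem diag_pot (f : ↥(cocycles1 (Surface h v))) (i : Fin n) :
    pot f i (1, 1) - pot f i (0, 0) = px f i + py f (h i) := by
  have h1 := pot_right f i (t := 1) (by simp)
  unfold px py
  linarith

theorem IsPotential.add {E : Type*} [TopologicalSpace E] {K : Set E} {f g : E → E → ℝ}
    {u w : E → ℝ} (hu : IsPotential K f u) (hw : IsPotential K g w) :
    IsPotential K (fun x y => f x y + g x y) (fun x => u x + w x) := by
  intro p hp
  obtain ⟨U, hU, H⟩ := hu p hp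
  obtain ⟨V, hV, H'⟩ := hw p hp
  refine ⟨U ∩ V, inter_mem hU hV, fun x hx y hy => ?_⟩
  dsimp only
  rw [H x ⟨hx.1.1, hx.2⟩ y ⟨hy.1.1, hy.2⟩, H' x ⟨hx.1.2, hx.2⟩ y ⟨hy.1.2, hy.2⟩]
  ring

theorem IsPotential.smul {E : Type*} [TopologicalSpace E] {K : Set E} {f : E → E → ℝ}
    {u : E → ℝ} (hu : IsPotential K f u) (c : ℝ) :
    IsPotential K (fun x y => c * f x y) (fun x => c * u x) := by
  intro p hp
  obtain ⟨U, hU, H⟩ := hu p hp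
  exact ⟨U, hU, fun x hx y hy => by dsimp only; rw [H x hx y hy]; ring⟩

theorem px_eq_of_isPotential {f : ↥(cocycles1 (Surface h v))} {i : Fin n} {u : ℝ × ℝ → ℝ}
    (hu : IsPotential unitSq (fun z w => f.1 (pt i z.1 z.2) (pt i w.1 w.2)) u) :
    px f i = u (1, 0) - u (0, 0) := by
  refine (eq_px (w := fun t => u (t, 0)) ?_ (by simp)).symm
  exact hu.comp (γ := fun t : ℝ => ((t, 0) : ℝ × ℝ)) (by fun_prop) fun t ht => ⟨ht, by simp⟩

theorem py_eq_of_isPotential {f : ↥(cocycles1 (Surface h v))} {i : Fin n} {u : ℝ × ℝ → ℝ}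
    (hu : IsPotential unitSq (fun z w => f.1 (pt i z.1 z.2) (pt i w.1 w.2)) u) :
    py f i = u (0, 1) - u (0, 0) := by
  refine (eq_py (w := fun t => u (0, t)) ?_ (by simp)).symm
  exact hu.comp (γ := fun t : ℝ => ((0, t) : ℝ × ℝ)) (by fun_prop) fun t ht => ⟨by simp, ht⟩

/-- The periods of a cocycle along the edges of the squares. -/
def per : ↥(cocycles1 (Surface h v)) →ₗ[ℝ] (Fin n → ℝ) × (Fin n → ℝ) where
  toFun f := (px f, py f)
  map_add' f g := by
    refine Prod.ext (funext fun i => ?_) (funext fun i => ?_)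
    · change px (f + g) i = px f i + px g i
      rw [px_eq_of_isPotential (f := f + g) ((isPotential_pot f i).add (isPotential_pot g i))]
      unfold px
      ring
    · change py (f + g) i = py f i + py g i
      rw [py_eq_of_isPotential (f := f + g) ((isPotential_pot f i).add (isPotential_pot g i))]
      unfold py
      ring
  map_smul' c f := by
    refine Prod.ext (funext fun i => ?_) (funext fun i => ?_)
    · change px (c • f) i = c * px f i
      rw [px_eq_of_isPotential (f := c • f) ((isPotential_pot f i).smul c)]
      unfold px
      ring
    · change py (c • f) i = c * py f i
      rw [py_eq_of_isPotential (f := c • f) ((isPotential_pot f i).smul c)]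
      unfold py
      ring

/-- Edge periods which come from a function on the vertices. -/
def IsVertexCob (h v : Equiv.Perm (Fin n)) (w : (Fin n → ℝ) × (Fin n → ℝ)) : Prop :=
  ∃ g : Fin n → ℝ, (∀ i, w.1 i = g (h i) - g i) ∧ (∀ i, w.2 i = g (v i) - g i)

/-- A cocycle with trivial edge periods is a coboundary. -/
theorem mem_coboundaries1 {f : ↥(cocycles1 (Surface h v))} (hf : IsVertexCob h v (per f)) :
    f.1 ∈ coboundaries1 (Surface h v) := by
  obtain ⟨g, hx, hy⟩ := hf
  change ∀ i, px f i = _ at hx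
  change ∀ i, py f i = _ at hy
  -- The value `g i` is prescribed at the lower left corner of the square `i` and continued by the
  -- potential of that square; the hypothesis on the periods makes the values agree along the edges.
  let u : Surface h v → ℝ := lift (fun i a b => g i + (pot f i (a, b) - pot f i (0, 0)))
    (by
      intro i b hb
      have h1 := pot_right f i hb
      have h2 := hx i
      unfold px at h2
      linarith)
    (by
      intro i a ha
      have h1 := pot_top f i ha
      have h2 := hy i
      unfold py at h2
      linarith)
  have hu : ∀ {i a b}, a ∈ Icc (0 : ℝ) 1 → b ∈ Icc (0 : ℝ) 1 →
      u (pt i a b) = g i + (pot f i (a, b) - pot f i (0, 0)) := fun ha hb => lift_pt _ _ _ ha hb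
  refine ⟨u, fun p => ?_⟩
  -- Potentials in the squares around `p` compare only pairs inside one square, in particular pairs
  -- containing `p`. The cocycle identity extends this to all pairs near `p`.
  have key : ∀ᶠ q in 𝓝 p, f.1 p q = u q - u p := by
    refine eventually_nhds ?_
    rintro j a ha b hb rfl
    obtain ⟨U, hU, H⟩ := isPotential_pot f j (a, b) ⟨ha, hb⟩
    filter_upwards [hU] with z hz hz'
    rw [hu ha hb, hu hz'.1 hz'.2]
    have := H (a, b) ⟨mem_of_mem_nhds hU, ha, hb⟩ z ⟨hz, hz'⟩
    dsimp only at this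
    rw [this]
    ring
  obtain ⟨W, hW, H⟩ := f.2 p
  refine ⟨_, inter_mem hW key, fun x hx y hy => ?_⟩
  have h1 := H p (mem_of_mem_nhds hW) x hx.1 y hy.1
  have h2 : f.1 p x = u x - u p := hx.2
  have h3 : f.1 p y = u y - u p := hy.2
  linarith

/-- This reduces all later equalities of cohomology classes to finite systems of edge periods. -/
theorem mk_eq_mk {f g : ↥(cocycles1 (Surface h v))} (hfg : IsVertexCob h v (per f - per g)) :
    H1.mk f = H1.mk g := by
  rw [← sub_eq_zero, ← map_sub]
  rw [← map_sub] at hfg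
  exact (Submodule.Quotient.mk_eq_zero _).2 (mem_coboundaries1 hfg)

/-! ### Periods and affine maps -/

theorem per_swap (f : ↥(cocycles1 (Surface v h))) :
    per (pullbackCocycle (swap h v : C(Surface h v, Surface v h)) f) =
      ((per f).2, (per f).1) := by
  refine Prod.ext (funext fun i => ?_) (funext fun i => ?_)
  · change px _ i = py f i
    refine ((eq_px (w := fun t => pot f i (0, t)) ?_ (by simp)).symm)
    refine (isPotential_pot_comp f i continuous_const continuous_id (mapsTo_const (by simp))
      (mapsTo_id _)).congr ?_
    intro x hx y hy
    change f.1 (swap h v _) (swap h v _) = _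
    rw [swap_pt hx (by simp), swap_pt hy (by simp)]
    rfl
  · change py _ i = px f i
    refine ((eq_py (w := fun t => pot f i (t, 0)) ?_ (by simp)).symm)
    refine (isPotential_pot_comp f i continuous_id continuous_const (mapsTo_id _)
      (mapsTo_const (by simp))).congr ?_
    intro x hx y hy
    change f.1 (swap h v _) (swap h v _) = _
    rw [swap_pt (by simp) hx, swap_pt (by simp) hy]
    rfl

/-- The action of the shear on edge periods. -/
def shearPer (R : Type*) [Add R] (h : Equiv.Perm (Fin n)) (w : (Fin n → R) × (Fin n → R)) :
    (Fin n → R) × (Fin n → R) := (w.1, fun i => w.1 i + w.2 (h i))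

/-- Bottom edges are fixed and the left edge of the square `i` is sent to the diagonal of that
square. -/
theorem per_shear (f : ↥(cocycles1 (Surface h (v * h⁻¹)))) :
    per (pullbackCocycle (shear h v : C(Surface h v, Surface h (v * h⁻¹))) f) =
      shearPer ℝ h (per f) := by
  refine Prod.ext (funext fun i => ?_) (funext fun i => ?_)
  · change px _ i = px f i
    refine ((eq_px (w := fun t => pot f i (t, 0)) ?_ (by simp)).symm)
    refine (isPotential_pot_comp f i continuous_id continuous_const (mapsTo_id _)
      (mapsTo_const (by simp))).congr ?_
    intro x hx y hy
    change f.1 (shear h v _) (shear h v _) = _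
    rw [shear_pt hx (by simp), shear_pt hy (by simp), if_pos (by simpa using hx.2),
      if_pos (by simpa using hy.2), add_zero, add_zero]
    rfl
  · change py _ i = px f i + py f (h i)
    rw [← diag_pot]
    refine ((eq_py (w := fun t => pot f i (t, t)) ?_ (by simp)).symm)
    refine (isPotential_pot_comp f i continuous_id continuous_id (mapsTo_id _)
      (mapsTo_id _)).congr ?_
    intro x hx y hy
    change f.1 (shear h v _) (shear h v _) = _
    rw [shear_pt (by simp) hx, shear_pt (by simp) hy, if_pos (by simpa using hx.2),
      if_pos (by simpa using hy.2), zero_add, zero_add]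
    rfl

end Origami

namespace Origami

open Set AlexanderSpanier

variable {n : ℕ} {h v h' v' : Equiv.Perm (Fin n)} {s : ℝ}

/-! ### General facts on Alexander–Spanier classes -/

section General

variable {X : Type} [TopologicalSpace X]

theorem mem_cocycles1_of_local {f : X → X → ℝ}
    (hf : ∀ p, ∃ U ∈ 𝓝 p, ∃ u : X → ℝ, ∀ x ∈ U, ∀ y ∈ U, f x y = u y - u x) :
    f ∈ cocycles1 X := by
  intro p
  obtain ⟨U, hU, u, H⟩ := hf p
  refine ⟨U, hU, fun x hx y hy z hz => ?_⟩
  rw [H y hy z hz, H x hx z hz, H x hx y hy]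
  ring

theorem mk1_eq_of_local {f g : ↥(cocycles1 X)}
    (hf : ∀ p, ∃ U ∈ 𝓝 p, ∀ x ∈ U, ∀ y ∈ U, f.1 x y = g.1 x y) : H1.mk f = H1.mk g := by
  rw [← sub_eq_zero, ← map_sub]
  refine (Submodule.Quotient.mk_eq_zero _).2 ⟨0, fun p => ?_⟩
  obtain ⟨U, hU, H⟩ := hf p
  refine ⟨U, hU, fun x hx y hy => ?_⟩
  have := H x hx y hy
  change f.1 x y - g.1 x y = 0 - 0
  linarith

theorem mk2_eq_of_local {f g : ↥(cocycles2 X)} (u : X → X → ℝ)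
    (hf : ∀ p, ∃ U ∈ 𝓝 p, ∀ x ∈ U, ∀ y ∈ U, ∀ z ∈ U,
      f.1 x y z - g.1 x y z = u y z - u x z + u x y) : H2.mk f = H2.mk g := by
  rw [← sub_eq_zero, ← map_sub]
  exact (Submodule.Quotient.mk_eq_zero _).2 ⟨u, hf⟩

theorem cup_anticomm (ξ η : H1 X) : cup ξ η = -cup η ξ := by
  obtain ⟨f, rfl⟩ := Submodule.Quotient.mk_surjective _ ξ
  obtain ⟨g, rfl⟩ := Submodule.Quotient.mk_surjective _ η
  change H2.mk (cupCocycle f g) = -H2.mk (cupCocycle g f)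
  rw [← map_neg]
  -- The coboundary of the pointwise product of the two cocycles is, up to sign, the sum of the two
  -- cup products.
  refine mk2_eq_of_local (fun x y => -(f.1 x y * g.1 x y)) fun p => ?_
  obtain ⟨U, hU, H⟩ := f.2 p
  obtain ⟨V, hV, K⟩ := g.2 p
  refine ⟨U ∩ V, inter_mem hU hV, fun x hx y hy z hz => ?_⟩
  have h1 := H x hx.1 y hy.1 z hz.1
  have h2 := K x hx.2 y hy.2 z hz.2
  change f.1 x y * g.1 y z - -(g.1 x y * f.1 y z) = _
  linear_combination g.1 x z * h1 + (f.1 x y + f.1 y z) * h2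

/-- Pullbacks are compatible with linear relations between cup products. -/
theorem cup_pullback {Y : Type} [TopologicalSpace Y] (φ : C(X, Y)) {ξ η ξ' η' : H1 Y} {a : ℝ}
    (e : cup ξ η = a • cup ξ' η') :
    cup (pullback φ ξ) (pullback φ η) = a • cup (pullback φ ξ') (pullback φ η') := by
  obtain ⟨f, rfl⟩ := Submodule.Quotient.mk_surjective _ ξ
  obtain ⟨g, rfl⟩ := Submodule.Quotient.mk_surjective _ η
  obtain ⟨f', rfl⟩ := Submodule.Quotient.mk_surjective _ ξ'
  obtain ⟨g', rfl⟩ := Submodule.Quotient.mk_surjective _ η'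
  change H2.mk (cupCocycle f g) = a • H2.mk (cupCocycle f' g') at e
  rw [← map_smul, ← sub_eq_zero, ← map_sub] at e
  obtain ⟨u, hu⟩ := (Submodule.Quotient.mk_eq_zero _).1 e
  change H2.mk (cupCocycle (pullbackCocycle φ f) (pullbackCocycle φ g)) =
    a • H2.mk (cupCocycle (pullbackCocycle φ f') (pullbackCocycle φ g'))
  rw [← map_smul]
  refine mk2_eq_of_local (fun x y => u (φ x) (φ y)) fun p => ?_
  obtain ⟨U, hU, H⟩ := hu (φ p)
  exact ⟨φ ⁻¹' U, φ.continuous.continuousAt hU, fun x hx y hy z hz => H _ hx _ hy _ hz⟩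

end General

/-! ### Bands of squares -/

/-- The square containing a point; on the edges, the square to the right and above. -/
def idx (x : Surface h v) : Fin n :=
  match nf x with
  | Sum.inl q => q.1
  | Sum.inr q => q.out

theorem idx_pt {i : Fin n} {a b : ℝ} (ha : a ∈ Icc (0 : ℝ) 1) (hb : b ∈ Icc (0 : ℝ) 1)
    (hab : ¬(Int.fract a = 0 ∧ Int.fract b = 0)) :
    idx (pt i a b : Surface h v) = base h v i a b := by
  rw [idx, nf_pt ha hb, if_neg hab]

/-- The points at height between `1 / 4` and `3 / 4` in their square. -/
def MidY (x : Surface h v) : Prop := 1 / 4 < tY x ∧ tY x < 3 / 4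

/-- The indicator function of the upper halves of the squares. -/
def stepY (x : Surface h v) : ℝ := if 1 / 2 ≤ tY x then 1 else 0

theorem midY_pt {i : Fin n} {a b : ℝ} (ha : a ∈ Icc (0 : ℝ) 1) (hb : b ∈ Icc (0 : ℝ) 1) :
    MidY (pt i a b : Surface h v) ↔ 1 / 4 < b ∧ b < 3 / 4 := by
  rw [MidY, tY_pt ha hb]
  rcases hb.2.eq_or_lt with rfl | h1
  · norm_num
  · rw [fract_of_mem_Ico ⟨hb.1, h1⟩]

theorem stepY_pt {i : Fin n} {a b : ℝ} (ha : a ∈ Icc (0 : ℝ) 1) (hb : b ∈ Ico (0 : ℝ) 1) :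
    stepY (pt i a b : Surface h v) = if 1 / 2 ≤ b then 1 else 0 := by
  rw [stepY, tY_pt ha (Ico_subset_Icc_self hb), fract_of_mem_Ico hb]

theorem idx_pt_mid {i : Fin n} {a b : ℝ} (ha : a ∈ Icc (0 : ℝ) 1) (hb : 1 / 4 < b ∧ b < 3 / 4) :
    idx (pt i a b : Surface h v) = if a = 1 then h i else i := by
  have hb' : b ∈ Ico (0 : ℝ) 1 := ⟨by linarith, by linarith⟩
  have hne : ¬(Int.fract a = 0 ∧ Int.fract b = 0) := by
    rw [fract_of_mem_Ico hb']
    rintro ⟨-, h0⟩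
    linarith
  rw [idx_pt ha (Ico_subset_Icc_self hb') hne, base, if_neg (by linarith : ¬ b = 1)]
  split_ifs <;> rfl

theorem eventually_mid {b : ℝ} (hb : 1 / 4 < b ∧ b < 3 / 4) (a : ℝ) :
    ∀ᶠ z : ℝ × ℝ in 𝓝 (a, b), 1 / 4 < z.2 ∧ z.2 < 3 / 4 :=
  (continuous_snd.tendsto (a, b)).eventually (Ioo_mem_nhds hb.1 hb.2)

theorem eventually_midY {p : Surface h v} (hp : MidY p) : ∀ᶠ q in 𝓝 p, MidY q := by
  refine eventually_nhds ?_
  rintro j a ha b hb rfl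
  filter_upwards [eventually_mid ((midY_pt ha hb).1 hp) a] with z hz hz'
  exact (midY_pt hz'.1 hz'.2).2 hz

/-- Near a point outside the open strip, the part of the strip that is visible lies on one side of
the middle line. -/
theorem eventually_stepY {p : Surface h v} (hp : ¬MidY p) :
    ∃ ε, ∀ᶠ q in 𝓝 p, MidY q → stepY q = ε := by
  refine ⟨if tY p ≤ 1 / 4 then 0 else 1, eventually_nhds ?_⟩
  rintro j a ha b hb rfl
  rw [midY_pt ha hb, not_and_or, not_lt, not_lt] at hp
  rcases hb.2.eq_or_lt with rfl | h1
  · filter_upwards [(continuous_snd.tendsto (a, (1 : ℝ))).eventually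
      (lt_mem_nhds (by norm_num : (3 / 4 : ℝ) < 1))] with z hz hz' hm
    rw [midY_pt hz'.1 hz'.2] at hm
    linarith [hm.2]
  rw [tY_pt ha hb, fract_of_mem_Ico ⟨hb.1, h1⟩]
  rcases hp with hp | hp
  · rw [if_pos hp]
    filter_upwards [(continuous_snd.tendsto (a, b)).eventually
      (gt_mem_nhds (by linarith : b < 1 / 2))] with z hz hz' hm
    rw [stepY_pt hz'.1 ⟨hz'.2.1, by linarith⟩, if_neg (by linarith)]
  · rw [if_neg (by linarith)]
    filter_upwards [(continuous_snd.tendsto (a, b)).eventually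
      (lt_mem_nhds (by linarith : 1 / 2 < b))] with z hz hz' hm
    rw [midY_pt hz'.1 hz'.2] at hm
    rw [stepY_pt hz'.1 ⟨hz'.2.1, by linarith⟩, if_pos hz.le]

/-- The functions which are constant on the cycles of a permutation. -/
def invFun (g : Equiv.Perm (Fin n)) : Submodule ℝ (Fin n → ℝ) where
  carrier := {χ | ∀ i, χ (g i) = χ i}
  add_mem' ha hb i := by simp only [Pi.add_apply, ha i, hb i]
  zero_mem' _ := rfl
  smul_mem' c χ ha i := by simp only [Pi.smul_apply, ha i]

/-- The strip continues across vertical edges from a square to its image under `h`, and `χ` does not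
change there. -/
theorem eventually_row {χ : Fin n → ℝ} (hχ : χ ∈ invFun h) {p : Surface h v} (hp : MidY p) :
    ∀ᶠ q in 𝓝 p, χ (idx q) = χ (idx p) := by
  refine eventually_nhds ?_
  rintro j a ha b hb rfl
  rw [midY_pt ha hb] at hp
  have aux : ∀ {c d : ℝ}, c ∈ Icc (0 : ℝ) 1 → 1 / 4 < d ∧ d < 3 / 4 →
      χ (idx (pt j c d : Surface h v)) = χ j := by
    intro c d hc hd
    rw [idx_pt_mid hc hd]
    split_ifs
    · exact hχ j
    · rfl
  filter_upwards [eventually_mid hp a] with z hz hz'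
  rw [aux hz'.1 hz, aux ha hp]

open Classical in
/-- The cochain measuring the crossings of the horizontal middle lines, with weights `χ`. -/
def rowFn (χ : Fin n → ℝ) (x y : Surface h v) : ℝ :=
  if MidY x ∧ MidY y then χ (idx x) * (stepY y - stepY x) else 0

open Classical in
/-- The local weight of `rowFn`. -/
def rowWt (χ : Fin n → ℝ) (p : Surface h v) : ℝ := if MidY p then χ (idx p) else 0

/-- Locally the crossing cochain is a constant multiple of the coboundary of `stepY`; in particular
it is a cocycle. Restricting to a strip around the middle lines avoids the jump of `stepY` at the
horizontal edges. -/
theorem rowFn_eq {χ : Fin n → ℝ} (hχ : χ ∈ invFun h) (p : Surface h v) :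
    ∃ U ∈ 𝓝 p, ∀ x ∈ U, ∀ y ∈ U, rowFn χ x y = rowWt χ p * (stepY y - stepY x) := by
  by_cases hp : MidY p
  · refine ⟨_, inter_mem (eventually_midY hp) (eventually_row hχ hp), fun x hx y hy => ?_⟩
    rw [rowFn, if_pos ⟨hx.1, hy.1⟩, rowWt, if_pos hp]
    congr 1
    exact hx.2
  · obtain ⟨ε, hε⟩ := eventually_stepY hp
    refine ⟨_, hε, fun x hx y hy => ?_⟩
    rw [rowWt, if_neg hp, zero_mul, rowFn]
    split_ifs with hm
    · rw [show stepY x = ε from hx hm.1, show stepY y = ε from hy hm.2, sub_self, mul_zero]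
    · rfl

/-- The crossing cocycles of the horizontal middle lines. -/
def row : ↥(invFun h) →ₗ[ℝ] ↥(cocycles1 (Surface h v)) where
  toFun χ := ⟨rowFn χ, mem_cocycles1_of_local fun p => by
    obtain ⟨U, hU, H⟩ := rowFn_eq χ.2 p
    exact ⟨U, hU, fun x => rowWt χ p * stepY x, fun x hx y hy => by rw [H x hx y hy, mul_sub]⟩⟩
  map_add' χ χ' := by
    ext x y
    simp only [rowFn, Submodule.coe_add, Pi.add_apply]
    split_ifs <;> ring
  map_smul' c χ := by
    ext x y
    simp only [rowFn, Submodule.coe_smul, Pi.smul_apply, smul_eq_mul, RingHom.id_apply]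
    split_ifs <;> ring

/-- A bottom edge stays away from the strip, and a left edge crosses the middle line once, upwards.
-/
theorem per_row (χ : ↥(invFun h)) : per (row (v := v) χ) = (0, (χ : Fin n → ℝ)) := by
  refine Prod.ext (funext fun i => ?_) (funext fun i => ?_)
  · change px _ i = 0
    refine ((eq_px (w := fun _ => 0) (fun p _ => ⟨univ, univ_mem, ?_⟩) (by simp)).symm).trans (by simp)
    intro x hx y hy
    change rowFn _ _ _ = _
    rw [rowFn, if_neg, sub_zero]
    rw [midY_pt hx.2 (by simp)]
    norm_num
  · change py _ i = χ.1 i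
    have step : ∀ {t : ℝ}, t ∈ Icc (0 : ℝ) 1 → 1 / 4 < t ∧ t < 3 / 4 →
        stepY (pt i 0 t : Surface h v) = if 1 / 2 ≤ t then 1 else 0 := fun ht hm =>
      stepY_pt (by simp) ⟨ht.1, by linarith⟩
    refine ((eq_py (w := fun t => χ.1 i * if 1 / 2 ≤ t then 1 else 0) (fun p hp => ?_)
      (t := 1) (by simp)).symm).trans (by norm_num)
    have mid : ∀ {t : ℝ}, t ∈ Icc (0 : ℝ) 1 →
        (MidY (pt i 0 t : Surface h v) ↔ 1 / 4 < t ∧ t < 3 / 4) := fun ht => midY_pt (by simp) ht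
    change ∃ U ∈ 𝓝 p, ∀ x ∈ U ∩ Icc 0 1, ∀ y ∈ U ∩ Icc 0 1, rowFn _ _ _ = _
    by_cases hm : 1 / 4 < p ∧ p < 3 / 4
    · refine ⟨Ioo (1 / 4) (3 / 4), Ioo_mem_nhds hm.1 hm.2, fun x hx y hy => ?_⟩
      rw [rowFn, if_pos ⟨(mid hx.2).2 hx.1, (mid hy.2).2 hy.1⟩, step hx.2 hx.1, step hy.2 hy.1,
        idx_pt_mid (by simp) hx.1]
      simp only [zero_ne_one, if_false]
      ring
    rw [not_and_or, not_lt, not_lt] at hm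
    rcases hm with hm | hm
    · refine ⟨Iio (1 / 2), Iio_mem_nhds (by linarith), fun x hx y hy => ?_⟩
      have hx1 : x < 1 / 2 := hx.1
      have hy1 : y < 1 / 2 := hy.1
      dsimp only
      rw [if_neg (by linarith), if_neg (by linarith), rowFn]
      split_ifs with hh
      · rw [step hx.2 ((mid hx.2).1 hh.1), step hy.2 ((mid hy.2).1 hh.2),
          if_neg (by linarith), if_neg (by linarith)]
        ring
      · ring
    · refine ⟨Ioi (1 / 2), Ioi_mem_nhds (by linarith), fun x hx y hy => ?_⟩
      have hx1 : 1 / 2 < x := hx.1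
      have hy1 : 1 / 2 < y := hy.1
      dsimp only
      rw [if_pos (by linarith), if_pos (by linarith), rowFn]
      split_ifs with hh
      · rw [step hx.2 ((mid hx.2).1 hh.1), step hy.2 ((mid hy.2).1 hh.2),
          if_pos (by linarith), if_pos (by linarith)]
        ring
      · ring

/-- The crossing cocycles of the vertical middle lines. -/
def col : ↥(invFun v) →ₗ[ℝ] ↥(cocycles1 (Surface h v)) :=
  pullbackCocycle (swap h v : C(Surface h v, Surface v h)) ∘ₗ row

theorem per_col (ψ : ↥(invFun v)) : per (col (h := h) ψ) = ((ψ : Fin n → ℝ), 0) := by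
  change per (pullbackCocycle _ (row ψ)) = _
  rw [per_swap, per_row]

/-- The points at abscissa between `1 / 4` and `3 / 4` in their square. -/
def MidX (x : Surface h v) : Prop := MidY (swap h v x)

/-- The indicator function of the right halves of the squares. -/
def stepX (x : Surface h v) : ℝ := stepY (swap h v x)

theorem midX_pt {i : Fin n} {a b : ℝ} (ha : a ∈ Icc (0 : ℝ) 1) (hb : b ∈ Icc (0 : ℝ) 1) :
    MidX (pt i a b : Surface h v) ↔ 1 / 4 < a ∧ a < 3 / 4 := by
  rw [MidX, swap_pt ha hb, midY_pt hb ha]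

theorem stepX_pt {i : Fin n} {a b : ℝ} (ha : a ∈ Ico (0 : ℝ) 1) (hb : b ∈ Icc (0 : ℝ) 1) :
    stepX (pt i a b : Surface h v) = if 1 / 2 ≤ a then 1 else 0 := by
  rw [stepX, swap_pt (Ico_subset_Icc_self ha) hb, stepY_pt hb ha]

theorem eventually_swap {P : Surface v h → Prop} {p : Surface h v}
    (H : ∀ᶠ q in 𝓝 (swap h v p), P q) : ∀ᶠ q in 𝓝 p, P (swap h v q) :=
  ((swap h v).continuous.tendsto p).eventually H

theorem eventually_midX {p : Surface h v} (hp : MidX p) : ∀ᶠ q in 𝓝 p, MidX q :=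
  eventually_swap (eventually_midY hp)

theorem eventually_stepX {p : Surface h v} (hp : ¬MidX p) :
    ∃ ε, ∀ᶠ q in 𝓝 p, MidX q → stepX q = ε := by
  obtain ⟨ε, hε⟩ := eventually_stepY hp
  exact ⟨ε, eventually_swap hε⟩

theorem idx_pt_center {i : Fin n} {a b : ℝ} (ha : 1 / 4 < a ∧ a < 3 / 4)
    (hb : 1 / 4 < b ∧ b < 3 / 4) : idx (pt i a b : Surface h v) = i := by
  rw [idx_pt_mid ⟨by linarith, by linarith⟩ hb, if_neg (by linarith)]

theorem exists_center {p : Surface h v} (hX : MidX p) (hY : MidY p) :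
    ∃ i a b, (1 / 4 < a ∧ a < 3 / 4) ∧ (1 / 4 < b ∧ b < 3 / 4) ∧ p = pt i a b := by
  obtain ⟨i, a, ha, b, hb, rfl⟩ := exists_pt p
  exact ⟨i, a, b, (midX_pt ha hb).1 hX, (midY_pt ha hb).1 hY, rfl⟩

theorem idx_swap {p : Surface h v} (hX : MidX p) (hY : MidY p) : idx (swap h v p) = idx p := by
  obtain ⟨i, a, b, ha, hb, rfl⟩ := exists_center hX hY
  rw [swap_pt ⟨by linarith, by linarith⟩ ⟨by linarith, by linarith⟩, idx_pt_center hb ha,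
    idx_pt_center ha hb]

theorem eventually_idx {p : Surface h v} (hX : MidX p) (hY : MidY p) :
    ∀ᶠ q in 𝓝 p, idx q = idx p := by
  refine eventually_nhds ?_
  rintro j a ha b hb rfl
  rw [midX_pt ha hb] at hX
  rw [midY_pt ha hb] at hY
  filter_upwards [(continuous_fst.tendsto (a, b)).eventually (Ioo_mem_nhds hX.1 hX.2),
    eventually_mid hY a] with z hz1 hz2 hz'
  rw [idx_pt_center hz1 hz2, idx_pt_center hX hY]

open Classical in
/-- The local weight of a crossing cocycle of the vertical middle lines. -/
def colWt (ψ : Fin n → ℝ) (p : Surface h v) : ℝ := rowWt ψ (swap h v p)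

theorem row_eq (χ : ↥(invFun h)) (p : Surface h v) : ∃ U ∈ 𝓝 p, ∀ x ∈ U, ∀ y ∈ U,
    (row χ).1 x y = rowWt χ p * (stepY y - stepY x) := rowFn_eq χ.2 p

theorem col_eq (ψ : ↥(invFun v)) (p : Surface h v) : ∃ U ∈ 𝓝 p, ∀ x ∈ U, ∀ y ∈ U,
    (col ψ).1 x y = colWt ψ p * (stepX y - stepX x) := by
  obtain ⟨U, hU, H⟩ := row_eq ψ (swap h v p)
  exact ⟨_, (swap h v).continuous.continuousAt hU, fun x hx y hy => H _ hx _ hy⟩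

/-- Both factors are locally multiples of the coboundary of the same function, so the product is
symmetric already on cochains; being also antisymmetric on classes, it vanishes. -/
theorem cup_row_row (χ χ' : ↥(invFun h)) :
    cup (H1.mk (row (v := v) χ)) (H1.mk (row χ')) = 0 := by
  have h1 : cup (H1.mk (row (v := v) χ)) (H1.mk (row χ')) =
      cup (H1.mk (row χ')) (H1.mk (row χ)) := by
    rw [cup_mk, cup_mk]
    refine mk2_eq_of_local 0 fun p => ?_
    obtain ⟨U, hU, H⟩ := row_eq χ p
    obtain ⟨V, hV, K⟩ := row_eq χ' p
    refine ⟨U ∩ V, inter_mem hU hV, fun x hx y hy z hz => ?_⟩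
    change (row χ).1 x y * (row χ').1 y z - (row χ').1 x y * (row χ).1 y z = 0 - 0 + 0
    rw [H x hx.1 y hy.1, H y hy.1 z hz.1, K x hx.2 y hy.2, K y hy.2 z hz.2]
    ring
  have h2 := cup_anticomm (H1.mk (row (v := v) χ)) (H1.mk (row χ'))
  rw [← h1] at h2
  have h3 : (2 : ℝ) • cup (H1.mk (row (v := v) χ)) (H1.mk (row χ')) = 0 := by
    rw [two_smul]
    nth_rewrite 2 [h2]
    exact add_neg_cancel _
  exact (smul_eq_zero.1 h3).resolve_left two_ne_zero

theorem cup_col_col (ψ ψ' : ↥(invFun v)) :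
    cup (H1.mk (col (h := h) ψ)) (H1.mk (col ψ')) = 0 := by
  have := cup_pullback (swap h v : C(Surface h v, Surface v h)) (a := 0)
    (ξ := H1.mk (row ψ)) (η := H1.mk (row ψ')) (ξ' := 0) (η' := 0)
    (by rw [cup_row_row, zero_smul])
  rw [zero_smul] at this
  exact this

/-! ### The area class -/

open Classical in
/-- The cochain measuring the passages over the centres of the squares, with weights `θ`. -/
def areaFn (θ : Fin n → ℝ) (x y z : Surface h v) : ℝ :=
  if MidX y ∧ MidX z ∧ MidY x ∧ MidY y then
    θ (idx y) * ((stepY y - stepY x) * (stepX z - stepX y)) else 0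

open Classical in
/-- The local weight of `areaFn`. -/
def areaWt (θ : Fin n → ℝ) (p : Surface h v) : ℝ := if MidX p ∧ MidY p then θ (idx p) else 0

/-- If the point is outside one of the two strips, the corresponding difference of step functions
vanishes nearby. Otherwise the point is near the centre of one square, where the weight is constant.
-/
theorem areaFn_eq (θ : Fin n → ℝ) (p : Surface h v) : ∃ U ∈ 𝓝 p, ∀ x ∈ U, ∀ y ∈ U, ∀ z ∈ U,
    areaFn θ x y z = areaWt θ p * ((stepY y - stepY x) * (stepX z - stepX y)) := by
  by_cases hX : MidX p
  · by_cases hY : MidY p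
    · refine ⟨_, inter_mem (inter_mem (eventually_midX hX) (eventually_midY hY))
        (eventually_idx hX hY), fun x hx y hy z hz => ?_⟩
      rw [areaFn, if_pos ⟨hy.1.1, hz.1.1, hx.1.2, hy.1.2⟩, areaWt, if_pos ⟨hX, hY⟩,
        show idx y = idx p from hy.2]
    · obtain ⟨ε, hε⟩ := eventually_stepY hY
      refine ⟨_, hε, fun x hx y hy z hz => ?_⟩
      rw [areaWt, if_neg (fun hh => hY hh.2), zero_mul, areaFn]
      split_ifs with hm
      · rw [show stepY x = ε from hx hm.2.2.1, show stepY y = ε from hy hm.2.2.2]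
        ring
      · rfl
  · obtain ⟨ε, hε⟩ := eventually_stepX hX
    refine ⟨_, hε, fun x hx y hy z hz => ?_⟩
    rw [areaWt, if_neg (fun hh => hX hh.1), zero_mul, areaFn]
    split_ifs with hm
    · rw [show stepX y = ε from hy hm.1, show stepX z = ε from hz hm.2.1]
      ring
    · rfl

/-- The cocycle measuring the passages over the centres of the squares. -/
def area : (Fin n → ℝ) →ₗ[ℝ] ↥(cocycles2 (Surface h v)) where
  toFun θ := ⟨areaFn θ, fun p => by
    obtain ⟨U, hU, H⟩ := areaFn_eq θ p
    refine ⟨U, hU, fun x hx y hy z hz w hw => ?_⟩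
    rw [H y hy z hz w hw, H x hx z hz w hw, H x hx y hy w hw, H x hx y hy z hz]
    ring⟩
  map_add' θ θ' := by
    ext x y z
    simp only [areaFn, Submodule.coe_add, Pi.add_apply]
    split_ifs <;> ring
  map_smul' c θ := by
    ext x y z
    simp only [areaFn, Submodule.coe_smul, Pi.smul_apply, smul_eq_mul, RingHom.id_apply]
    split_ifs <;> ring

theorem area_eq (θ : Fin n → ℝ) (p : Surface h v) : ∃ U ∈ 𝓝 p, ∀ x ∈ U, ∀ y ∈ U, ∀ z ∈ U,
    (area θ).1 x y z = areaWt θ p * ((stepY y - stepY x) * (stepX z - stepX y)) := areaFn_eq θ p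

open Classical in
theorem rowWt_mul_colWt (χ ψ : Fin n → ℝ) (p : Surface h v) :
    rowWt χ p * colWt ψ p = areaWt (fun i => χ i * ψ i) p := by
  have e : colWt ψ p = if MidX p then ψ (idx (swap h v p)) else 0 := rfl
  rw [e]
  unfold rowWt areaWt
  by_cases hX : MidX p
  · by_cases hY : MidY p
    · rw [if_pos hY, if_pos hX, if_pos ⟨hX, hY⟩, idx_swap hX hY]
    · rw [if_neg hY, if_neg (c := MidX p ∧ MidY p) (fun hh => hY hh.2), zero_mul]
  · rw [if_neg (c := MidX p) hX, if_neg (c := MidX p ∧ MidY p) (fun hh => hX hh.1), mul_zero]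

/-- A horizontal and a vertical middle line cross only at the centres of squares. -/
theorem cup_row_col (χ : ↥(invFun h)) (ψ : ↥(invFun v)) :
    cup (H1.mk (row χ)) (H1.mk (col ψ)) =
      H2.mk (area (h := h) (v := v) fun i => χ.1 i * ψ.1 i) := by
  rw [cup_mk]
  refine mk2_eq_of_local 0 fun p => ?_
  obtain ⟨U, hU, H⟩ := row_eq χ p
  obtain ⟨V, hV, K⟩ := col_eq ψ p
  obtain ⟨W, hW, L⟩ := area_eq (fun i => χ.1 i * ψ.1 i) p
  refine ⟨U ∩ V ∩ W, inter_mem (inter_mem hU hV) hW, fun x hx y hy z hz => ?_⟩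
  change (row χ).1 x y * (col ψ).1 y z - (area _).1 x y z = 0 - 0 + 0
  rw [H x hx.1.1 y hy.1.1, K y hy.1.2 z hz.1.2, L x hx.2 y hy.2 z hz.2, ← rowWt_mul_colWt]
  ring

/-- A step function with jumps at the vertical middle lines. -/
def jump (θ : Fin n → ℝ) (x : Surface h v) : ℝ := θ (if tX x < 1 / 2 then idx x else h (idx x))

theorem jump_pt (θ : Fin n → ℝ) {i : Fin n} {a b : ℝ} (ha : a ∈ Icc (0 : ℝ) 1)
    (hb : 1 / 4 < b ∧ b < 3 / 4) :
    jump θ (pt i a b : Surface h v) = if a < 1 / 2 then θ i else θ (h i) := by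
  rw [jump, tX_pt ha ⟨by linarith, by linarith⟩, idx_pt_mid ha hb]
  rcases ha.2.eq_or_lt with rfl | h1
  · norm_num
  · rw [fract_of_mem_Ico ⟨ha.1, h1⟩, if_neg h1.ne]
    split_ifs <;> rfl

theorem eventually_jump (θ : Fin n → ℝ) {p : Surface h v} (hX : ¬MidX p) (hY : MidY p) :
    ∀ᶠ q in 𝓝 p, jump θ q = jump θ p := by
  refine eventually_nhds ?_
  rintro j a ha b hb rfl
  rw [midX_pt ha hb, not_and_or, not_lt, not_lt] at hX
  rw [midY_pt ha hb] at hY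
  rw [jump_pt θ ha hY]
  rcases hX with hX | hX
  · filter_upwards [(continuous_fst.tendsto (a, b)).eventually
      (gt_mem_nhds (by linarith : a < 1 / 2)), eventually_mid hY a] with z hz1 hz2 hz'
    rw [jump_pt θ hz'.1 hz2, if_pos hz1, if_pos (by linarith)]
  · filter_upwards [(continuous_fst.tendsto (a, b)).eventually
      (lt_mem_nhds (by linarith : 1 / 2 < a)), eventually_mid hY a] with z hz1 hz2 hz'
    rw [jump_pt θ hz'.1 hz2, if_neg (by linarith), if_neg (by linarith)]

theorem jump_eq (θ : Fin n → ℝ) {p : Surface h v} (hX : MidX p) (hY : MidY p) :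
    jump θ p = θ (idx p) + (θ (h (idx p)) - θ (idx p)) * stepX p := by
  obtain ⟨i, a, b, ha, hb, rfl⟩ := exists_center hX hY
  rw [jump_pt θ ⟨by linarith, by linarith⟩ hb, idx_pt_center ha hb,
    stepX_pt ⟨by linarith, by linarith⟩ ⟨by linarith, by linarith⟩]
  rcases lt_or_ge a (1 / 2) with h1 | h1
  · rw [if_pos h1, if_neg (by linarith)]
    ring
  · rw [if_neg (by linarith), if_pos h1]
    ring

/-- The constant weight one. -/
def oneInv (g : Equiv.Perm (Fin n)) : ↥(invFun g) := ⟨fun _ => 1, fun _ => rfl⟩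

/-- Along a horizontal strip `jump θ` changes from `θ i` to `θ (h i)` at the vertical middle line of
the square `i`, and nowhere else. -/
theorem mul_jump_sub (θ : Fin n → ℝ) (p : Surface h v) : ∃ U ∈ 𝓝 p, ∀ x ∈ U, ∀ y ∈ U,
    rowWt (oneInv h) p * (jump θ y - jump θ x) =
      areaWt (fun i => θ (h i) - θ i) p * (stepX y - stepX x) := by
  by_cases hY : MidY p
  · by_cases hX : MidX p
    · refine ⟨_, inter_mem (inter_mem (eventually_midX hX) (eventually_midY hY))
        (eventually_idx hX hY), fun x hx y hy => ?_⟩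
      rw [rowWt, if_pos hY, areaWt, if_pos ⟨hX, hY⟩, jump_eq θ hx.1.1 hx.1.2,
        jump_eq θ hy.1.1 hy.1.2, show idx x = idx p from hx.2, show idx y = idx p from hy.2]
      simp only [oneInv]
      ring
    · refine ⟨_, eventually_jump θ hX hY, fun x hx y hy => ?_⟩
      rw [show jump θ x = jump θ p from hx, show jump θ y = jump θ p from hy, areaWt,
        if_neg fun hh => hX hh.1]
      ring
  · refine ⟨univ, univ_mem, fun x _ y _ => ?_⟩
    rw [rowWt, if_neg hY, areaWt, if_neg fun hh => hY hh.2]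
    ring

/-- The unit horizontal crossing cocycle multiplied by the coboundary of `jump θ` is a coboundary,
and locally it is the area cocycle of the weight `θ ∘ h - θ`: masses can be moved to the
neighbouring square. -/
theorem mk_area_h (θ : Fin n → ℝ) :
    H2.mk (area (h := h) (v := v) fun i => θ (h i)) = H2.mk (area θ) := by
  rw [← sub_eq_zero, ← map_sub, ← map_sub, ← map_zero H2.mk]
  refine mk2_eq_of_local (fun x y => -((row (oneInv h)).1 x y * jump θ y)) fun p => ?_
  obtain ⟨U, hU, H⟩ := row_eq (oneInv h) p
  obtain ⟨V, hV, K⟩ := mul_jump_sub θ p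
  obtain ⟨W, hW, L⟩ := area_eq (fun i => θ (h i) - θ i) p
  refine ⟨U ∩ V ∩ W, inter_mem (inter_mem hU hV) hW, fun x hx y hy z hz => ?_⟩
  change (area _).1 x y z - 0 = _
  rw [H x hx.1.1 y hy.1.1, H y hy.1.1 z hz.1.1, H x hx.1.1 z hz.1.1]
  have h1 := K y hy.1.2 z hz.1.2
  have h2 : (area _).1 x y z = _ := L x hx.2 y hy.2 z hz.2
  linear_combination h2 - (stepY y - stepY x) * h1

theorem areaWt_swap (θ : Fin n → ℝ) (p : Surface h v) :
    areaWt θ (swap h v p) = areaWt θ p := by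
  have e : swap v h (swap h v p) = p := (swap h v).left_inv p
  have e1 : MidX (swap h v p) ↔ MidY p := by rw [MidX, e]
  unfold areaWt
  by_cases hX : MidX p
  · by_cases hY : MidY p
    · rw [if_pos ⟨e1.2 hY, hX⟩, if_pos ⟨hX, hY⟩, idx_swap hX hY]
    · rw [if_neg (fun hh => hY (e1.1 hh.1)), if_neg fun hh => hY hh.2]
  · rw [if_neg (fun hh => hX hh.2), if_neg fun hh => hX hh.1]

theorem stepX_swap (p : Surface h v) : stepX (swap h v p) = stepY p := by
  have e : swap v h (swap h v p) = p := (swap h v).left_inv p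
  rw [stepX, e]

theorem mk_area_v (θ : Fin n → ℝ) :
    H2.mk (area (h := h) (v := v) fun i => θ (v i)) = H2.mk (area θ) := by
  rw [← sub_eq_zero, ← map_sub, ← map_sub, ← map_zero H2.mk]
  -- The vertical step comes first in `areaFn`, so here the function multiplies the crossing cocycle
  -- on the left.
  refine mk2_eq_of_local (fun x y => jump θ (swap h v x) * (col (oneInv v)).1 x y) fun p => ?_
  obtain ⟨U, hU, H⟩ := col_eq (oneInv v) p
  obtain ⟨V, hV, K⟩ := mul_jump_sub θ (swap h v p)
  obtain ⟨W, hW, L⟩ := area_eq (fun i => θ (v i) - θ i) p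
  refine ⟨U ∩ (swap h v) ⁻¹' V ∩ W,
    inter_mem (inter_mem hU ((swap h v).continuous.continuousAt hV)) hW, fun x hx y hy z hz => ?_⟩
  change (area _).1 x y z - 0 = _
  rw [H x hx.1.1 y hy.1.1, H y hy.1.1 z hz.1.1, H x hx.1.1 z hz.1.1]
  have h1 := K _ hx.1.2 _ hy.1.2
  rw [areaWt_swap, stepX_swap, stepX_swap] at h1
  have h2 : (area _).1 x y z = _ := L x hx.2 y hy.2 z hz.2
  change colWt _ p * _ = _ at h1
  linear_combination h2 - (stepX z - stepX y) * h1

/-- The class of a single square. -/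
def kap (h v : Equiv.Perm (Fin n)) (i : Fin n) : H2 (Surface h v) :=
  H2.mk (area fun j => if i = j then 1 else 0)

theorem kap_eq (ht : Transitive h v) (i j : Fin n) : kap h v i = kap h v j := by
  refine ht (fun j => kap h v i = kap h v j) ?_ ?_ i j rfl
  · intro k
    have := mk_area_h (h := h) (v := v) (fun j => if h k = j then (1 : ℝ) else 0)
    simp only [EmbeddingLike.apply_eq_iff_eq] at this
    change kap h v k = kap h v (h k) at this
    rw [this]
  · intro k
    have := mk_area_v (h := h) (v := v) (fun j => if v k = j then (1 : ℝ) else 0)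
    simp only [EmbeddingLike.apply_eq_iff_eq] at this
    change kap h v k = kap h v (v k) at this
    rw [this]

theorem mk_area (ht : Transitive h v) (i₀ : Fin n) (θ : Fin n → ℝ) :
    H2.mk (area θ) = (∑ i, θ i) • kap h v i₀ := by
  have := LinearMap.pi_apply_eq_sum_univ (H2.mk ∘ₗ area (h := h) (v := v)) θ
  rw [Finset.sum_smul]
  refine this.trans (Finset.sum_congr rfl fun i _ => ?_)
  rw [← kap_eq ht i i₀]
  rfl

/-- The class with periods `ψ` along horizontal edges and `χ` along vertical ones. -/
def cls (h v : Equiv.Perm (Fin n)) : ↥(invFun h) × ↥(invFun v) →ₗ[ℝ] H1 (Surface h v) :=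
  (H1.mk ∘ₗ row).coprod (H1.mk ∘ₗ col)

/-- Only the mixed products survive, and each point mass represents the same class; so the cup
product becomes a pairing of invariant functions on the squares. -/
theorem cup_cls (ht : Transitive h v) (i₀ : Fin n) (a b : ↥(invFun h) × ↥(invFun v)) :
    cup (cls h v a) (cls h v b) =
      (∑ i, (a.1.1 i * b.2.1 i - b.1.1 i * a.2.1 i)) • kap h v i₀ := by
  change cup (H1.mk (row a.1) + H1.mk (col a.2)) (H1.mk (row b.1) + H1.mk (col b.2)) = _
  rw [map_add, map_add, LinearMap.add_apply, LinearMap.add_apply, cup_row_row, cup_col_col, cup_row_col,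
    cup_anticomm (H1.mk (col a.2)), cup_row_col, mk_area ht i₀, mk_area ht i₀,
    Finset.sum_sub_distrib, sub_smul]
  abel

end Origami

namespace Origami

open Set AlexanderSpanier

variable {n : ℕ} {h v h' v' : Equiv.Perm (Fin n)} {s : ℝ}

/-! ### The area class does not vanish -/

/-- A cochain of degree two with a primitive is the coboundary of the primitive at small scales. -/
theorem exists_uniform {c : Surface h v → Surface h v → Surface h v → ℝ}
    (hc : c ∈ coboundaries2 (Surface h v)) : ∃ u : Surface h v → Surface h v → ℝ, ∀ i : Fin n,
    ∃ δ > 0, ∀ x ∈ unitSq, ∀ y ∈ unitSq, ∀ z ∈ unitSq, dist y x < δ → dist z x < δ →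
      c (pt i x.1 x.2) (pt i y.1 y.2) (pt i z.1 z.2) = u (pt i y.1 y.2) (pt i z.1 z.2) -
        u (pt i x.1 x.2) (pt i z.1 z.2) + u (pt i x.1 x.2) (pt i y.1 y.2) := by
  obtain ⟨u, hu⟩ := hc
  refine ⟨u, fun i => ?_⟩
  choose U hU H using hu
  obtain ⟨δ, hδ, K⟩ := lebesgue_number_lemma_of_metric (s := unitSq)
    (c := fun p : Surface h v => (fun z : ℝ × ℝ => (pt i z.1 z.2 : Surface h v)) ⁻¹' interior (U p))
    (isCompact_Icc.prod isCompact_Icc) (fun p => isOpen_interior.preimage (continuous_pt i))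
    (fun x _ => mem_iUnion.2 ⟨pt i x.1 x.2, mem_interior_iff_mem_nhds.2 (hU _)⟩)
  refine ⟨δ, hδ, fun x hx y hy z hz hxy hxz => ?_⟩
  obtain ⟨p, hp⟩ := K x hx
  exact H p _ (interior_subset (hp (Metric.mem_ball_self hδ))) _ (interior_subset (hp hxy)) _
    (interior_subset (hp hxz))

/-- Discrete Stokes formula: inside each square the sums telescope, and the boundary terms cancel
because `h` and `v` permute the squares. -/
theorem sum_grid_eq_zero (N : ℕ) (A B : Fin n → ℕ → ℕ → ℝ) (hA : ∀ i k, A i k N = A (v i) k 0)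
    (hB : ∀ i l, B i N l = B (h i) 0 l) :
    ∑ i, ∑ k ∈ Finset.range N, ∑ l ∈ Finset.range N,
      ((B i (k + 1) l - B i k l) - (A i k (l + 1) - A i k l)) = 0 := by
  have h1 : ∀ i, ∑ k ∈ Finset.range N, ∑ l ∈ Finset.range N,
      ((B i (k + 1) l - B i k l) - (A i k (l + 1) - A i k l)) =
      ∑ l ∈ Finset.range N, (B (h i) 0 l - B i 0 l) -
        ∑ k ∈ Finset.range N, (A (v i) k 0 - A i k 0) := by
    intro i
    simp only [Finset.sum_sub_distrib (f := fun l => B _ _ l - B _ _ l),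
      Finset.sum_sub_distrib (f := fun k => ∑ l ∈ Finset.range N, (B i (k + 1) l - B i k l))]
    congr 1
    · rw [Finset.sum_comm]
      refine Finset.sum_congr rfl fun l _ => ?_
      rw [Finset.sum_range_sub (fun k => B i k l), hB]
    · refine Finset.sum_congr rfl fun k _ => ?_
      rw [Finset.sum_range_sub (fun l => A i k l), hA]
  simp only [h1]
  simp only [Finset.sum_sub_distrib]
  rw [Equiv.sum_comp h (fun i => ∑ l ∈ Finset.range N, B i 0 l),
    Equiv.sum_comp v (fun i => ∑ k ∈ Finset.range N, A i k 0)]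
  ring

theorem area_apply (θ : Fin n → ℝ) (x y z : Surface h v) :
    (area θ).1 x y z = areaFn θ x y z := rfl

/-- A primitive of the cocycle would be exact on all small triangles of a fine grid. Summed over the
grid, the contributions of the primitive cancel, while the cocycle contributes only at the centre of
the square `i₀`, with absolute value one. -/
theorem kap_ne_zero (i₀ : Fin n) : kap h v i₀ ≠ 0 := by
  intro e
  have e' : H2.mk (area (h := h) (v := v) fun j => if i₀ = j then 1 else 0) = 0 := e
  have e'' : (area (h := h) (v := v) fun j => if i₀ = j then 1 else 0).1 ∈
      coboundaries2 (Surface h v) :=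
    (Submodule.Quotient.mk_eq_zero ((coboundaries2 _).submoduleOf (cocycles2 _))).1 e'
  obtain ⟨u, hu⟩ := exists_uniform e''
  choose δ hδ H using hu
  -- The sum dominates every `1 / δ i`, so that the mesh is below all scales; the extra `2` keeps
  -- the grid cell next to the centre inside the strips.
  obtain ⟨m, hm⟩ := exists_nat_gt (∑ i, 1 / δ i + 2)
  have hsum : 0 ≤ ∑ i, 1 / δ i := Finset.sum_nonneg fun i _ => by have := hδ i; positivity
  have hm2 : (2 : ℝ) < m := by linarith
  -- An even number puts the middle lines on the grid. Since the step functions equal one on them,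
  -- the jump occurs between the indices `m` and `m + 1`.
  let N : ℕ := 2 * (m + 1)
  have hN : (N : ℝ) = 2 * (m + 1) := by simp [N]
  have hN0 : (0 : ℝ) < N := by rw [hN]; linarith
  have hδN : ∀ i, 1 / (N : ℝ) < δ i := by
    intro i
    have h1 : 1 / δ i ≤ ∑ i, 1 / δ i :=
      Finset.single_le_sum (f := fun i => 1 / δ i) (fun i _ => by have := hδ i; positivity)
        (Finset.mem_univ i)
    rw [div_lt_comm₀ hN0 (hδ i), hN]
    linarith
  let Q : Fin n → ℕ → ℕ → Surface h v := fun i k l => pt i (k / N) (l / N)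
  have hI : ∀ {k : ℕ}, k ≤ N → (k / N : ℝ) ∈ Icc (0 : ℝ) 1 := fun hk =>
    ⟨by positivity, by rw [div_le_one hN0]; exact_mod_cast hk⟩
  have hd0 : ∀ k : ℕ, dist ((k : ℝ) / N) (k / N) ≤ 1 / N := fun k => by
    rw [dist_self]; positivity
  have hd1 : ∀ k : ℕ, dist (((k + 1 : ℕ) : ℝ) / N) (k / N) ≤ 1 / N := fun k => by
    rw [Real.dist_eq, ← sub_div]
    push_cast
    rw [add_sub_cancel_left, abs_of_nonneg (by positivity)]
  -- Both triangles of a grid cell share the diagonal; it cancels in the difference and only the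
  -- four sides remain.
  have loc : ∀ i, ∀ k < N, ∀ l < N,
      (area fun j => if i₀ = j then 1 else 0).1 (Q i k l) (Q i (k + 1) l) (Q i (k + 1) (l + 1)) -
      (area fun j => if i₀ = j then 1 else 0).1 (Q i k l) (Q i k (l + 1)) (Q i (k + 1) (l + 1)) =
      (u (Q i (k + 1) l) (Q i (k + 1) (l + 1)) - u (Q i k l) (Q i k (l + 1))) -
        (u (Q i k (l + 1)) (Q i (k + 1) (l + 1)) - u (Q i k l) (Q i (k + 1) l)) := by
    intro i k hk l hl
    have hlt : ∀ {k' l' : ℕ}, dist ((k' : ℝ) / N) (k / N) ≤ 1 / N →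
        dist ((l' : ℝ) / N) (l / N) ≤ 1 / N →
        dist (((k' : ℝ) / N, (l' : ℝ) / N) : ℝ × ℝ) ((k : ℝ) / N, (l : ℝ) / N) < δ i :=
      fun h1 h2 => lt_of_le_of_lt (max_le h1 h2) (hδN i)
    have e1 := H i ((k : ℝ) / N, (l : ℝ) / N) ⟨hI hk.le, hI hl.le⟩
      (((k + 1 : ℕ) : ℝ) / N, (l : ℝ) / N) ⟨hI hk, hI hl.le⟩
      (((k + 1 : ℕ) : ℝ) / N, ((l + 1 : ℕ) : ℝ) / N) ⟨hI hk, hI hl⟩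
      (hlt (hd1 k) (hd0 l)) (hlt (hd1 k) (hd1 l))
    have e2 := H i ((k : ℝ) / N, (l : ℝ) / N) ⟨hI hk.le, hI hl.le⟩
      ((k : ℝ) / N, ((l + 1 : ℕ) : ℝ) / N) ⟨hI hk.le, hI hl⟩
      (((k + 1 : ℕ) : ℝ) / N, ((l + 1 : ℕ) : ℝ) / N) ⟨hI hk, hI hl⟩
      (hlt (hd0 k) (hd1 l)) (hlt (hd1 k) (hd1 l))
    rw [e1, e2]
    ring
  have half : ∀ {k : ℕ}, 1 / 2 ≤ (k / N : ℝ) ↔ m + 1 ≤ k := by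
    intro k
    rw [le_div_iff₀ hN0, hN, ← Nat.cast_le (α := ℝ)]
    push_cast
    constructor <;> intro <;> linarith
  -- In this triangle the first step is horizontal, so the vertical difference vanishes.
  have area1 : ∀ i, ∀ k < N, ∀ l < N,
      (area fun j => if i₀ = j then 1 else 0).1 (Q i k l) (Q i (k + 1) l) (Q i (k + 1) (l + 1)) =
        0 := by
    intro i k hk l hl
    rw [area_apply, areaFn]
    have e1 : stepY (Q i (k + 1) l) = stepY (Q i k l) := by
      rw [stepY, stepY, tY_pt (hI hk) (hI hl.le), tY_pt (hI hk.le) (hI hl.le)]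
    rw [e1, sub_self, zero_mul, mul_zero, ite_self]
  have jumpN : ∀ k : ℕ, ((if m + 1 ≤ k + 1 then 1 else 0) - (if m + 1 ≤ k then 1 else 0) : ℝ) =
      if k = m then 1 else 0 := by
    intro k
    rcases lt_trichotomy k m with h1 | h1 | h1
    · rw [if_neg (by lia), if_neg (by lia), if_neg (by lia), sub_zero]
    · rw [if_pos (by lia), if_neg (by lia), if_pos (by lia), sub_zero]
    · rw [if_pos (by lia), if_pos (by lia), if_neg (by lia), sub_self]
  have area2 : ∀ i, ∀ k < N, ∀ l < N,
      (area fun j => if i₀ = j then 1 else 0).1 (Q i k l) (Q i k (l + 1)) (Q i (k + 1) (l + 1)) =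
        (if i₀ = i then 1 else 0) * ((if l = m then 1 else 0) * (if k = m then 1 else 0)) := by
    intro i k hk l hl
    rw [area_apply]
    have mX : ∀ {k l : ℕ}, k ≤ N → l ≤ N →
        (MidX (Q i k l) ↔ 1 / 4 < (k / N : ℝ) ∧ (k / N : ℝ) < 3 / 4) := fun hk hl =>
      midX_pt (hI hk) (hI hl)
    have mY : ∀ {k l : ℕ}, k ≤ N → l ≤ N →
        (MidY (Q i k l) ↔ 1 / 4 < (l / N : ℝ) ∧ (l / N : ℝ) < 3 / 4) := fun hk hl =>
      midY_pt (hI hk) (hI hl)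
    rw [areaFn, mX hk.le hl, mX hk hl, mY hk.le hl.le, mY hk.le hl]
    have sX : ∀ {k l : ℕ}, k ≤ N → l ≤ N → (k / N : ℝ) < 3 / 4 →
        stepX (Q i k l) = if m + 1 ≤ k then 1 else 0 := fun hk hl h3 => by
      rw [stepX_pt ⟨(hI hk).1, by linarith⟩ (hI hl)]
      simp only [half]
    have sY : ∀ {k l : ℕ}, k ≤ N → l ≤ N → (l / N : ℝ) < 3 / 4 →
        stepY (Q i k l) = if m + 1 ≤ l then 1 else 0 := fun hk hl h3 => by
      rw [stepY_pt (hI hk) ⟨(hI hl).1, by linarith⟩]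
      simp only [half]
    split
    · rename_i hc
      have sI : idx (Q i k (l + 1)) = i := idx_pt_center hc.1 hc.2.2.2
      rw [sI, sX hk.le hl hc.1.2, sX hk hl hc.2.1.2, sY hk.le hl.le hc.2.2.1.2,
        sY hk.le hl hc.2.2.2.2, jumpN, jumpN]
    · rename_i hc
      have hlk : ¬(l = m ∧ k = m) := by
        rintro ⟨rfl, rfl⟩
        apply hc
        have b1 : 1 / 4 < (k / N : ℝ) ∧ (k / N : ℝ) < 3 / 4 := by
          rw [lt_div_iff₀ hN0, div_lt_iff₀ hN0, hN]
          constructor <;> linarith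
        have b2 : 1 / 4 < ((k + 1 : ℕ) / N : ℝ) ∧ ((k + 1 : ℕ) / N : ℝ) < 3 / 4 := by
          rw [lt_div_iff₀ hN0, div_lt_iff₀ hN0, hN]
          push_cast
          constructor <;> linarith
        exact ⟨b1, b2, b1, b2⟩
      rcases not_and_or.1 hlk with h1 | h1 <;> simp [h1]
  have total := sum_grid_eq_zero (h := h) (v := v) N (fun i k l => u (Q i k l) (Q i (k + 1) l))
    (fun i k l => u (Q i k l) (Q i k (l + 1)))
    (by
      intro i k
      simp only [Q, div_self hN0.ne', pt_top, Nat.cast_zero, zero_div])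
    (by
      intro i l
      simp only [Q, div_self hN0.ne', pt_right, Nat.cast_zero, zero_div])
  have hmN : m < N := by lia
  have : ∑ i, ∑ k ∈ Finset.range N, ∑ l ∈ Finset.range N,
      (-((if i₀ = i then 1 else 0) * ((if l = m then 1 else 0) * (if k = m then 1 else 0))) : ℝ) =
        0 := by
    refine Eq.trans ?_ total
    refine Finset.sum_congr rfl fun i _ => Finset.sum_congr rfl fun k hk =>
      Finset.sum_congr rfl fun l hl => ?_
    rw [Finset.mem_range] at hk hl
    rw [← loc i k hk l hl, area1 i k hk l hl, area2 i k hk l hl, zero_sub]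
  simp [hmN] at this

end Origami

/-! ### Classes of the differential -/

namespace TranslationSurface

open AlexanderSpanier

variable {M : TranslationSurface}

theorem IsClassOf.unique {ℓ : ℂ →ₗ[ℝ] ℝ} {ξ η : H1 M.carrier} (hξ : M.IsClassOf ℓ ξ)
    (hη : M.IsClassOf ℓ η) : ξ = η := by
  obtain ⟨c, rfl, hc⟩ := hξ
  obtain ⟨d, rfl, hd⟩ := hη
  refine Origami.mk1_eq_of_local fun p => ?_
  obtain ⟨U, hU, H⟩ := hc p
  obtain ⟨V, hV, K⟩ := hd p
  exact ⟨U ∩ V, inter_mem hU hV, fun x hx y hy => (H x hx.1 y hy.1).trans (K x hx.2 y hy.2).symm⟩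

theorem IsClassOf.comb {ℓ ℓ' : ℂ →ₗ[ℝ] ℝ} {ξ η : H1 M.carrier} (hξ : M.IsClassOf ℓ ξ)
    (hη : M.IsClassOf ℓ' η) (a b : ℝ) : M.IsClassOf (a • ℓ + b • ℓ') (a • ξ + b • η) := by
  obtain ⟨c, rfl, hc⟩ := hξ
  obtain ⟨d, rfl, hd⟩ := hη
  refine ⟨a • c + b • d, by simp only [map_add, map_smul], fun p => ?_⟩
  obtain ⟨U, hU, H⟩ := hc p
  obtain ⟨V, hV, K⟩ := hd p
  refine ⟨U ∩ V, inter_mem hU hV, fun x hx y hy => ?_⟩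
  change a * c.1 x y + b * d.1 x y = a * ℓ _ + b * ℓ' _
  rw [H x hx.1 y hy.1, K x hx.2 y hy.2]

theorem IsClassOf.pullback {ℓ : ℂ →ₗ[ℝ] ℝ} {ξ : H1 M.carrier} (hξ : M.IsClassOf ℓ ξ)
    {f : M.carrier ≃ₜ M.carrier} {D : ℂ →ₗ[ℝ] ℂ} (hf : M.IsAffineWith f D) :
    M.IsClassOf (ℓ ∘ₗ D) (AlexanderSpanier.pullback (f : C(M.carrier, M.carrier)) ξ) := by
  obtain ⟨c, rfl, hc⟩ := hξ
  refine ⟨pullbackCocycle (f : C(M.carrier, M.carrier)) c, rfl, fun p => ?_⟩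
  obtain ⟨U, hU, H⟩ := hc (f p)
  refine ⟨_, inter_mem (f.continuous.continuousAt hU) (hf.2 p), fun x hx y hy => ?_⟩
  have hx2 : M.primitive (f p) (f x) = D (M.primitive p x) := hx.2
  have hy2 : M.primitive (f p) (f y) = D (M.primitive p y) := hy.2
  change c.1 (f x) (f y) = ℓ (D _)
  rw [H _ hx.1 _ hy.1, hx2, hy2, map_sub D]

/-- The classes of `Re ω` and `Im ω`, together with a generator of the line of cup products. -/
structure Periods (M : TranslationSurface) where
  re : H1 M.carrier
  im : H1 M.carrier
  kappa : H2 M.carrier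
  area : ℝ
  isClassOf_re : M.IsClassOf Complex.reLm re
  isClassOf_im : M.IsClassOf Complex.imLm im
  kappa_ne_zero : kappa ≠ 0
  area_ne_zero : area ≠ 0
  cup_re_im : cup re im = area • kappa
  exists_cup : ∀ ξ η : H1 M.carrier, ∃ a : ℝ, cup ξ η = a • kappa

namespace Periods

theorem tautologicalPlane_eq (P : Periods M) : M.tautologicalPlane = Submodule.span ℝ {P.re, P.im} := by
  rw [tautologicalPlane]
  congr 1
  ext ξ
  simp only [Set.mem_ofPred_eq, Set.mem_insert_iff, Set.mem_singleton_iff]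
  constructor
  · rintro (h | h)
    · exact Or.inl (h.unique P.isClassOf_re)
    · exact Or.inr (h.unique P.isClassOf_im)
  · rintro (rfl | rfl)
    · exact Or.inl P.isClassOf_re
    · exact Or.inr P.isClassOf_im

theorem mem_H1perp (P : Periods M) {ξ : H1 M.carrier} : ξ ∈ M.H1perp ↔ cup ξ P.re = 0 ∧ cup ξ P.im = 0 := by
  change (∀ η ∈ M.tautologicalPlane, cup ξ η = 0) ↔ _
  rw [P.tautologicalPlane_eq]
  constructor
  · intro H
    exact ⟨H _ (Submodule.subset_span (by simp)), H _ (Submodule.subset_span (by simp))⟩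
  · rintro ⟨h1, h2⟩ η hη
    have : Submodule.span ℝ {P.re, P.im} ≤ LinearMap.ker (cup ξ) := by
      rw [Submodule.span_le]
      rintro _ (rfl | rfl)
      · exact h1
      · exact h2
    exact this hη

/-- The pullback of the class of `ℓ ∘ ω` is the class of `ℓ ∘ D ∘ ω`, and `ℓ ∘ D` is a combination
of real and imaginary part. -/
theorem pullback_re_im (P : Periods M) {f : M.carrier ≃ₜ M.carrier} {D : ℂ →ₗ[ℝ] ℂ} (hf : M.IsAffineWith f D) :
    pullback (f : C(M.carrier, M.carrier)) P.re = (D 1).re • P.re + (D Complex.I).re • P.im ∧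
    pullback (f : C(M.carrier, M.carrier)) P.im = (D 1).im • P.re + (D Complex.I).im • P.im := by
  have hD : ∀ z : ℂ, D z = z.re • D 1 + z.im • D Complex.I := by
    intro z
    rw [← map_smul, ← map_smul, ← map_add]
    congr 1
    apply Complex.ext <;> simp
  constructor
  · refine (P.isClassOf_re.pullback hf).unique ?_
    convert P.isClassOf_re.comb P.isClassOf_im (D 1).re (D Complex.I).re using 1
    ext z
    change (D z).re = (D 1).re * z.re + (D Complex.I).re * z.im
    rw [hD z]
    simp
    ring
  · refine (P.isClassOf_im.pullback hf).unique ?_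
    convert P.isClassOf_re.comb P.isClassOf_im (D 1).im (D Complex.I).im using 1
    ext z
    change (D z).im = (D 1).im * z.re + (D Complex.I).im * z.im
    rw [hD z]
    simp
    ring

theorem det_eq (D : ℂ →ₗ[ℝ] ℂ) :
    LinearMap.det D = (D 1).re * (D Complex.I).im - (D Complex.I).re * (D 1).im := by
  rw [← LinearMap.det_toMatrix Complex.basisOneI, Matrix.det_fin_two]
  simp [LinearMap.toMatrix_apply]

/-- Affine maps preserve cup products. -/
theorem cup_pullback (P : Periods M) {f : M.carrier ≃ₜ M.carrier} (hf : f ∈ M.affineGroup) (ξ η : H1 M.carrier) :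
    cup (pullback (f : C(M.carrier, M.carrier)) ξ) (pullback (f : C(M.carrier, M.carrier)) η) =
      cup ξ η := by
  obtain ⟨D, hdet, hD⟩ := hf
  obtain ⟨h1, h2⟩ := P.pullback_re_im hD
  -- The product `Re ω ∪ Im ω` is multiplied by the determinant of `D`, which is one. As it spans
  -- the line of cup products, this fixes the action on all of them.
  have key : cup (pullback (f : C(M.carrier, M.carrier)) P.re)
      (pullback (f : C(M.carrier, M.carrier)) P.im) = cup P.re P.im := by
    have hzero : ∀ ζ : H1 M.carrier, cup ζ ζ = 0 := by
      intro ζ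
      have h3 : (2 : ℝ) • cup ζ ζ = 0 := by
        rw [two_smul]
        nth_rewrite 2 [Origami.cup_anticomm]
        exact add_neg_cancel _
      exact (smul_eq_zero.1 h3).resolve_left two_ne_zero
    rw [h1, h2]
    simp only [map_add, map_smul, LinearMap.add_apply, LinearMap.smul_apply, hzero,
      Origami.cup_anticomm P.im P.re, smul_zero, zero_add, add_zero, smul_neg, smul_smul]
    rw [← neg_smul, ← add_smul]
    rw [det_eq] at hdet
    convert one_smul ℝ _ using 2
    linarith
  obtain ⟨a, ha⟩ := P.exists_cup ξ η
  have e : cup ξ η = (a / P.area) • cup P.re P.im := by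
    rw [P.cup_re_im, smul_smul, div_mul_cancel₀ _ P.area_ne_zero, ha]
  rw [Origami.cup_pullback _ e, key, e]

/-- Affine maps preserve `H¹_⊥`. -/
theorem pullback_mem_H1perp (P : Periods M) {f : M.carrier ≃ₜ M.carrier} (hf : f ∈ M.affineGroup)
    {ξ : H1 M.carrier} (hξ : ξ ∈ M.H1perp) :
    pullback (f : C(M.carrier, M.carrier)) ξ ∈ M.H1perp := by
  have hf' := hf
  obtain ⟨D, hdet, hD⟩ := hf'
  obtain ⟨h1, h2⟩ := P.pullback_re_im hD
  obtain ⟨e1, e2⟩ := P.mem_H1perp.1 hξ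
  have k1 := P.cup_pullback hf ξ P.re
  have k2 := P.cup_pullback hf ξ P.im
  rw [h1, e1, map_add, map_smul, map_smul] at k1
  rw [h2, e2, map_add, map_smul, map_smul] at k2
  rw [det_eq] at hdet
  set A := cup (pullback (f : C(M.carrier, M.carrier)) ξ) P.re
  set B := cup (pullback (f : C(M.carrier, M.carrier)) ξ) P.im
  refine P.mem_H1perp.2 ⟨?_, ?_⟩
  -- Cramer's rule: the vanishing products with the pullbacks of `Re ω` and `Im ω` are solved for
  -- those with `Re ω` and `Im ω`.
  · have : ((D 1).re * (D Complex.I).im - (D Complex.I).re * (D 1).im) • A = 0 := by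
      calc _ = (D Complex.I).im • ((D 1).re • A + (D Complex.I).re • B) -
            (D Complex.I).re • ((D 1).im • A + (D Complex.I).im • B) := by module
        _ = 0 := by rw [k1, k2]; simp
    rwa [hdet, one_smul] at this
  · have : ((D 1).re * (D Complex.I).im - (D Complex.I).re * (D 1).im) • B = 0 := by
      calc _ = (D 1).re • ((D 1).im • A + (D Complex.I).im • B) -
            (D 1).im • ((D 1).re • A + (D Complex.I).re • B) := by module
        _ = 0 := by rw [k1, k2]; simp
    rwa [hdet, one_smul] at this

/-- Every affine map has a restriction to `H¹_⊥`. -/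
theorem exists_gammaPerp (P : Periods M) {f : M.carrier ≃ₜ M.carrier} (hf : f ∈ M.affineGroup) :
    ∃ g ∈ M.gammaPerp, ∀ ξ : ↥M.H1perp,
      (g ξ : H1 M.carrier) = pullback (f : C(M.carrier, M.carrier)) ξ :=
  ⟨(pullback (f : C(M.carrier, M.carrier))).restrict fun _ hξ => P.pullback_mem_H1perp hf hξ,
    ⟨f, hf, fun _ => rfl⟩, fun _ => rfl⟩

end Periods

end TranslationSurface

namespace Origami

open Set AlexanderSpanier

variable {n : ℕ} {h v h' v' : Equiv.Perm (Fin n)} {s : ℝ}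

/-! ### The periods of the differential -/

/-- The representative of a number modulo one of least absolute value. -/
def wrap (t : ℝ) : ℝ := t - round t

theorem wrap_eq {t u : ℝ} (m : ℤ) (e : t = u + m) (hu : |u| < 1 / 2) : wrap t = u := by
  rw [abs_lt] at hu
  have : round u = 0 := round_eq_zero_iff.2 ⟨by linarith, by linarith⟩
  rw [wrap, e, round_add_intCast, this]
  push_cast
  ring

/-- The cochain `(x, y) ↦ ℓ (∫_x^y ω)`. -/
def formFn (s : ℝ) (ℓ : ℂ →ₗ[ℝ] ℝ) (x y : Surface h v) : ℝ :=
  ℓ (s * ((wrap (tX y - tX x) : ℝ) + (wrap (tY y - tY x) : ℝ) * Complex.I))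

/-- Near `p` the coordinates differ from those of `p` by less than `1 / 4`, up to integers, so
differences of coordinates are below `1 / 2` and `wrap` recovers them. -/
theorem formFn_eq (hs : 0 < s) (ℓ : ℂ →ₗ[ℝ] ℝ) (p : Surface h v) : ∃ U ∈ 𝓝 p, ∀ x ∈ U, ∀ y ∈ U,
    formFn s ℓ x y = ℓ (prim hs p y - prim hs p x) := by
  have key : ∀ᶠ q in 𝓝 p, ∃ a b : ℝ, |a| < 1 / 4 ∧ |b| < 1 / 4 ∧
      prim hs p q = s * ((a : ℝ) + (b : ℝ) * Complex.I) ∧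
      (∃ m : ℤ, tX q = tX p + a + m) ∧ ∃ m : ℤ, tY q = tY p + b + m := by
    refine eventually_nhds ?_
    rintro j a ha b hb rfl
    filter_upwards [prim_pt (h := h) (v := v) hs (j := j) ha hb,
      Metric.ball_mem_nhds (a, b) (by norm_num : (0 : ℝ) < 1 / 4)] with z hz hz2 hz'
    rw [Metric.mem_ball, Prod.dist_eq, max_lt_iff, Real.dist_eq, Real.dist_eq] at hz2
    refine ⟨z.1 - a, z.2 - b, hz2.1, hz2.2, hz hz', ⟨⌊a⌋ - ⌊z.1⌋, ?_⟩, ⟨⌊b⌋ - ⌊z.2⌋, ?_⟩⟩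
    · rw [tX_pt hz'.1 hz'.2, tX_pt ha hb, Int.fract, Int.fract]
      push_cast
      ring
    · rw [tY_pt hz'.1 hz'.2, tY_pt ha hb, Int.fract, Int.fract]
      push_cast
      ring
  refine ⟨_, key, fun x hx y hy => ?_⟩
  obtain ⟨a, b, ha, hb, e, ⟨m, hm⟩, m', hm'⟩ := hx
  obtain ⟨c, d, hc, hd, e', ⟨k, hk⟩, k', hk'⟩ := hy
  rw [abs_lt] at ha hb hc hd
  rw [formFn, wrap_eq (u := c - a) (k - m) (by push_cast; linarith) (by rw [abs_lt]; constructor <;> linarith),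
    wrap_eq (u := d - b) (k' - m') (by push_cast; linarith) (by rw [abs_lt]; constructor <;> linarith),
    e, e']
  congr 1
  push_cast
  ring

/-- The cocycle `(x, y) ↦ ℓ (∫_x^y ω)`. -/
def form (hs : 0 < s) (ℓ : ℂ →ₗ[ℝ] ℝ) : ↥(cocycles1 (Surface h v)) :=
  ⟨formFn s ℓ, mem_cocycles1_of_local fun p => by
    obtain ⟨U, hU, H⟩ := formFn_eq hs ℓ p
    exact ⟨U, hU, fun x => ℓ (prim hs p x), fun x hx y hy => by rw [H x hx y hy, map_sub]⟩⟩

theorem isPotential_form (hs : 0 < s) (ℓ : ℂ →ₗ[ℝ] ℝ) (i : Fin n) :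
    IsPotential unitSq (fun z w => (form (h := h) (v := v) hs ℓ).1 (pt i z.1 z.2) (pt i w.1 w.2))
      (fun z => ℓ (s * (z.1 + z.2 * Complex.I))) := by
  rintro ⟨a, b⟩ ⟨ha, hb⟩
  obtain ⟨U, hU, H⟩ := formFn_eq hs ℓ (pt i a b : Surface h v)
  refine ⟨_, inter_mem ((continuous_pt i).continuousAt hU) (prim_pt (h := h) (v := v) hs (j := i) ha hb),
    fun x hx y hy => ?_⟩
  change formFn s ℓ _ _ = _
  have hx2 := hx.1.2 hx.2
  have hy2 := hy.1.2 hy.2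
  rw [H _ hx.1.1 _ hy.1.1, hx2, hy2, ← map_sub]
  congr 1
  push_cast
  ring

theorem per_form (hs : 0 < s) (ℓ : ℂ →ₗ[ℝ] ℝ) :
    per (form (h := h) (v := v) hs ℓ) = (fun _ => ℓ s, fun _ => ℓ (s * Complex.I)) := by
  refine Prod.ext (funext fun i => ?_) (funext fun i => ?_)
  · refine (px_eq_of_isPotential (isPotential_form hs ℓ i)).trans ?_
    simp
  · refine (py_eq_of_isPotential (isPotential_form hs ℓ i)).trans ?_
    simp

/-- The form has constant periods along horizontal and along vertical edges, like the crossing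
cocycles with constant weights. -/
theorem mk_form (hs : 0 < s) (ℓ : ℂ →ₗ[ℝ] ℝ) : H1.mk (form (h := h) (v := v) hs ℓ) =
    cls h v (ℓ (s * Complex.I) • oneInv h, ℓ s • oneInv v) := by
  change _ = H1.mk (row _) + H1.mk (col _)
  rw [← map_add]
  refine mk_eq_mk ⟨0, ?_⟩
  rw [per_form, map_add, per_row, per_col]
  simp [oneInv]

theorem isClassOf_form (hs : 0 < s) (ht : Transitive h v) (i₀ : Fin n) (ℓ : ℂ →ₗ[ℝ] ℝ)
    {a b : ℝ} (ha : ℓ (s * Complex.I) = a) (hb : ℓ s = b) :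
    (surf hs ht i₀).IsClassOf ℓ (cls h v (a • oneInv h, b • oneInv v)) := by
  subst ha hb
  refine ⟨form (h := h) (v := v) hs ℓ, mk_form hs ℓ, fun p => ?_⟩
  obtain ⟨U, hU, H⟩ := formFn_eq hs ℓ p
  refine ⟨U, hU, fun x hx y hy => (H x hx y hy).trans ?_⟩
  exact congrArg₂ (fun a b => ℓ (a - b)) (surf_primitive hs ht i₀ p y).symm
    (surf_primitive hs ht i₀ p x).symm

/-- Every system of periods is a combination of crossing cocycles, up to functions on the
vertices. -/
def Spans (h v : Equiv.Perm (Fin n)) : Prop :=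
  ∀ x y : Fin n → ℝ, (∀ i, x i + y (h i) = y i + x (v i)) →
    ∃ χ ∈ invFun h, ∃ ψ ∈ invFun v, IsVertexCob h v (x - ψ, y - χ)

theorem exists_cls (hsp : Spans h v) (ξ : H1 (Surface h v)) : ∃ a, cls h v a = ξ := by
  obtain ⟨f, rfl⟩ := Submodule.Quotient.mk_surjective _ ξ
  obtain ⟨χ, hχ, ψ, hψ, hc⟩ := hsp (px f) (py f) (px_add_py f)
  refine ⟨(⟨χ, hχ⟩, ⟨ψ, hψ⟩), Eq.symm ?_⟩
  change H1.mk f = H1.mk (row _) + H1.mk (col _)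
  rw [← map_add]
  refine mk_eq_mk ?_
  rw [map_add, per_row, per_col]
  convert hc using 1
  refine Prod.ext ?_ ?_
  · change px f - (0 + ψ) = _
    rw [zero_add]
  · change py f - (χ + 0) = _
    rw [add_zero]

/-- The period data of a square-tiled surface. -/
def periods (hs : 0 < s) (ht : Transitive h v) (i₀ : Fin n) (hsp : Spans h v) :
    (surf hs ht i₀).Periods where
  re := cls h v ((0 : ℝ) • oneInv h, s • oneInv v)
  im := cls h v (s • oneInv h, (0 : ℝ) • oneInv v)
  kappa := kap h v i₀
  area := -(n * s ^ 2)
  isClassOf_re := by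
    exact isClassOf_form hs ht i₀ Complex.reLm (by simp) (by simp)
  isClassOf_im := by
    exact isClassOf_form hs ht i₀ Complex.imLm (by simp) (by simp)
  kappa_ne_zero := kap_ne_zero i₀
  area_ne_zero := by
    have : (n : ℝ) ≠ 0 := by
      have := i₀.pos
      positivity
    have := hs.ne'
    simp [*]
  cup_re_im := by
    refine (cup_cls ht i₀ _ _).trans ?_
    congr 1
    simp [oneInv, sq]
  exists_cup := by
    intro ξ η
    obtain ⟨a, rfl⟩ := exists_cls hsp ξ
    obtain ⟨b, rfl⟩ := exists_cls hsp η
    exact ⟨_, cup_cls ht i₀ a b⟩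

end Origami

/-! ### Zariski closures of groups generated by transvections -/

namespace ZariskiSp4

open Matrix

section Closure

variable {ι : Type} {S : Set (Matrix ι ι ℝ)}

theorem subset_zariskiClosure : S ⊆ zariskiClosure S := fun _ hA _ hP => hP _ hA

/-- Polynomial maps carry Zariski closures into Zariski closures. -/
theorem mem_zariskiClosure_of_polynomial {T : Set (Matrix ι ι ℝ)} {A : Matrix ι ι ℝ}
    (hA : A ∈ zariskiClosure S) (φ : Matrix ι ι ℝ → Matrix ι ι ℝ)
    (Q : ι × ι → MvPolynomial (ι × ι) ℝ)
    (hQ : ∀ B : Matrix ι ι ℝ, ∀ e, MvPolynomial.eval (fun e => B e.1 e.2) (Q e) = φ B e.1 e.2)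
    (hS : ∀ B ∈ S, φ B ∈ zariskiClosure T) : φ A ∈ zariskiClosure T := by
  intro P hP
  have key : ∀ B : Matrix ι ι ℝ, MvPolynomial.eval (fun e => B e.1 e.2) (MvPolynomial.bind₁ Q P) =
      MvPolynomial.eval (fun e => φ B e.1 e.2) P := by
    intro B
    rw [← MvPolynomial.coe_aeval_eq_eval, RingHom.coe_coe, MvPolynomial.aeval_bind₁,
      ← MvPolynomial.coe_aeval_eq_eval, RingHom.coe_coe]
    congr 2
    funext e
    rw [← hQ, ← MvPolynomial.coe_aeval_eq_eval, RingHom.coe_coe]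
  rw [← key]
  exact hA _ fun B hB => by rw [key]; exact hS B hB P hP

/-- Multiplication by a fixed matrix is polynomial. It is applied on the right by members of `S` and
afterwards on the left by members of the closure. -/
theorem mul_mem_zariskiClosure [Fintype ι] (hS : ∀ A ∈ S, ∀ B ∈ S, A * B ∈ S)
    {A B : Matrix ι ι ℝ} (hA : A ∈ zariskiClosure S) (hB : B ∈ zariskiClosure S) :
    A * B ∈ zariskiClosure S := by
  have right : ∀ B ∈ S, A * B ∈ zariskiClosure S := by
    intro B hB
    refine mem_zariskiClosure_of_polynomial hA (fun A => A * B)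
      (fun e => ∑ k, MvPolynomial.X (e.1, k) * MvPolynomial.C (B k e.2)) ?_
      fun C hC => subset_zariskiClosure (hS C hC B hB)
    intro C e
    simp [Matrix.mul_apply]
  refine mem_zariskiClosure_of_polynomial hB (fun B => A * B)
    (fun e => ∑ k, MvPolynomial.C (A e.1 k) * MvPolynomial.X (k, e.2)) ?_ right
  intro C e
  simp [Matrix.mul_apply]

/-- A line meeting a set in infinitely many points lies in its Zariski closure. -/
theorem line_mem_zariskiClosure (A N : Matrix ι ι ℝ) {c : ℝ} (hc : c ≠ 0)
    (h : ∀ k : ℕ, A + ((k + 1) * c) • N ∈ zariskiClosure S) (t : ℝ) :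
    A + t • N ∈ zariskiClosure S := by
  intro P hP
  -- The restriction of `P` to the line is a polynomial in one variable with infinitely many zeros.
  let q : Polynomial ℝ := MvPolynomial.aeval
    (fun e : ι × ι => Polynomial.C (A e.1 e.2) + Polynomial.X * Polynomial.C (N e.1 e.2)) P
  have hq : ∀ r : ℝ, q.eval r = MvPolynomial.eval (fun e => (A + r • N) e.1 e.2) P := by
    intro r
    have h1 := MvPolynomial.map_aeval (fun e : ι × ι => Polynomial.C (A e.1 e.2) +
      Polynomial.X * Polynomial.C (N e.1 e.2)) (Polynomial.evalRingHom r) P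
    change q.eval r = _ at h1
    rw [h1]
    have h2 : (Polynomial.evalRingHom r).comp (algebraMap ℝ (Polynomial ℝ)) = RingHom.id ℝ := by
      ext x
      simp
    rw [h2]
    simp only [map_add, map_mul, Polynomial.coe_evalRingHom, Polynomial.eval_C, Polynomial.eval_X]
    rfl
  rw [← hq]
  have : q = 0 := by
    refine Polynomial.eq_zero_of_infinite_isRoot q ?_
    refine Set.Infinite.mono (s := Set.range fun k : ℕ => ((k : ℝ) + 1) * c) ?_ ?_
    · rintro _ ⟨k, rfl⟩
      change q.eval _ = 0
      rw [hq]
      exact h k P hP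
    · refine Set.infinite_range_of_injective fun k l hkl => ?_
      have := mul_right_cancel₀ hc hkl
      exact_mod_cast add_right_cancel this
  rw [this, Polynomial.eval_zero]

end Closure

/-- Vectors of the symplectic space. -/
abbrev Vec : Type := Fin 2 ⊕ Fin 2 → ℝ

/-- The vector with given coordinates. -/
def vec (a b c d : ℝ) : Vec := Sum.elim ![a, b] ![c, d]

theorem vec_eta (x : Vec) :
    x = vec (x (Sum.inl 0)) (x (Sum.inl 1)) (x (Sum.inr 0)) (x (Sum.inr 1)) := by
  funext i
  rcases i with i | i <;> fin_cases i <;> rfl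

theorem vec_ext {x y : Vec} (h0 : x (Sum.inl 0) = y (Sum.inl 0)) (h1 : x (Sum.inl 1) = y (Sum.inl 1))
    (h2 : x (Sum.inr 0) = y (Sum.inr 0)) (h3 : x (Sum.inr 1) = y (Sum.inr 1)) : x = y := by
  rw [vec_eta x, vec_eta y, h0, h1, h2, h3]

/-- The symplectic form. -/
def om (x y : Vec) : ℝ :=
  x (Sum.inl 0) * y (Sum.inr 0) - x (Sum.inr 0) * y (Sum.inl 0) +
    (x (Sum.inl 1) * y (Sum.inr 1) - x (Sum.inr 1) * y (Sum.inl 1))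

theorem om_vec (a b c d a' b' c' d' : ℝ) :
    om (vec a b c d) (vec a' b' c' d') = a * c' - c * a' + (b * d' - d * b') := rfl

theorem om_add_left (x y z : Vec) : om (x + y) z = om x z + om y z := by
  simp only [om, Pi.add_apply]
  ring

theorem om_add_right (x y z : Vec) : om x (y + z) = om x y + om x z := by
  simp only [om, Pi.add_apply]
  ring

theorem om_smul_left (c : ℝ) (x y : Vec) : om (c • x) y = c * om x y := by
  simp only [om, Pi.smul_apply, smul_eq_mul]
  ring

theorem om_smul_right (c : ℝ) (x y : Vec) : om x (c • y) = c * om x y := by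
  simp only [om, Pi.smul_apply, smul_eq_mul]
  ring

theorem om_sub_left (x y z : Vec) : om (x - y) z = om x z - om y z := by
  simp only [om, Pi.sub_apply]
  ring

theorem om_self (x : Vec) : om x x = 0 := by
  simp only [om]
  ring

theorem om_swap (x y : Vec) : om x y = -om y x := by
  simp only [om]
  ring

theorem exists_om_ne_zero {x : Vec} (hx : x ≠ 0) : ∃ z, om x z ≠ 0 := by
  by_contra! H
  apply hx
  have h0 := H (vec 1 0 0 0)
  have h1 := H (vec 0 1 0 0)
  have h2 := H (vec 0 0 1 0)
  have h3 := H (vec 0 0 0 1)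
  simp [om, vec] at h0 h1 h2 h3
  exact vec_ext h2 h3 h0 h1

/-- The sign comes from the convention for `Matrix.J`, whose upper right block is `-1`. -/
theorem om_eq (x y : Vec) : om x y = -(x ⬝ᵥ (J (Fin 2) ℝ *ᵥ y)) := by
  simp [om, J, dotProduct, mulVec, Fintype.sum_sum_type, Fin.sum_univ_two, Matrix.one_apply]
  ring

/-- The coefficients of the linear form `om v`. -/
def dual (v : Vec) : Vec :=
  vec (-v (Sum.inr 0)) (-v (Sum.inr 1)) (v (Sum.inl 0)) (v (Sum.inl 1))

theorem dual_dotProduct (v x : Vec) : dual v ⬝ᵥ x = om v x := by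
  simp [dual, vec, om, dotProduct, Fintype.sum_sum_type, Fin.sum_univ_two]
  ring

/-- The symplectic transvection `x ↦ x + t om(v, x) v`. -/
def tv (v : Vec) (t : ℝ) : Matrix (Fin 2 ⊕ Fin 2) (Fin 2 ⊕ Fin 2) ℝ :=
  1 + t • vecMulVec v (dual v)

theorem tv_mulVec (v : Vec) (t : ℝ) (x : Vec) : tv v t *ᵥ x = x + (t * om v x) • v := by
  rw [tv, add_mulVec, one_mulVec, smul_mulVec, vecMulVec_mulVec, dual_dotProduct]
  simp [mul_smul]

theorem ext_mulVec {A B : Matrix (Fin 2 ⊕ Fin 2) (Fin 2 ⊕ Fin 2) ℝ}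
    (H : ∀ x : Vec, A *ᵥ x = B *ᵥ x) : A = B :=
  Matrix.toLin'.injective (LinearMap.ext H)

theorem om_tv (v : Vec) (t : ℝ) (x y : Vec) : om (tv v t *ᵥ x) (tv v t *ᵥ y) = om x y := by
  rw [tv_mulVec, tv_mulVec, om_add_left, om_add_right, om_add_right, om_smul_left, om_smul_left,
    om_smul_right, om_smul_right, om_self, om_swap x v]
  ring

theorem tv_mul_tv (v : Vec) (s t : ℝ) : tv v s * tv v t = tv v (s + t) := by
  refine ext_mulVec fun x => ?_
  rw [← mulVec_mulVec, tv_mulVec, tv_mulVec, tv_mulVec, om_add_right, om_smul_right, om_self]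
  module

theorem tv_smul (c : ℝ) (v : Vec) (t : ℝ) : tv (c • v) t = tv v (c ^ 2 * t) := by
  refine ext_mulVec fun x => ?_
  rw [tv_mulVec, tv_mulVec, om_smul_left]
  module

/-- Conjugating a transvection by an isometry moves its direction: the vector on the left is the
image of `v` under `tv w s`. -/
theorem tv_conj (w v : Vec) (s t : ℝ) :
    tv (v + (s * om w v) • w) t = tv w s * tv v t * tv w (-s) := by
  refine ext_mulVec fun x => ?_
  rw [← mulVec_mulVec, ← mulVec_mulVec, tv_mulVec, tv_mulVec, tv_mulVec, tv_mulVec]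
  simp only [om_add_left, om_add_right, om_smul_left, om_smul_right, om_self, om_swap v w]
  module

/-! #### Sets of vectors closed under transvections -/

/-- A cone which is stable under the transvections along its members contains all nonzero vectors,
provided it contains certain four vectors. -/
theorem mem_of_transvection_closed {V : Set Vec} (hs : ∀ x ∈ V, ∀ c : ℝ, c ≠ 0 → c • x ∈ V)
    (ha : ∀ x ∈ V, ∀ y ∈ V, om x y ≠ 0 → ∀ t : ℝ, x + t • y ∈ V)
    (h1 : vec 1 0 0 0 ∈ V) (h2 : vec 0 0 1 0 ∈ V) {p q r p' q' r' : ℝ}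
    (h3 : vec p r q 0 ∈ V) (h4 : vec p' 0 q' r' ∈ V) (hr : r ≠ 0) (hr' : r' ≠ 0)
    (hpq : p ^ 2 + q ^ 2 ≠ 0) (hpq' : p' ^ 2 + q' ^ 2 ≠ 0) {x : Vec} (hx : x ≠ 0) : x ∈ V := by
  have hadd : ∀ x ∈ V, ∀ y ∈ V, om x y ≠ 0 → x + y ∈ V := fun x hx y hy hxy => by
    simpa using ha x hx y hy hxy 1
  -- The first two vectors pair non-trivially, so the whole punctured plane they span belongs to
  -- `V`.
  have plane : ∀ a c : ℝ, a ^ 2 + c ^ 2 ≠ 0 → vec a 0 c 0 ∈ V := by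
    intro a c hac
    by_cases h0 : a = 0
    · have hc : c ≠ 0 := by
        rintro rfl
        simp [h0] at hac
      have := hs _ h2 c hc
      convert this using 1
      apply vec_ext <;> simp [vec, h0]
    · have := hs _ (ha _ h1 _ h2 (by simp [om_vec]) (c / a)) a h0
      convert this using 1
      apply vec_ext <;> simp [vec]
      field_simp
  -- With fixed components `α`, `β`, the component in this plane can be changed to any non-zero one,
  -- by adding vectors of the plane.
  have move : ∀ α β : ℝ, ∀ p q : ℝ, vec p α q β ∈ V → p ^ 2 + q ^ 2 ≠ 0 → ∀ a c : ℝ,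
      a ^ 2 + c ^ 2 ≠ 0 → vec a α c β ∈ V := by
    intro α β
    have step : ∀ p q : ℝ, vec p α q β ∈ V → ∀ a c : ℝ, p * c - q * a ≠ 0 → vec a α c β ∈ V := by
      intro p q hpq a c hne
      have hne' : (a - p) ^ 2 + (c - q) ^ 2 ≠ 0 := by
        intro h0
        have e1 : a - p = 0 := by nlinarith [sq_nonneg (a - p), sq_nonneg (c - q)]
        have e2 : c - q = 0 := by nlinarith [sq_nonneg (a - p), sq_nonneg (c - q)]
        apply hne
        rw [sub_eq_zero.1 e1, sub_eq_zero.1 e2]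
        ring
      have := hadd _ hpq _ (plane _ _ hne') (by
        rw [om_vec]
        intro h0
        apply hne
        linarith)
      convert this using 1
      apply vec_ext <;> simp [vec]
    intro p q hV hpq a c hac
    by_cases hd : p * c - q * a = 0
    · refine step (-q) p (step p q hV (-q) p ?_) a c ?_
      · intro h0
        apply hpq
        linarith
      · intro h0
        have : (p ^ 2 + q ^ 2) * (a ^ 2 + c ^ 2) = 0 := by
          linear_combination (p * c - q * a) * hd - (p * a + q * c) * h0
        exact (mul_ne_zero hpq hac) this
    · exact step p q hV a c hd
  have plane1 : ∀ a c α : ℝ, a ^ 2 + c ^ 2 ≠ 0 → vec a α c 0 ∈ V := by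
    intro a c α hac
    by_cases h0 : α = 0
    · rw [h0]
      exact plane a c hac
    · have hne : α / r ≠ 0 := div_ne_zero h0 hr
      have := hs _ h3 (α / r) hne
      refine move α 0 (α / r * p) (α / r * q) ?_ ?_ a c hac
      · convert this using 1
        apply vec_ext <;> simp [vec]
        field_simp
      · rw [mul_pow, mul_pow, ← mul_add]
        exact mul_ne_zero (pow_ne_zero _ hne) hpq
  have plane2 : ∀ a c β : ℝ, a ^ 2 + c ^ 2 ≠ 0 → vec a 0 c β ∈ V := by
    intro a c β hac
    by_cases h0 : β = 0
    · rw [h0]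
      exact plane a c hac
    · have hne : β / r' ≠ 0 := div_ne_zero h0 hr'
      have := hs _ h4 (β / r') hne
      refine move 0 β (β / r' * p') (β / r' * q') ?_ ?_ a c hac
      · convert this using 1
        apply vec_ext <;> simp [vec]
        field_simp
      · rw [mul_pow, mul_pow, ← mul_add]
        exact mul_ne_zero (pow_ne_zero _ hne) hpq'
  have generic : ∀ a c α β : ℝ, α ≠ 0 → β ≠ 0 → vec a α c β ∈ V := by
    intro a c α β hα hβ
    -- The vector is written as a sum of one member without `β` and one without `α`; their pairing
    -- is the expression required to be non-zero.
    have split : ∀ a' c' : ℝ, a' ^ 2 + c' ^ 2 ≠ 0 → (a - a') ^ 2 + (c - c') ^ 2 ≠ 0 →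
        a' * c - c' * a + α * β ≠ 0 → vec a α c β ∈ V := by
      intro a' c' e1 e2 e3
      have := hadd _ (plane1 a' c' α e1) _ (plane2 (a - a') (c - c') β e2) (by
        rw [om_vec]
        intro h0
        apply e3
        linarith)
      convert this using 1
      apply vec_ext <;> simp [vec]
    by_cases hac : a ^ 2 + c ^ 2 = 0
    · have e1 : a = 0 := by nlinarith [sq_nonneg a, sq_nonneg c]
      have e2 : c = 0 := by nlinarith [sq_nonneg a, sq_nonneg c]
      refine split 1 0 (by norm_num) (by rw [e1, e2]; norm_num) ?_
      rw [e1, e2]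
      simpa using ⟨hα, hβ⟩
    · have hab : α * β ≠ 0 := mul_ne_zero hα hβ
      -- With `(a', c') = (k c, -k a)` the pairing of the two summands becomes `2 α β`.
      set k := α * β / (a ^ 2 + c ^ 2) with hk
      have hk' : k * (a ^ 2 + c ^ 2) = α * β := by rw [hk]; field_simp
      have hk0 : k ≠ 0 := div_ne_zero hab hac
      refine split (k * c) (-(k * a)) ?_ ?_ ?_
      · have : (k * c) ^ 2 + (-(k * a)) ^ 2 = k ^ 2 * (a ^ 2 + c ^ 2) := by ring
        rw [this]
        exact mul_ne_zero (pow_ne_zero _ hk0) hac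
      · have : (a - k * c) ^ 2 + (c - -(k * a)) ^ 2 = (1 + k ^ 2) * (a ^ 2 + c ^ 2) := by ring
        rw [this]
        exact mul_ne_zero (by positivity) hac
      · have : k * c * c - -(k * a) * a + α * β = 2 * (α * β) := by rw [← hk']; ring
        rw [this]
        exact mul_ne_zero two_ne_zero hab
  rw [vec_eta x] at hx ⊢
  generalize x (Sum.inl 0) = a at hx ⊢
  generalize x (Sum.inl 1) = α at hx ⊢
  generalize x (Sum.inr 0) = c at hx ⊢
  generalize x (Sum.inr 1) = β at hx ⊢
  by_cases hac : a ^ 2 + c ^ 2 = 0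
  · have e1 : a = 0 := by nlinarith [sq_nonneg a, sq_nonneg c]
    have e2 : c = 0 := by nlinarith [sq_nonneg a, sq_nonneg c]
    subst e1 e2
    by_cases hα : α = 0
    · by_cases hβ : β = 0
      · refine absurd ?_ hx
        apply vec_ext <;> simp [vec, hα, hβ]
      -- A vector orthogonal to the plane is the sum of a generic vector and one that lacks a
      -- component.
      · have := hadd _ (generic 1 0 1 β one_ne_zero hβ) _ (plane1 (-1) 0 (-1) (by norm_num)) (by
          rw [om_vec]
          simpa using hβ)
        convert this using 1
        apply vec_ext <;> simp [vec, hα]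
    · by_cases hβ : β = 0
      · have := hadd _ (generic 1 0 α 1 hα one_ne_zero) _ (plane2 (-1) 0 (-1) (by norm_num)) (by
          rw [om_vec]
          simpa using hα)
        convert this using 1
        apply vec_ext <;> simp [vec, hβ]
      · exact generic 0 0 α β hα hβ
  · by_cases hα : α = 0
    · rw [hα]
      exact plane2 a c β hac
    · by_cases hβ : β = 0
      · rw [hβ]
        exact plane1 a c α hac
      · exact generic a c α β hα hβ

/-! #### Transvections generate the symplectic group -/

variable {G : Set (Matrix (Fin 2 ⊕ Fin 2) (Fin 2 ⊕ Fin 2) ℝ)}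

/-- Some isometry in `G` moves `x` to `y` and fixes the members of `F`. -/
def Moves (G : Set (Matrix (Fin 2 ⊕ Fin 2) (Fin 2 ⊕ Fin 2) ℝ)) (F : Set Vec) (x y : Vec) : Prop :=
  ∃ g ∈ G, (∀ a b, om (g *ᵥ a) (g *ᵥ b) = om a b) ∧ g *ᵥ x = y ∧ ∀ f ∈ F, g *ᵥ f = f

theorem Moves.trans (hG : ∀ A ∈ G, ∀ B ∈ G, A * B ∈ G) {F : Set Vec} {x y z : Vec}
    (h1 : Moves G F x y) (h2 : Moves G F y z) : Moves G F x z := by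
  obtain ⟨g, hg, g1, g2, g3⟩ := h1
  obtain ⟨k, hk, k1, k2, k3⟩ := h2
  refine ⟨k * g, hG _ hk _ hg, fun a b => ?_, ?_, fun f hf => ?_⟩
  · rw [← mulVec_mulVec, ← mulVec_mulVec, k1, g1]
  · rw [← mulVec_mulVec, g2, k2]
  · rw [← mulVec_mulVec, g3 f hf, k3 f hf]

/-- The transvection along `y - x`, suitably scaled, sends `x` to `y` and fixes everything
orthogonal to `y - x`. -/
theorem moves_of_om_ne_zero (hT : ∀ v t, tv v t ∈ G) {F : Set Vec} {x y : Vec} (hxy : om x y ≠ 0)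
    (hF : ∀ f ∈ F, om x f = om y f) : Moves G F x y := by
  refine ⟨tv (y - x) (om y x)⁻¹, hT _ _, om_tv _ _, ?_, fun f hf => ?_⟩
  · have : om y x ≠ 0 := by
      rw [om_swap]
      exact neg_ne_zero.2 hxy
    rw [tv_mulVec, om_sub_left, om_self, sub_zero, inv_mul_cancel₀ this, one_smul]
    abel
  · rw [tv_mulVec, om_sub_left, hF f hf, sub_self, mul_zero, zero_smul, add_zero]

theorem moves_of_intermediate (hG : ∀ A ∈ G, ∀ B ∈ G, A * B ∈ G) (hT : ∀ v t, tv v t ∈ G)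
    {F : Set Vec} {x y z : Vec} (hF : ∀ f ∈ F, om x f = om y f) (hz : ∀ f ∈ F, om z f = om y f)
    (hxz : om x z ≠ 0) (hzy : om z y ≠ 0) : Moves G F x y :=
  (moves_of_om_ne_zero hT hxz fun f hf => (hF f hf).trans (hz f hf).symm).trans hG
    (moves_of_om_ne_zero hT hzy hz)

/-- If `x` and `y` are orthogonal, `x + r` pairs non-trivially with both and has the same pairings
with the members of `F`. -/
theorem moves_of_pairing (hG : ∀ A ∈ G, ∀ B ∈ G, A * B ∈ G) (hT : ∀ v t, tv v t ∈ G)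
    {F : Set Vec} {x y r : Vec} (hF : ∀ f ∈ F, om x f = om y f) (hr : ∀ f ∈ F, om r f = 0)
    (hx : om r x = 1) (hy : om r y = 1) : Moves G F x y := by
  by_cases hxy : om x y = 0
  · refine moves_of_intermediate hG hT (z := x + r) hF (fun f hf => ?_) ?_ ?_
    · rw [om_add_left, hr f hf, add_zero, hF f hf]
    · rw [om_add_right, om_self, om_swap, hx]
      norm_num
    · rw [om_add_left, hxy, hy]
      norm_num
  · exact moves_of_om_ne_zero hT hxy hF

/-- A vector space is not the union of two hyperplanes. -/
theorem exists_om_ne_zero₂ {x y : Vec} (hx : x ≠ 0) (hy : y ≠ 0) :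
    ∃ z, om x z ≠ 0 ∧ om z y ≠ 0 := by
  obtain ⟨a, ha⟩ := exists_om_ne_zero hx
  obtain ⟨b, hb⟩ := exists_om_ne_zero hy
  have hb' : om b y ≠ 0 := by
    rw [om_swap]
    exact neg_ne_zero.2 hb
  by_cases h1 : om a y = 0
  · by_cases h2 : om x b = 0
    · refine ⟨a + b, ?_, ?_⟩
      · rwa [om_add_right, h2, add_zero]
      · rwa [om_add_left, h1, zero_add]
    · exact ⟨b, h2, hb'⟩
  · exact ⟨a, ha, h1⟩

theorem moves_hyperbolic (hG : ∀ A ∈ G, ∀ B ∈ G, A * B ∈ G) (hT : ∀ v t, tv v t ∈ G)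
    {p q x y : Vec} (hpq : om p q = 1) (hxp : om x p = 0) (hxq : om x q = 0) (hyp : om y p = 0)
    (hyq : om y q = 0) (hx : x ≠ 0) (hy : y ≠ 0) : Moves G {p, q} x y := by
  obtain ⟨z, h1, h2⟩ := exists_om_ne_zero₂ hx hy
  -- The intermediate vector is projected to the orthogonal complement of the hyperbolic plane of
  -- `p` and `q`; this keeps its pairings with `x` and `y`.
  refine moves_of_intermediate hG hT (z := z + (om q z) • p - (om p z) • q) ?_ ?_ ?_ ?_
  · rintro f (rfl | rfl)
    · rw [hxp, hyp]
    · rw [hxq, hyq]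
  · have e : om q p = -1 := by rw [om_swap, hpq]
    rintro f (rfl | rfl)
    · rw [om_sub_left, om_add_left, om_smul_left, om_smul_left, om_self, e, hyp, om_swap z]
      ring
    · rw [om_sub_left, om_add_left, om_smul_left, om_smul_left, om_self, hpq, hyq, om_swap z]
      ring
  · rw [sub_eq_add_neg, ← neg_smul, om_add_right, om_add_right, om_smul_right, om_smul_right, hxp,
      hxq]
    simpa using h1
  · rw [om_sub_left, om_add_left, om_smul_left, om_smul_left, om_swap p y, om_swap q y, hyp, hyq]
    simpa using h2

/-- A semigroup of matrices containing all transvections contains all symplectic matrices. -/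
theorem mem_of_isometry (hG : ∀ A ∈ G, ∀ B ∈ G, A * B ∈ G) (hT : ∀ v t, tv v t ∈ G)
    {A : Matrix (Fin 2 ⊕ Fin 2) (Fin 2 ⊕ Fin 2) ℝ}
    (hA : ∀ a b, om (A *ᵥ a) (A *ᵥ b) = om a b) : A ∈ G := by
  have ne : ∀ {x y : Vec}, om x y ≠ 0 → x ≠ 0 := by
    rintro _ y hxy rfl
    apply hxy
    simp [om]
  set e₁ := vec 1 0 0 0
  set e₂ := vec 0 1 0 0
  set f₁ := vec 0 0 1 0
  set f₂ := vec 0 0 0 1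
  have o1 : om e₁ f₁ = 1 := by simp [e₁, f₁, om_vec]
  have o2 : om e₂ f₂ = 1 := by simp [e₂, f₂, om_vec]
  have o3 : om e₁ e₂ = 0 := by simp [e₁, e₂, om_vec]
  have o4 : om e₁ f₂ = 0 := by simp [e₁, f₂, om_vec]
  have o5 : om f₁ e₂ = 0 := by simp [f₁, e₂, om_vec]
  have o6 : om f₁ f₂ = 0 := by simp [f₁, f₂, om_vec]
  have z1 : om (A *ᵥ e₁) (A *ᵥ f₁) ≠ 0 := by rw [hA, o1]; exact one_ne_zero
  have z2 : om (A *ᵥ e₂) (A *ᵥ f₂) ≠ 0 := by rw [hA, o2]; exact one_ne_zero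
  -- The images of `e₁`, `f₁`, `e₂`, `f₂` are put in place one after the other, each isometry fixing
  -- the images already reached. An isometry is determined by these four images.
  obtain ⟨z, hz1, hz2⟩ := exists_om_ne_zero₂ (ne (x := e₁) (by rw [o1]; exact one_ne_zero)) (ne z1)
  obtain ⟨g₁, G1, i1, a1, -⟩ := moves_of_intermediate hG hT (F := ∅) (by simp) (by simp) hz1 hz2
  obtain ⟨g₂, G2, i2, a2, b2⟩ := moves_of_pairing hG hT (F := {A *ᵥ e₁}) (x := g₁ *ᵥ f₁)
    (y := A *ᵥ f₁) (r := A *ᵥ e₁)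
    (by
      rintro _ rfl
      nth_rewrite 1 [← a1]
      rw [i1, hA])
    (by
      rintro _ rfl
      exact om_self _)
    (by
      nth_rewrite 1 [← a1]
      rw [i1, o1]) (by rw [hA, o1])
  have c2 : g₂ *ᵥ (g₁ *ᵥ e₁) = A *ᵥ e₁ := by rw [a1, b2 _ rfl]
  obtain ⟨g₃, G3, i3, a3, b3⟩ := moves_hyperbolic hG hT (p := A *ᵥ e₁) (q := A *ᵥ f₁)
    (x := g₂ *ᵥ (g₁ *ᵥ e₂)) (y := A *ᵥ e₂) (by rw [hA, o1])
    (by rw [← c2, i2, i1, om_swap, o3, neg_zero]) (by rw [← a2, i2, i1, om_swap, o5, neg_zero])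
    (by rw [hA, om_swap, o3, neg_zero]) (by rw [hA, om_swap, o5, neg_zero])
    (ne (y := g₂ *ᵥ (g₁ *ᵥ f₂)) (by rw [i2, i1, o2]; exact one_ne_zero)) (ne z2)
  have c3 : g₃ *ᵥ (g₂ *ᵥ (g₁ *ᵥ e₁)) = A *ᵥ e₁ := by rw [c2, b3 _ (by simp)]
  have d3 : g₃ *ᵥ (g₂ *ᵥ (g₁ *ᵥ f₁)) = A *ᵥ f₁ := by rw [a2, b3 _ (by simp)]
  obtain ⟨g₄, G4, i4, a4, b4⟩ := moves_of_pairing hG hT (F := {A *ᵥ e₁, A *ᵥ f₁, A *ᵥ e₂})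
    (x := g₃ *ᵥ (g₂ *ᵥ (g₁ *ᵥ f₂))) (y := A *ᵥ f₂) (r := A *ᵥ e₂)
    (by
      rintro _ (rfl | rfl | rfl)
      · rw [hA]
        rw [← c3, i3, i2, i1]
      · rw [hA]
        rw [← d3, i3, i2, i1]
      · rw [hA]
        rw [← a3, i3, i2, i1])
    (by
      rintro _ (rfl | rfl | rfl)
      · rw [hA, om_swap, o3, neg_zero]
      · rw [hA, om_swap, o5, neg_zero]
      · exact om_self _)
    (by rw [← a3, i3, i2, i1, o2]) (by rw [hA, o2])
  have main : g₄ * (g₃ * (g₂ * g₁)) = A := by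
    refine ext_mulVec fun x => ?_
    have hx : x = x (Sum.inl 0) • e₁ + x (Sum.inl 1) • e₂ + x (Sum.inr 0) • f₁ +
        x (Sum.inr 1) • f₂ := by
      apply vec_ext <;> simp [e₁, e₂, f₁, f₂, vec]
    rw [hx]
    simp only [mulVec_add, mulVec_smul, ← mulVec_mulVec]
    rw [c3, d3, a3, a4, b4 _ (by simp), b4 _ (by simp), b4 _ (by simp)]
  rw [← main]
  exact hG _ G4 _ (hG _ G3 _ (hG _ G2 _ G1))

/-- Membership is expressed in Mathlib by `A * J * Aᵀ = J`; passing to the transpose gives the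
condition on the form. -/
theorem mem_symplecticGroup_iff_om {A : Matrix (Fin 2 ⊕ Fin 2) (Fin 2 ⊕ Fin 2) ℝ} :
    A ∈ symplecticGroup (Fin 2) ℝ ↔ ∀ a b, om (A *ᵥ a) (A *ᵥ b) = om a b := by
  rw [← SymplecticGroup.transpose_mem_iff, SymplecticGroup.mem_iff, transpose_transpose]
  have e : ∀ a b : Vec, om (A *ᵥ a) (A *ᵥ b) = -(a ⬝ᵥ ((Aᵀ * J (Fin 2) ℝ * A) *ᵥ b)) := by
    intro a b
    rw [om_eq, ← mulVec_mulVec, ← mulVec_mulVec, dotProduct_mulVec a Aᵀ, vecMul_transpose]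
  constructor
  · intro H a b
    rw [e, H, om_eq]
  · intro H
    refine ext_mulVec fun b => ?_
    refine dotProduct_eq _ _ fun a => ?_
    have := H a b
    rw [e, om_eq, neg_inj] at this
    rwa [dotProduct_comm, dotProduct_comm _ a]

theorem zariskiClosure_subset_symplecticGroup
    {S : Set (Matrix (Fin 2 ⊕ Fin 2) (Fin 2 ⊕ Fin 2) ℝ)} (hS : ∀ A ∈ S, A ∈ symplecticGroup (Fin 2) ℝ)
    {A : Matrix (Fin 2 ⊕ Fin 2) (Fin 2 ⊕ Fin 2) ℝ} (hA : A ∈ zariskiClosure S) :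
    A ∈ symplecticGroup (Fin 2) ℝ := by
  rw [SymplecticGroup.mem_iff]
  ext i j
  -- The relation `B * J * Bᵀ = J` is polynomial in the entries, so it persists on the Zariski
  -- closure.
  let P : MvPolynomial ((Fin 2 ⊕ Fin 2) × (Fin 2 ⊕ Fin 2)) ℝ :=
    ∑ k, (∑ l, MvPolynomial.X (i, l) * MvPolynomial.C (J (Fin 2) ℝ l k)) * MvPolynomial.X (j, k) -
      MvPolynomial.C (J (Fin 2) ℝ i j)
  have hP : ∀ B : Matrix (Fin 2 ⊕ Fin 2) (Fin 2 ⊕ Fin 2) ℝ,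
      MvPolynomial.eval (fun e => B e.1 e.2) P =
        (B * J (Fin 2) ℝ * Bᵀ) i j - J (Fin 2) ℝ i j := by
    intro B
    simp only [P, map_sub, map_sum, map_mul, MvPolynomial.eval_X, MvPolynomial.eval_C,
      Matrix.mul_apply, transpose_apply]
  have := hA P fun B hB => by
    rw [hP, SymplecticGroup.mem_iff.1 (hS B hB), sub_self]
  rw [hP] at this
  exact sub_eq_zero.1 this

/-- A criterion for a semigroup of symplectic matrices to be Zariski dense. -/
theorem zariskiClosure_eq {S : Set (Matrix (Fin 2 ⊕ Fin 2) (Fin 2 ⊕ Fin 2) ℝ)}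
    (hS : ∀ A ∈ S, A ∈ symplecticGroup (Fin 2) ℝ) (hmul : ∀ A ∈ S, ∀ B ∈ S, A * B ∈ S)
    {p q r p' q' r' c₁ c₂ c₃ c₄ : ℝ} (h1 : tv (vec 1 0 0 0) c₁ ∈ S) (h2 : tv (vec 0 0 1 0) c₂ ∈ S)
    (h3 : tv (vec p r q 0) c₃ ∈ S) (h4 : tv (vec p' 0 q' r') c₄ ∈ S) (hc₁ : c₁ ≠ 0) (hc₂ : c₂ ≠ 0)
    (hc₃ : c₃ ≠ 0) (hc₄ : c₄ ≠ 0) (hr : r ≠ 0) (hr' : r' ≠ 0) (hpq : p ^ 2 + q ^ 2 ≠ 0)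
    (hpq' : p' ^ 2 + q' ^ 2 ≠ 0) : zariskiClosure S =
      (symplecticGroup (Fin 2) ℝ : Set (Matrix (Fin 2 ⊕ Fin 2) (Fin 2 ⊕ Fin 2) ℝ)) := by
  refine Set.Subset.antisymm (fun A hA => zariskiClosure_subset_symplecticGroup hS hA)
    fun A hA => ?_
  have hG : ∀ A ∈ zariskiClosure S, ∀ B ∈ zariskiClosure S, A * B ∈ zariskiClosure S :=
    fun A hA B hB => mul_mem_zariskiClosure hmul hA hB
  -- Powers of one transvection are transvections along the same vector whose factors are multiples
  -- of `c`: infinitely many points of a line.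
  have line : ∀ (v : Vec) (c : ℝ), c ≠ 0 → tv v c ∈ S → ∀ t, tv v t ∈ zariskiClosure S := by
    intro v c hc hv
    refine line_mem_zariskiClosure 1 _ hc fun k => subset_zariskiClosure ?_
    change tv v ((k + 1) * c) ∈ S
    induction k with
    | zero => simpa using hv
    | succ k ih =>
      have := hmul _ ih _ hv
      rw [tv_mul_tv] at this
      convert this using 2
      push_cast
      ring
  have all : ∀ v : Vec, v ≠ 0 → ∀ t, tv v t ∈ zariskiClosure S := by
    intro v hv
    refine mem_of_transvection_closed (V := {v | ∀ t, tv v t ∈ zariskiClosure S}) ?_ ?_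
      (line _ _ hc₁ h1) (line _ _ hc₂ h2) (line _ _ hc₃ h3) (line _ _ hc₄ h4) hr hr' hpq hpq' hv
    · intro x hx c _ t
      rw [tv_smul]
      exact hx _
    -- Choosing the factor `s / om y x` makes the conjugated direction equal to `x + s • y`.
    · intro x hx y hy hxy s t
      have hyx : om y x ≠ 0 := by
        rw [om_swap]
        exact neg_ne_zero.2 hxy
      have := tv_conj y x (s / om y x) t
      rw [div_mul_cancel₀ _ hyx] at this
      rw [this]
      exact hG _ (hG _ (hy _) _ (hx _)) _ (hy _)
  refine mem_of_isometry hG (fun v t => ?_) (mem_symplecticGroup_iff_om.1 hA)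
  by_cases hv : v = 0
  · have : tv v t = tv (vec 1 0 0 0) 0 := by
      refine ext_mulVec fun x => ?_
      simp [tv_mulVec, hv]
    rw [this]
    exact line _ _ hc₁ h1 0
  · exact all v hv t

end ZariskiSp4

/-! ### Affine groups containing transvections -/

namespace TranslationSurface

open AlexanderSpanier ZariskiSp4
open Matrix hiding vec

variable {M : TranslationSurface}

theorem trans_mem_affineGroup {f f' : M.carrier ≃ₜ M.carrier} (hf : f ∈ M.affineGroup)
    (hf' : f' ∈ M.affineGroup) : f.trans f' ∈ M.affineGroup := by
  obtain ⟨D, hD, h1, h2⟩ := hf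
  obtain ⟨D', hD', h1', h2'⟩ := hf'
  refine ⟨D' ∘ₗ D, by rw [LinearMap.det_comp, hD, hD', one_mul], fun p => (h1' _).trans (h1 _),
    fun p => ?_⟩
  filter_upwards [h2 p, (f.continuous.tendsto p).eventually (h2' (f p))] with x e1 e2
  rw [Homeomorph.trans_apply, Homeomorph.trans_apply, e2, e1]
  rfl

theorem comp_mem_gammaPerp {g g' : ↥M.H1perp →ₗ[ℝ] ↥M.H1perp} (hg : g ∈ M.gammaPerp)
    (hg' : g' ∈ M.gammaPerp) : g ∘ₗ g' ∈ M.gammaPerp := by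
  obtain ⟨f, hf, e⟩ := hg
  obtain ⟨f', hf', e'⟩ := hg'
  refine ⟨f.trans f', trans_mem_affineGroup hf hf', fun ξ => ?_⟩
  rw [LinearMap.comp_apply, e, e']
  obtain ⟨c, hc⟩ := Submodule.Quotient.mk_surjective _ (ξ : H1 M.carrier)
  rw [← hc]
  rfl

namespace Periods

/-- Some affine map acts on the classes `E j` as the transvection along `u` with factor `t`. -/
def HasTransvection (M : TranslationSurface) (E : Fin 2 ⊕ Fin 2 → H1 M.carrier) (u : Vec) (t : ℝ) :
    Prop :=
  ∃ f ∈ M.affineGroup, ∀ j, pullback (f : C(M.carrier, M.carrier)) (E j) =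
    E j + (t * dual u j) • ∑ i, u i • E i

section

variable (P : Periods M) {E : Fin 2 ⊕ Fin 2 → H1 M.carrier} {c : ℝ}

theorem cup_sum (hcup : ∀ i j, cup (E i) (E j) = (c * J (Fin 2) ℝ i j) • P.kappa) (x y : Vec) :
    cup (∑ i, x i • E i) (∑ i, y i • E i) = (-c * om x y) • P.kappa := by
  simp only [map_sum, map_smul, LinearMap.sum_apply, LinearMap.smul_apply, hcup, smul_smul]
  simp only [← Finset.sum_smul, smul_smul, om_eq]
  congr 1
  simp only [dotProduct, mulVec, Finset.mul_sum, neg_mul_neg]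
  rw [Finset.sum_comm]
  refine Finset.sum_congr rfl fun i _ => ?_
  refine Finset.sum_congr rfl fun j _ => ?_
  ring

/-- The cup products form a non-degenerate Gram matrix. -/
theorem linearIndependent (hc : c ≠ 0)
    (hcup : ∀ i j, cup (E i) (E j) = (c * J (Fin 2) ℝ i j) • P.kappa) : LinearIndependent ℝ E := by
  rw [Fintype.linearIndependent_iff]
  intro x hx
  have key : ∀ y, om x y = 0 := by
    intro y
    have h1 := P.cup_sum hcup x y
    rw [hx, map_zero, LinearMap.zero_apply] at h1
    simpa [P.kappa_ne_zero, hc] using h1.symm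
  have e : x = 0 := by
    refine vec_ext ?_ ?_ ?_ ?_
    · simpa [om, vec] using key (vec 0 0 1 0)
    · simpa [om, vec] using key (vec 0 0 0 1)
    · simpa [om, vec] using key (vec 1 0 0 0)
    · simpa [om, vec] using key (vec 0 1 0 0)
  intro i
  rw [e]
  rfl

/-- A criterion for Zariski density in terms of four transvections. -/
theorem zariskiClosureIsSp4 (hc : c ≠ 0)
    (hcup : ∀ i j, cup (E i) (E j) = (c * J (Fin 2) ℝ i j) • P.kappa)
    (hE : ∀ i, E i ∈ M.H1perp) (hspan : ∀ ξ ∈ M.H1perp, ∃ w : Vec, ξ = ∑ i, w i • E i)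
    {p q r p' q' r' c₁ c₂ c₃ c₄ : ℝ} (h1 : HasTransvection M E (vec 1 0 0 0) c₁)
    (h2 : HasTransvection M E (vec 0 0 1 0) c₂) (h3 : HasTransvection M E (vec p r q 0) c₃)
    (h4 : HasTransvection M E (vec p' 0 q' r') c₄) (hc₁ : c₁ ≠ 0) (hc₂ : c₂ ≠ 0)
    (hc₃ : c₃ ≠ 0) (hc₄ : c₄ ≠ 0) (hr : r ≠ 0) (hr' : r' ≠ 0) (hpq : p ^ 2 + q ^ 2 ≠ 0)
    (hpq' : p' ^ 2 + q' ^ 2 ≠ 0) : ZariskiClosureIsSp4 M := by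
  let E' : Fin 2 ⊕ Fin 2 → ↥M.H1perp := fun i => ⟨E i, hE i⟩
  have coe_sum : ∀ w : Vec, ((∑ i, w i • E' i : ↥M.H1perp) : H1 M.carrier) = ∑ i, w i • E i := by
    intro w
    rw [Submodule.coe_sum]
    rfl
  have hli : LinearIndependent ℝ E' :=
    LinearIndependent.of_comp M.H1perp.subtype (P.linearIndependent hc hcup)
  have hsp : ⊤ ≤ Submodule.span ℝ (Set.range E') := by
    rintro ⟨ξ, hξ⟩ -
    obtain ⟨w, hw⟩ := hspan ξ hξ
    have : (⟨ξ, hξ⟩ : ↥M.H1perp) = ∑ i, w i • E' i := Subtype.ext (hw.trans (coe_sum w).symm)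
    rw [this]
    exact Submodule.sum_mem _ fun i _ =>
      Submodule.smul_mem _ _ (Submodule.subset_span (Set.mem_range_self i))
  let b : Module.Basis (Fin 2 ⊕ Fin 2) ℝ ↥M.H1perp := Module.Basis.mk hli hsp
  have hb : ∀ i, b i = E' i := fun i => Module.Basis.mk_apply hli hsp i
  have hrepr : ∀ x : ↥M.H1perp, (x : H1 M.carrier) = ∑ i, b.repr x i • E i := by
    intro x
    conv_lhs => rw [← b.sum_repr x]
    simp only [hb]
    exact coe_sum _
  have hcup' : ∀ x y : ↥M.H1perp, cup (x : H1 M.carrier) (y : H1 M.carrier) =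
      (-c * om (b.repr x) (b.repr y)) • P.kappa := by
    intro x y
    rw [hrepr x, hrepr y]
    exact P.cup_sum hcup _ _
  -- The factor `c` of the Gram matrix is absorbed in the generator of `H²`.
  refine ⟨b, ⟨c • P.kappa, smul_ne_zero hc P.kappa_ne_zero, fun i j => ?_⟩, ?_⟩
  · rw [hb, hb, smul_smul, mul_comm]
    exact hcup i j
  have hT : ∀ {u t}, HasTransvection M E u t → tv u t ∈ LinearMap.toMatrix b b '' M.gammaPerp := by
    rintro u t ⟨f, hf, H⟩
    obtain ⟨g, hg, e⟩ := P.exists_gammaPerp hf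
    refine ⟨g, hg, ?_⟩
    have : g = Matrix.toLin b b (tv u t) := by
      refine b.ext fun j => ?_
      rw [Matrix.toLin_self]
      refine Subtype.ext ?_
      rw [e, hb]
      simp only [hb]
      rw [show (pullback (f : C(M.carrier, M.carrier))) (E' j : H1 M.carrier) = _ from H j]
      rw [coe_sum (fun i => tv u t i j)]
      simp only [tv, Matrix.add_apply, Matrix.smul_apply, vecMulVec_apply, Matrix.one_apply,
        add_smul, Finset.sum_add_distrib, ite_smul, one_smul, zero_smul, Finset.sum_ite_eq',
        Finset.mem_univ, if_true, Finset.smul_sum, smul_smul, smul_eq_mul]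
      congr 1
      refine Finset.sum_congr rfl fun i _ => ?_
      congr 1
      ring
    rw [this, LinearMap.toMatrix_toLin]
  refine zariskiClosure_eq ?_ ?_ (hT h1) (hT h2) (hT h3) (hT h4) hc₁ hc₂ hc₃ hc₄ hr hr' hpq hpq'
  · rintro _ ⟨g, ⟨f, hf, e⟩, rfl⟩
    rw [mem_symplecticGroup_iff_om]
    intro x y
    have hx : ∀ x : Vec, x = b.repr (b.equivFun.symm x) := fun x =>
      (b.equivFun.apply_symm_apply x).symm
    rw [hx x, hx y, LinearMap.toMatrix_mulVec_repr, LinearMap.toMatrix_mulVec_repr]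
    have k := P.cup_pullback hf (b.equivFun.symm x : ↥M.H1perp) (b.equivFun.symm y : ↥M.H1perp)
    rw [← e, ← e, hcup', hcup'] at k
    exact mul_left_cancel₀ (neg_ne_zero.2 hc) (smul_left_injective ℝ P.kappa_ne_zero k)
  · rintro _ ⟨g, hg, rfl⟩ _ ⟨g', hg', rfl⟩
    exact ⟨g ∘ₗ g', comp_mem_gammaPerp hg hg', LinearMap.toMatrix_comp b b b g g'⟩

end

end Periods

end TranslationSurface

namespace Origami

open Set AlexanderSpanier ZariskiSp4 TranslationSurface.Periods

variable {n : ℕ} {s : ℝ}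

/-! ### Words in the elementary shears -/

/-- A pair of permutations describing a square-tiled surface. -/
abbrev Gluing (n : ℕ) : Type := Equiv.Perm (Fin n) × Equiv.Perm (Fin n)

/-- Edge periods: along the bottoms and along the left sides of the squares. -/
abbrev EdgePer (n : ℕ) (R : Type) : Type := (Fin n → R) × (Fin n → R)

/-- There is an affine homeomorphism of determinant `d` from `S` to `S'` which acts on edge periods
by `T`. -/
def Related (hs : 0 < s) (S S' : Gluing n) (d : ℝ) (T : EdgePer n ℝ → EdgePer n ℝ) : Prop :=
  ∃ (F : Surface S.1 S.2 ≃ₜ Surface S'.1 S'.2) (D : ℂ →ₗ[ℝ] ℂ), LinearMap.det D = d ∧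
    IsAffine hs F D ∧ ∀ f, per (pullbackCocycle (F : C(Surface S.1 S.2, Surface S'.1 S'.2)) f) =
      T (per f)

theorem Related.refl (hs : 0 < s) (S : Gluing n) : Related hs S S 1 id :=
  ⟨Homeomorph.refl _, LinearMap.id, LinearMap.det_id, ⟨fun _ => rfl, fun _ => Eventually.of_forall
    fun _ => rfl⟩, fun _ => rfl⟩

theorem Related.trans {hs : 0 < s} {S S' S'' : Gluing n} {d d' : ℝ}
    {T T' : EdgePer n ℝ → EdgePer n ℝ} (H : Related hs S S' d T) (H' : Related hs S' S'' d' T') :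
    Related hs S S'' (d' * d) (T ∘ T') := by
  obtain ⟨F, D, hd, hD, hT⟩ := H
  obtain ⟨F', D', hd', hD', hT'⟩ := H'
  refine ⟨F.trans F', D' ∘ₗ D, by rw [LinearMap.det_comp, hd, hd'], hD'.comp hD F.continuous,
    fun f => ?_⟩
  rw [Function.comp_apply, ← hT', ← hT]
  rfl

theorem Related.symm {hs : 0 < s} {S S' : Gluing n} {T T' : EdgePer n ℝ → EdgePer n ℝ}
    (H : Related hs S S' 1 T) (hT' : ∀ w, T' (T w) = w) : Related hs S' S 1 T' := by
  obtain ⟨F, D, hd, hD, hT⟩ := H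
  let e := LinearMap.equivOfDetNeZero D (by rw [hd]; exact one_ne_zero)
  have he : (e.symm : ℂ →ₗ[ℝ] ℂ) ∘ₗ D = LinearMap.id := by
    ext z
    exact e.symm_apply_apply z
  refine ⟨F.symm, e.symm, ?_, hD.symm he, fun f => ?_⟩
  · have := congrArg LinearMap.det he
    rwa [LinearMap.det_comp, hd, mul_one, LinearMap.det_id] at this
  · have k := hT (pullbackCocycle (F.symm : C(Surface S'.1 S'.2, Surface S.1 S.2)) f)
    have k' : pullbackCocycle (F : C(Surface S.1 S.2, Surface S'.1 S'.2))
        (pullbackCocycle (F.symm : C(Surface S'.1 S'.2, Surface S.1 S.2)) f) = f := by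
      ext x y
      change f.1 (F.symm (F x)) (F.symm (F y)) = f.1 x y
      rw [F.symm_apply_apply, F.symm_apply_apply]
    rw [k'] at k
    rw [k, hT']

theorem related_swap (hs : 0 < s) (S : Gluing n) :
    Related hs S (S.2, S.1) (-1) (fun w => (w.2, w.1)) :=
  ⟨swap S.1 S.2, linMap 0 1 1 0, by rw [det_linMap]; norm_num, isAffine_swap hs S.1 S.2,
    fun f => per_swap f⟩

theorem related_shear (hs : 0 < s) (S : Gluing n) :
    Related hs S (S.1, S.2 * S.1⁻¹) 1 (shearPer ℝ S.1) :=
  ⟨shear S.1 S.2, linMap 1 1 0 1, by rw [det_linMap]; norm_num, isAffine_shear hs S.1 S.2,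
    fun f => per_shear f⟩

/-- The elementary shears and their inverses. -/
inductive Letter
  | right
  | left
  | up
  | down

/-- The gluing of the sheared surface. -/
def Letter.next : Letter → Gluing n → Gluing n
  | .right, S => (S.1, S.2 * S.1⁻¹)
  | .left, S => (S.1, S.2 * S.1)
  | .up, S => (S.1 * S.2⁻¹, S.2)
  | .down, S => (S.1 * S.2, S.2)

/-- The action of a shear on edge periods. -/
def Letter.act {R : Type} [AddCommGroup R] : Letter → Gluing n → EdgePer n R → EdgePer n R
  | .right, S, w => (w.1, fun i => w.1 i + w.2 (S.1 i))
  | .left, S, w => (w.1, fun i => w.2 (S.1⁻¹ i) - w.1 (S.1⁻¹ i))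
  | .up, S, w => (fun i => w.2 i + w.1 (S.2 i), w.2)
  | .down, S, w => (fun i => w.1 (S.2⁻¹ i) - w.2 (S.2⁻¹ i), w.2)

/-- A vertical shear is a horizontal one conjugated by the reflection, whose determinant `-1` occurs
twice; the other two letters are inverses. -/
theorem Letter.related (hs : 0 < s) : ∀ (l : Letter) (S : Gluing n),
    Related hs S (l.next S) 1 (l.act S) := by
  have h1 : ∀ S : Gluing n, Related hs S (Letter.right.next S) 1 (Letter.right.act S) :=
    related_shear hs
  have h2 : ∀ S : Gluing n, Related hs S (Letter.up.next S) 1 (Letter.up.act S) := by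
    intro S
    have := ((related_swap hs S).trans (h1 (S.2, S.1))).trans (related_swap hs _)
    norm_num at this
    exact this
  rintro (_ | _ | _ | _) S
  · exact h1 S
  · have := (h1 (S.1, S.2 * S.1)).symm (T' := Letter.left.act S) (by
      intro w
      simp [Letter.act])
    simpa [Letter.next] using this
  · exact h2 S
  · have := (h2 (S.1 * S.2, S.2)).symm (T' := Letter.down.act S) (by
      intro w
      simp [Letter.act])
    simpa [Letter.next] using this

/-- The gluing reached by a word. -/
def run : List Letter → Gluing n → Gluing n
  | [], S => S
  | l :: L, S => run L (l.next S)

/-- The action of a word on edge periods. -/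
def act {R : Type} [AddCommGroup R] : List Letter → Gluing n → EdgePer n R → EdgePer n R
  | [], _, w => w
  | l :: L, S, w => l.act S (act L (l.next S) w)

/-- Pullback is contravariant: the action of the first letter is applied last. -/
theorem related_run (hs : 0 < s) : ∀ (L : List Letter) (S : Gluing n),
    Related hs S (run L S) 1 (act L S)
  | [], S => Related.refl hs S
  | l :: L, S => by
    have := (l.related hs S).trans (related_run hs L (l.next S))
    rwa [one_mul] at this

/-- Real periods from integral ones. -/
def realPer (w : EdgePer n ℤ) : EdgePer n ℝ := (fun i => w.1 i, fun i => w.2 i)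

/-- Thanks to this, the action of a word on real periods is decided by integer arithmetic. -/
theorem act_realPer : ∀ (L : List Letter) (S : Gluing n) (w : EdgePer n ℤ),
    act L S (realPer w) = realPer (act L S w)
  | [], _, _ => rfl
  | l :: L, S, w => by
    rw [act, act, act_realPer L]
    rcases l with _ | _ | _ | _ <;> simp [Letter.act, realPer]

/-! ### Integral certificates -/

/-- Integral periods of a symplectic basis of the complement of the tautological plane, up to the
factor `c`. -/
structure PerpBasis (h v : Equiv.Perm (Fin n)) (c : ℤ) where
  per : Fin 2 ⊕ Fin 2 → EdgePer n ℤ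
  inv_fst : ∀ j i, (per j).1 (v i) = (per j).1 i
  inv_snd : ∀ j i, (per j).2 (h i) = (per j).2 i
  sum_fst : ∀ j, ∑ i, (per j).1 i = 0
  sum_snd : ∀ j, ∑ i, (per j).2 i = 0
  gram : ∀ j k, ∑ i, ((per j).2 i * (per k).1 i - (per k).2 i * (per j).1 i) =
    c * Matrix.J (Fin 2) ℤ j k

namespace PerpBasis

variable {h v : Equiv.Perm (Fin n)} {c : ℤ} (B : PerpBasis h v c)

/-- The invariant functions of a basis vector. -/
def pair (j : Fin 2 ⊕ Fin 2) : ↥(invFun h) × ↥(invFun v) :=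
  (⟨fun i => (B.per j).2 i, fun i => congrArg Int.cast (B.inv_snd j i)⟩,
    ⟨fun i => (B.per j).1 i, fun i => congrArg Int.cast (B.inv_fst j i)⟩)

/-- The cocycle of a basis vector. -/
def cocycle (j : Fin 2 ⊕ Fin 2) : ↥(cocycles1 (Surface h v)) :=
  row (B.pair j).1 + col (B.pair j).2

theorem per_cocycle (j : Fin 2 ⊕ Fin 2) : Origami.per (B.cocycle j) = realPer (B.per j) := by
  rw [cocycle, map_add, per_row, per_col]
  simp [realPer, pair]

/-- The cohomology class of a basis vector. -/
def vector (j : Fin 2 ⊕ Fin 2) : H1 (Surface h v) := H1.mk (B.cocycle j)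

theorem vector_eq (j : Fin 2 ⊕ Fin 2) : B.vector j = cls h v (B.pair j) := by
  rw [vector, cocycle, map_add]
  rfl

theorem cup_vector (ht : Transitive h v) (i₀ : Fin n) (j k : Fin 2 ⊕ Fin 2) :
    cup (B.vector j) (B.vector k) = ((c : ℝ) * Matrix.J (Fin 2) ℝ j k) • kap h v i₀ := by
  rw [vector_eq, vector_eq, cup_cls ht i₀]
  congr 1
  have hJ : Matrix.J (Fin 2) ℝ j k = (Matrix.J (Fin 2) ℤ j k : ℝ) := by
    rcases j with j | j <;> rcases k with k | k <;> fin_cases j <;> fin_cases k <;>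
      simp [Matrix.J]
  rw [hJ]
  have := congrArg (Int.cast : ℤ → ℝ) (B.gram j k)
  push_cast at this
  exact this

/-- The word `L` acts on the basis as a transvection along `u`, up to functions on the vertices. -/
def IsTransvection (L : List Letter) (u : Fin 2 ⊕ Fin 2 → ℤ) (d m : ℤ)
    (g : Fin 2 ⊕ Fin 2 → Fin n → ℤ) : Prop :=
  run L (h, v) = (h, v) ∧ ∀ j i,
    d * ((act L (h, v) (B.per j)).1 i - (B.per j).1 i) =
      m * Sum.elim ![-u (.inr 0), -u (.inr 1)] ![u (.inl 0), u (.inl 1)] j *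
        (∑ k, u k * (B.per k).1 i) + (g j (h i) - g j i) ∧
    d * ((act L (h, v) (B.per j)).2 i - (B.per j).2 i) =
      m * Sum.elim ![-u (.inr 0), -u (.inr 1)] ![u (.inl 0), u (.inl 1)] j *
        (∑ k, u k * (B.per k).2 i) + (g j (v i) - g j i)

/-- A word returning to the initial gluing is realised by an affine self-map of determinant one. Its
action on classes is the action on edge periods modulo vertex functions. -/
theorem hasTransvection (hs : 0 < s) (ht : Transitive h v) (i₀ : Fin n) {L : List Letter}
    {u : Fin 2 ⊕ Fin 2 → ℤ} {d m : ℤ} {g : Fin 2 ⊕ Fin 2 → Fin n → ℤ} (hd : d ≠ 0)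
    (H : B.IsTransvection L u d m g) :
    HasTransvection (surf hs ht i₀) B.vector (fun k => u k) (m / d) := by
  obtain ⟨F, D, hdet, hD, hT⟩ : Related hs (h, v) (h, v) 1 (act L (h, v)) := by
    have := related_run hs L (h, v)
    rwa [H.1] at this
  refine ⟨F, ⟨D, hdet, fun p => ?_, fun p => ?_⟩, fun j => ?_⟩
  · change mult (F p) - 1 = 0 ↔ mult p - 1 = 0
    exact iff_of_eq (congrArg (fun m => m - 1 = 0) (hD.1 p))
  · filter_upwards [hD.2 p] with x hx
    exact (surf_primitive hs ht i₀ _ _).trans (hx.trans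
      (congrArg D (surf_primitive hs ht i₀ p x).symm))
  · change H1.mk (pullbackCocycle (F : C(Surface h v, Surface h v)) (B.cocycle j)) =
      H1.mk (B.cocycle j) + ((m / d : ℝ) * dual (fun k => (u k : ℝ)) j) •
        ∑ k, (u k : ℝ) • H1.mk (B.cocycle k)
    simp only [← map_smul, ← map_sum, ← map_add]
    -- The integer `d` clears denominators in the certificate, so the vertex function is divided by
    -- it.
    refine mk_eq_mk ⟨fun i => g j i / d, ?_⟩
    have hd' : (d : ℝ) ≠ 0 := by exact_mod_cast hd
    have hdual : dual (fun k => (u k : ℝ)) j =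
        ((Sum.elim ![-u (.inr 0), -u (.inr 1)] ![u (.inl 0), u (.inl 1)] j : ℤ) : ℝ) := by
      rcases j with j | j <;> fin_cases j <;> simp [dual, vec]
    rw [hdual]
    have K := H.2 j
    generalize Sum.elim ![-u (.inr 0), -u (.inr 1)] ![u (.inl 0), u (.inl 1)] j = z at K ⊢
    rw [hT]
    simp only [map_add, map_smul, map_sum, per_cocycle, act_realPer]
    refine ⟨fun i => ?_, fun i => ?_⟩
    · have e : (d * ((act L (h, v) (B.per j)).1 i - (B.per j).1 i) : ℝ) =
        m * z * (∑ k, (u k : ℝ) * ((B.per k).1 i : ℝ)) + (g j (h i) - g j i) := by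
        have := congrArg (Int.cast : ℤ → ℝ) (K i).1
        push_cast at this
        exact this
      simp only [Prod.fst_sub, Prod.fst_add, Prod.smul_fst, Prod.fst_sum, Pi.sub_apply,
        Pi.add_apply, Pi.smul_apply, Finset.sum_apply, smul_eq_mul, realPer]
      rw [← sub_div, eq_div_iff hd', ← sub_eq_iff_eq_add'.2 e]
      field_simp
      ring
    · have e : (d * ((act L (h, v) (B.per j)).2 i - (B.per j).2 i) : ℝ) =
        m * z * (∑ k, (u k : ℝ) * ((B.per k).2 i : ℝ)) + (g j (v i) - g j i) := by
        have := congrArg (Int.cast : ℤ → ℝ) (K i).2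
        push_cast at this
        exact this
      simp only [Prod.snd_sub, Prod.snd_add, Prod.smul_snd, Prod.snd_sum, Pi.sub_apply,
        Pi.add_apply, Pi.smul_apply, Finset.sum_apply, smul_eq_mul, realPer]
      rw [← sub_div, eq_div_iff hd', ← sub_eq_iff_eq_add'.2 e]
      field_simp
      ring

/-- Pairing with `Re ω` and `Im ω` amounts to summing the invariant functions over all squares. -/
theorem vector_mem (hs : 0 < s) (ht : Transitive h v) (i₀ : Fin n) (hsp : Spans h v)
    (j : Fin 2 ⊕ Fin 2) : B.vector j ∈ (surf hs ht i₀).H1perp := by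
  refine (periods hs ht i₀ hsp).mem_H1perp.2 ⟨?_, ?_⟩
  · rw [vector_eq]
    refine (cup_cls ht i₀ _ _).trans ?_
    have : ∑ i, ((B.per j).2 i : ℝ) = 0 := by exact_mod_cast B.sum_snd j
    simp [pair, oneInv, ← Finset.sum_mul, this]
    rfl
  · rw [vector_eq]
    refine (cup_cls ht i₀ _ _).trans ?_
    have : ∑ i, ((B.per j).1 i : ℝ) = 0 := by exact_mod_cast B.sum_fst j
    simp [pair, oneInv, ← Finset.mul_sum, this]
    rfl

/-- Invariant functions with vanishing sums are combinations of the basis vectors, up to functions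
on the vertices. -/
def IsSpanning : Prop := ∀ χ ∈ invFun h, ∀ ψ ∈ invFun v, ∑ i, χ i = 0 → ∑ i, ψ i = 0 →
  ∃ w : Vec, IsVertexCob h v ((ψ, χ) - ∑ j, w j • realPer (B.per j))

theorem exists_eq_sum (hs : 0 < s) (ht : Transitive h v) (i₀ : Fin n) (hsp : Spans h v)
    (hB : B.IsSpanning) {ξ : H1 (Surface h v)} (hξ : ξ ∈ (surf hs ht i₀).H1perp) :
    ∃ w : Vec, ξ = ∑ j, w j • B.vector j := by
  obtain ⟨a, rfl⟩ := exists_cls hsp ξ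
  obtain ⟨h1, h2⟩ := (periods hs ht i₀ hsp).mem_H1perp.1 hξ
  have e1 := (cup_cls ht i₀ _ _).symm.trans h1
  have e2 := (cup_cls ht i₀ _ _).symm.trans h2
  have z1 := (smul_eq_zero.1 e1).resolve_right (kap_ne_zero i₀)
  have z2 := (smul_eq_zero.1 e2).resolve_right (kap_ne_zero i₀)
  obtain ⟨w, hw⟩ := hB a.1.1 a.1.2 a.2.1 a.2.2
    (by simpa [oneInv, ← Finset.sum_mul, hs.ne'] using z1)
    (by simpa [oneInv, ← Finset.mul_sum, hs.ne'] using z2)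
  refine ⟨w, ?_⟩
  change H1.mk (row a.1) + H1.mk (col a.2) = ∑ j, w j • H1.mk (B.cocycle j)
  simp only [← map_smul, ← map_sum, ← map_add]
  refine mk_eq_mk ?_
  simp only [map_add, map_smul, map_sum, per_cocycle, per_row, per_col, Prod.mk_add_mk, zero_add,
    add_zero]
  exact hw

end PerpBasis

end Origami

namespace Origami

open Set AlexanderSpanier ZariskiSp4 TranslationSurface.Periods

/-! ### The two surfaces -/

theorem hPerm_apply : ∀ i, hPerm i = ![0, 2, 1, 4, 5, 3] i := by decide

theorem vPermHyp_apply : ∀ i, vPermHyp i = ![1, 0, 3, 2, 4, 5] i := by decide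

theorem vPermOdd_apply : ∀ i, vPermOdd i = ![3, 0, 4, 1, 2, 5] i := by decide

theorem forall_fin_six {p : Fin 6 → Prop} :
    (∀ i, p i) ↔ p 0 ∧ p 1 ∧ p 2 ∧ p 3 ∧ p 4 ∧ p 5 := by
  simp [Fin.forall_fin_succ]

theorem spans_hyp : Spans hPerm vPermHyp := by
  intro x y H
  simp [forall_fin_six, hPerm_apply, vPermHyp_apply] at H
  obtain ⟨h0, h1, h2, h3, h4, h5⟩ := H
  -- Here closedness alone forces `y` to be invariant under `h` and `x` under `v`; no vertex
  -- function is needed.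
  refine ⟨y, forall_fin_six.2 ?_, x, forall_fin_six.2 ?_, 0, by simp, by simp⟩
  · simp [hPerm_apply]
    and_intros <;> linarith
  · simp [vPermHyp_apply]
    and_intros <;> linarith

theorem spans_odd : Spans hPerm vPermOdd := by
  intro x y H
  simp [forall_fin_six, hPerm_apply, vPermOdd_apply] at H
  obtain ⟨h0, h1, h2, h3, h4, h5⟩ := H
  -- The lower left corner of the square `2` is the regular vertex. The value is chosen so that the
  -- corrected horizontal periods agree on the squares `0` and `1`, which lie in one cycle of
  -- `vPermOdd`.
  let g : Fin 6 → ℝ := fun i => if i = 2 then x 1 - x 0 else 0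
  refine ⟨fun i => y i - (g (vPermOdd i) - g i), forall_fin_six.2 ?_,
    fun i => x i - (g (hPerm i) - g i), forall_fin_six.2 ?_, g, by simp, by simp⟩
  · simp [hPerm_apply, vPermOdd_apply, g]
    and_intros <;> linarith
  · simp [hPerm_apply, vPermOdd_apply, g]
    and_intros <;> linarith

/-- A basis of the complement of the tautological plane. -/
def basisHyp : PerpBasis hPerm vPermHyp (6) where
  per := Sum.elim ![(![-2, -2, 1, 1, 2, 0], ![-4, -1, -1, 2, 2, 2]),
      (![-1, -1, 3, 3, -4, 0], ![-3, 3, 3, -1, -1, -1])]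
    ![(![-1, -1, -1, -1, 4, 0], ![-3, -3, -3, 3, 3, 3]),
      (![6, 6, -15, -15, 18, 0], ![15, -12, -12, 3, 3, 3])]
  inv_fst := by decide
  inv_snd := by decide
  sum_fst := by decide
  sum_snd := by decide
  gram := by decide +kernel

/-- As in the other certificates below, the word is a conjugate `w x ^ k w⁻¹` of a power of one
shear, a multitwist along parallel cylinders. The vertex function is supported at the square whose
lower left corner is the regular vertex, here the square `5`. -/
theorem isTransvectionHyp_inl_zero : basisHyp.IsTransvection
    [.right, .right, .up, .up, .up, .up, .left, .left]
    (Sum.elim ![1, 0] ![0, 0]) 1 (2)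
    (fun j i => Sum.elim ![0, 0] ![-2, 0] j * if i = 5 then 1 else 0) := by
  unfold PerpBasis.IsTransvection
  decide +kernel

theorem isTransvectionHyp_inr_zero : basisHyp.IsTransvection
    [.right, .right, .right, .up, .up, .up, .up, .left, .left, .left]
    (Sum.elim ![0, 0] ![1, 0]) 1 (2)
    (fun j i => Sum.elim ![4, 0] ![0, 0] j * if i = 5 then 1 else 0) := by
  unfold PerpBasis.IsTransvection
  decide +kernel

theorem isTransvectionHyp_inl_one : basisHyp.IsTransvection
    [.left, .down, .right, .right, .right, .right, .up, .right]
    (Sum.elim ![-5, 3] ![5, 0]) 1 (-2)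
    (fun j i => Sum.elim ![10, 0] ![10, -6] j * if i = 5 then 1 else 0) := by
  unfold PerpBasis.IsTransvection
  decide +kernel

theorem isTransvectionHyp_inr_one : basisHyp.IsTransvection
    [.down, .left, .left, .up, .up, .up, .up, .right, .right, .up]
    (Sum.elim ![8, 0] ![-7, 1]) 1 (2)
    (fun j i => Sum.elim ![-42, 6] ![-48, 0] j * if i = 5 then 1 else 0) := by
  unfold PerpBasis.IsTransvection
  decide +kernel

/-- A basis of the complement of the tautological plane. -/
def basisOdd : PerpBasis hPerm vPermOdd (-36) where
  per := Sum.elim ![(![3, 3, -3, 3, -3, -3], ![-3, -3, -3, 3, 3, 3]),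
      (![-3, -3, 9, -3, 9, -9], ![-9, 9, 9, -3, -3, -3])]
    ![(![-3, -3, 3, -3, 3, 3], ![-5, 1, 1, 1, 1, 1]),
      (![0, 0, 0, 0, 0, 0], ![2, -4, -4, 2, 2, 2])]
  inv_fst := by decide
  inv_snd := by decide
  sum_fst := by decide
  sum_snd := by decide
  gram := by decide +kernel

/-- The identities are multiplied by `3`, since the factors of the transvections need not be
integral in the chosen basis. -/
theorem isTransvectionOdd_inl_zero : basisOdd.IsTransvection
    [.down, .right, .right, .right, .up]
    (Sum.elim ![1, 0] ![0, 0]) 3 (6)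
    (fun j i => Sum.elim ![0, 0] ![-36, 0] j * if i = 2 then 1 else 0) := by
  unfold PerpBasis.IsTransvection
  decide +kernel

theorem isTransvectionOdd_inr_zero : basisOdd.IsTransvection
    [.up, .up, .right, .up, .up, .up, .up, .up, .left, .down, .down]
    (Sum.elim ![0, 0] ![1, 0]) 3 (-18)
    (fun j i => Sum.elim ![0, 0] ![0, 0] j * if i = 2 then 1 else 0) := by
  unfold PerpBasis.IsTransvection
  decide +kernel

theorem isTransvectionOdd_inl_one : basisOdd.IsTransvection
    [.right, .up, .up, .up, .up, .left]
    (Sum.elim ![-1, 1] ![0, 0]) 3 (-1)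
    (fun j i => Sum.elim ![0, 0] ![18, -18] j * if i = 2 then 1 else 0) := by
  unfold PerpBasis.IsTransvection
  decide +kernel

theorem isTransvectionOdd_inr_one : basisOdd.IsTransvection
    [.down, .down, .down, .right, .right, .right, .right, .right, .up, .up, .up]
    (Sum.elim ![1, 0] ![0, -1]) 3 (18)
    (fun j i => Sum.elim ![0, 0] ![0, 0] j * if i = 2 then 1 else 0) := by
  unfold PerpBasis.IsTransvection
  decide +kernel

theorem isSpanning_hyp : basisHyp.IsSpanning := by
  intro χ hχ ψ hψ hχ0 hψ0
  have hχ' : ∀ i, χ (hPerm i) = χ i := hχ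
  have hψ' : ∀ i, ψ (vPermHyp i) = ψ i := hψ
  simp [forall_fin_six, hPerm_apply] at hχ'
  simp [forall_fin_six, vPermHyp_apply] at hψ'
  simp [Fin.sum_univ_succ] at hχ0 hψ0
  refine ⟨vec (-2 * ψ 0 - ψ 2 + 1 / 3 * χ 0 + 2 / 3 * χ 1)
    (-1 / 2 * ψ 0 - 5 / 2 * ψ 2 - 5 / 6 * χ 0 + 11 / 6 * χ 1)
    (3 / 2 * ψ 0 + 1 / 2 * ψ 2 - 1 / 2 * χ 0 - 1 / 2 * χ 1)
    (-1 / 3 * ψ 0 - 2 / 3 * ψ 2 - 1 / 9 * χ 0 + 4 / 9 * χ 1),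
    -- As the sum of `ψ` vanishes, the coefficient is `-ψ 5`. It removes the period along the bottom
    -- of the square `5`, which is zero for all basis vectors.
    fun i => (2 * ψ 0 + 2 * ψ 2 + ψ 4) * if i = 5 then 1 else 0, forall_fin_six.2 ?_,
    forall_fin_six.2 ?_⟩
  · simp [hPerm_apply, basisHyp, realPer, vec, Fin.sum_univ_two]
    and_intros <;> linarith
  · simp [vPermHyp_apply, basisHyp, realPer, vec, Fin.sum_univ_two]
    and_intros <;> linarith

theorem isSpanning_odd : basisOdd.IsSpanning := by
  intro χ hχ ψ hψ hχ0 hψ0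
  have hχ' : ∀ i, χ (hPerm i) = χ i := hχ
  have hψ' : ∀ i, ψ (vPermOdd i) = ψ i := hψ
  simp [forall_fin_six, hPerm_apply] at hχ'
  simp [forall_fin_six, vPermOdd_apply] at hψ'
  simp [Fin.sum_univ_succ] at hχ0 hψ0
  refine ⟨vec (1 / 6 * ψ 0 - 1 / 9 * χ 0 - 1 / 18 * χ 1) (1 / 6 * ψ 0 + 1 / 6 * ψ 2)
    (-1 / 3 * ψ 0 - 1 / 6 * ψ 2 - 1 / 9 * χ 0 - 1 / 18 * χ 1)
    (1 / 6 * ψ 0 + 1 / 3 * ψ 2 + 1 / 18 * χ 0 - 2 / 9 * χ 1), 0, forall_fin_six.2 ?_,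
    forall_fin_six.2 ?_⟩
  · simp [basisOdd, realPer, vec, Fin.sum_univ_two]
    and_intros <;> linarith
  · simp [basisOdd, realPer, vec, Fin.sum_univ_two]
    and_intros <;> linarith

theorem cast_elim (a b c d : ℤ) :
    (fun k => ((Sum.elim ![a, b] ![c, d] k : ℤ) : ℝ)) = vec a b c d := by
  funext k
  rcases k with k | k <;> fin_cases k <;> rfl

theorem zariskiClosureIsSp4_hyp {s : ℝ} (hs : 0 < s) (ht : Transitive hPerm vPermHyp) (i₀ : Fin 6) :
    ZariskiClosureIsSp4 (surf hs ht i₀) := by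
  have h1 := basisHyp.hasTransvection hs ht i₀ (by norm_num) isTransvectionHyp_inl_zero
  have h2 := basisHyp.hasTransvection hs ht i₀ (by norm_num) isTransvectionHyp_inr_zero
  have h3 := basisHyp.hasTransvection hs ht i₀ (by norm_num) isTransvectionHyp_inl_one
  have h4 := basisHyp.hasTransvection hs ht i₀ (by norm_num) isTransvectionHyp_inr_one
  rw [cast_elim] at h1 h2 h3 h4
  push_cast at h1 h2 h3 h4
  exact (periods hs ht i₀ spans_hyp).zariskiClosureIsSp4 (c := ((6 : ℤ) : ℝ)) (by norm_num)
    (basisHyp.cup_vector ht i₀) (basisHyp.vector_mem hs ht i₀ spans_hyp)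
    (fun _ hξ => basisHyp.exists_eq_sum hs ht i₀ spans_hyp isSpanning_hyp hξ) h1 h2 h3 h4
    (by norm_num) (by norm_num) (by norm_num) (by norm_num) (by norm_num) (by norm_num)
    (by norm_num) (by norm_num)

theorem zariskiClosureIsSp4_odd {s : ℝ} (hs : 0 < s) (ht : Transitive hPerm vPermOdd) (i₀ : Fin 6) :
    ZariskiClosureIsSp4 (surf hs ht i₀) := by
  have h1 := basisOdd.hasTransvection hs ht i₀ (by norm_num) isTransvectionOdd_inl_zero
  have h2 := basisOdd.hasTransvection hs ht i₀ (by norm_num) isTransvectionOdd_inr_zero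
  have h3 := basisOdd.hasTransvection hs ht i₀ (by norm_num) isTransvectionOdd_inl_one
  have h4 := basisOdd.hasTransvection hs ht i₀ (by norm_num) isTransvectionOdd_inr_one
  rw [cast_elim] at h1 h2 h3 h4
  push_cast at h1 h2 h3 h4
  exact (periods hs ht i₀ spans_odd).zariskiClosureIsSp4 (c := ((-36 : ℤ) : ℝ)) (by norm_num)
    (basisOdd.cup_vector ht i₀) (basisOdd.vector_mem hs ht i₀ spans_odd)
    (fun _ hξ => basisOdd.exists_eq_sum hs ht i₀ spans_odd isSpanning_odd hξ) h1 h2 h3 h4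
    (by norm_num) (by norm_num) (by norm_num) (by norm_num) (by norm_num) (by norm_num)
    (by norm_num) (by norm_num)

end Origami

namespace Origami

open Set AlexanderSpanier

variable {n : ℕ} {h v : Equiv.Perm (Fin n)} {s : ℝ}

/-! ### Half-turns -/

theorem pt_eq_pt_Ico {i j : Fin n} {a b c d : ℝ} (ha : a ∈ Ico (0 : ℝ) 1) (hb : b ∈ Ico (0 : ℝ) 1)
    (hc : c ∈ Ico (0 : ℝ) 1) (hd : d ∈ Ico (0 : ℝ) 1) (hab : ¬(a = 0 ∧ b = 0)) :
    (pt i a b : Surface h v) = pt j c d ↔ i = j ∧ a = c ∧ b = d := by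
  rw [pt_eq_pt_iff (Ico_subset_Icc_self ha) (Ico_subset_Icc_self hb) (Ico_subset_Icc_self hc)
    (Ico_subset_Icc_self hd), fract_of_mem_Ico ha, fract_of_mem_Ico hb, fract_of_mem_Ico hc,
    fract_of_mem_Ico hd]
  · simp [base, ha.2.ne, hb.2.ne, hc.2.ne, hd.2.ne]
  · rwa [fract_of_mem_Ico ha, fract_of_mem_Ico hb]

theorem one_sub_mem {a : ℝ} (ha : a ∈ Icc (0 : ℝ) 1) : 1 - a ∈ Icc (0 : ℝ) 1 :=
  ⟨by linarith [ha.2], by linarith [ha.1]⟩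

/-- A half-turn sends the lower left corner of `i` to the upper right corner of `σ i`, the lower
left corner of `v (h (σ i))`; this map of corners commutes with `comm h v`. -/
theorem minimalPeriod_rotate {σ : Equiv.Perm (Fin n)} (hh : ∀ i, h (σ (h i)) = σ i)
    (hv : ∀ i, v (σ (v i)) = σ i) (i : Fin n) :
    Function.minimalPeriod (comm h v) (v (h (σ i))) = Function.minimalPeriod (comm h v) i := by
  have hc : Function.Semiconj (fun i => v (h (σ i))) (comm h v) (comm h v) := by
    intro i
    obtain ⟨j, rfl⟩ : ∃ j, h (v j) = i := ⟨v.symm (h.symm i), by simp⟩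
    have h3 : ∀ j, σ (h j) = h.symm (σ j) := fun j => by
      rw [← hh j, Equiv.symm_apply_apply]
    have h4 : ∀ j, σ (v j) = v.symm (σ j) := fun j => by
      rw [← hv j, Equiv.symm_apply_apply]
    simp [comm, h3, h4]
  rw [Function.minimalPeriod_eq_minimalPeriod_iff]
  intro k
  rw [Function.IsPeriodicPt, Function.IsFixedPt, Function.IsPeriodicPt, Function.IsFixedPt,
    ← (hc.iterate_right k).eq]
  exact ((v.injective.comp h.injective).comp σ.injective).eq_iff

/-- The half-turn of every square, the squares being permuted by `σ`. -/
def rotateFun (σ : Equiv.Perm (Fin n)) (hh : ∀ i, h (σ (h i)) = σ i) (hv : ∀ i, v (σ (v i)) = σ i) :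
    Surface h v → Surface h v :=
  lift (fun i a b => pt (σ i) (1 - a) (1 - b))
    (fun i b _ => by rw [sub_self, sub_zero, pt_right, hh])
    (fun i a _ => by rw [sub_self, sub_zero, pt_top, hv])

section

variable {σ : Equiv.Perm (Fin n)} (hh : ∀ i, h (σ (h i)) = σ i) (hv : ∀ i, v (σ (v i)) = σ i)

theorem rotateFun_pt {i : Fin n} {a b : ℝ} (ha : a ∈ Icc (0 : ℝ) 1) (hb : b ∈ Icc (0 : ℝ) 1) :
    rotateFun σ hh hv (pt i a b) = pt (σ i) (1 - a) (1 - b) := by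
  rw [rotateFun, lift_pt _ _ _ ha hb]

theorem rotateFun_rotateFun (hσ : ∀ i, σ (σ i) = i) (p : Surface h v) :
    rotateFun σ hh hv (rotateFun σ hh hv p) = p := by
  obtain ⟨i, a, ha, b, hb, rfl⟩ := exists_pt p
  rw [rotateFun_pt hh hv ha hb, rotateFun_pt hh hv (one_sub_mem ha) (one_sub_mem hb), hσ,
    sub_sub_cancel, sub_sub_cancel]

theorem continuous_rotateFun : Continuous (rotateFun σ hh hv) :=
  continuous_lift _ _ _ fun i =>
    ((continuous_pt (σ i)).comp (f := fun z : ℝ × ℝ => (1 - z.1, 1 - z.2))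
      (by fun_prop)).continuousOn

/-- The half-turn as a homeomorphism. -/
def rotate (hσ : ∀ i, σ (σ i) = i) : Surface h v ≃ₜ Surface h v where
  toFun := rotateFun σ hh hv
  invFun := rotateFun σ hh hv
  left_inv := rotateFun_rotateFun hh hv hσ
  right_inv := rotateFun_rotateFun hh hv hσ
  continuous_toFun := continuous_rotateFun hh hv
  continuous_invFun := continuous_rotateFun hh hv

theorem isAffine_rotateFun (hs : 0 < s) : IsAffine hs (rotateFun σ hh hv) (-LinearMap.id) := by
  refine isAffine_of_squares (fun p => ?_) ?_
  · obtain ⟨i, a, ha, b, hb, rfl⟩ := exists_pt_Ico p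
    rw [rotateFun_pt hh hv (Ico_subset_Icc_self ha) (Ico_subset_Icc_self hb)]
    have side : ∀ {c : ℝ}, c ∈ Ico (0 : ℝ) 1 → c ≠ 0 → 1 - c ∈ Ico (0 : ℝ) 1 ∧ 1 - c ≠ 0 :=
      fun hc h0 => ⟨⟨by linarith [hc.2], by linarith [lt_of_le_of_ne hc.1 h0.symm]⟩,
        by linarith [hc.2]⟩
    by_cases ha0 : a = 0 <;> by_cases hb0 : b = 0
    · subst ha0 hb0
      rw [sub_zero, pt_right, pt_top, mult_vertex, mult_vertex, minimalPeriod_rotate hh hv]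
    · subst ha0
      rw [sub_zero, pt_right, mult_of_ne (by simp) (side hb hb0).1 fun k => (side hb hb0).2 k.2,
        mult_of_ne ha hb fun k => hb0 k.2]
    · subst hb0
      rw [sub_zero, pt_top, mult_of_ne (side ha ha0).1 (by simp) fun k => (side ha ha0).2 k.1,
        mult_of_ne ha hb fun k => ha0 k.1]
    · rw [mult_of_ne (side ha ha0).1 (side hb hb0).1 fun k => (side ha ha0).2 k.1,
        mult_of_ne ha hb fun k => ha0 k.1]
  · intro j a ha b hb
    have c : ContinuousAt (fun z : ℝ × ℝ => (1 - z.1, 1 - z.2)) (a, b) := by fun_prop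
    filter_upwards [c.eventually (prim_pt (h := h) (v := v) hs (j := σ j) (one_sub_mem ha)
      (one_sub_mem hb))] with z hz hz'
    rw [rotateFun_pt hh hv ha hb, rotateFun_pt hh hv hz'.1 hz'.2,
      hz ⟨one_sub_mem hz'.1, one_sub_mem hz'.2⟩]
    apply Complex.ext <;> simp <;> ring

/-- Fixed points of a half-turn are centres of squares, midpoints of edges or vertices. -/
theorem rotateFun_eq_self_iff (i : Fin n) {a b : ℝ} (ha : a ∈ Ico (0 : ℝ) 1)
    (hb : b ∈ Ico (0 : ℝ) 1) : rotateFun σ hh hv (pt i a b) = pt i a b ↔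
      (a = 1 / 2 ∧ b = 1 / 2 ∧ σ i = i) ∨ (a = 0 ∧ b = 1 / 2 ∧ h (σ i) = i) ∨
      (a = 1 / 2 ∧ b = 0 ∧ v (σ i) = i) ∨
      (a = 0 ∧ b = 0 ∧ (comm h v).SameCycle (v (h (σ i))) i) := by
  rw [rotateFun_pt hh hv (Ico_subset_Icc_self ha) (Ico_subset_Icc_self hb)]
  have side : ∀ {c : ℝ}, c ∈ Ico (0 : ℝ) 1 → c ≠ 0 → 1 - c ∈ Ico (0 : ℝ) 1 ∧ 1 - c ≠ 0 :=
    fun hc h0 => ⟨⟨by linarith [hc.2], by linarith [lt_of_le_of_ne hc.1 h0.symm]⟩,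
      by linarith [hc.2]⟩
  have half : ∀ {c : ℝ}, 1 - c = c ↔ c = 1 / 2 := fun {c} =>
    ⟨fun e => by linarith, fun e => by linarith⟩
  by_cases ha0 : a = 0 <;> by_cases hb0 : b = 0
  · subst ha0 hb0
    rw [sub_zero, pt_right, pt_top, pt_vertex_iff]
    norm_num
  · subst ha0
    rw [sub_zero, pt_right, pt_eq_pt_Ico (by simp) (side hb hb0).1 ha hb
      fun k => (side hb hb0).2 k.2, half]
    simp [hb0, and_comm]
  · subst hb0
    rw [sub_zero, pt_top, pt_eq_pt_Ico (side ha ha0).1 (by simp) ha hb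
      fun k => (side ha ha0).2 k.1, half]
    simp [ha0, and_comm]
  · rw [pt_eq_pt_Ico (side ha ha0).1 (side hb hb0).1 ha hb fun k => (side ha ha0).2 k.1, half, half]
    simp [ha0, hb0]
    tauto

end

/-! ### The hyperelliptic surface -/

theorem transitive_hyp : Transitive hPerm vPermHyp := by
  intro P hh hv
  simp [forall_fin_six, hPerm_apply] at hh
  simp [forall_fin_six, vPermHyp_apply] at hv
  have h1 : P 1 ↔ P 0 := hv.1
  have h2 : P 2 ↔ P 0 := hh.1.trans h1
  have h3 : P 3 ↔ P 0 := hv.2.2.1.trans h2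
  have h4 : P 4 ↔ P 0 := hh.2.2.1.trans h3
  have h5 : P 5 ↔ P 0 := hh.2.2.2.1.trans h4
  have key : ∀ i, P i ↔ P 0 := forall_fin_six.2 ⟨Iff.rfl, h1, h2, h3, h4, h5⟩
  intro i j hi
  rwa [key, ← key i]

theorem sameCycle_of_pow {g : Equiv.Perm (Fin n)} {i j : Fin n} (k : ℕ) (e : (g ^ k) i = j) :
    g.SameCycle i j := ⟨k, by simpa using e⟩

theorem not_sameCycle_of_fixed {g : Equiv.Perm (Fin n)} {i j : Fin n} (hj : g j = j) (hij : i ≠ j) :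
    ¬g.SameCycle i j := fun H => hij ((Equiv.Perm.SameCycle.eq_of_right H hj))

theorem minimalPeriod_hyp : Function.minimalPeriod (comm hPerm vPermHyp) 0 = 5 := by
  have : Fact (Nat.Prime 5) := ⟨by norm_num⟩
  refine Function.minimalPeriod_eq_prime ?_ ?_
  · change (comm hPerm vPermHyp)^[5] 0 = 0
    decide +kernel
  · change comm hPerm vPermHyp 0 ≠ 0
    decide

theorem sameCycle_hyp : ∀ j, j ≠ 5 → (comm hPerm vPermHyp).SameCycle 0 j := by
  refine forall_fin_six.2 ⟨fun _ => .refl _ _, fun _ => sameCycle_of_pow 3 (by decide +kernel),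
    fun _ => sameCycle_of_pow 2 (by decide +kernel), fun _ => sameCycle_of_pow 1 (by decide +kernel),
    fun _ => sameCycle_of_pow 4 (by decide +kernel), fun e => absurd rfl e⟩

theorem inH4_hyp (hs : 0 < s) : (surf hs transitive_hyp 0).InH4 := by
  refine inH4_surf hs transitive_hyp 0 minimalPeriod_hyp fun j => ?_
  by_cases hj : j = 5
  · subst hj
    exact Or.inr (by decide)
  · exact Or.inl (sameCycle_hyp j hj)

theorem rotate_hPerm : ∀ i, hPerm (Equiv.swap 4 5 (hPerm i)) = Equiv.swap 4 5 i := by decide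

theorem rotate_vPermHyp : ∀ i, vPermHyp (Equiv.swap 4 5 (vPermHyp i)) = Equiv.swap 4 5 i := by decide

/-- The exchange of the squares `4` and `5` fixes the other four centres. It leaves two midpoints of
vertical edges and none of horizontal edges, and preserves both vertices. -/
theorem fixedPoints_hyp :
    {p : Surface hPerm vPermHyp | rotateFun (Equiv.swap 4 5) rotate_hPerm rotate_vPermHyp p = p} =
      (fun i : Fin 6 => pt i (1 / 2) (1 / 2)) '' ({0, 1, 2, 3} : Finset (Fin 6)) ∪
      (fun i : Fin 6 => pt i 0 (1 / 2)) '' ({0, 5} : Finset (Fin 6)) ∪ {pt 0 0 0, pt 5 0 0} := by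
  have e1 : ∀ i : Fin 6, Equiv.swap 4 5 i = i ↔ i ∈ ({0, 1, 2, 3} : Finset (Fin 6)) := by decide
  have e2 : ∀ i : Fin 6, hPerm (Equiv.swap 4 5 i) = i ↔ i ∈ ({0, 5} : Finset (Fin 6)) := by decide
  have e3 : ∀ i : Fin 6, vPermHyp (Equiv.swap 4 5 i) ≠ i := by decide
  have e4 : ∀ i : Fin 6, (comm hPerm vPermHyp).SameCycle (vPermHyp (hPerm (Equiv.swap 4 5 i))) i := by
    intro i
    by_cases hi : i = 5
    · subst hi
      exact ⟨0, by decide⟩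
    · refine (sameCycle_hyp _ ?_).symm.trans (sameCycle_hyp _ hi)
      revert i
      decide
  ext p
  obtain ⟨i, a, ha, b, hb, rfl⟩ := exists_pt_Ico p
  rw [mem_ofPred_eq, rotateFun_eq_self_iff _ _ i ha hb, e1, e2]
  simp only [e3, and_false, false_or, e4, and_true]
  constructor
  · rintro (⟨rfl, rfl, hi⟩ | ⟨rfl, rfl, hi⟩ | ⟨rfl, rfl⟩)
    · exact Or.inl (Or.inl ⟨i, hi, rfl⟩)
    · exact Or.inl (Or.inr ⟨i, hi, rfl⟩)
    · by_cases hi : i = 5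
      · exact Or.inr (Or.inr (by rw [hi]; rfl))
      · exact Or.inr (Or.inl (pt_vertex_iff.2 (sameCycle_hyp i hi).symm))
  · have m : (1 / 2 : ℝ) ∈ Ico (0 : ℝ) 1 := ⟨by norm_num, by norm_num⟩
    have z : (0 : ℝ) ∈ Ico (0 : ℝ) 1 := by simp
    have vert : ∀ j : Fin 6, (pt i a b : Surface hPerm vPermHyp) = pt j 0 0 → a = 0 ∧ b = 0 := by
      intro j e
      by_contra hab
      rw [pt_eq_pt_Ico ha hb z z hab] at e
      exact hab e.2
    rintro ((⟨j, hj, e⟩ | ⟨j, hj, e⟩) | e | e)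
    · obtain ⟨rfl, rfl, rfl⟩ := (pt_eq_pt_Ico m m ha hb (by norm_num)).1 e
      exact Or.inl ⟨rfl, rfl, hj⟩
    · obtain ⟨rfl, rfl, rfl⟩ := (pt_eq_pt_Ico z m ha hb (by norm_num)).1 e
      exact Or.inr (Or.inl ⟨rfl, rfl, hj⟩)
    · exact Or.inr (Or.inr (vert 0 e))
    · exact Or.inr (Or.inr (vert 5 e))

theorem ncard_fixedPoints_hyp :
    {p : Surface hPerm vPermHyp |
      rotateFun (Equiv.swap 4 5) rotate_hPerm rotate_vPermHyp p = p}.ncard = 8 := by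
  have m : (1 / 2 : ℝ) ∈ Ico (0 : ℝ) 1 := ⟨by norm_num, by norm_num⟩
  have z : (0 : ℝ) ∈ Ico (0 : ℝ) 1 := by simp
  rw [fixedPoints_hyp, ncard_union_eq, ncard_union_eq, ncard_image_of_injective,
    ncard_image_of_injective, ncard_coe_finset, ncard_coe_finset, ncard_pair]
  · rfl
  · rw [Ne, pt_vertex_iff]
    exact not_sameCycle_of_fixed (by decide) (by decide)
  · intro i j e
    exact ((pt_eq_pt_Ico z m z m (by norm_num)).1 e).1
  · intro i j e
    exact ((pt_eq_pt_Ico m m m m (by norm_num)).1 e).1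
  · rw [Set.disjoint_left]
    rintro _ ⟨i, -, rfl⟩ ⟨j, -, e⟩
    have := (pt_eq_pt_Ico z m m m (by norm_num)).1 e
    norm_num at this
  · rw [Set.disjoint_left]
    rintro _ (⟨i, -, rfl⟩ | ⟨i, -, rfl⟩) (e | e)
    · have := (pt_eq_pt_Ico m m z z (by norm_num)).1 e
      norm_num at this
    · have := (pt_eq_pt_Ico m m z z (by norm_num)).1 e
      norm_num at this
    · have := (pt_eq_pt_Ico z m z z (by norm_num)).1 e
      norm_num at this
    · have := (pt_eq_pt_Ico z m z z (by norm_num)).1 e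
      norm_num at this

theorem inH4Hyp (hs : 0 < s) : (surf hs transitive_hyp 0).InH4Hyp := by
  refine ⟨inH4_hyp hs, rotate rotate_hPerm rotate_vPermHyp (σ := Equiv.swap 4 5) (by decide),
    ⟨fun p => ?_, fun p => ?_⟩, rotateFun_rotateFun rotate_hPerm rotate_vPermHyp (by decide), ncard_fixedPoints_hyp⟩
  · exact iff_of_eq (congrArg (fun m => m - 1 = 0)
      ((isAffine_rotateFun rotate_hPerm rotate_vPermHyp hs).1 p))
  · filter_upwards [(isAffine_rotateFun rotate_hPerm rotate_vPermHyp hs).2 p] with x hx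
    exact (surf_primitive hs _ 0 _ _).trans (hx.trans
      (congrArg (-LinearMap.id : ℂ →ₗ[ℝ] ℂ) (surf_primitive hs _ 0 p x).symm))

end Origami

namespace Origami

open Set

variable {n : ℕ} {h v : Equiv.Perm (Fin n)} {s : ℝ}

/-! ### Functions given on unit intervals -/

theorem mem_Icc_floor (T : ℝ) : T ∈ Icc (⌊T⌋ : ℝ) (⌊T⌋ + 1) :=
  ⟨Int.floor_le T, (Int.lt_floor_add_one T).le⟩

theorem mem_Icc_ceil (T : ℝ) : T ∈ Icc ((⌈T⌉ - 1 : ℤ) : ℝ) ((⌈T⌉ - 1 : ℤ) + 1) :=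
  ⟨by push_cast; linarith [Int.ceil_lt_add_one T], by push_cast; linarith [Int.le_ceil T]⟩

theorem Icc_floor_mem (T : ℝ) : Icc (⌊T⌋ : ℝ) (⌊T⌋ + 1) ∈ 𝓝[Ici T] T := by
  filter_upwards [self_mem_nhdsWithin, nhdsWithin_le_nhds (Iio_mem_nhds (Int.lt_floor_add_one T))]
    with S h1 h2
  exact ⟨(Int.floor_le T).trans h1, le_of_lt h2⟩

theorem Icc_ceil_mem (T : ℝ) : Icc ((⌈T⌉ - 1 : ℤ) : ℝ) ((⌈T⌉ - 1 : ℤ) + 1) ∈ 𝓝[Iic T] T := by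
  filter_upwards [self_mem_nhdsWithin, nhdsWithin_le_nhds (Ioi_mem_nhds
    (by push_cast; linarith [Int.ceil_lt_add_one T] : ((⌈T⌉ - 1 : ℤ) : ℝ) < T))] with S h1 h2
  refine ⟨le_of_lt h2, ?_⟩
  push_cast
  linarith [Int.le_ceil T, show S ≤ T from h1]

/-- At an integer the two adjacent intervals supply continuity from the left and from the right. -/
theorem continuous_of_pieces {Y : Type*} [TopologicalSpace Y] {F : ℝ → Y}
    (H : ∀ m : ℤ, ContinuousOn F (Icc (m : ℝ) (m + 1))) : Continuous F := by
  refine continuous_iff_continuousAt.2 fun T => ?_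
  rw [← continuousWithinAt_univ, ← Iic_union_Ici (a := T)]
  exact (((H _) T (mem_Icc_ceil T)).mono_of_mem_nhdsWithin (Icc_ceil_mem T)).union
    (((H _) T (mem_Icc_floor T)).mono_of_mem_nhdsWithin (Icc_floor_mem T))

theorem hasDerivAt_of_pieces {F : ℝ → ℂ} {w : ℂ} {T : ℝ}
    (H : ∀ m : ℤ, T ∈ Icc (m : ℝ) (m + 1) → HasDerivWithinAt F w (Icc (m : ℝ) (m + 1)) T) :
    HasDerivAt F w T := by
  rw [← hasDerivWithinAt_univ, ← Iic_union_Ici (a := T)]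
  exact ((H _ (mem_Icc_ceil T)).mono_of_mem_nhdsWithin (Icc_ceil_mem T)).union
    ((H _ (mem_Icc_floor T)).mono_of_mem_nhdsWithin (Icc_floor_mem T))

/-! ### Arcs through the cells of a subdivision

Every square is subdivided into nine cells of side `1 / 3`, whose centres have coordinates `c / 6`
with `c = 1, 3, 5`.  An arc joins the midpoints of two edges of a cell. -/

/-- A coordinate of an arc through a cell. -/
def pos (c d d' : ℤ) (τ : ℝ) : ℝ := (c - (1 - τ) ^ 2 * d + τ ^ 2 * d') / 6

/-- The derivative of a coordinate of an arc. -/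
def spd (d d' : ℤ) (τ : ℝ) : ℝ := ((1 - τ) * d + τ * d') / 3

theorem pos_zero (c d d' : ℤ) : pos c d d' 0 = ((c - d : ℤ) : ℝ) / 6 := by simp [pos]

theorem pos_one (c d d' : ℤ) : pos c d d' 1 = ((c + d' : ℤ) : ℝ) / 6 := by simp [pos]

theorem hasDerivAt_pos (c d d' : ℤ) (τ : ℝ) : HasDerivAt (pos c d d') (spd d d' τ) τ := by
  have h1 : HasDerivAt (fun τ : ℝ => 1 - τ) (-1) τ := (hasDerivAt_id τ).const_sub 1
  have := ((((hasDerivAt_const τ (c : ℝ)).sub ((h1.pow 2).mul_const (d : ℝ))).add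
    (((hasDerivAt_id τ).pow 2).mul_const (d' : ℝ))).div_const 6)
  refine this.congr_deriv ?_
  simp [spd]
  ring

theorem continuous_pos (c d d' : ℤ) : Continuous (pos c d d') := by
  unfold pos
  fun_prop

theorem abs_offset {d d' : ℤ} (hd : |d| ≤ 1) (hd' : |d'| ≤ 1) (τ : ℝ) :
    |-(1 - τ) ^ 2 * d + τ ^ 2 * d'| ≤ (1 - τ) ^ 2 + τ ^ 2 := by
  have h1 : |(d : ℝ)| ≤ 1 := by exact_mod_cast hd
  have h2 : |(d' : ℝ)| ≤ 1 := by exact_mod_cast hd'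
  refine (abs_add_le _ _).trans (add_le_add ?_ ?_)
  · rw [abs_mul, abs_neg, abs_of_nonneg (sq_nonneg _)]
    exact mul_le_of_le_one_right (sq_nonneg _) h1
  · rw [abs_mul, abs_of_nonneg (sq_nonneg _)]
    exact mul_le_of_le_one_right (sq_nonneg _) h2

theorem pos_mem_Icc {c d d' : ℤ} (hc : c = 1 ∨ c = 3 ∨ c = 5) (hd : |d| ≤ 1) (hd' : |d'| ≤ 1)
    {τ : ℝ} (hτ : τ ∈ Icc (0 : ℝ) 1) : pos c d d' τ ∈ Icc (0 : ℝ) 1 := by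
  have h1 := abs_le.1 (abs_offset hd hd' τ)
  have h2 : (1 : ℝ) ≤ c ∧ (c : ℝ) ≤ 5 := by rcases hc with rfl | rfl | rfl <;> norm_num
  have h3 : 0 ≤ τ * (1 - τ) := mul_nonneg hτ.1 (by linarith [hτ.2])
  constructor
  · unfold pos
    rw [le_div_iff₀ (by norm_num)]
    nlinarith
  · unfold pos
    rw [div_le_iff₀ (by norm_num)]
    nlinarith

/-- The interior of an arc stays in the open cell: the offset is at most `(1 - τ)² + τ²`, which is
below one. -/
theorem abs_pos_sub {c d d' : ℤ} (hd : |d| ≤ 1) (hd' : |d'| ≤ 1) {τ : ℝ} (hτ : τ ∈ Ioo (0 : ℝ) 1) :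
    |6 * pos c d d' τ - c| < 1 := by
  have h1 := abs_offset hd hd' τ
  have h3 : 0 < τ * (1 - τ) := mul_pos hτ.1 (by linarith [hτ.2])
  have e : 6 * pos c d d' τ - c = -(1 - τ) ^ 2 * d + τ ^ 2 * d' := by
    unfold pos
    ring
  rw [e]
  nlinarith

theorem pos_mem_Ioo {c d d' : ℤ} (hc : c = 1 ∨ c = 3 ∨ c = 5) (hd : |d| ≤ 1) (hd' : |d'| ≤ 1)
    {τ : ℝ} (hτ : τ ∈ Ioo (0 : ℝ) 1) : pos c d d' τ ∈ Ioo (0 : ℝ) 1 := by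
  have h1 := abs_lt.1 (abs_pos_sub (c := c) hd hd' hτ)
  have h2 : (1 : ℝ) ≤ c ∧ (c : ℝ) ≤ 5 := by rcases hc with rfl | rfl | rfl <;> norm_num
  constructor <;> linarith

/-- Normal form of the lattice point with coordinates `A / 6`, `B / 6` in the `i`-th square. -/
def node (h v : Equiv.Perm (Fin n)) (i : Fin n) (A B : ℤ) : Fin n × ℤ × ℤ :=
  ((if B = 6 then v else 1) ((if A = 6 then h else 1) i), A % 6, B % 6)

theorem fract_div_six (A : ℤ) : Int.fract ((A : ℝ) / 6) = ((A % 6 : ℤ) : ℝ) / 6 := by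
  rw [Int.fract_eq_iff]
  have h1 : 0 ≤ A % 6 := Int.emod_nonneg _ (by norm_num)
  have h2 : A % 6 < 6 := Int.emod_lt_of_pos _ (by norm_num)
  refine ⟨div_nonneg (by exact_mod_cast h1) (by norm_num), ?_, A / 6, ?_⟩
  · rw [div_lt_one (by norm_num)]
    exact_mod_cast h2
  · have : (A : ℝ) = ((6 * (A / 6) + A % 6 : ℤ) : ℝ) := by rw [Int.mul_ediv_add_emod]
    rw [this]
    push_cast
    ring

theorem div_six_mem {A : ℤ} (hA : 0 ≤ A ∧ A ≤ 6) : (A : ℝ) / 6 ∈ Icc (0 : ℝ) 1 :=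
  ⟨div_nonneg (by exact_mod_cast hA.1) (by norm_num), by
    rw [div_le_one (by norm_num)]
    exact_mod_cast hA.2⟩

/-- Equality of such points becomes decidable integer data, so incidences of curves can be computed.
-/
theorem pt_eq_pt_node {i j : Fin n} {A B A' B' : ℤ} (hA : 0 ≤ A ∧ A ≤ 6) (hB : 0 ≤ B ∧ B ≤ 6)
    (hA' : 0 ≤ A' ∧ A' ≤ 6) (hB' : 0 ≤ B' ∧ B' ≤ 6) (hv : ¬(A % 6 = 0 ∧ B % 6 = 0)) :
    (pt i (A / 6) (B / 6) : Surface h v) = pt j (A' / 6) (B' / 6) ↔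
      node h v i A B = node h v j A' B' := by
  have one : ∀ A : ℤ, (A : ℝ) / 6 = 1 ↔ A = 6 := fun A => by
    rw [div_eq_one_iff_eq (by norm_num)]
    exact_mod_cast Iff.rfl
  have div : ∀ A B : ℤ, (A : ℝ) / 6 = (B : ℝ) / 6 ↔ A = B := fun A B => by
    rw [div_left_inj' (by norm_num)]
    exact_mod_cast Iff.rfl
  rw [pt_eq_pt_iff (div_six_mem hA) (div_six_mem hB) (div_six_mem hA') (div_six_mem hB')]
  · simp only [fract_div_six, div, base, one, node, Prod.mk.injEq]
  · simpa only [fract_div_six, div_eq_zero_iff, Int.cast_eq_zero, OfNat.ofNat_ne_zero,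
      or_false] using hv

/-! ### Closed curves through cells -/

/-- A closed curve through the cells of the subdivided squares: the `m`-th cell lies in the square
`sq m`, has centre `(cx m / 6, cy m / 6)`, and is entered in the direction `(dx m, dy m)`. -/
structure Track (h v : Equiv.Perm (Fin n)) where
  len : ℕ
  [ne : NeZero len]
  sq : ZMod len → Fin n
  cx : ZMod len → ℤ
  cy : ZMod len → ℤ
  dx : ZMod len → ℤ
  dy : ZMod len → ℤ
  cx_odd : ∀ m, cx m = 1 ∨ cx m = 3 ∨ cx m = 5
  cy_odd : ∀ m, cy m = 1 ∨ cy m = 3 ∨ cy m = 5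
  unit : ∀ m, (|dx m| = 1 ∧ dy m = 0) ∨ (dx m = 0 ∧ |dy m| = 1)
  forward : ∀ m, 0 ≤ dx m * dx (m + 1) + dy m * dy (m + 1)
  glue : ∀ m, node h v (sq m) (cx m + dx (m + 1)) (cy m + dy (m + 1)) =
    node h v (sq (m + 1)) (cx (m + 1) - dx (m + 1)) (cy (m + 1) - dy (m + 1))
  cell_inj : ∀ m m', sq m = sq m' → cx m = cx m' → cy m = cy m' → m = m'
  entry_inj : ∀ m m', node h v (sq m) (cx m - dx m) (cy m - dy m) =
    node h v (sq m') (cx m' - dx m') (cy m' - dy m') → m = m'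

namespace Track

attribute [instance] ne

variable (P Q : Track h v)

theorem abs_dx (m : ZMod P.len) : |P.dx m| ≤ 1 := by
  rcases P.unit m with h1 | h1
  · exact h1.1.le
  · simp [h1.1]

theorem abs_dy (m : ZMod P.len) : |P.dy m| ≤ 1 := by
  rcases P.unit m with h1 | h1
  · simp [h1.2]
  · exact h1.2.le

/-- Horizontal coordinate in the `m`-th cell. -/
def posX (m : ZMod P.len) : ℝ → ℝ := pos (P.cx m) (P.dx m) (P.dx (m + 1))

/-- Vertical coordinate in the `m`-th cell. -/
def posY (m : ZMod P.len) : ℝ → ℝ := pos (P.cy m) (P.dy m) (P.dy (m + 1))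

theorem posX_mem (m : ZMod P.len) {τ : ℝ} (hτ : τ ∈ Icc (0 : ℝ) 1) : P.posX m τ ∈ Icc (0 : ℝ) 1 :=
  pos_mem_Icc (P.cx_odd m) (P.abs_dx m) (P.abs_dx _) hτ

theorem posY_mem (m : ZMod P.len) {τ : ℝ} (hτ : τ ∈ Icc (0 : ℝ) 1) : P.posY m τ ∈ Icc (0 : ℝ) 1 :=
  pos_mem_Icc (P.cy_odd m) (P.abs_dy m) (P.abs_dy _) hτ

/-- The curve, with one unit of time for each cell. -/
def point (T : ℝ) : Surface h v :=
  pt (P.sq (⌊T⌋ : ℤ)) (P.posX (⌊T⌋ : ℤ) (Int.fract T)) (P.posY (⌊T⌋ : ℤ) (Int.fract T))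

theorem entry_mem (m : ZMod P.len) : (0 ≤ P.cx m - P.dx m ∧ P.cx m - P.dx m ≤ 6) ∧
    (0 ≤ P.cy m - P.dy m ∧ P.cy m - P.dy m ≤ 6) := by
  have h1 := abs_le.1 (P.abs_dx m)
  have h2 := abs_le.1 (P.abs_dy m)
  have h3 := P.cx_odd m
  have h4 := P.cy_odd m
  lia

theorem exit_mem (m : ZMod P.len) : (0 ≤ P.cx m + P.dx (m + 1) ∧ P.cx m + P.dx (m + 1) ≤ 6) ∧
    (0 ≤ P.cy m + P.dy (m + 1) ∧ P.cy m + P.dy (m + 1) ≤ 6) := by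
  have h1 := abs_le.1 (P.abs_dx (m + 1))
  have h2 := abs_le.1 (P.abs_dy (m + 1))
  have h3 := P.cx_odd m
  have h4 := P.cy_odd m
  lia

theorem entry_ne (m : ZMod P.len) :
    ¬((P.cx m - P.dx m) % 6 = 0 ∧ (P.cy m - P.dy m) % 6 = 0) := by
  have h3 := P.cx_odd m
  have h4 := P.cy_odd m
  rcases P.unit m with h1 | h1 <;> lia

theorem exit_ne (m : ZMod P.len) :
    ¬((P.cx m + P.dx (m + 1)) % 6 = 0 ∧ (P.cy m + P.dy (m + 1)) % 6 = 0) := by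
  have h3 := P.cx_odd m
  have h4 := P.cy_odd m
  rcases P.unit (m + 1) with h1 | h1 <;> lia

theorem pt_exit (m : ZMod P.len) : (pt (P.sq m) (P.posX m 1) (P.posY m 1) : Surface h v) =
    pt (P.sq (m + 1)) (P.posX (m + 1) 0) (P.posY (m + 1) 0) := by
  simp only [posX, posY, pos_zero, pos_one]
  exact (pt_eq_pt_node (P.exit_mem m).1 (P.exit_mem m).2 (P.entry_mem _).1 (P.entry_mem _).2
    (P.exit_ne m)).2 (P.glue m)

theorem floor_fract_cases {T : ℝ} {m : ℤ} (hT : T ∈ Icc (m : ℝ) (m + 1)) :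
    (⌊T⌋ = m ∧ Int.fract T = T - m) ∨ (⌊T⌋ = m + 1 ∧ Int.fract T = 0 ∧ T - m = 1) := by
  rcases hT.2.lt_or_eq with h1 | h1
  · have : ⌊T⌋ = m := Int.floor_eq_iff.2 ⟨hT.1, h1⟩
    exact Or.inl ⟨this, by rw [Int.fract, this]⟩
  · have : ⌊T⌋ = m + 1 := by
      rw [h1]
      exact_mod_cast Int.floor_intCast (m + 1)
    refine Or.inr ⟨this, ?_, by rw [h1]; ring⟩
    rw [Int.fract, this, h1]
    push_cast
    ring

theorem point_eq {T : ℝ} {m : ℤ} (hT : T ∈ Icc (m : ℝ) (m + 1)) :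
    P.point T = pt (P.sq m) (P.posX m (T - m)) (P.posY m (T - m)) := by
  unfold point
  rcases floor_fract_cases hT with ⟨h1, h2⟩ | ⟨h1, h2, h3⟩
  · rw [h1, h2]
  · rw [h1, h2, h3, Int.cast_add, Int.cast_one, pt_exit]

theorem sub_mem {T : ℝ} {m : ℤ} (hT : T ∈ Icc (m : ℝ) (m + 1)) : T - m ∈ Icc (0 : ℝ) 1 :=
  ⟨by linarith [hT.1], by linarith [hT.2]⟩

theorem continuous_point : Continuous P.point := by
  refine continuous_of_pieces fun m => ContinuousOn.congr ?_ fun T hT => P.point_eq hT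
  refine Continuous.continuousOn ?_
  exact (continuous_pt (P.sq m)).comp (f := fun T : ℝ => (P.posX m (T - m), P.posY m (T - m)))
    (((continuous_pos _ _ _).comp (continuous_sub_right _)).prodMk
      ((continuous_pos _ _ _).comp (continuous_sub_right _)))

theorem point_add_len (T : ℝ) : P.point (T + P.len) = P.point T := by
  unfold point
  rw [Int.floor_add_natCast, Int.fract_add_natCast]
  simp

/-- Velocity in the `m`-th cell. -/
def cellVel (m : ZMod P.len) (τ : ℝ) : ℂ :=
  spd (P.dx m) (P.dx (m + 1)) τ + spd (P.dy m) (P.dy (m + 1)) τ * Complex.I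

/-- Velocity of the curve, in squares of side one. -/
def speed (T : ℝ) : ℂ := P.cellVel (⌊T⌋ : ℤ) (Int.fract T)

theorem speed_eq {T : ℝ} {m : ℤ} (hT : T ∈ Icc (m : ℝ) (m + 1)) :
    P.speed T = P.cellVel m (T - m) := by
  unfold speed
  rcases floor_fract_cases hT with ⟨h1, h2⟩ | ⟨h1, h2, h3⟩
  · rw [h1, h2]
  · rw [h1, h2, h3]
    simp [cellVel, spd]

theorem continuous_cellVel (m : ZMod P.len) : Continuous (P.cellVel m) := by
  unfold cellVel spd
  fun_prop

theorem continuous_speed : Continuous P.speed :=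
  continuous_of_pieces fun m => ContinuousOn.congr
    ((P.continuous_cellVel m).comp (continuous_sub_right (m : ℝ))).continuousOn
    fun _ hT => P.speed_eq hT

theorem inner_nonneg (m : ZMod P.len) :
    (0 : ℝ) ≤ P.dx m * P.dx (m + 1) + P.dy m * P.dy (m + 1) := by
  exact_mod_cast P.forward m

theorem norm_sq (m : ZMod P.len) : (P.dx m : ℝ) ^ 2 + (P.dy m : ℝ) ^ 2 = 1 := by
  have : P.dx m ^ 2 + P.dy m ^ 2 = 1 := by
    rcases P.unit m with ⟨h1, h2⟩ | ⟨h1, h2⟩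
    · rw [h2, ← sq_abs, h1]
      norm_num
    · rw [h1, ← sq_abs (P.dy m), h2]
      norm_num
  exact_mod_cast this

/-- The velocity interpolates linearly between two unit vectors, and `forward` excludes opposite
ones. -/
theorem cellVel_ne_zero (m : ZMod P.len) {τ : ℝ} (hτ : τ ∈ Icc (0 : ℝ) 1) : P.cellVel m τ ≠ 0 := by
  intro e
  have e1 := congrArg Complex.re e
  have e2 := congrArg Complex.im e
  simp only [cellVel, spd, Complex.add_re, Complex.add_im, Complex.mul_re, Complex.mul_im,
    Complex.ofReal_re, Complex.ofReal_im, Complex.I_re, Complex.I_im, Complex.zero_re,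
    Complex.zero_im] at e1 e2
  have h1 := P.norm_sq m
  have h2 := P.norm_sq (m + 1)
  have h3 := P.inner_nonneg m
  have h4 : 0 ≤ τ * (1 - τ) := mul_nonneg hτ.1 (by linarith [hτ.2])
  have h5 := mul_nonneg h4 h3
  have a1 : (1 - τ) * P.dx m + τ * P.dx (m + 1) = 0 := by linarith
  have a2 : (1 - τ) * P.dy m + τ * P.dy (m + 1) = 0 := by linarith
  have key : (1 - τ) ^ 2 + τ ^ 2 + 2 * (τ * (1 - τ) *
      (P.dx m * P.dx (m + 1) + P.dy m * P.dy (m + 1))) = 0 := by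
    linear_combination ((1 - τ) * P.dx m + τ * P.dx (m + 1)) * a1 +
      ((1 - τ) * P.dy m + τ * P.dy (m + 1)) * a2 - (1 - τ) ^ 2 * h1 - τ ^ 2 * h2
  nlinarith [sq_nonneg (2 * τ - 1)]

theorem fract_mem (T : ℝ) : Int.fract T ∈ Icc (0 : ℝ) 1 :=
  ⟨Int.fract_nonneg T, (Int.fract_lt_one T).le⟩

theorem speed_ne_zero (T : ℝ) : P.speed T ≠ 0 := P.cellVel_ne_zero _ (fract_mem T)

theorem hasDerivAt_prim (hs : 0 < s) (T : ℝ) :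
    HasDerivAt (fun S => prim hs (P.point T) (P.point S)) (s * P.speed T) T := by
  refine hasDerivAt_of_pieces fun m hT => ?_
  have hX := P.posX_mem m (sub_mem hT)
  have hY := P.posY_mem m (sub_mem hT)
  rw [P.speed_eq hT]
  have dX : HasDerivAt (fun S : ℝ => P.posX m (S - m)) (spd (P.dx m) (P.dx (m + 1)) (T - m)) T :=
    (hasDerivAt_pos _ _ _ (T - m)).comp_sub_const T m
  have dY : HasDerivAt (fun S : ℝ => P.posY m (S - m)) (spd (P.dy m) (P.dy (m + 1)) (T - m)) T :=
    (hasDerivAt_pos _ _ _ (T - m)).comp_sub_const T m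
  have d : HasDerivAt (fun S : ℝ => (s : ℂ) * (((P.posX m (S - m) - P.posX m (T - m) : ℝ) : ℂ) +
      ((P.posY m (S - m) - P.posY m (T - m) : ℝ) : ℂ) * Complex.I)) (s * P.cellVel m (T - m)) T :=
    (((dX.sub_const _).ofReal_comp).add (((dY.sub_const _).ofReal_comp).mul_const _)).const_mul _
  have c : ContinuousAt (fun S : ℝ => (P.posX m (S - m), P.posY m (S - m))) T :=
    dX.continuousAt.prodMk dY.continuousAt
  have ev := c.eventually (prim_pt (h := h) (v := v) hs (j := P.sq m) hX hY)
  refine d.hasDerivWithinAt.congr_of_eventuallyEq ?_ ?_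
  · filter_upwards [nhdsWithin_le_nhds ev, self_mem_nhdsWithin] with S hS hS'
    rw [P.point_eq hT, P.point_eq hS']
    exact hS ⟨P.posX_mem m (sub_mem hS'), P.posY_mem m (sub_mem hS')⟩
  · rw [prim_self]
    simp

end Track

end Origami

/-! ### Simplicity, index and intersections of tracks -/

namespace Origami

open Set

variable {n : ℕ} {h v : Equiv.Perm (Fin n)} {s : ℝ}

namespace Track

variable (P Q : Track h v)

/-- Normal form of the point where the `m`-th cell is entered. -/
def entry (m : ZMod P.len) : Fin n × ℤ × ℤ :=
  node h v (P.sq m) (P.cx m - P.dx m) (P.cy m - P.dy m)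

/-- The cells with the given numbers coincide. -/
def SameCell (m : ZMod P.len) (m' : ZMod Q.len) : Prop :=
  P.sq m = Q.sq m' ∧ P.cx m = Q.cx m' ∧ P.cy m = Q.cy m'

instance (m : ZMod P.len) (m' : ZMod Q.len) : Decidable (P.SameCell Q m m') :=
  inferInstanceAs (Decidable (_ ∧ _ ∧ _))

/-- In units of `1 / 6` the centre of a cell has odd coordinates, while the midpoint of an edge has
one even coordinate. So it lies in no open cell. -/
theorem entry_even (m : ZMod P.len) (A B : ℤ) (hA : A = 1 ∨ A = 3 ∨ A = 5)
    (hB : B = 1 ∨ B = 3 ∨ B = 5)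
    (h1 : |((P.cx m - P.dx m : ℤ) : ℝ) - A| < 1) (h2 : |((P.cy m - P.dy m : ℤ) : ℝ) - B| < 1) :
    False := by
  have k1 : |P.cx m - P.dx m - A| < 1 := by exact_mod_cast h1
  have k2 : |P.cy m - P.dy m - B| < 1 := by exact_mod_cast h2
  rw [Int.abs_lt_one_iff] at k1 k2
  have h3 := P.cx_odd m
  have h4 := P.cy_odd m
  rcases P.unit m with ⟨h5, h6⟩ | ⟨h5, h6⟩
  · rcases (abs_eq (by norm_num)).1 h5 with h5 | h5 <;> lia
  · rcases (abs_eq (by norm_num)).1 h6 with h6 | h6 <;> lia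

theorem eq_of_abs_lt {c c' : ℤ} (hc : c = 1 ∨ c = 3 ∨ c = 5) (hc' : c' = 1 ∨ c' = 3 ∨ c' = 5)
    {x : ℝ} (h1 : |6 * x - c| < 1) (h2 : |6 * x - c'| < 1) : c = c' := by
  rw [abs_lt] at h1 h2
  have h3 : (c : ℝ) < c' + 2 := by linarith
  have h4 : (c' : ℝ) < c + 2 := by linarith
  have h5 : c < c' + 2 := by exact_mod_cast h3
  have h6 : c' < c + 2 := by exact_mod_cast h4
  lia

/-- Two arcs meet where both cells are entered, or inside a common cell. -/
theorem eq_cases {m : ZMod P.len} {m' : ZMod Q.len} {τ τ' : ℝ} (hτ : τ ∈ Ico (0 : ℝ) 1)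
    (hτ' : τ' ∈ Ico (0 : ℝ) 1) (e : (pt (P.sq m) (P.posX m τ) (P.posY m τ) : Surface h v) =
      pt (Q.sq m') (Q.posX m' τ') (Q.posY m' τ')) :
    (τ = 0 ∧ τ' = 0 ∧ P.entry m = Q.entry m') ∨
      (P.SameCell Q m m' ∧ P.posX m τ = Q.posX m' τ' ∧ P.posY m τ = Q.posY m' τ') := by
  have inside : ∀ (R : Track h v) (m : ZMod R.len) {τ : ℝ}, τ ∈ Ioo (0 : ℝ) 1 →
      R.posX m τ ∈ Ioo (0 : ℝ) 1 ∧ R.posY m τ ∈ Ioo (0 : ℝ) 1 := fun R m _ h =>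
    ⟨pos_mem_Ioo (R.cx_odd m) (R.abs_dx m) (R.abs_dx _) h,
      pos_mem_Ioo (R.cy_odd m) (R.abs_dy m) (R.abs_dy _) h⟩
  have mixed : ∀ (P Q : Track h v) (m : ZMod P.len) (m' : ZMod Q.len) {τ : ℝ}, τ ∈ Ioo (0 : ℝ) 1 →
      (pt (Q.sq m') (Q.posX m' τ) (Q.posY m' τ) : Surface h v) ≠
        pt (P.sq m) (P.posX m 0) (P.posY m 0) := by
    intro P Q m m' τ h e
    obtain ⟨-, e1, e2⟩ := pt_interior_eq (inside Q m' h).1 (inside Q m' h).2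
      (P.posX_mem m (by simp)) (P.posY_mem m (by simp)) e
    have k1 := abs_pos_sub (c := Q.cx m') (Q.abs_dx m') (Q.abs_dx (m' + 1)) h
    have k2 := abs_pos_sub (c := Q.cy m') (Q.abs_dy m') (Q.abs_dy (m' + 1)) h
    change |6 * Q.posX m' τ - _| < 1 at k1
    change |6 * Q.posY m' τ - _| < 1 at k2
    rw [e1, posX, pos_zero, mul_div_cancel₀ _ (by norm_num)] at k1
    rw [e2, posY, pos_zero, mul_div_cancel₀ _ (by norm_num)] at k2
    exact P.entry_even m _ _ (Q.cx_odd m') (Q.cy_odd m') k1 k2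
  rcases hτ.1.eq_or_lt with rfl | h1 <;> rcases hτ'.1.eq_or_lt with rfl | h2
  · left
    refine ⟨rfl, rfl, ?_⟩
    simp only [posX, posY, pos_zero] at e
    exact (pt_eq_pt_node (P.entry_mem m).1 (P.entry_mem m).2 (Q.entry_mem _).1 (Q.entry_mem _).2
      (P.entry_ne m)).1 e
  · exact absurd e.symm (mixed P Q m m' ⟨h2, hτ'.2⟩)
  · exact absurd e (mixed Q P m' m ⟨h1, hτ.2⟩)
  · right
    have i2 := inside Q m' ⟨h2, hτ'.2⟩
    obtain ⟨e0, e1, e2⟩ := pt_interior_eq (inside P m ⟨h1, hτ.2⟩).1 (inside P m ⟨h1, hτ.2⟩).2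
      (Ioo_subset_Icc_self i2.1) (Ioo_subset_Icc_self i2.2) e
    have k1 := abs_pos_sub (c := P.cx m) (P.abs_dx m) (P.abs_dx (m + 1)) ⟨h1, hτ.2⟩
    have k2 := abs_pos_sub (c := P.cy m) (P.abs_dy m) (P.abs_dy (m + 1)) ⟨h1, hτ.2⟩
    have k3 := abs_pos_sub (c := Q.cx m') (Q.abs_dx m') (Q.abs_dx (m' + 1)) ⟨h2, hτ'.2⟩
    have k4 := abs_pos_sub (c := Q.cy m') (Q.abs_dy m') (Q.abs_dy (m' + 1)) ⟨h2, hτ'.2⟩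
    change |6 * P.posX m τ - _| < 1 at k1
    change |6 * P.posY m τ - _| < 1 at k2
    change |6 * Q.posX m' τ' - _| < 1 at k3
    change |6 * Q.posY m' τ' - _| < 1 at k4
    rw [← e1] at k3
    rw [← e2] at k4
    exact ⟨⟨e0, eq_of_abs_lt (P.cx_odd m) (Q.cx_odd m') k1 k3,
      eq_of_abs_lt (P.cy_odd m) (Q.cy_odd m') k2 k4⟩, e1, e2⟩

/-- Along the sum of the two directions the arc advances at constant positive speed, because `1 + d
> 0`. -/
theorem eq_of_pos_eq {m : ZMod P.len} {τ τ' : ℝ} (e1 : P.posX m τ = P.posX m τ')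
    (e2 : P.posY m τ = P.posY m τ') : τ = τ' := by
  simp only [posX, posY, pos] at e1 e2
  have h1 := P.norm_sq m
  have h2 := P.norm_sq (m + 1)
  have h3 := P.inner_nonneg m
  set d := (P.dx m * P.dx (m + 1) + P.dy m * P.dy (m + 1) : ℝ) with hd
  have key : (1 + d) * (2 * τ - 2 * τ') = 0 := by
    linear_combination (6 * (P.dx m + P.dx (m + 1))) * e1 + (6 * (P.dy m + P.dy (m + 1))) * e2 +
      ((1 - τ) ^ 2 - (1 - τ') ^ 2) * h1 - (τ ^ 2 - τ' ^ 2) * h2 + (2 * τ - 2 * τ') * hd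
  have : 2 * τ - 2 * τ' = 0 := (mul_eq_zero.1 key).resolve_left (by linarith)
  linarith

theorem fract_mem_Ico (T : ℝ) : Int.fract T ∈ Ico (0 : ℝ) 1 :=
  ⟨Int.fract_nonneg T, Int.fract_lt_one T⟩

theorem val_floor {T : ℝ} (hT : T ∈ Ico (0 : ℝ) P.len) :
    (((⌊T⌋ : ℤ) : ZMod P.len).val : ℤ) = ⌊T⌋ := by
  rw [ZMod.val_intCast]
  refine Int.emod_eq_of_lt (Int.floor_nonneg.2 hT.1) (Int.floor_lt.2 ?_)
  exact_mod_cast hT.2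

theorem len_pos : (0 : ℝ) < P.len := by exact_mod_cast Nat.pos_of_ne_zero (NeZero.ne P.len)

/-- Two equal points are either entry points, which `entry_inj` distinguishes, or lie inside one
cell, which is visited once and traversed injectively. -/
theorem injOn_point : InjOn P.point (Ico (0 : ℝ) P.len) := by
  intro T hT T' hT' e
  have key : ((⌊T⌋ : ℤ) : ZMod P.len) = ((⌊T'⌋ : ℤ) : ZMod P.len) ∧ Int.fract T = Int.fract T' := by
    rcases P.eq_cases P (fract_mem_Ico T) (fract_mem_Ico T') e with ⟨h1, h2, h3⟩ | ⟨h1, h2, h3⟩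
    · exact ⟨P.entry_inj _ _ h3, h1.trans h2.symm⟩
    · have hm := P.cell_inj _ _ h1.1 h1.2.1 h1.2.2
      rw [← hm] at h2 h3
      exact ⟨hm, P.eq_of_pos_eq h2 h3⟩
  have hf : ⌊T⌋ = ⌊T'⌋ := by rw [← P.val_floor hT, ← P.val_floor hT', key.1]
  rw [← Int.floor_add_fract T, ← Int.floor_add_fract T', hf, key.2]

theorem mult_point (T : ℝ) : mult (P.point T) = 1 := by
  have hX := P.posX_mem (⌊T⌋ : ℤ) (fract_mem T)
  have hY := P.posY_mem (⌊T⌋ : ℤ) (fract_mem T)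
  rw [point, mult_pt hX hY, if_neg]
  rcases (Int.fract_nonneg T).eq_or_lt with h0 | h0
  · rw [← h0, posX, posY, pos_zero, pos_zero, fract_div_six, fract_div_six]
    simpa using P.entry_ne (⌊T⌋ : ℤ)
  · have h1 : P.posX (⌊T⌋ : ℤ) (Int.fract T) ∈ Ioo (0 : ℝ) 1 :=
      pos_mem_Ioo (P.cx_odd _) (P.abs_dx _) (P.abs_dx _) ⟨h0, Int.fract_lt_one T⟩
    rw [fract_of_mem_Ico (Ioo_subset_Ico_self h1)]
    exact fun k => h1.1.ne' k.1

/-- The simple closed curve of a track. -/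
def curve (hs : 0 < s) (ht : Transitive h v) (i₀ : Fin n) :
    (surf hs ht i₀).SimpleClosedCurve where
  toFun t := P.point (P.len * t)
  vel t := (P.len * s : ℝ) * P.speed (P.len * t)
  continuous_toFun := P.continuous_point.comp (continuous_const.mul continuous_id)
  periodic t := by
    rw [mul_add, mul_one]
    exact P.point_add_len _
  injOn := by
    intro t ht t' ht' e
    have mem : ∀ {t : ℝ}, t ∈ Ico (0 : ℝ) 1 → P.len * t ∈ Ico (0 : ℝ) P.len := fun ht =>
      ⟨mul_nonneg P.len_pos.le ht.1, mul_lt_of_lt_one_right P.len_pos ht.2⟩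
    exact mul_left_cancel₀ P.len_pos.ne' (P.injOn_point (mem ht) (mem ht') e)
  regular t := by
    change mult (P.point _) - 1 = 0
    rw [mult_point]
  hasDeriv t := by
    have h1 : HasDerivAt (fun t : ℝ => P.len * t) (P.len : ℝ) t := by
      simpa using (hasDerivAt_id t).const_mul (P.len : ℝ)
    have h2 := (P.hasDerivAt_prim hs (P.len * t)).scomp t h1
    refine (h2.congr_deriv ?_).congr_of_eventuallyEq
      (Eventually.of_forall fun u => surf_primitive hs ht i₀ _ _)
    rw [Complex.real_smul]
    push_cast
    ring
  continuous_vel :=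
    continuous_const.mul (P.continuous_speed.comp (continuous_const.mul continuous_id))
  vel_ne_zero t := mul_ne_zero (by
    have := P.len_pos
    exact_mod_cast (by positivity : (P.len * s : ℝ) ≠ 0)) (P.speed_ne_zero _)

/-! ### The index of a track -/

/-- The number of quarter turns to the left in the `m`-th cell. -/
def turn (m : ZMod P.len) : ℤ := P.dx m * P.dy (m + 1) - P.dy m * P.dx (m + 1)

/-- The direction in which a cell is entered. -/
def dir (m : ZMod P.len) : ℂ := P.dx m + P.dy m * Complex.I

theorem turn_spec (m : ZMod P.len) : (P.turn m = -1 ∨ P.turn m = 0 ∨ P.turn m = 1) ∧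
    P.dir (m + 1) = P.dir m * Complex.I ^ P.turn m := by
  have key : ∀ a b c d : ℤ, ((a = 1 ∨ a = -1) ∧ b = 0 ∨ a = 0 ∧ (b = 1 ∨ b = -1)) →
      ((c = 1 ∨ c = -1) ∧ d = 0 ∨ c = 0 ∧ (d = 1 ∨ d = -1)) → 0 ≤ a * c + b * d →
      (a * d - b * c = -1 ∨ a * d - b * c = 0 ∨ a * d - b * c = 1) ∧
      (c + d * Complex.I : ℂ) = (a + b * Complex.I) * Complex.I ^ (a * d - b * c) := by
    intro a b c d
    rintro (⟨rfl | rfl, rfl⟩ | ⟨rfl, rfl | rfl⟩) (⟨rfl | rfl, rfl⟩ | ⟨rfl, rfl | rfl⟩) <;> norm_num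
  have hu : ∀ m, (P.dx m = 1 ∨ P.dx m = -1) ∧ P.dy m = 0 ∨
      P.dx m = 0 ∧ (P.dy m = 1 ∨ P.dy m = -1) := by
    intro m
    rcases P.unit m with ⟨h1, h2⟩ | ⟨h1, h2⟩
    · exact Or.inl ⟨(abs_eq (by norm_num)).1 h1, h2⟩
    · exact Or.inr ⟨h1, (abs_eq (by norm_num)).1 h2⟩
  exact key _ _ _ _ (hu m) (hu (m + 1)) (P.forward m)

theorem exists_dir_eq (m : ZMod P.len) : ∃ a : ℤ, P.dir m = Complex.I ^ a := by
  unfold dir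
  rcases P.unit m with ⟨h1, h2⟩ | ⟨h1, h2⟩
  · rcases (abs_eq (by norm_num)).1 h1 with h1 | h1
    · exact ⟨0, by simp [h1, h2]⟩
    · exact ⟨2, by rw [h1, h2]; norm_num⟩
  · rcases (abs_eq (by norm_num)).1 h2 with h2 | h2
    · exact ⟨1, by simp [h1, h2]⟩
    · exact ⟨-1, by simp [h1, h2]⟩

/-- Partial sums in both directions of the integers, so that the turning angle is defined for all
times. -/
theorem exists_sum (f : ℤ → ℤ) (c : ℤ) : ∃ a : ℤ → ℤ, a 0 = c ∧ ∀ m, a (m + 1) = a m + f m := by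
  refine ⟨fun m => c + ∑ j ∈ Finset.range m.toNat, f j -
    ∑ j ∈ Finset.range (-m).toNat, f (-(j + 1)), by simp, fun m => ?_⟩
  dsimp only
  rcases le_or_gt 0 m with hm | hm
  · obtain ⟨k, rfl⟩ := Int.eq_ofNat_of_zero_le hm
    rw [show (-((k : ℤ) + 1)).toNat = 0 by lia, show (-(k : ℤ)).toNat = 0 by lia,
      show ((k : ℤ) + 1).toNat = k + 1 by lia, show (k : ℤ).toNat = k by lia, Finset.sum_range_succ]
    ring
  · obtain ⟨k, hk⟩ := Int.eq_ofNat_of_zero_le (by lia : 0 ≤ -(m + 1))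
    obtain rfl : m = -((k : ℤ) + 1) := by lia
    rw [show (-((k : ℤ) + 1)).toNat = 0 by lia, show (-((k : ℤ) + 1) + 1).toNat = 0 by lia,
      show (-(-((k : ℤ) + 1) + 1)).toNat = k by lia, show (-(-((k : ℤ) + 1))).toNat = k + 1 by lia,
      Finset.sum_range_succ]
    ring

/-- The angles of the directions, in quarter turns. -/
theorem exists_turning : ∃ a : ℤ → ℤ, (∀ m : ℤ, P.dir m = Complex.I ^ a m) ∧
    ∀ m : ℤ, a (m + 1) = a m + P.turn m := by
  obtain ⟨c, hc⟩ := P.exists_dir_eq ((0 : ℤ) : ZMod P.len)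
  obtain ⟨a, ha, H⟩ := exists_sum (fun m => P.turn m) c
  refine ⟨a, fun m => ?_, H⟩
  have step : ∀ m : ℤ, P.dir ((m + 1 : ℤ) : ZMod P.len) = Complex.I ^ a (m + 1) ↔
      P.dir m = Complex.I ^ a m := by
    intro m
    rw [H, zpow_add₀ Complex.I_ne_zero, Int.cast_add, Int.cast_one, (P.turn_spec m).2]
    exact mul_left_inj' (zpow_ne_zero _ Complex.I_ne_zero)
  induction m using Int.induction_on with
  | zero => rw [hc, ha]
  | succ k ih => exact (step k).2 ih
  | pred k ih =>
    refine (step _).1 ?_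
    rwa [sub_add_cancel]

/-- The velocity in a cell, relative to the direction in which it is entered. -/
def bend (e : ℤ) (τ : ℝ) : ℂ := (1 - τ : ℝ) + (τ : ℝ) * Complex.I ^ e

/-- Relative to the entry direction the velocity turns by at most a quarter, so the principal
argument is continuous on each cell. -/
theorem bend_mem {e : ℤ} (he : e = -1 ∨ e = 0 ∨ e = 1) (τ : ℝ) : bend e τ ∈ Complex.slitPlane := by
  rw [Complex.mem_slitPlane_iff]
  rcases he with rfl | rfl | rfl
  · by_cases hτ : τ = 0
    · left
      simp [bend, hτ]
    · right
      simpa [bend] using hτ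
  · left
    simp [bend]
  · by_cases hτ : τ = 0
    · left
      simp [bend, hτ]
    · right
      simpa [bend] using hτ

theorem arg_bend_one {e : ℤ} (he : e = -1 ∨ e = 0 ∨ e = 1) :
    (bend e 1).arg = Real.pi / 2 * e := by
  rcases he with rfl | rfl | rfl
  · simp [bend]
  · simp [bend]
  · simp [bend]

theorem cellVel_eq (m : ZMod P.len) (τ : ℝ) :
    P.cellVel m τ = (1 / 3 : ℝ) * (P.dir m * bend (P.turn m) τ) := by
  have h1 := (P.turn_spec m).2
  have h2 : P.dir m * bend (P.turn m) τ = (1 - τ : ℝ) * P.dir m + (τ : ℝ) * P.dir (m + 1) := by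
    rw [h1, bend]
    ring
  rw [h2, cellVel, dir, dir, spd, spd]
  push_cast
  ring

theorem exp_quarter (a : ℤ) : Complex.exp ((Real.pi / 2 * a : ℝ) * Complex.I) = Complex.I ^ a := by
  have e : ((Real.pi / 2 * a : ℝ) * Complex.I : ℂ) = a * (Real.pi / 2 * Complex.I) := by
    push_cast
    ring
  rw [e, Complex.exp_int_mul, Complex.exp_pi_div_two_mul_I]

/-- A continuous angle is the accumulated number of quarter turns plus the argument inside the
current cell. Over one period it grows by a quarter turn for each unit of the sum. -/
theorem hasIndex (hs : 0 < s) (ht : Transitive h v) (i₀ : Fin n) {k : ℤ}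
    (hk : ∑ j ∈ Finset.range P.len, P.turn (j : ℕ) = 4 * k) : (P.curve hs ht i₀).HasIndex k := by
  obtain ⟨a, h1, h2⟩ := P.exists_turning
  let θ : ℝ → ℝ := fun T => Real.pi / 2 * a ⌊T⌋ + (bend (P.turn (⌊T⌋ : ℤ)) (Int.fract T)).arg
  have hθ : ∀ m : ℤ, ∀ T ∈ Icc (m : ℝ) (m + 1),
      θ T = Real.pi / 2 * a m + (bend (P.turn m) (T - m)).arg := by
    intro m T hT
    simp only [θ]
    rcases floor_fract_cases hT with ⟨e1, e2⟩ | ⟨e1, e2, e3⟩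
    · rw [e1, e2]
    · rw [e1, e2, e3, arg_bend_one (P.turn_spec m).1, h2]
      simp [bend]
      ring
  have cont : Continuous θ := by
    refine continuous_of_pieces fun m => ContinuousOn.congr ?_ (hθ m)
    refine Continuous.continuousOn (continuous_const.add ?_)
    refine continuous_iff_continuousAt.2 fun T => ?_
    refine ContinuousAt.comp (f := fun x : ℝ => bend (P.turn m) (x - m))
      (Complex.continuousAt_arg (bend_mem (P.turn_spec m).1 _)) ?_
    unfold bend
    fun_prop
  have sum : ∀ N : ℕ, a N = a 0 + ∑ j ∈ Finset.range N, P.turn (j : ℕ) := by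
    intro N
    induction N with
    | zero => simp
    | succ N ih =>
      rw [Finset.sum_range_succ, ← add_assoc, ← ih, Nat.cast_add, Nat.cast_one, h2, Int.cast_natCast]
  refine ⟨fun t => θ (P.len * t), cont.comp (continuous_const.mul continuous_id), fun t => ?_, ?_⟩
  · have hpos : 0 < P.len * s * (1 / 3) := mul_pos (mul_pos P.len_pos hs) (by norm_num)
    have e : (P.curve hs ht i₀).vel t = (P.len * s * (1 / 3) : ℝ) *
        (Complex.I ^ a ⌊P.len * t⌋ *
          bend (P.turn (⌊P.len * t⌋ : ℤ)) (Int.fract (P.len * t))) := by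
      change (P.len * s : ℝ) * P.cellVel _ _ = _
      rw [cellVel_eq, h1]
      push_cast
      ring
    have hn : ‖Complex.I ^ a ⌊P.len * t⌋‖ = 1 := by rw [norm_zpow, Complex.norm_I, one_zpow]
    rw [e, norm_mul, norm_mul, hn, one_mul, Complex.norm_of_nonneg hpos.le]
    simp only [θ]
    rw [Complex.ofReal_add, add_mul, Complex.exp_add, exp_quarter]
    conv_lhs => rw [← Complex.norm_mul_exp_arg_mul_I (bend _ _)]
    push_cast
    ring
  · have e0 : θ 0 = Real.pi / 2 * a 0 := by
      rw [hθ 0 0 (by simp)]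
      simp [bend]
    have e1 : θ P.len = Real.pi / 2 * a P.len := by
      rw [hθ P.len P.len (by simp)]
      simp [bend]
    dsimp only
    rw [mul_one, mul_zero, e0, e1, sum, hk]
    push_cast
    ring

/-! ### Intersections of tracks -/

/-- The oriented area spanned by the directions in two cells. -/
def cross (m : ZMod P.len) (m' : ZMod Q.len) : ℤ := P.dx m * Q.dy m' - P.dy m * Q.dx m'

/-- The tracks enter no cell at the same point, they run straight and in different directions
through common cells, and the sum of the signs of their crossings is `c`. -/
def Crosses (c : ℤ) : Prop :=
  (∀ m m', P.SameCell Q m m' → (P.dx (m + 1) = P.dx m ∧ P.dy (m + 1) = P.dy m) ∧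
    (Q.dx (m' + 1) = Q.dx m' ∧ Q.dy (m' + 1) = Q.dy m') ∧ P.cross Q m m' ≠ 0) ∧
  (∀ m m', P.entry m ≠ Q.entry m') ∧
  ∑ m, ∑ m', (if P.SameCell Q m m' then (P.cross Q m m').sign else 0) = c

/-- The time at which the middle of the `m`-th cell is reached. -/
def time (m : ZMod P.len) : ℝ := (m.val + 1 / 2) / P.len

theorem len_mul_time (m : ZMod P.len) : P.len * P.time m = m.val + 1 / 2 :=
  mul_div_cancel₀ _ P.len_pos.ne'

theorem time_mem (m : ZMod P.len) : P.time m ∈ Ico (0 : ℝ) 1 := by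
  have h1 : ((m.val + 1 : ℕ) : ℝ) ≤ P.len := by exact_mod_cast ZMod.val_lt m
  push_cast at h1
  refine ⟨div_nonneg (by positivity) P.len_pos.le, ?_⟩
  rw [time, div_lt_one P.len_pos]
  linarith

theorem floor_fract_time (m : ZMod P.len) :
    ((⌊P.len * P.time m⌋ : ℤ) : ZMod P.len) = m ∧ Int.fract (P.len * P.time m) = 1 / 2 := by
  have h1 : ⌊P.len * P.time m⌋ = m.val := by
    rw [len_mul_time, Int.floor_eq_iff]
    constructor <;> push_cast <;> linarith
  refine ⟨by simp [h1], ?_⟩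
  rw [Int.fract, h1, len_mul_time]
  push_cast
  ring

theorem time_injective : Function.Injective P.time := by
  intro m m' e
  rw [← (P.floor_fract_time m).1, ← (P.floor_fract_time m').1, e]

theorem eq_time {t : ℝ} (ht : t ∈ Ico (0 : ℝ) 1) (hf : Int.fract (P.len * t) = 1 / 2) :
    t = P.time ((⌊P.len * t⌋ : ℤ) : ZMod P.len) := by
  have h1 := P.val_floor (T := P.len * t)
    ⟨mul_nonneg P.len_pos.le ht.1, mul_lt_of_lt_one_right P.len_pos ht.2⟩
  have h2 : ((((⌊P.len * t⌋ : ℤ) : ZMod P.len).val : ℤ) : ℝ) = ⌊P.len * t⌋ := by rw [h1]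
  rw [time, eq_div_iff P.len_pos.ne', ← hf, mul_comm t]
  rw [Int.cast_natCast] at h2
  rw [h2, Int.floor_add_fract]

theorem sign_cast (x : ℤ) : ((SignType.sign (x : ℝ) : SignType) : ℤ) = x.sign := by
  rcases lt_trichotomy x 0 with h1 | rfl | h1
  · rw [sign_neg (by exact_mod_cast h1), Int.sign_eq_neg_one_of_neg h1]
    rfl
  · simp
  · rw [sign_pos (by exact_mod_cast h1), Int.sign_eq_one_of_pos h1]
    rfl

/-- No entry points coincide, so the curves meet only inside common cells. There both are straight
in independent directions and cross exactly once, at the centre, which each reaches at the middle of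
its passage. -/
theorem hasIntersection (hs : 0 < s) (ht : Transitive h v) (i₀ : Fin n) {c : ℤ}
    (H : P.Crosses Q c) : (P.curve hs ht i₀).HasIntersection (Q.curve hs ht i₀) c := by
  obtain ⟨H1, H2, H3⟩ := H
  let K : Finset (ZMod P.len × ZMod Q.len) :=
    Finset.univ.filter fun q => P.SameCell Q q.1 q.2
  have hK : ∀ q, q ∈ K ↔ P.SameCell Q q.1 q.2 := fun q => by simp [K]
  let f : ZMod P.len × ZMod Q.len → ℝ × ℝ := fun q => (P.time q.1, Q.time q.2)
  have hf : Function.Injective f := fun q q' e =>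
    Prod.ext (P.time_injective (Prod.ext_iff.1 e).1) (Q.time_injective (Prod.ext_iff.1 e).2)
  have straight : ∀ (R : Track h v) (m : ZMod R.len), R.dx (m + 1) = R.dx m →
      R.dy (m + 1) = R.dy m → ∀ τ, 6 * R.posX m τ - R.cx m = (2 * τ - 1) * R.dx m ∧
        6 * R.posY m τ - R.cy m = (2 * τ - 1) * R.dy m := by
    intro R m e1 e2 τ
    rw [posX, posY, pos, pos, e1, e2]
    constructor <;> ring
  have hmeets : (P.curve hs ht i₀).meets (Q.curve hs ht i₀) = f '' K := by
    ext ⟨t, t'⟩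
    constructor
    · rintro ⟨k1, k2, e⟩
      change P.point (P.len * t) = Q.point (Q.len * t') at e
      rcases P.eq_cases Q (fract_mem_Ico _) (fract_mem_Ico _) e with ⟨-, -, h3⟩ | ⟨h1, h2, h3⟩
      · exact absurd h3 (H2 _ _)
      · obtain ⟨a1, a2, a3⟩ := H1 _ _ h1
        obtain ⟨b1, b2⟩ := straight P _ a1.1 a1.2 (Int.fract (P.len * t))
        obtain ⟨b3, b4⟩ := straight Q _ a2.1 a2.2 (Int.fract (Q.len * t'))
        rw [h2, h1.2.1] at b1
        rw [h3, h1.2.2] at b2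
        have e1 := b1.symm.trans b3
        have e2 := b2.symm.trans b4
        have a3' : (P.dx (⌊P.len * t⌋ : ℤ) * Q.dy (⌊Q.len * t'⌋ : ℤ) -
          P.dy (⌊P.len * t⌋ : ℤ) * Q.dx (⌊Q.len * t'⌋ : ℤ) : ℝ) ≠ 0 := by exact_mod_cast a3
        have z1 : 2 * Int.fract (P.len * t) - 1 = 0 := by
          refine (mul_eq_zero.1 ?_).resolve_right a3'
          linear_combination (Q.dy (⌊Q.len * t'⌋ : ℤ) : ℝ) * e1 - Q.dx (⌊Q.len * t'⌋ : ℤ) * e2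
        have z2 : 2 * Int.fract (Q.len * t') - 1 = 0 := by
          refine (mul_eq_zero.1 ?_).resolve_right a3'
          linear_combination (P.dy (⌊P.len * t⌋ : ℤ) : ℝ) * e1 - P.dx (⌊P.len * t⌋ : ℤ) * e2
        exact ⟨(_, _), (hK _).2 h1, Prod.ext (P.eq_time k1 (by linarith)).symm
          (Q.eq_time k2 (by linarith)).symm⟩
    · rintro ⟨⟨m, m'⟩, hq, e⟩
      obtain ⟨rfl, rfl⟩ := Prod.ext_iff.1 e
      refine ⟨P.time_mem m, Q.time_mem m', ?_⟩
      change P.point (P.len * P.time m) = Q.point (Q.len * Q.time m')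
      have h1 := (hK _).1 hq
      obtain ⟨a1, a2, -⟩ := H1 _ _ h1
      obtain ⟨b1, b2⟩ := straight P _ a1.1 a1.2 (1 / 2)
      obtain ⟨b3, b4⟩ := straight Q _ a2.1 a2.2 (1 / 2)
      rw [point, point, (P.floor_fract_time m).2, (P.floor_fract_time m).1,
        (Q.floor_fract_time m').2, (Q.floor_fract_time m').1]
      have x1 : P.posX m (1 / 2) = Q.posX m' (1 / 2) := by
        rw [h1.2.1] at b1
        linarith
      have x2 : P.posY m (1 / 2) = Q.posY m' (1 / 2) := by
        rw [h1.2.2] at b2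
        linarith
      rw [x1, x2, h1.1]
  have hwedge : ∀ q ∈ K, ∃ r : ℝ, 0 < r ∧ (P.curve hs ht i₀).wedge (Q.curve hs ht i₀) (f q) =
      r * (P.cross Q q.1 q.2 : ℝ) := by
    rintro ⟨m, m'⟩ hq
    obtain ⟨a1, a2, -⟩ := H1 _ _ ((hK _).1 hq)
    have vel : ∀ (R : Track h v) (m : ZMod R.len), R.dx (m + 1) = R.dx m →
        R.dy (m + 1) = R.dy m → (R.curve hs ht i₀).vel (R.time m) =
          (R.len * s / 3 : ℝ) * (R.dx m + R.dy m * Complex.I) := by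
      intro R m e1 e2
      change (R.len * s : ℝ) * R.cellVel _ _ = _
      rw [(R.floor_fract_time m).1, (R.floor_fract_time m).2, cellVel, spd, spd, e1, e2]
      push_cast
      ring
    refine ⟨(P.len * s / 3) * (Q.len * s / 3), ?_, ?_⟩
    · have := P.len_pos
      have := Q.len_pos
      positivity
    · change (starRingEnd ℂ ((P.curve hs ht i₀).vel (P.time m)) *
        (Q.curve hs ht i₀).vel (Q.time m')).im = _
      rw [vel P m a1.1 a1.2, vel Q m' a2.1 a2.2, cross]
      generalize P.len * s / 3 = A
      generalize Q.len * s / 3 = B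
      simp
      ring
  refine ⟨?_, ?_, ?_⟩
  · rw [hmeets]
    exact K.finite_toSet.image f
  · rw [hmeets]
    rintro _ ⟨q, hq, rfl⟩
    obtain ⟨r, hr, e⟩ := hwedge q hq
    rw [e]
    exact mul_ne_zero hr.ne' (by exact_mod_cast (H1 _ _ ((hK q).1 hq)).2.2)
  · rw [hmeets, finsum_mem_image hf.injOn, finsum_mem_coe_finset, ← H3, ← Finset.sum_product',
      Finset.univ_product_univ, ← Finset.sum_filter]
    refine Finset.sum_congr rfl fun q hq => ?_
    obtain ⟨r, hr, e⟩ := hwedge q hq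
    rw [e, sign_mul, sign_pos hr, one_mul, sign_cast]

end Track

end Origami

namespace Origami

open Set

variable {s : ℝ}

/-! ### The surface of odd spin parity -/

theorem transitive_odd : Transitive hPerm vPermOdd := by
  intro P hh hv
  simp [forall_fin_six, hPerm_apply] at hh
  simp [forall_fin_six, vPermOdd_apply] at hv
  have h3 : P 3 ↔ P 0 := hv.1
  have h1 : P 1 ↔ P 0 := hv.2.2.2.1.trans h3
  have h2 : P 2 ↔ P 0 := hh.1.trans h1
  have h4 : P 4 ↔ P 0 := hv.2.2.1.trans h2
  have h5 : P 5 ↔ P 0 := hh.2.2.2.1.trans h4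
  have key : ∀ i, P i ↔ P 0 := forall_fin_six.2 ⟨Iff.rfl, h1, h2, h3, h4, h5⟩
  intro i j hi
  rwa [key, ← key i]

theorem minimalPeriod_odd : Function.minimalPeriod (comm hPerm vPermOdd) 0 = 5 := by
  have : Fact (Nat.Prime 5) := ⟨by norm_num⟩
  refine Function.minimalPeriod_eq_prime ?_ ?_
  · change (comm hPerm vPermOdd)^[5] 0 = 0
    decide +kernel
  · change comm hPerm vPermOdd 0 ≠ 0
    decide

theorem sameCycle_odd : ∀ j, j ≠ 2 → (comm hPerm vPermOdd).SameCycle 0 j := by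
  refine forall_fin_six.2 ⟨fun _ => .refl _ _, fun _ => sameCycle_of_pow 3 (by decide +kernel),
    fun e => absurd rfl e, fun _ => sameCycle_of_pow 2 (by decide +kernel),
    fun _ => sameCycle_of_pow 1 (by decide +kernel), fun _ => sameCycle_of_pow 4 (by decide +kernel)⟩

theorem inH4_odd (hs : 0 < s) : (surf hs transitive_odd 0).InH4 := by
  refine inH4_surf hs transitive_odd 0 minimalPeriod_odd fun j => ?_
  by_cases hj : j = 2
  · subst hj
    exact Or.inr (by decide)
  · exact Or.inl (sameCycle_odd j hj)

/-- The core of the first horizontal cylinder. -/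
def rowOne : Track hPerm vPermOdd where
  len := 3
  sq := fun m => ([0, 0, 0] : List (Fin 6)).getD m.val 0
  cx := fun m => ([1, 3, 5] : List ℤ).getD m.val 0
  cy := fun m => ([3, 3, 3] : List ℤ).getD m.val 0
  dx := fun m => ([1, 1, 1] : List ℤ).getD m.val 0
  dy := fun m => ([0, 0, 0] : List ℤ).getD m.val 0
  cx_odd := by decide +kernel
  cy_odd := by decide +kernel
  unit := by decide +kernel
  forward := by decide +kernel
  glue := by decide +kernel
  cell_inj := by decide +kernel
  entry_inj := by decide +kernel

/-- The core of the second horizontal cylinder. -/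
def rowTwo : Track hPerm vPermOdd where
  len := 6
  sq := fun m => ([1, 1, 1, 2, 2, 2] : List (Fin 6)).getD m.val 0
  cx := fun m => ([1, 3, 5, 1, 3, 5] : List ℤ).getD m.val 0
  cy := fun m => ([3, 3, 3, 3, 3, 3] : List ℤ).getD m.val 0
  dx := fun m => ([1, 1, 1, 1, 1, 1] : List ℤ).getD m.val 0
  dy := fun m => ([0, 0, 0, 0, 0, 0] : List ℤ).getD m.val 0
  cx_odd := by decide +kernel
  cy_odd := by decide +kernel
  unit := by decide +kernel
  forward := by decide +kernel
  glue := by decide +kernel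
  cell_inj := by decide +kernel
  entry_inj := by decide +kernel

/-- The core of the third horizontal cylinder. -/
def rowThree : Track hPerm vPermOdd where
  len := 9
  sq := fun m => ([3, 3, 3, 4, 4, 4, 5, 5, 5] : List (Fin 6)).getD m.val 0
  cx := fun m => ([1, 3, 5, 1, 3, 5, 1, 3, 5] : List ℤ).getD m.val 0
  cy := fun m => ([3, 3, 3, 3, 3, 3, 3, 3, 3] : List ℤ).getD m.val 0
  dx := fun m => ([1, 1, 1, 1, 1, 1, 1, 1, 1] : List ℤ).getD m.val 0
  dy := fun m => ([0, 0, 0, 0, 0, 0, 0, 0, 0] : List ℤ).getD m.val 0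
  cx_odd := by decide +kernel
  cy_odd := by decide +kernel
  unit := by decide +kernel
  forward := by decide +kernel
  glue := by decide +kernel
  cell_inj := by decide +kernel
  entry_inj := by decide +kernel

/-- A curve crossing the first cylinder once, and the second one twice, in opposite directions. -/
def dualOne : Track hPerm vPermOdd where
  len := 13
  sq := fun m => ([3, 4, 2, 2, 2, 4, 3, 1, 1, 1, 0, 0, 0] : List (Fin 6)).getD m.val 0
  cx := fun m => ([5, 1, 1, 1, 1, 1, 5, 5, 5, 5, 5, 5, 5] : List ℤ).getD m.val 0
  cy := fun m => ([1, 1, 5, 3, 1, 5, 5, 1, 3, 5, 1, 3, 5] : List ℤ).getD m.val 0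
  dx := fun m => ([0, 1, 0, 0, 0, 0, -1, 0, 0, 0, 0, 0, 0] : List ℤ).getD m.val 0
  dy := fun m => ([1, 0, -1, -1, -1, -1, 0, 1, 1, 1, 1, 1, 1] : List ℤ).getD m.val 0
  cx_odd := by decide +kernel
  cy_odd := by decide +kernel
  unit := by decide +kernel
  forward := by decide +kernel
  glue := by decide +kernel
  cell_inj := by decide +kernel
  entry_inj := by decide +kernel

/-- A curve crossing the second cylinder once. -/
def dualTwo : Track hPerm vPermOdd where
  len := 7
  sq := fun m => ([4, 5, 5, 4, 2, 2, 2] : List (Fin 6)).getD m.val 0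
  cx := fun m => ([5, 1, 1, 5, 5, 5, 5] : List ℤ).getD m.val 0
  cy := fun m => ([1, 1, 5, 5, 1, 3, 5] : List ℤ).getD m.val 0
  dx := fun m => ([0, 1, 0, -1, 0, 0, 0] : List ℤ).getD m.val 0
  dy := fun m => ([1, 0, -1, 0, 1, 1, 1] : List ℤ).getD m.val 0
  cx_odd := by decide +kernel
  cy_odd := by decide +kernel
  unit := by decide +kernel
  forward := by decide +kernel
  glue := by decide +kernel
  cell_inj := by decide +kernel
  entry_inj := by decide +kernel

/-- A curve crossing the third cylinder once. -/
def dualThree : Track hPerm vPermOdd where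
  len := 3
  sq := fun m => ([5, 5, 5] : List (Fin 6)).getD m.val 0
  cx := fun m => ([3, 3, 3] : List ℤ).getD m.val 0
  cy := fun m => ([1, 3, 5] : List ℤ).getD m.val 0
  dx := fun m => ([0, 0, 0] : List ℤ).getD m.val 0
  dy := fun m => ([1, 1, 1] : List ℤ).getD m.val 0
  cx_odd := by decide +kernel
  cy_odd := by decide +kernel
  unit := by decide +kernel
  forward := by decide +kernel
  glue := by decide +kernel
  cell_inj := by decide +kernel
  entry_inj := by decide +kernel

/-- The cores of the horizontal cylinders. -/
def rows : Fin 3 → Track hPerm vPermOdd := ![rowOne, rowTwo, rowThree]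

/-- Curves dual to the cores of the horizontal cylinders. -/
def duals : Fin 3 → Track hPerm vPermOdd := ![dualOne, dualTwo, dualThree]

/-- The intersection pattern is a finite check on the cells of the tracks. -/
theorem rows_crosses_duals : ∀ i j, (rows i).Crosses (duals j) (if i = j then 1 else 0) := by
  unfold Track.Crosses
  decide +kernel

theorem rows_crosses_rows : ∀ i j, i ≠ j → (rows i).Crosses (rows j) 0 := by
  unfold Track.Crosses
  decide +kernel

theorem duals_crosses_duals : ∀ i j, i ≠ j → (duals i).Crosses (duals j) 0 := by
  unfold Track.Crosses
  decide +kernel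

theorem sum_turn_rows : ∀ i, ∑ k ∈ Finset.range (rows i).len, (rows i).turn (k : ℕ) = 4 * 0 := by
  decide +kernel

theorem sum_turn_duals : ∀ i, ∑ k ∈ Finset.range (duals i).len, (duals i).turn (k : ℕ) =
    4 * ![-1, -1, 0] i := by
  decide +kernel

theorem inH4Odd (hs : 0 < s) : (surf hs transitive_odd 0).InH4Odd := by
  -- The cores have index `0` and the dual curves `-1`, `-1`, `0`, so the sum is `0 + 0 + 1`.
  refine ⟨inH4_odd hs, fun i => (rows i).curve hs transitive_odd 0,
    fun i => (duals i).curve hs transitive_odd 0, fun _ => 0, ![-1, -1, 0], fun i j => ?_,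
    fun i j hij => ?_, fun i j hij => ?_, fun i => ?_, fun i => ?_, by decide⟩
  · exact Track.hasIntersection _ _ hs _ _ (rows_crosses_duals i j)
  · exact Track.hasIntersection _ _ hs _ _ (rows_crosses_rows i j hij)
  · exact Track.hasIntersection _ _ hs _ _ (duals_crosses_duals i j hij)
  · exact Track.hasIndex _ hs _ _ (sum_turn_rows i)
  · exact Track.hasIndex _ hs _ _ (sum_turn_duals i)

end Origami

end

theorem proposition4p2 (s : ℝ) (hs : 0 < s) :
    (∃ M : TranslationSurface, M.IsSquareTiled s hPerm vPermHyp ∧ M.InH4Hyp ∧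
      ZariskiClosureIsSp4 M) ∧
    (∃ M : TranslationSurface, M.IsSquareTiled s hPerm vPermOdd ∧ M.InH4Odd ∧
      ZariskiClosureIsSp4 M) :=
  ⟨⟨Origami.surf hs Origami.transitive_hyp 0, Origami.isSquareTiled_surf hs _ 0,
      Origami.inH4Hyp hs, Origami.zariskiClosureIsSp4_hyp hs _ 0⟩,
    ⟨Origami.surf hs Origami.transitive_odd 0, Origami.isSquareTiled_surf hs _ 0,
      Origami.inH4Odd hs, Origami.zariskiClosureIsSp4_odd hs _ 0⟩⟩
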